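/- **Model.** We work on the randomized word RAM with word length $w$: in unit time it performs addition, subtraction, multiplication, shifts and bitwise Boolean operations on $w$-bit words, comparisons, memory accesses, and draws a uniformly random element of $\{0,\dots,v-1\}$ for a given $v\le 2^w$; a program is a finite text using constantly many registers and memory arrays. For each size parameter $n$ fix a set $W(n)$ of admissible word lengths such that every $w\in W(n)$ satisfies $w\ge 1$ and $w\ge 2\log_2 n$, and such that $w=2^{O(n\log n)}$ uniformly over $w\in W(n)$. An algorithm for a problem is a (possibly randomized) program that on every instance with parameter $n$ and every $w\in W(n)$ halts with probability one with the correct output. The problem *requires expected time* $\Omega(T(n))$ if for every algorithm for it there is $c>0$ such that, for all sufficiently large $n$, the supremum of its expected running time over all $w\in W(n)$ and all instances with parameter $n$ is at least $c\,T(n)$. **Problems.** *3XOR*: given a set $X$ of $n$ words of $w$ bits, decide whether there are $a,b,c\in X$ with $a\oplus b=c$ (bitwise XOR). *Offline SetDisjointness*: given a finite set $C=\{0,\dots,|C|-1\}$, finite families $A$ and $B$ of subsets of $C$ (each set given as a list of its elements), and $q$ pairs $(S,S')\in A\times B$, where all numbers in the input ($|C|$, $|A|$, $|B|$, $q$ and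 the total sizes of the two families) fit into a word, find all of the $q$ pairs with $S\cap S'\ne\emptyset$. **Theorem.** Let $0<\gamma<1$ be such that some number between $a\,n^\gamma$ and $b\,n^\gamma$ can be computed from $n$ on the word RAM in expected time $O(n^{2-\varepsilon})$, for some constants $a,b,\varepsilon>0$ and for all word lengths $w \geq \max(1, 2\log_2 n)$ (this holds, for instance, for every rational $\gamma$). There are constants $k_0,K_0>0$, depending only on $\gamma$, such that the following holds for all constants $0<k\le k_0$ and $K\ge K_0$, for all $W$ as above and for every $f$ with $f(n)=n^{o(1)}$. If 3XOR requires expected time $\Omega(n^2/f(n))$, then offline SetDisjointness, restricted to instances with $$k\,n^{2-2\gamma}\le|C|\le K\,n^{2-2\gamma},\qquad |A|=|B|,\qquad k\,n\log n\le|A|\le K\,n\log n,$$ $$|S|\le K\,n^{1-\gamma}\ \text{ for all } S\in A\cup B,\qquad k\,n^{1+\gamma}\log n\le q\le K\,n^{1+\gamma}\log n,$$ also requires expected time $\Omega(n^2/f(n))$. -/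

import Mathlib

open Filter Topology
open scoped ENNReal

/-! ## The randomized word RAM

Words are bit vectors of length `w`.  A machine has registers and memory banks, both indexed by
natural numbers; every bank is an array of `2 ^ w` words addressed by words.  A program is a finite
text, so it refers to a constant number of registers and banks only.  Control flow is structured
(sequencing, branching on a comparison, loops), and every elementary operation, every test and
every control step costs one unit of time. -/

namespace WordRAM

/-- The binary word operations: arithmetic modulo `2 ^ w`, shifts, bitwise Boolean operations. -/
inductive BinOp where
  | add | sub | mul | shl | shr | and | or | xor

def BinOp.eval {w : ℕ} : BinOp → BitVec w → BitVec w → BitVec w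
  | .add, x, y => x + y
  | .sub, x, y => x - y
  | .mul, x, y => x * y
  | .shl, x, y => x <<< y.toNat
  | .shr, x, y => x >>> y.toNat
  | .and, x, y => x &&& y
  | .or, x, y => x ||| y
  | .xor, x, y => x ^^^ y

/-- Elementary operations. In the comments, `r i` is register `i` and `m k` is bank `k`. -/
inductive Instr where
  /-- `r d := c` (modulo `2 ^ w`) -/
  | const (d c : ℕ)
  /-- `r d := r a ∘ r b` -/
  | op (o : BinOp) (d a b : ℕ)
  /-- `r d := bitwise complement of r a` -/
  | not (d a : ℕ)
  /-- `r d := m k [r a]` -/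
  | load (d k a : ℕ)
  /-- `m k [r a] := r s` -/
  | store (k a s : ℕ)
  /-- `r d :=` a uniformly random element of `{0, …, v - 1}`, where `v` is the content of `r a`,
  and the content `0` stands for `v = 2 ^ w` -/
  | rand (d a : ℕ)

/-- Comparisons of (unsigned) register contents. -/
inductive Test where
  | eq (a b : ℕ)
  | lt (a b : ℕ)

/-- Programs. -/
inductive Program where
  | skip
  | instr (i : Instr)
  | seq (p q : Program)
  | ite (t : Test) (p q : Program)
  | loop (t : Test) (p : Program)

/-- Contents of the registers and of the memory banks. -/
@[ext] structure State (w : ℕ) where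
  reg : ℕ → BitVec w
  mem : ℕ → BitVec w → BitVec w

def State.setReg {w : ℕ} (s : State w) (d : ℕ) (x : BitVec w) : State w :=
  { s with reg := Function.update s.reg d x }

def State.setMem {w : ℕ} (s : State w) (k : ℕ) (a x : BitVec w) : State w :=
  { s with mem := Function.update s.mem k (Function.update (s.mem k) a x) }

/-- The uniform distribution on `{0, …, v - 1}`, where `v = 0` stands for `2 ^ w`. -/
noncomputable def randWord {w : ℕ} (v : BitVec w) : PMF (BitVec w) :=
  (PMF.uniformOfFinset (Finset.range (if v.toNat = 0 then 2 ^ w else v.toNat))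
    ⟨0, by
      rw [Finset.mem_range]
      split_ifs with h
      · positivity
      · omega⟩).map (BitVec.ofNat w)

noncomputable def Instr.exec {w : ℕ} (s : State w) : Instr → PMF (State w)
  | .const d c => PMF.pure (s.setReg d (BitVec.ofNat w c))
  | .op o d a b => PMF.pure (s.setReg d (o.eval (s.reg a) (s.reg b)))
  | .not d a => PMF.pure (s.setReg d (~~~ (s.reg a)))
  | .load d k a => PMF.pure (s.setReg d (s.mem k (s.reg a)))
  | .store k a x => PMF.pure (s.setMem k (s.reg a) (s.reg x))
  | .rand d a => (randWord (s.reg a)).map (fun x => s.setReg d x)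

def Test.eval {w : ℕ} (s : State w) : Test → Bool
  | .eq a b => decide (s.reg a = s.reg b)
  | .lt a b => decide ((s.reg a).toNat < (s.reg b).toNat)

/-- A configuration: what remains to be executed, and the current state. The machine has halted
when nothing remains. -/
abbrev Config (w : ℕ) : Type := List Program × State w

/-- One time step. -/
noncomputable def step {w : ℕ} : Config w → PMF (Config w)
  | ([], s) => PMF.pure ([], s)
  | (.skip :: k, s) => PMF.pure (k, s)
  | (.instr i :: k, s) => (i.exec s).map (fun s' => (k, s'))
  | (.seq p q :: k, s) => PMF.pure (p :: q :: k, s)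
  | (.ite t p q :: k, s) => PMF.pure (if t.eval s then (p :: k, s) else (q :: k, s))
  | (.loop t p :: k, s) => PMF.pure (if t.eval s then (p :: .loop t p :: k, s) else (k, s))

/-- The distribution of the configuration after `t` steps. -/
noncomputable def stepN {w : ℕ} (x : Config w) : ℕ → PMF (Config w)
  | 0 => PMF.pure x
  | t + 1 => (stepN x t).bind step

/-- The expected running time of `p` from state `s`: the sum over all `t` of the probability that
the running time exceeds `t`. -/
noncomputable def expectedTime {w : ℕ} (p : Program) (s : State w) : ℝ≥0∞ :=
  ∑' t : ℕ, (stepN ([p], s) t).toOuterMeasure {x | x.1 ≠ []}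

/-- Started in `s`, the program `p` halts with probability one in a state that satisfies `post`. -/
def HaltsWith {w : ℕ} (p : Program) (s : State w) (post : State w → Prop) : Prop :=
  ⨆ t : ℕ, (stepN ([p], s) t).toOuterMeasure {x | x.1 = [] ∧ post x.2} = 1

/-! ## Problems and their expected running time -/

/-- A computational problem. The instances are grouped by a size parameter `n` and by the word
length `w` of the machine; an instance has an initial machine state and a condition on the final
state. -/
structure Problem where
  Inst : ℕ → ℕ → Type
  input : ∀ {n w : ℕ}, Inst n w → State w
  output : ∀ {n w : ℕ}, Inst n w → State w → Prop

/-- The (possibly randomized, zero-error) program `p` solves the problem on all word RAMs whose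
word length is admissible, `W n` being the set of admissible word lengths for size `n`. -/
def Solves (W : ℕ → Set ℕ) (P : Problem) (p : Program) : Prop :=
  ∀ n, ∀ w ∈ W n, ∀ I : P.Inst n w, HaltsWith p (P.input I) (P.output I)

/-- Worst case over the instances with parameter `n` of the expected running time. -/
noncomputable def worstCaseTime (W : ℕ → Set ℕ) (P : Problem) (p : Program) (n : ℕ) : ℝ≥0∞ :=
  ⨆ w ∈ W n, ⨆ I : P.Inst n w, expectedTime p (P.input I)

/-- Every algorithm for `P` requires expected time `Ω(T n)`. -/
def RequiresExpectedTime (W : ℕ → Set ℕ) (P : Problem) (T : ℕ → ℝ) : Prop :=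
  ∀ p : Program, Solves W P p →
    ∃ c : ℝ, 0 < c ∧ ∀ᶠ n in atTop, ENNReal.ofReal (c * T n) ≤ worstCaseTime W P p n

/-- Admissible word lengths: `w ≥ 2 log₂ n` (and `w ≥ 1`), and `w = 2 ^ O(n log n)`. -/
structure AdmissibleWordLengths (W : ℕ → Set ℕ) : Prop where
  pos : ∀ n, ∀ w ∈ W n, 1 ≤ w
  lower : ∀ n, ∀ w ∈ W n, n ^ 2 ≤ 2 ^ w
  upper : ∃ K : ℝ, ∀ᶠ n : ℕ in atTop, ∀ w ∈ W n,
    (w : ℝ) ≤ (2 : ℝ) ^ (K * (n * Real.logb 2 n))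

/-- The bank that holds the list `l` from address `0` on, followed by zeros. -/
def bank {w : ℕ} (l : List ℕ) : BitVec w → BitVec w :=
  fun a => BitVec.ofNat w (l.getD a.toNat 0)

/-- The state whose registers hold `regs` from register `0` on and whose banks hold the lists
`banks` from bank `0` on; everything else is zero. -/
def initState (w : ℕ) (regs : List ℕ) (banks : List (List ℕ)) : State w where
  reg i := BitVec.ofNat w (regs.getD i 0)
  mem k := bank (banks.getD k [])

end WordRAM

open WordRAM

/-- 3XOR: given a set `X` of `n` words (as a repetition-free list), decide whether there are
`a, b, c ∈ X` with `a ⊕ b = c`. Input: register `0` holds `w`, register `1` holds `n`, bank `0`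
holds the elements of `X`. Output: register `0` is nonzero iff there is such a triple. -/
def threeXOR : Problem where
  Inst n w := {X : List (BitVec w) // X.Nodup ∧ X.length = n}
  input {n w} X := initState w [w, n] [X.1.map BitVec.toNat]
  output X s := s.reg 0 ≠ 0 ↔ ∃ a ∈ X.1, ∃ b ∈ X.1, ∃ c ∈ X.1, a ^^^ b = c

/-- An instance of offline SetDisjointness: the finite set `C = {0, …, card - 1}`, finite families
`A` and `B` of subsets of `C` (every set as a repetition-free list of its elements), and a list of
queries, i.e. pairs of (indices of) a member of `A` and a member of `B`. -/
structure SetDisjInstance where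
  card : ℕ
  A : List (List ℕ)
  B : List (List ℕ)
  queries : List (ℕ × ℕ)
  nodup_A : ∀ S ∈ A, S.Nodup
  nodup_B : ∀ S ∈ B, S.Nodup
  subset_A : ∀ S ∈ A, ∀ x ∈ S, x < card
  subset_B : ∀ S ∈ B, ∀ x ∈ S, x < card
  queries_lt : ∀ q ∈ queries, q.1 < A.length ∧ q.2 < B.length

namespace SetDisjInstance

/-- All numbers that occur in the input fit into a word. -/
def Fits (I : SetDisjInstance) (w : ℕ) : Prop :=
  I.card < 2 ^ w ∧ I.A.length < 2 ^ w ∧ I.B.length < 2 ^ w ∧ I.queries.length < 2 ^ w ∧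
    I.A.flatten.length < 2 ^ w ∧ I.B.flatten.length < 2 ^ w

/-- The size restrictions `|C| = Θ(n^(2-2γ))`, `|A| = |B| = Θ(n log n)`, `|S| = O(n^(1-γ))` for all
`S ∈ A ∪ B`, `q = Θ(n^(1+γ) log n)`, with lower constant `k` and upper constant `K`. -/
structure HasSize (γ k K : ℝ) (n : ℕ) (I : SetDisjInstance) : Prop where
  card_ge : k * (n : ℝ) ^ (2 - 2 * γ) ≤ I.card
  card_le : (I.card : ℝ) ≤ K * (n : ℝ) ^ (2 - 2 * γ)
  length_eq : I.A.length = I.B.length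
  length_ge : k * (n * Real.log n) ≤ I.A.length
  length_le : (I.A.length : ℝ) ≤ K * (n * Real.log n)
  set_A_le : ∀ S ∈ I.A, (S.length : ℝ) ≤ K * (n : ℝ) ^ (1 - γ)
  set_B_le : ∀ S ∈ I.B, (S.length : ℝ) ≤ K * (n : ℝ) ^ (1 - γ)
  queries_ge : k * ((n : ℝ) ^ (1 + γ) * Real.log n) ≤ I.queries.length
  queries_le : (I.queries.length : ℝ) ≤ K * ((n : ℝ) ^ (1 + γ) * Real.log n)

/-- Positions at which the sets of a family start in the concatenation of the family: entry `i` is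
the total length of the first `i` sets, for `0 ≤ i ≤` number of sets. -/
def offsets (F : List (List ℕ)) : List ℕ :=
  (List.range (F.length + 1)).map fun i => (F.take i).flatten.length

/-- The two sets of a query have a common element. -/
def Meets (I : SetDisjInstance) (q : ℕ × ℕ) : Prop :=
  ∃ x, x ∈ I.A.getD q.1 [] ∧ x ∈ I.B.getD q.2 []

end SetDisjInstance

/-- Offline SetDisjointness on the instances of the given sizes. Input: registers `0` to `4` hold
`w`, `|C|`, `|A|`, `|B|`, `q`; banks `0` and `1` hold the offsets and the concatenation of `A`,
banks `2` and `3` those of `B`, banks `4` and `5` the first and second components of the queries.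
Output: for every `j < q`, cell `j` of bank `6` is nonzero iff the two sets of the `j`-th query
have a common element. -/
def setDisjointness (γ k K : ℝ) : Problem where
  Inst n w := {I : SetDisjInstance // I.HasSize γ k K n ∧ I.Fits w}
  input {_ w} I := initState w
    [w, I.1.card, I.1.A.length, I.1.B.length, I.1.queries.length]
    [SetDisjInstance.offsets I.1.A, I.1.A.flatten, SetDisjInstance.offsets I.1.B, I.1.B.flatten,
      I.1.queries.map Prod.fst, I.1.queries.map Prod.snd]
  output {_ w} I s := ∀ (j : ℕ) (hj : j < I.1.queries.length),
    s.mem 6 (BitVec.ofNat w j) ≠ 0 ↔ I.1.Meets (I.1.queries[j])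

/-- `n ^ γ` can be computed up to constant factors in expected time `O(n ^ (2 - ε))`, for some
`ε > 0`, by a word RAM program that finds `w` in register `0` and `n` in register `1` and leaves
the result in register `0`. (For rational `γ` it is computable in time `O(log n)`.) -/
def PowComputable (γ : ℝ) : Prop :=
  ∃ p : Program, ∃ ε a b D : ℝ, 0 < ε ∧ 0 < a ∧ ∀ n w : ℕ, 1 ≤ n → 1 ≤ w → n ^ 2 ≤ 2 ^ w →
    HaltsWith p (initState w [w, n] [])
      (fun s => a * (n : ℝ) ^ γ ≤ ((s.reg 0).toNat : ℝ) ∧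
        ((s.reg 0).toNat : ℝ) ≤ b * (n : ℝ) ^ γ) ∧
    expectedTime p (initState w [w, n] []) ≤ ENNReal.ofReal (D * (n : ℝ) ^ (2 - ε))

/-- `f(n) = n ^ o(1)`. -/
def IsPowLittleOOne (f : ℕ → ℝ) : Prop :=
  ∃ g : ℕ → ℝ, Tendsto g atTop (𝓝 0) ∧ ∀ᶠ n : ℕ in atTop, f n = (n : ℝ) ^ g n

/-!
# A lower bound for offline SetDisjointness from 3XOR

Given an algorithm for offline SetDisjointness, 3XOR is solved by a zero-error algorithm whose
expected time is that of one call plus `O(n ^ (2 - δ))` for some `δ > 0`. Since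
`n ^ 2 / f n = n ^ (2 - o(1))`, a lower bound of this order for 3XOR passes to the call.

**Buckets.** Let `R` be a power of two of order `n ^ γ`, and `m` a power of two with
`n ≤ R * m ≤ 2 * n`. A random hash function that is linear over the field with two elements
divides the `n` words into `R` buckets. With probability at least one half there are at most
`n * m` collisions (`card_many_collisions`), so that one of `L = O(log n)` independent functions
is good with high probability. Arrange the words by buckets and cut the resulting sequence into
chunks of length `m`. If `a ^^^ b = c`, then the buckets of `a` and `b` add up to the hash value
of `c`. Hence it is enough to test, for each word `c` and each bucket, the chunks that meet the
bucket against the chunks that meet its partner (`exists_triple`), and for a good function there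
are at most `11 * n * R` such tests `(c, i, j)` (`length_triples_le`), each asking whether chunks
`i` and `j` contain words with sum `c`.

**Tests as disjointness queries.** A second linear hash function `h`, into `4 * m ^ 2` values, is
applied to the words. The value `h c` is a sum `u * 2 ^ (s + 1) + u'` without carries, where
`m = 2 ^ s`, and `h a ^^^ h b = h c` holds iff `h a`, shifted by the first summand, equals `h b`,
shifted by the second. There are only `2 * m` values of `u` and of `u'`, so that it suffices to
put into the families all shifts by first summands, and by second summands, of the hashed chunks
(`meets_query_iff`). A test without a solution survives one function `h` with probability at most
`1 / 4` (`card_survives`), hence all of `L` independent ones with probability at most `4 ^ (-L)`.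
The sets for all `L` functions make up a single instance, `Params.inst`, and its sizes are the
required ones (`Params.Scaled.hasSize`).

**Zero error.** If no test survives, there is no solution. Otherwise one surviving test is checked
by brute force, and if it fails the check, or if no good hash function has been found, 3XOR is
solved by brute force in time `O(n ^ 3)`. The probabilities of these events are so small that this
adds only a constant to the expected time (`avgWords_bad_le`, `avgWords_falseSurvivor_le`).

**Hashing fast.** A bit of a hash value is the parity of a word. Words may be as long as
`2 ^ O(n * log n)`, but `parityProg` computes parities in time `O(log log w)`, by which all hash
values are obtained within the time bound; see `eventually_mainTime_le`.

**Programs.** `Ok` is total correctness with a bound on the expected time, and `Ok.call` composes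
a program that is known only through its specification with a continuation. `Det` is its
counterpart for programs without random choices; together with `Frame`, which says what a program
leaves unchanged, it gives the rules by which the single parts of the reduction are verified. The
given programs run in their own copies of the registers and banks (`Program.rename`), so that the
numbers divisible by three belong to the reduction. `reduction_spec` is the specification of the
whole reduction. Inputs below a threshold, for which the numbers of the reduction may not fit into
a word, are solved by brute force.
-/

namespace WordRAM

/-! ### Expectations over discrete distributions -/

/-- The expectation of `F` under the distribution `p`. -/
noncomputable def mean {α : Type*} (p : PMF α) (F : α → ℝ≥0∞) : ℝ≥0∞ := ∑' a, p a * F a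

section Mean
variable {α β : Type*}

theorem mean_pure (a : α) (F : α → ℝ≥0∞) : mean (PMF.pure a) F = F a := by
  unfold mean
  rw [tsum_eq_single a]
  · simp
  · intro b hb
    simp [PMF.pure_apply, hb]

theorem mean_bind (p : PMF α) (f : α → PMF β) (F : β → ℝ≥0∞) :
    mean (p.bind f) F = mean p (fun a => mean (f a) F) := by
  unfold mean
  simp_rw [PMF.bind_apply, ← ENNReal.tsum_mul_right, ← ENNReal.tsum_mul_left]
  rw [ENNReal.tsum_comm]
  simp_rw [mul_assoc]

theorem mean_map (p : PMF α) (f : α → β) (F : β → ℝ≥0∞) :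
    mean (p.map f) F = mean p (fun a => F (f a)) := by
  rw [PMF.map, mean_bind]
  simp [mean_pure]

theorem mean_mono {p : PMF α} {F G : α → ℝ≥0∞} (h : ∀ a ∈ p.support, F a ≤ G a) :
    mean p F ≤ mean p G := by
  refine ENNReal.tsum_le_tsum fun a => ?_
  by_cases ha : a ∈ p.support
  · exact mul_le_mul_right (h a ha) _
  · rw [(PMF.apply_eq_zero_iff p a).2 ha]; simp

theorem mean_add (p : PMF α) (F G : α → ℝ≥0∞) :
    mean p (fun a => F a + G a) = mean p F + mean p G := by
  unfold mean
  simp_rw [mul_add]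
  exact ENNReal.tsum_add

theorem mean_const (p : PMF α) (c : ℝ≥0∞) : mean p (fun _ => c) = c := by
  unfold mean
  rw [ENNReal.tsum_mul_right, p.tsum_coe, one_mul]

theorem mean_iSup (p : PMF α) (F : ℕ → α → ℝ≥0∞) (hF : ∀ a, Monotone fun t => F t a) :
    mean p (fun a => ⨆ t, F t a) = ⨆ t, mean p (F t) := by
  unfold mean
  simp_rw [ENNReal.mul_iSup, ENNReal.tsum_eq_iSup_sum]
  rw [iSup_comm]
  refine iSup_congr fun s => ?_
  rw [ENNReal.finsetSum_iSup_of_monotone]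
  intro a t t' h
  exact mul_le_mul_right (hF a h) _

theorem mean_tsum (p : PMF α) (F : ℕ → α → ℝ≥0∞) :
    mean p (fun a => ∑' t, F t a) = ∑' t, mean p (F t) := by
  unfold mean
  simp_rw [← ENNReal.tsum_mul_left]
  rw [ENNReal.tsum_comm]

theorem toOuterMeasure_bind (p : PMF α) (f : α → PMF β) (A : Set β) :
    (p.bind f).toOuterMeasure A = mean p (fun a => (f a).toOuterMeasure A) :=
  PMF.toOuterMeasure_bind_apply p f A

theorem toOuterMeasure_le_one (p : PMF α) (A : Set α) : p.toOuterMeasure A ≤ 1 := by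
  have h := p.toOuterMeasure_mono (s := A) (t := Set.univ) (by simp)
  rwa [(p.toOuterMeasure_apply_eq_one_iff _).2 (Set.subset_univ _)] at h

end Mean

/-! ### Expected time and halting probability of configurations -/

variable {w : ℕ}

theorem stepN_succ' (x : Config w) (t : ℕ) :
    stepN x (t + 1) = (step x).bind (fun y => stepN y t) := by
  induction t with
  | zero => simp [stepN]
  | succ t ih =>
    rw [stepN, ih, PMF.bind_bind]
    rfl

/-- The probability that the running time from configuration `x` exceeds `t`. -/
noncomputable def aliveProb (x : Config w) (t : ℕ) : ℝ≥0∞ :=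
  (stepN x t).toOuterMeasure {y | y.1 ≠ []}

/-- The expected running time from a configuration. -/
noncomputable def cfgTime (x : Config w) : ℝ≥0∞ := ∑' t : ℕ, aliveProb x t

/-- The probability of having halted after `t` steps in a state that satisfies `post`. -/
noncomputable def haltProbAt (post : State w → Prop) (x : Config w) (t : ℕ) : ℝ≥0∞ :=
  (stepN x t).toOuterMeasure {y | y.1 = [] ∧ post y.2}

/-- The probability of halting eventually in a state that satisfies `post`. -/
noncomputable def haltProb (post : State w → Prop) (x : Config w) : ℝ≥0∞ :=
  ⨆ t : ℕ, haltProbAt post x t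

theorem stepN_nil (s : State w) (t : ℕ) : stepN (([], s) : Config w) t = PMF.pure ([], s) := by
  induction t with
  | zero => rfl
  | succ t ih => rw [stepN, ih, PMF.pure_bind]; rfl

theorem aliveProb_succ (x : Config w) (t : ℕ) :
    aliveProb x (t + 1) = mean (step x) (fun y => aliveProb y t) := by
  rw [aliveProb, stepN_succ', toOuterMeasure_bind]; rfl

theorem aliveProb_nil (s : State w) (t : ℕ) : aliveProb (([], s) : Config w) t = 0 := by
  rw [aliveProb, stepN_nil, PMF.toOuterMeasure_pure_apply]; simp

theorem aliveProb_zero {x : Config w} (hx : x.1 ≠ []) : aliveProb x 0 = 1 := by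
  rw [aliveProb, stepN, PMF.toOuterMeasure_pure_apply]; simp [hx]

theorem cfgTime_nil (s : State w) : cfgTime (([], s) : Config w) = 0 := by
  simp [cfgTime, aliveProb_nil]

/-- First-step analysis of the expected running time. -/
theorem cfgTime_step {x : Config w} (hx : x.1 ≠ []) :
    cfgTime x = 1 + mean (step x) cfgTime := by
  rw [cfgTime, tsum_eq_zero_add' ENNReal.summable, aliveProb_zero hx]
  simp_rw [aliveProb_succ]
  rw [← mean_tsum]
  rfl

theorem haltProbAt_succ (post : State w → Prop) (x : Config w) (t : ℕ) :
    haltProbAt post x (t + 1) = mean (step x) (fun y => haltProbAt post y t) := by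
  rw [haltProbAt, stepN_succ', toOuterMeasure_bind]; rfl

theorem haltProbAt_nil {post : State w → Prop} {s : State w} (h : post s) (t : ℕ) :
    haltProbAt post ([], s) t = 1 := by
  rw [haltProbAt, stepN_nil, PMF.toOuterMeasure_pure_apply]; simp [h]

theorem haltProb_nil {post : State w → Prop} {s : State w} (h : post s) :
    haltProb post ([], s) = 1 := by
  simp [haltProb, haltProbAt_nil h]

theorem haltProb_le_one (post : State w → Prop) (x : Config w) : haltProb post x ≤ 1 :=
  iSup_le fun _ => toOuterMeasure_le_one _ _

theorem haltProbAt_le_succ (post : State w → Prop) (x : Config w) (t : ℕ) :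
    haltProbAt post x t ≤ haltProbAt post x (t + 1) := by
  induction t generalizing x with
  | zero =>
    by_cases h : x.1 = [] ∧ post x.2
    · obtain ⟨l, s⟩ := x
      obtain ⟨h1, h2⟩ := h
      simp only at h1 h2
      subst h1
      rw [haltProbAt_nil h2, haltProbAt_nil h2]
    · rw [haltProbAt, stepN, PMF.toOuterMeasure_pure_apply, if_neg (by simpa using h)]
      exact zero_le
  | succ t ih =>
    rw [haltProbAt_succ, haltProbAt_succ post x (t + 1)]
    exact mean_mono fun y _ => ih y

theorem haltProbAt_mono (post : State w → Prop) (x : Config w) : Monotone (haltProbAt post x) :=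
  monotone_nat_of_le_succ (haltProbAt_le_succ post x)

theorem haltProb_step (post : State w → Prop) (x : Config w) :
    haltProb post x = mean (step x) (haltProb post) := by
  unfold haltProb
  rw [mean_iSup _ _ (fun y => haltProbAt_mono post y)]
  simp_rw [← haltProbAt_succ]
  refine le_antisymm (iSup_le fun t => ?_) (iSup_le fun t => ?_)
  · exact (haltProbAt_le_succ post x t).trans (le_iSup (fun t => haltProbAt post x (t + 1)) t)
  · exact le_iSup (fun t => haltProbAt post x t) (t + 1)

/-! ### Execution in front of a continuation -/

/-- The configuration `x` with the programs `k` to be executed afterwards. -/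
def Config.andThen (x : Config w) (k : List Program) : Config w := (x.1 ++ k, x.2)

theorem step_andThen (x : Config w) (hx : x.1 ≠ []) (k : List Program) :
    step (x.andThen k) = (step x).map (fun y => y.andThen k) := by
  obtain ⟨l, s⟩ := x
  cases l with
  | nil => exact absurd rfl hx
  | cons p l =>
    cases p with
    | skip => simp [Config.andThen, step, PMF.pure_map]
    | instr i =>
      simp only [Config.andThen, step, List.cons_append, PMF.map_comp]
      rfl
    | seq p q => simp [Config.andThen, step, PMF.pure_map]
    | ite t p q =>
      simp only [Config.andThen, step, List.cons_append, PMF.pure_map]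
      split_ifs <;> rfl
    | loop t p =>
      simp only [Config.andThen, step, List.cons_append, PMF.pure_map]
      split_ifs <;> rfl

/-- From `x` only halting states in `Q` can be reached. -/
def HaltsIn (Q : State w → Prop) (x : Config w) : Prop :=
  ∀ t, ∀ y ∈ (stepN x t).support, y.1 = [] → Q y.2

theorem HaltsIn.step {Q : State w → Prop} {x y : Config w} (h : HaltsIn Q x)
    (hy : y ∈ (step x).support) : HaltsIn Q y := by
  intro t z hz hz1
  refine h (t + 1) z ?_ hz1
  rw [stepN_succ', PMF.mem_support_bind_iff]
  exact ⟨y, hy, hz⟩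

/-- If the machine halts in `Q` with probability one, then it cannot halt outside of `Q`. -/
theorem haltsIn_of_haltProb {Q : State w → Prop} {x : Config w} (h : haltProb Q x = 1) :
    HaltsIn Q x := by
  intro t y hy hy1
  by_contra hQ
  obtain ⟨l, s⟩ := y
  simp only at hy1 hQ
  subst hy1
  -- Halting configurations are absorbing, so the mass of a bad one is lost forever.
  set ε := stepN x t ([], s) with hε
  have hε0 : ε ≠ 0 := (PMF.mem_support_iff _ _).1 hy
  have key : ∀ t', t ≤ t' → haltProbAt Q x t' ≤ 1 - ε := by
    intro t' ht'
    have hmass : ε ≤ stepN x t' ([], s) := by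
      induction t', ht' using Nat.le_induction with
      | base => exact le_rfl
      | succ t' _ ih =>
        refine ih.trans ?_
        rw [stepN, PMF.bind_apply]
        refine le_trans ?_ (ENNReal.le_tsum (([], s) : Config w))
        simp [WordRAM.step]
    have hadd : haltProbAt Q x t' + stepN x t' ([], s) ≤ 1 := by
      rw [haltProbAt, ← PMF.toOuterMeasure_apply_singleton, PMF.toOuterMeasure_apply,
        PMF.toOuterMeasure_apply, ← ENNReal.tsum_add, ← (stepN x t').tsum_coe]
      refine ENNReal.tsum_le_tsum fun z => ?_
      by_cases hz : z = ([], s)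
      · subst hz
        simp [hQ]
      · simp only [Set.indicator, Set.mem_singleton_iff, hz, if_false, add_zero]
        split_ifs <;> simp
    calc haltProbAt Q x t' ≤ 1 - stepN x t' ([], s) :=
          ENNReal.le_sub_of_add_le_right (ne_top_of_le_ne_top ENNReal.one_ne_top
            (PMF.coe_le_one _ _)) hadd
      _ ≤ 1 - ε := tsub_le_tsub_left hmass 1
  have : haltProb Q x ≤ 1 - ε := by
    refine iSup_le fun t' => ?_
    exact (haltProbAt_mono Q x (le_max_right t t')).trans (key _ (le_max_left t t'))
  rw [h] at this
  exact absurd this (not_le.2 (ENNReal.sub_lt_self ENNReal.one_ne_top one_ne_zero hε0))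

/-- If the continuation `k` is correct from all states in `Q`, then it is correct after a
computation that halts in `Q`. -/
theorem haltProb_andThen {Q post : State w → Prop} {k : List Program}
    (hk : ∀ s, Q s → haltProb post (k, s) = 1) (x : Config w) :
    haltProb Q x ≤ haltProb post (x.andThen k) := by
  refine iSup_le fun t => ?_
  have hnil : ∀ (y : Config w), y.1 = [] → ∀ t, haltProbAt Q y t ≤ haltProb post (y.andThen k) := by
    rintro ⟨l, s⟩ hl t
    simp only at hl
    subst hl
    by_cases hs : Q s
    · simp only [Config.andThen, List.nil_append, hk s hs]
      exact toOuterMeasure_le_one _ _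
    · rw [haltProbAt, stepN_nil, PMF.toOuterMeasure_pure_apply, if_neg (by simpa using hs)]
      exact zero_le
  induction t generalizing x with
  | zero =>
    by_cases hx : x.1 = []
    · exact hnil x hx 0
    · rw [haltProbAt, stepN, PMF.toOuterMeasure_pure_apply, if_neg (by simp [hx])]
      exact zero_le
  | succ t ih =>
    by_cases hx : x.1 = []
    · exact hnil x hx _
    · rw [haltProbAt_succ, haltProb_step, step_andThen x hx, mean_map]
      exact mean_mono fun y _ => ih y

/-- Expected running times of a computation that halts in `Q` and of its continuation add up. -/
theorem cfgTime_andThen {Q : State w → Prop} {k : List Program} {M : ℝ≥0∞}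
    (hk : ∀ s, Q s → cfgTime (k, s) ≤ M) {x : Config w} (hx : HaltsIn Q x) :
    cfgTime (x.andThen k) ≤ cfgTime x + M := by
  have hnil : ∀ (y : Config w), y.1 = [] → HaltsIn Q y → cfgTime (y.andThen k) ≤ M := by
    rintro ⟨l, s⟩ hl hy
    simp only at hl
    subst hl
    refine hk s (hy 0 ([], s) ?_ rfl)
    simp [stepN]
  have key : ∀ T, ∀ y : Config w, HaltsIn Q y →
      ∑ t ∈ Finset.range T, aliveProb (y.andThen k) t ≤ cfgTime y + M := by
    intro T
    induction T with
    | zero => simp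
    | succ T ih =>
      intro y hy
      by_cases hy1 : y.1 = []
      · exact (ENNReal.sum_le_tsum _).trans ((hnil y hy1 hy).trans le_add_self)
      · have hne : (y.andThen k).1 ≠ [] := by simp [Config.andThen, hy1]
        rw [Finset.sum_range_succ', aliveProb_zero hne, cfgTime_step hy1]
        have : ∑ t ∈ Finset.range T, aliveProb (y.andThen k) (t + 1)
            = mean (step y) (fun z => ∑ t ∈ Finset.range T, aliveProb (z.andThen k) t) := by
          simp_rw [aliveProb_succ, step_andThen y hy1, mean_map]
          unfold mean
          simp_rw [Finset.mul_sum]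
          rw [Summable.tsum_finsetSum (fun _ _ => ENNReal.summable)]
        rw [this, add_comm, add_assoc]
        refine add_le_add_right ?_ _
        calc _ ≤ mean (step y) (fun z => cfgTime z + M) :=
              mean_mono fun z hz => ih z (hy.step hz)
          _ = _ := by rw [mean_add, mean_const]
  rw [cfgTime, ENNReal.tsum_eq_iSup_nat]
  exact iSup_le fun T => key T x hx

/-! ### Total correctness with a bound on the expected time -/

/-- From the configuration `x` the machine halts with probability one in a state that satisfies
`post`, and its expected running time is at most `T`. -/
def Ok (x : Config w) (post : State w → Prop) (T : ℝ≥0∞) : Prop :=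
  haltProb post x = 1 ∧ cfgTime x ≤ T

theorem Ok.mono {x : Config w} {post : State w → Prop} {T T' : ℝ≥0∞} (h : Ok x post T)
    (hT : T ≤ T') : Ok x post T' := ⟨h.1, h.2.trans hT⟩

theorem Ok.nil {s : State w} {post : State w → Prop} (h : post s) : Ok ([], s) post 0 :=
  ⟨haltProb_nil h, (cfgTime_nil s).le⟩

/-- One deterministic step. -/
theorem Ok.of_step {x y : Config w} {post : State w → Prop} {T : ℝ≥0∞} (hx : x.1 ≠ [])
    (hs : step x = PMF.pure y) (h : Ok y post T) : Ok x post (1 + T) := by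
  refine ⟨?_, ?_⟩
  · rw [haltProb_step, hs, mean_pure, h.1]
  · rw [cfgTime_step hx, hs, mean_pure]
    exact add_le_add_right h.2 _

theorem Ok.seq {p q : Program} {k : List Program} {s : State w} {post : State w → Prop}
    {T : ℝ≥0∞} (h : Ok (p :: q :: k, s) post T) : Ok (.seq p q :: k, s) post (1 + T) :=
  h.of_step (by simp) rfl

theorem Ok.ite {t : Test} {p q : Program} {k : List Program} {s : State w}
    {post : State w → Prop} {T : ℝ≥0∞} (h₁ : t.eval s = true → Ok (p :: k, s) post T)
    (h₂ : t.eval s = false → Ok (q :: k, s) post T) : Ok (.ite t p q :: k, s) post (1 + T) := by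
  cases ht : t.eval s
  · exact (h₂ ht).of_step (by simp) (by simp [step, ht])
  · exact (h₁ ht).of_step (by simp) (by simp [step, ht])

/-- Running a subprogram whose behaviour is known only up to its postcondition. -/
theorem Ok.call {p : Program} {k : List Program} {s : State w} {Q post : State w → Prop}
    {T : ℝ≥0∞} (hp : HaltsWith p s Q) (h : ∀ s', Q s' → Ok (k, s') post T) :
    Ok (p :: k, s) post (expectedTime p s + T) := by
  have hp' : haltProb Q ([p], s) = 1 := hp
  refine ⟨le_antisymm (haltProb_le_one _ _) ?_, ?_⟩
  · rw [← hp']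
    exact haltProb_andThen (fun s' hs' => (h s' hs').1) ([p], s)
  · exact cfgTime_andThen (x := ([p], s)) (fun s' hs' => (h s' hs').2) (haltsIn_of_haltProb hp')

theorem Ok.haltsWith {p : Program} {s : State w} {post : State w → Prop} {T : ℝ≥0∞}
    (h : Ok ([p], s) post T) : HaltsWith p s post ∧ expectedTime p s ≤ T := h

/-! ### Relocation of programs -/

/-- The instruction with registers and banks renamed by `ρ`. -/
def Instr.rename (ρ : ℕ → ℕ) : Instr → Instr
  | .const d c => .const (ρ d) c
  | .op o d a b => .op o (ρ d) (ρ a) (ρ b)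
  | .not d a => .not (ρ d) (ρ a)
  | .load d k a => .load (ρ d) (ρ k) (ρ a)
  | .store k a s => .store (ρ k) (ρ a) (ρ s)
  | .rand d a => .rand (ρ d) (ρ a)

/-- The test with registers renamed by `ρ`. -/
def Test.rename (ρ : ℕ → ℕ) : Test → Test
  | .eq a b => .eq (ρ a) (ρ b)
  | .lt a b => .lt (ρ a) (ρ b)

/-- The program with registers and banks renamed by `ρ`. -/
def Program.rename (ρ : ℕ → ℕ) : Program → Program
  | .skip => .skip
  | .instr i => .instr (i.rename ρ)
  | .seq p q => .seq (p.rename ρ) (q.rename ρ)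
  | .ite t p q => .ite (t.rename ρ) (p.rename ρ) (q.rename ρ)
  | .loop t p => .loop (t.rename ρ) (p.rename ρ)

/-- The `j`-th of three disjoint copies of the register and bank numbers. The reduction itself
works with copy `0`, the algorithm for offline SetDisjointness is run in copy `1`, and the program
for powers in copy `2`. -/
def copy (j i : ℕ) : ℕ := 3 * i + j

/-- The state with `s` in the registers and banks of copy `j`, and `s₀` elsewhere. -/
def State.embed (j : ℕ) (s₀ s : State w) : State w where
  reg i := if i % 3 = j then s.reg (i / 3) else s₀.reg i
  mem k := if k % 3 = j then s.mem (k / 3) else s₀.mem k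

section Rename
variable {j : ℕ} (hj : j < 3) (s₀ s : State w)
include hj

theorem embed_reg_copy (i : ℕ) : (State.embed j s₀ s).reg (copy j i) = s.reg i := by
  have h1 : (3 * i + j) % 3 = j := by omega
  have h2 : (3 * i + j) / 3 = i := by omega
  simp [State.embed, copy, h1, h2]

theorem embed_mem_copy (k : ℕ) : (State.embed j s₀ s).mem (copy j k) = s.mem k := by
  have h1 : (3 * k + j) % 3 = j := by omega
  have h2 : (3 * k + j) / 3 = k := by omega
  simp [State.embed, copy, h1, h2]

theorem embed_setReg (d : ℕ) (x : BitVec w) :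
    (State.embed j s₀ s).setReg (copy j d) x = State.embed j s₀ (s.setReg d x) := by
  ext1
  · funext i
    simp only [State.embed, State.setReg, Function.update_apply, copy]
    by_cases h : i % 3 = j
    · have : i = 3 * d + j ↔ i / 3 = d := by omega
      simp [h, this]
    · have : i ≠ 3 * d + j := by omega
      simp [h, this]
  · rfl

theorem embed_setMem (k : ℕ) (a x : BitVec w) :
    (State.embed j s₀ s).setMem (copy j k) a x = State.embed j s₀ (s.setMem k a x) := by
  ext1
  · rfl
  · funext i
    simp only [State.setMem, embed_mem_copy hj, Function.update_apply]
    simp only [State.embed, Function.update_apply, copy]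
    by_cases h : i % 3 = j
    · have : i = 3 * k + j ↔ i / 3 = k := by omega
      simp [h, this]
    · have : i ≠ 3 * k + j := by omega
      simp [h, this]

theorem exec_rename (i : Instr) :
    (i.rename (copy j)).exec (State.embed j s₀ s) = (i.exec s).map (State.embed j s₀) := by
  cases i <;> simp only [Instr.rename, Instr.exec, embed_reg_copy hj, embed_mem_copy hj,
    embed_setReg hj, embed_setMem hj, PMF.pure_map, PMF.map_comp]
  rfl

theorem eval_rename (t : Test) : (t.rename (copy j)).eval (State.embed j s₀ s) = t.eval s := by
  cases t <;> simp only [Test.rename, Test.eval, embed_reg_copy hj]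

/-- The configuration `x` relocated to copy `j`. -/
def Config.embed (j : ℕ) (s₀ : State w) (x : Config w) : Config w :=
  (x.1.map (Program.rename (copy j)), State.embed j s₀ x.2)

theorem step_rename (x : Config w) :
    step (x.embed j s₀) = (step x).map (Config.embed j s₀) := by
  obtain ⟨l, s⟩ := x
  cases l with
  | nil => simp [Config.embed, step, PMF.pure_map]
  | cons p l =>
    cases p with
    | skip => simp [Config.embed, step, PMF.pure_map, Program.rename]
    | instr i =>
      simp only [Config.embed, step, List.map_cons, Program.rename, exec_rename hj, PMF.map_comp]
      rfl
    | seq p q => simp [Config.embed, step, PMF.pure_map, Program.rename]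
    | ite t p q =>
      simp only [Config.embed, step, List.map_cons, Program.rename, eval_rename hj, PMF.pure_map]
      split_ifs <;> rfl
    | loop t p =>
      simp only [Config.embed, step, List.map_cons, Program.rename, eval_rename hj, PMF.pure_map]
      split_ifs <;> rfl

theorem stepN_rename (x : Config w) (t : ℕ) :
    stepN (x.embed j s₀) t = (stepN x t).map (Config.embed j s₀) := by
  induction t with
  | zero => simp [stepN, PMF.pure_map]
  | succ t ih =>
    rw [stepN, ih, stepN, PMF.bind_map, PMF.map_bind]
    congr 1
    funext y
    exact step_rename hj s₀ y

theorem expectedTime_rename (p : Program) :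
    expectedTime (p.rename (copy j)) (State.embed j s₀ s) = expectedTime p s := by
  refine tsum_congr fun t => ?_
  have := stepN_rename hj s₀ ([p], s) t
  rw [show ([p.rename (copy j)], State.embed j s₀ s) = Config.embed j s₀ ([p], s) from rfl,
    this, PMF.toOuterMeasure_map_apply]
  congr 1
  ext y
  simp [Config.embed]

/-- A relocated program computes in its copy what the original program computes, and leaves the
other copies unchanged. -/
theorem haltsWith_rename {p : Program} {s : State w} {Q : State w → Prop} (h : HaltsWith p s Q) :
    HaltsWith (p.rename (copy j)) (State.embed j s₀ s)
      (fun s' => ∃ s₁, Q s₁ ∧ s' = State.embed j s₀ s₁) := by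
  change haltProb (fun s' => ∃ s₁, Q s₁ ∧ s' = State.embed j s₀ s₁)
    ([p.rename (copy j)], State.embed j s₀ s) = 1
  refine le_antisymm (haltProb_le_one _ _) ?_
  rw [← h]
  refine iSup_mono fun t => ?_
  have := stepN_rename hj s₀ ([p], s) t
  rw [show ([p.rename (copy j)], State.embed j s₀ s) = Config.embed j s₀ ([p], s) from rfl,
    haltProbAt, this, PMF.toOuterMeasure_map_apply]
  refine PMF.toOuterMeasure_mono _ ?_
  rintro y ⟨⟨h1, h2⟩, -⟩
  exact ⟨by simp [Config.embed, h1], y.2, h2, rfl⟩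

/-- Running a relocated program from a state whose copy `j` is the initial state `s`. -/
theorem Ok.call_rename {p : Program} {k : List Program} {s s₁ : State w} {Q post : State w → Prop}
    {T : ℝ≥0∞} (hp : HaltsWith p s Q) (hr : ∀ i, s₁.reg (copy j i) = s.reg i)
    (hm : ∀ i, s₁.mem (copy j i) = s.mem i)
    (h : ∀ s', Q s' → Ok (k, State.embed j s₁ s') post T) :
    Ok (p.rename (copy j) :: k, s₁) post (expectedTime p s + T) := by
  have hs : s₁ = State.embed j s₁ s := by
    ext1
    · funext i
      by_cases hi : i % 3 = j
      · have : i = copy j (i / 3) := by simp only [copy]; omega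
        simp only [State.embed, hi, if_true]
        rw [← hr]
        exact congrArg _ this
      · simp [State.embed, hi]
    · funext i
      by_cases hi : i % 3 = j
      · have : i = copy j (i / 3) := by simp only [copy]; omega
        simp only [State.embed, hi, if_true]
        rw [← hm]
        exact congrArg _ this
      · simp [State.embed, hi]
  have h1 := haltsWith_rename hj s₁ hp
  rw [← hs] at h1
  have h2 := expectedTime_rename hj s₁ s p
  rw [← hs] at h2
  rw [← h2]
  refine Ok.call h1 ?_
  rintro s' ⟨s'', hQ, rfl⟩
  exact h s'' hQ

end Rename

/-! ### Deterministic executions -/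

/-- The effect of a deterministic instruction. -/
def Instr.run (s : State w) : Instr → State w
  | .const d c => s.setReg d (BitVec.ofNat w c)
  | .op o d a b => s.setReg d (o.eval (s.reg a) (s.reg b))
  | .not d a => s.setReg d (~~~ (s.reg a))
  | .load d k a => s.setReg d (s.mem k (s.reg a))
  | .store k a x => s.setMem k (s.reg a) (s.reg x)
  | .rand _ _ => s

/-- Whether the instruction makes no random choice. -/
def Instr.isDet : Instr → Bool
  | .rand _ _ => false
  | _ => true

theorem Instr.exec_eq {i : Instr} (h : i.isDet = true) (s : State w) :
    i.exec s = PMF.pure (i.run s) := by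
  cases i <;> first | rfl | exact absurd h (by simp [Instr.isDet])

/-- `Runs p s t s'`: started in `s`, the program `p` makes no random choices and halts in state
`s'` after exactly `t` steps. -/
inductive Runs : Program → State w → ℕ → State w → Prop
  | skip (s) : Runs .skip s 1 s
  | instr (i s) (h : i.isDet = true) : Runs (.instr i) s 1 (i.run s)
  | seq {p q s t₁ s₁ t₂ s₂} : Runs p s t₁ s₁ → Runs q s₁ t₂ s₂ → Runs (.seq p q) s (t₁ + t₂ + 1) s₂
  | ite_true {c p q s t s'} : c.eval s = true → Runs p s t s' → Runs (.ite c p q) s (t + 1) s'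
  | ite_false {c p q s t s'} : c.eval s = false → Runs q s t s' → Runs (.ite c p q) s (t + 1) s'
  | loop_done {c p s} : c.eval s = false → Runs (.loop c p) s 1 s
  | loop_step {c p s t₁ s₁ t₂ s₂} : c.eval s = true → Runs p s t₁ s₁ →
      Runs (.loop c p) s₁ t₂ s₂ → Runs (.loop c p) s (t₁ + t₂ + 1) s₂

/-- A deterministic run can be executed in front of any continuation. -/
theorem Runs.ok {p : Program} {s s' : State w} {t : ℕ} (h : Runs p s t s') {k : List Program}
    {post : State w → Prop} {T : ℝ≥0∞} (hk : Ok (k, s') post T) : Ok (p :: k, s) post (t + T) := by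
  induction h generalizing k T with
  | skip s => simpa using hk.of_step (x := (.skip :: k, s)) (by simp) rfl
  | instr i s h =>
    simpa using hk.of_step (x := (.instr i :: k, s)) (by simp)
      (by simp [step, Instr.exec_eq h, PMF.pure_map])
  | seq _ _ ih₁ ih₂ =>
    refine (Ok.seq (ih₁ (ih₂ hk))).mono (le_of_eq ?_)
    push_cast
    ring
  | ite_true hc _ ih =>
    refine ((ih hk).of_step (x := (_ :: k, _)) (by simp) (by simp [step, hc])).mono (le_of_eq ?_)
    push_cast
    ring
  | ite_false hc _ ih =>
    refine ((ih hk).of_step (x := (_ :: k, _)) (by simp) (by simp [step, hc])).mono (le_of_eq ?_)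
    push_cast
    ring
  | loop_done hc =>
    simpa using hk.of_step (x := (_ :: k, _)) (by simp) (by simp [step, hc])
  | loop_step hc _ _ ih₁ ih₂ =>
    refine ((ih₁ (ih₂ hk)).of_step (x := (_ :: k, _)) (by simp) (by simp [step, hc])).mono
      (le_of_eq ?_)
    push_cast
    ring

/-! ### Registers and banks that a program may change -/

/-- Whether the instruction writes register `r`. -/
def Instr.writesReg : Instr → ℕ → Bool
  | .const d _, r => Nat.beq d r
  | .op _ d _ _, r => Nat.beq d r
  | .not d _, r => Nat.beq d r
  | .load d _ _, r => Nat.beq d r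
  | .store _ _ _, _ => false
  | .rand d _, r => Nat.beq d r

/-- Whether the instruction writes bank `b`. -/
def Instr.writesMem : Instr → ℕ → Bool
  | .store k _ _, b => Nat.beq k b
  | _, _ => false

/-- Whether the program contains an instruction that writes register `r`. -/
def Program.writesReg : Program → ℕ → Bool
  | .skip, _ => false
  | .instr i, r => i.writesReg r
  | .seq p q, r => p.writesReg r || q.writesReg r
  | .ite _ p q, r => p.writesReg r || q.writesReg r
  | .loop _ p, r => p.writesReg r

/-- Whether the program contains an instruction that writes bank `b`. -/
def Program.writesMem : Program → ℕ → Bool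
  | .skip, _ => false
  | .instr i, b => i.writesMem b
  | .seq p q, b => p.writesMem b || q.writesMem b
  | .ite _ p q, b => p.writesMem b || q.writesMem b
  | .loop _ p, b => p.writesMem b

theorem beq_eq_false_iff {a b : ℕ} : Nat.beq a b = false ↔ a ≠ b := by
  rw [← Bool.not_eq_true, Nat.beq_eq]

/-- `s'` agrees with `s` on everything that `p` cannot change. -/
structure Frame (p : Program) (s s' : State w) : Prop where
  reg : ∀ r, p.writesReg r = false → s'.reg r = s.reg r
  mem : ∀ b, p.writesMem b = false → s'.mem b = s.mem b

theorem Frame.refl (p : Program) (s : State w) : Frame p s s := ⟨fun _ _ => rfl, fun _ _ => rfl⟩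

theorem Frame.trans {p : Program} {s s₁ s₂ : State w} (h₁ : Frame p s s₁) (h₂ : Frame p s₁ s₂) :
    Frame p s s₂ :=
  ⟨fun r hr => (h₂.reg r hr).trans (h₁.reg r hr), fun b hb => (h₂.mem b hb).trans (h₁.mem b hb)⟩

theorem Frame.of_imp {p q : Program} {s s' : State w} (h : Frame p s s')
    (hr : ∀ r, q.writesReg r = false → p.writesReg r = false)
    (hm : ∀ b, q.writesMem b = false → p.writesMem b = false) : Frame q s s' :=
  ⟨fun r h' => h.reg r (hr r h'), fun b h' => h.mem b (hm b h')⟩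

theorem Instr.frame (i : Instr) (s : State w) : Frame (.instr i) s (i.run s) := by
  refine ⟨fun r hr => ?_, fun b hb => ?_⟩
  · cases i <;> simp only [Program.writesReg, Instr.writesReg, beq_eq_false_iff] at hr <;>
      simp [Instr.run, State.setReg, State.setMem, Function.update_apply] <;>
      exact fun h => absurd h.symm hr
  · cases i <;> simp only [Program.writesMem, Instr.writesMem, beq_eq_false_iff] at hb <;>
      simp only [Instr.run, State.setReg, State.setMem, Function.update_apply]
    exact if_neg (Ne.symm hb)

theorem Runs.frame {p : Program} {s s' : State w} {t : ℕ} (h : Runs p s t s') : Frame p s s' := by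
  induction h with
  | skip s => exact Frame.refl _ _
  | instr i s _ => exact i.frame s
  | seq _ _ ih₁ ih₂ =>
    exact (ih₁.of_imp (by simp +contextual [Program.writesReg])
      (by simp +contextual [Program.writesMem])).trans
      (ih₂.of_imp (by simp +contextual [Program.writesReg])
        (by simp +contextual [Program.writesMem]))
  | ite_true _ _ ih =>
    exact ih.of_imp (by simp +contextual [Program.writesReg])
      (by simp +contextual [Program.writesMem])
  | ite_false _ _ ih =>
    exact ih.of_imp (by simp +contextual [Program.writesReg])
      (by simp +contextual [Program.writesMem])
  | loop_done _ => exact Frame.refl _ _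
  | loop_step _ _ _ ih₁ ih₂ =>
    exact (ih₁.of_imp (by simp +contextual [Program.writesReg])
      (by simp +contextual [Program.writesMem])).trans ih₂

/-- Whether the instruction writes no register with a number less than `c`. -/
def Instr.regsFrom (c : ℕ) : Instr → Bool
  | .const d _ => Nat.ble c d
  | .op _ d _ _ => Nat.ble c d
  | .not d _ => Nat.ble c d
  | .load d _ _ => Nat.ble c d
  | .store _ _ _ => true
  | .rand d _ => Nat.ble c d

/-- Whether the program writes only registers with numbers at least `c`. -/
def Program.regsFrom (c : ℕ) : Program → Bool
  | .skip => true
  | .instr i => i.regsFrom c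
  | .seq p q => p.regsFrom c && q.regsFrom c
  | .ite _ p q => p.regsFrom c && q.regsFrom c
  | .loop _ p => p.regsFrom c

theorem Program.writesReg_of_regsFrom {c r : ℕ} (hr : r < c) {p : Program}
    (h : p.regsFrom c = true) : p.writesReg r = false := by
  induction p with
  | skip => rfl
  | instr i =>
    cases i <;> simp only [Program.regsFrom, Instr.regsFrom, Nat.ble_eq] at h <;>
      simp only [Program.writesReg, Instr.writesReg, beq_eq_false_iff] <;> omega
  | seq p q ihp ihq =>
    simp only [Program.regsFrom, Bool.and_eq_true] at h
    simp [Program.writesReg, ihp h.1, ihq h.2]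
  | ite c p q ihp ihq =>
    simp only [Program.regsFrom, Bool.and_eq_true] at h
    simp [Program.writesReg, ihp h.1, ihq h.2]
  | loop c p ih => exact ih h

theorem Frame.below {p : Program} {s s' : State w} (h : Frame p s s') {c : ℕ}
    (hc : p.regsFrom c = true) {r : ℕ} (hr : r < c) : s'.reg r = s.reg r :=
  h.reg r (Program.writesReg_of_regsFrom hr hc)

/-! ### Rules for deterministic programs -/

/-- Started in `s`, the program `p` makes no random choices and halts within `T` steps in a state
that satisfies `Q`. -/
def Det (p : Program) (s : State w) (T : ℕ) (Q : State w → Prop) : Prop :=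
  ∃ t s', Runs p s t s' ∧ t ≤ T ∧ Q s'

theorem Det.mono {p : Program} {s : State w} {T T' : ℕ} {Q Q' : State w → Prop}
    (h : Det p s T Q) (hT : T ≤ T') (hQ : ∀ s', Frame p s s' → Q s' → Q' s') : Det p s T' Q' := by
  obtain ⟨t, s', hr, ht, hq⟩ := h
  exact ⟨t, s', hr, ht.trans hT, hQ s' hr.frame hq⟩

theorem Det.le {p : Program} {s : State w} {T T' : ℕ} {Q : State w → Prop}
    (h : Det p s T Q) (hT : T ≤ T') : Det p s T' Q := h.mono hT fun _ _ h => h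

theorem Det.ok {p : Program} {s : State w} {T : ℕ} {Q post : State w → Prop} {k : List Program}
    {T' : ℝ≥0∞} (h : Det p s T Q) (hk : ∀ s', Frame p s s' → Q s' → Ok (k, s') post T') :
    Ok (p :: k, s) post (T + T') := by
  obtain ⟨t, s', hr, ht, hq⟩ := h
  refine (hr.ok (hk s' hr.frame hq)).mono (add_le_add_left ?_ _)
  exact_mod_cast ht

theorem Det.skip {s : State w} {Q : State w → Prop} (h : Q s) : Det .skip s 1 Q :=
  ⟨1, s, .skip s, le_rfl, h⟩

theorem Det.instr {i : Instr} {s : State w} {Q : State w → Prop} (h : Q (i.run s))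
    (hi : i.isDet = true := by rfl) : Det (.instr i) s 1 Q :=
  ⟨1, _, .instr i s hi, le_rfl, h⟩

theorem Det.seq {p q : Program} {s : State w} {T₁ T₂ : ℕ} {Q Q' : State w → Prop}
    (h₁ : Det p s T₁ Q) (h₂ : ∀ s', Frame p s s' → Q s' → Det q s' T₂ Q') :
    Det (.seq p q) s (T₁ + T₂ + 1) Q' := by
  obtain ⟨t, s', hr, ht, hq⟩ := h₁
  obtain ⟨t', s'', hr', ht', hq'⟩ := h₂ s' hr.frame hq
  exact ⟨_, s'', .seq hr hr', by omega, hq'⟩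

theorem Det.ite {c : Test} {p q : Program} {s : State w} {T : ℕ} {Q : State w → Prop}
    (h₁ : c.eval s = true → Det p s T Q) (h₂ : c.eval s = false → Det q s T Q) :
    Det (.ite c p q) s (T + 1) Q := by
  cases hc : c.eval s
  · obtain ⟨t, s', hr, ht, hq⟩ := h₂ hc
    exact ⟨_, s', .ite_false hc hr, by omega, hq⟩
  · obtain ⟨t, s', hr, ht, hq⟩ := h₁ hc
    exact ⟨_, s', .ite_true hc hr, by omega, hq⟩

/-- A loop that makes exactly `N` iterations. -/
theorem Det.loop {c : Test} {p : Program} {s : State w} {N : ℕ} (T : ℕ → ℕ)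
    (Inv : ℕ → State w → Prop) (h0 : Inv 0 s)
    (hb : ∀ j < N, ∀ s', Frame (.loop c p) s s' → Inv j s' →
      c.eval s' = true ∧ Det p s' (T j) (Inv (j + 1)))
    (he : ∀ s', Frame (.loop c p) s s' → Inv N s' → c.eval s' = false) :
    Det (.loop c p) s (∑ j ∈ Finset.range N, (T j + 1) + 1) (Inv N) := by
  have key : ∀ M j, j + M = N → ∀ s', Frame (.loop c p) s s' → Inv j s' →
      Det (.loop c p) s' (∑ i ∈ Finset.range M, (T (j + i) + 1) + 1) (Inv N) := by
    intro M
    induction M with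
    | zero =>
      intro j hj s' hf hi
      obtain rfl : j = N := by omega
      exact ⟨1, s', .loop_done (he s' hf hi), by simp, hi⟩
    | succ M ih =>
      intro j hj s' hf hi
      obtain ⟨hc, t, s₁, hr, ht, hq⟩ := hb j (by omega) s' hf hi
      have hf₁ : Frame (.loop c p) s s₁ :=
        hf.trans (hr.frame.of_imp (by simp [Program.writesReg]) (by simp [Program.writesMem]))
      obtain ⟨t', s₂, hr', ht', hq'⟩ := ih (j + 1) (by omega) s₁ hf₁ hq
      refine ⟨_, s₂, .loop_step hc hr hr', ?_, hq'⟩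
      rw [Finset.sum_range_succ']
      have e : ∑ i ∈ Finset.range M, (T (j + (i + 1)) + 1)
          = ∑ i ∈ Finset.range M, (T (j + 1 + i) + 1) :=
        Finset.sum_congr rfl fun i _ => by rw [show j + (i + 1) = j + 1 + i by omega]
      rw [e, add_zero]
      omega
  simpa using key N 0 (by omega) s (Frame.refl _ _) h0

/-- Sequential composition. -/
infixr:67 " ;; " => Program.seq

/-- A straight-line program. -/
def blk : List Instr → Program
  | [] => .skip
  | i :: l => .instr i ;; blk l

/-- The effect of a straight-line program. -/
def execs : List Instr → State w → State w
  | [], s => s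
  | i :: l, s => execs l (i.run s)

theorem Det.blk {l : List Instr} {s : State w} {Q : State w → Prop} (h : Q (execs l s))
    (hl : l.all Instr.isDet = true := by rfl) : Det (blk l) s (2 * l.length + 1) Q := by
  induction l generalizing s with
  | nil => exact Det.skip h
  | cons i l ih =>
    simp only [List.all_cons, Bool.and_eq_true] at hl
    refine (Det.seq (Det.instr (Q := fun s' => s' = i.run s) rfl hl.1) ?_).mono
      (T := 1 + (2 * l.length + 1) + 1) (Q := Q) (by simp only [List.length_cons]; omega)
      (fun _ _ h => h)
    rintro s' - rfl
    exact ih h hl.2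

/-! ### Reading registers and banks -/

@[simp] theorem reg_setReg (s : State w) (d r : ℕ) (x : BitVec w) :
    (s.setReg d x).reg r = if r = d then x else s.reg r := by
  simp [State.setReg, Function.update_apply]

@[simp] theorem mem_setReg (s : State w) (d : ℕ) (x : BitVec w) : (s.setReg d x).mem = s.mem := rfl

@[simp] theorem reg_setMem (s : State w) (k : ℕ) (a x : BitVec w) : (s.setMem k a x).reg = s.reg :=
  rfl

@[simp] theorem mem_setMem (s : State w) (k b : ℕ) (a x : BitVec w) :
    (s.setMem k a x).mem b = if b = k then Function.update (s.mem k) a x else s.mem b := by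
  simp [State.setMem, Function.update_apply]

/-! ### Counting loops -/

/-- The register that holds the number one. -/
notation "rOne" => 6
/-- The register that holds the number zero. -/
notation "rZero" => 9

/-- Run `p` while register `i` is less than register `m`, incrementing register `i`. -/
def forUp (i m : ℕ) (p : Program) : Program :=
  .loop (.lt i m) (p ;; .instr (.op .add i i rOne))

/-- Run `p` with register `i` running through the numbers less than the content of register `m`. -/
def forRange (i m : ℕ) (p : Program) : Program := .instr (.const i 0) ;; forUp i m p

theorem ofNat_inj_of_lt {a b : ℕ} (ha : a < 2 ^ w) (hb : b < 2 ^ w) :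
    BitVec.ofNat w a = BitVec.ofNat w b ↔ a = b := by
  refine ⟨fun h => ?_, fun h => by rw [h]⟩
  have := congrArg BitVec.toNat h
  rwa [BitVec.toNat_ofNat, BitVec.toNat_ofNat, Nat.mod_eq_of_lt ha, Nat.mod_eq_of_lt hb] at this

theorem toNat_ofNat_of_lt {a : ℕ} (ha : a < 2 ^ w) : (BitVec.ofNat w a).toNat = a := by
  rw [BitVec.toNat_ofNat, Nat.mod_eq_of_lt ha]

theorem eval_lt_ofNat {s : State w} {i m a b : ℕ} (hi : s.reg i = BitVec.ofNat w a)
    (hm : s.reg m = BitVec.ofNat w b) (ha : a < 2 ^ w) (hb : b < 2 ^ w) :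
    (Test.lt i m).eval s = decide (a < b) := by
  simp [Test.eval, hi, hm, Nat.mod_eq_of_lt ha, Nat.mod_eq_of_lt hb]

theorem eval_eq_ofNat {s : State w} {i m a b : ℕ} (hi : s.reg i = BitVec.ofNat w a)
    (hm : s.reg m = BitVec.ofNat w b) (ha : a < 2 ^ w) (hb : b < 2 ^ w) :
    (Test.eq i m).eval s = decide (a = b) := by
  simp [Test.eval, hi, hm, ofNat_inj_of_lt ha hb]

/-- A loop in which register `i` runs from `a` to `a + N`. What the body does not write is
unchanged, so that the invariant need only describe what it does write. -/
theorem Det.forUp {i m a N : ℕ} {p : Program} {s : State w} (T : ℕ → ℕ)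
    (Inv : ℕ → State w → Prop) (hN : a + N < 2 ^ w) (hi : s.reg i = BitVec.ofNat w a)
    (hm : s.reg m = BitVec.ofNat w (a + N)) (h1 : s.reg rOne = BitVec.ofNat w 1)
    (wi : p.writesReg i = false) (wm : (WordRAM.forUp i m p).writesReg m = false)
    (w1 : (WordRAM.forUp i m p).writesReg rOne = false)
    (hInv : ∀ j s v, Inv j s → Inv j (s.setReg i v)) (h0 : Inv 0 s)
    (hb : ∀ j < N, ∀ s', Frame (WordRAM.forUp i m p) s s' → s'.reg i = BitVec.ofNat w (a + j) →
      Inv j s' → Det p s' (T j) (Inv (j + 1))) :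
    Det (WordRAM.forUp i m p) s (∑ j ∈ Finset.range N, (T j + 3) + 1) (Inv N) := by
  refine (Det.loop (N := N) (fun j => T j + 2)
    (fun j s' => s'.reg i = BitVec.ofNat w (a + j) ∧ Inv j s') ⟨by simpa using hi, h0⟩ ?_ ?_).mono
    le_rfl (fun _ _ h => h.2)
  · rintro j hj s' hf ⟨hij, hinv⟩
    have hm' := (hf.reg m wm).trans hm
    refine ⟨?_, ?_⟩
    · rw [eval_lt_ofNat hij hm' (by omega) hN]
      simpa using hj
    · refine (Det.seq (hb j hj s' hf hij hinv) (T₂ := 1) ?_).le le_rfl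
      intro s₁ hf₁ hinv₁
      refine Det.instr ?_
      have e1 : s₁.reg i = BitVec.ofNat w (a + j) := (hf₁.reg i wi).trans hij
      have w1' : p.writesReg rOne = false := by
        simp only [WordRAM.forUp, Program.writesReg, Bool.or_eq_false_iff] at w1
        exact w1.1
      have e2 : s₁.reg rOne = BitVec.ofNat w 1 :=
        ((hf₁.reg _ w1').trans (hf.reg _ w1)).trans h1
      refine ⟨?_, hInv _ _ _ hinv₁⟩
      simp only [Instr.run, reg_setReg, if_true, BinOp.eval, e1, e2, BitVec.ofNat_add_ofNat]
      congr 1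
  · rintro s' hf ⟨hij, -⟩
    rw [eval_lt_ofNat hij ((hf.reg m wm).trans hm) hN hN]
    simp

theorem Det.forRange {i m N : ℕ} {p : Program} {s : State w} (T : ℕ → ℕ)
    (Inv : ℕ → State w → Prop) (hN : N < 2 ^ w)
    (hm : s.reg m = BitVec.ofNat w N) (h1 : s.reg rOne = BitVec.ofNat w 1)
    (wi : p.writesReg i = false) (wm : (WordRAM.forRange i m p).writesReg m = false)
    (w1 : (WordRAM.forRange i m p).writesReg rOne = false)
    (hInv : ∀ j s v, Inv j s → Inv j (s.setReg i v)) (h0 : Inv 0 s)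
    (hb : ∀ j < N, ∀ s', Frame (WordRAM.forRange i m p) s s' → s'.reg i = BitVec.ofNat w j →
      Inv j s' → Det p s' (T j) (Inv (j + 1))) :
    Det (WordRAM.forRange i m p) s (∑ j ∈ Finset.range N, (T j + 3) + 3) (Inv N) := by
  have hfr : ∀ s₁ s₂ : State w, Frame (WordRAM.forUp i m p) s₁ s₂ →
      Frame (WordRAM.forRange i m p) s₁ s₂ := fun s₁ s₂ h =>
    h.of_imp (by simp [WordRAM.forRange, Program.writesReg])
      (by simp [WordRAM.forRange, Program.writesMem])
  have hfr0 : ∀ s₁ s₂ : State w, Frame (.instr (.const i 0)) s₁ s₂ →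
      Frame (WordRAM.forRange i m p) s₁ s₂ := fun s₁ s₂ h =>
    h.of_imp (by simp +contextual [WordRAM.forRange, Program.writesReg])
      (by simp +contextual [WordRAM.forRange, Program.writesMem])
  have wm' : (WordRAM.forUp i m p).writesReg m = false := by
    simp only [WordRAM.forRange, Program.writesReg, Bool.or_eq_false_iff] at wm
    exact wm.2
  have w1' : (WordRAM.forUp i m p).writesReg rOne = false := by
    simp only [WordRAM.forRange, Program.writesReg, Bool.or_eq_false_iff] at w1
    exact w1.2
  refine (Det.seq (T₁ := 1) (T₂ := ∑ j ∈ Finset.range N, (T j + 3) + 1)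
    (Q := fun s' => s'.reg i = BitVec.ofNat w 0 ∧ Inv 0 s') (Det.instr ?_) ?_).le (by omega)
  · exact ⟨by simp [Instr.run], hInv _ _ _ h0⟩
  · rintro s₁ hf₁ ⟨hi, hinv⟩
    have hf₁' := hfr0 _ _ hf₁
    refine Det.forUp T Inv (a := 0) (by simpa using hN) hi
      (by rw [zero_add]; exact (hf₁'.reg m wm).trans hm) ((hf₁'.reg _ w1).trans h1)
      wi wm' w1' hInv hinv ?_
    intro j hj s₂ hf₂ hij hinv₂
    exact hb j hj s₂ (hf₁'.trans (hfr _ _ hf₂)) (by simpa using hij) hinv₂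

/-! ### Random words -/

theorem card_bitVec : Fintype.card (BitVec w) = 2 ^ w := by
  rw [Fintype.card_congr (⟨BitVec.toFin, BitVec.ofFin, fun _ => rfl, fun _ => rfl⟩ :
    BitVec w ≃ Fin (2 ^ w)), Fintype.card_fin]

/-- A random element of `{0, …, 2 ^ w - 1}` is a uniformly random word. -/
theorem mean_randWord_zero (F : BitVec w → ℝ≥0∞) :
    mean (randWord (0 : BitVec w)) F = (∑ x, F x) / 2 ^ w := by
  have hu : mean (randWord (0 : BitVec w)) F = ∑' a : ℕ,
      (if a ∈ Finset.range (2 ^ w) then ((2 ^ w : ℕ) : ℝ≥0∞)⁻¹ else 0) * F (BitVec.ofNat w a) := by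
    rw [randWord, mean_map, mean]
    refine tsum_congr fun a => ?_
    congr 1
    exact (PMF.uniformOfFinset_apply _ a).trans (by simp)
  rw [hu, tsum_eq_sum (s := Finset.range (2 ^ w)) (by intro b hb; simp only [if_neg hb, zero_mul])]
  rw [Finset.sum_congr rfl (g := fun a => ((2 ^ w : ℕ) : ℝ≥0∞)⁻¹ * F (BitVec.ofNat w a))
    (by intro a ha; rw [if_pos ha]), ← Finset.mul_sum, mul_comm, div_eq_mul_inv]
  congr 1
  · refine Finset.sum_bij' (fun a _ => BitVec.ofNat w a) (fun x _ => x.toNat) ?_ ?_ ?_ ?_ ?_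
    · intro a _; exact Finset.mem_univ _
    · intro x _; exact Finset.mem_range.2 x.isLt
    · intro a ha; exact toNat_ofNat_of_lt (Finset.mem_range.1 ha)
    · intro x _; simp
    · intro a _; rfl
  · norm_num

theorem Ok.instr {i : Instr} {k : List Program} {s : State w} {post : State w → Prop} {T : ℝ≥0∞}
    (h : Ok (k, i.run s) post T) (hi : i.isDet = true := by rfl) :
    Ok (.instr i :: k, s) post (1 + T) :=
  h.of_step (x := (.instr i :: k, s)) (by simp) (by simp [step, Instr.exec_eq hi, PMF.pure_map])

theorem Ok.loop_true {c : Test} {p : Program} {k : List Program} {s : State w}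
    {post : State w → Prop} {T : ℝ≥0∞} (hc : c.eval s = true)
    (h : Ok (p :: .loop c p :: k, s) post T) : Ok (.loop c p :: k, s) post (1 + T) :=
  h.of_step (x := (.loop c p :: k, s)) (by simp) (by simp [step, hc])

theorem Ok.loop_false {c : Test} {p : Program} {k : List Program} {s : State w}
    {post : State w → Prop} {T : ℝ≥0∞} (hc : c.eval s = false) (h : Ok (k, s) post T) :
    Ok (.loop c p :: k, s) post (1 + T) :=
  h.of_step (x := (.loop c p :: k, s)) (by simp) (by simp [step, hc])

theorem Ok.rand {d a : ℕ} {k : List Program} {s : State w} {post : State w → Prop}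
    {T : BitVec w → ℝ≥0∞} (ha : s.reg a = 0) (h : ∀ x, Ok (k, s.setReg d x) post (T x)) :
    Ok (.instr (.rand d a) :: k, s) post (1 + (∑ x, T x) / 2 ^ w) := by
  have hs : step ((.instr (.rand d a) :: k, s) : Config w) =
      (randWord (0 : BitVec w)).map (fun x => (k, s.setReg d x)) := by
    simp only [step, Instr.exec, ha, PMF.map_comp]
    rfl
  refine ⟨?_, ?_⟩
  · rw [haltProb_step, hs, mean_map]
    simp_rw [(h _).1]
    exact mean_const _ 1
  · rw [cfgTime_step (by simp), hs, mean_map, ← mean_randWord_zero]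
    exact add_le_add_right (mean_mono fun x _ => (h x).2) _

/-- Fill bank `b` with random words, at the addresses less than the content of register `m`;
registers `i` and `x` are used for the address and the word. -/
def drawWords (i m x b : ℕ) : Program :=
  forRange i m (.instr (.rand x rZero) ;; .instr (.store b i x))

/-- The average of `G` over all sequences of `N` words. -/
noncomputable def avgWords (w N : ℕ) (G : (Fin N → BitVec w) → ℝ≥0∞) : ℝ≥0∞ :=
  (∑ ω, G ω) / (2 ^ w) ^ N

theorem avgWords_succ (N : ℕ) (G : (Fin (N + 1) → BitVec w) → ℝ≥0∞) :
    avgWords w (N + 1) G = (∑ x, avgWords w N fun ω => G (Fin.cons x ω)) / 2 ^ w := by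
  unfold avgWords
  simp_rw [div_eq_mul_inv, ← Finset.sum_mul]
  rw [mul_assoc, ← ENNReal.mul_inv (by left; positivity) (by right; positivity), ← pow_succ]
  congr 1
  rw [← (Fin.consEquiv (fun _ : Fin (N + 1) => BitVec w)).sum_comp, Fintype.sum_prod_type]
  rfl

theorem avgWords_add_const (N : ℕ) (c : ℝ≥0∞) (G : (Fin N → BitVec w) → ℝ≥0∞) :
    avgWords w N (fun ω => c + G ω) = c + avgWords w N G := by
  unfold avgWords
  rw [Finset.sum_add_distrib, ENNReal.add_div]
  congr 1
  rw [Finset.sum_const, Finset.card_univ, Fintype.card_fun, card_bitVec, Fintype.card_fin,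
    nsmul_eq_mul]
  push_cast
  rw [mul_comm]
  exact ENNReal.mul_div_cancel_right (by positivity)
    (ENNReal.pow_ne_top (ENNReal.pow_ne_top (by simp)))

/-- Filling a bank with random words, the bound on the time of the continuation being averaged
over the words drawn. -/
theorem Ok.drawWords {i m x b N : ℕ} {k : List Program} {s : State w} {post : State w → Prop}
    {G : (Fin N → BitVec w) → ℝ≥0∞} (hN : N < 2 ^ w) (hm : s.reg m = BitVec.ofNat w N)
    (h1 : s.reg rOne = BitVec.ofNat w 1) (h0 : s.reg rZero = BitVec.ofNat w 0)
    (him : i ≠ m) (hxm : x ≠ m) (hix : i ≠ x) (hi1 : i ≠ rOne) (hx1 : x ≠ rOne) (hi0 : i ≠ rZero)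
    (hx0 : x ≠ rZero)
    (h : ∀ ω, ∀ s', Frame (WordRAM.drawWords i m x b) s s' →
      (∀ j : Fin N, s'.mem b (BitVec.ofNat w j) = ω j) → Ok (k, s') post (G ω)) :
    Ok (WordRAM.drawWords i m x b :: k, s) post (6 * N + 3 + avgWords w N G) := by
  have key : ∀ M j, j + M = N → ∀ G' : (Fin M → BitVec w) → ℝ≥0∞, ∀ s₁ : State w,
      Frame (WordRAM.drawWords i m x b) s s₁ → s₁.reg i = BitVec.ofNat w j →
      (∀ ω, ∀ s', Frame (WordRAM.drawWords i m x b) s s' →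
        (∀ l < j, s'.mem b (BitVec.ofNat w l) = s₁.mem b (BitVec.ofNat w l)) →
        (∀ l : Fin M, s'.mem b (BitVec.ofNat w (j + l)) = ω l) → Ok (k, s') post (G' ω)) →
      Ok (forUp i m (.instr (.rand x rZero) ;; .instr (.store b i x)) :: k, s₁) post
        (6 * M + 1 + avgWords w M G') := by
    intro M
    induction M with
    | zero =>
      intro j hj G' s₁ hf hij hk
      have hmem := hf.reg m (by
        simp [WordRAM.drawWords, WordRAM.forRange, WordRAM.forUp, Program.writesReg,
          Instr.writesReg, beq_eq_false_iff, him, hxm])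
      have hev : (Test.lt i m).eval s₁ = false := by
        rw [eval_lt_ofNat hij (hmem.trans hm) (by omega) hN]
        simp; omega
      have := Ok.loop_false (p := (.instr (.rand x rZero) ;; .instr (.store b i x)) ;;
        .instr (.op .add i i rOne)) hev (hk Fin.elim0 s₁ hf (fun _ _ => rfl) (fun l => l.elim0))
      refine this.mono ?_
      simp only [avgWords, Nat.cast_zero, mul_zero, zero_add, Finset.univ_unique,
        Finset.sum_singleton, pow_zero, div_one]
      exact le_of_eq (congrArg (fun v => 1 + G' v) (Subsingleton.elim _ _))
    | succ M ih =>
      intro j hj G' s₁ hf hij hk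
      have hw : ∀ r, r ≠ i → r ≠ x → (WordRAM.drawWords i m x b).writesReg r = false := by
        intro r h1 h2
        simp [WordRAM.drawWords, WordRAM.forRange, WordRAM.forUp, Program.writesReg,
          Instr.writesReg, beq_eq_false_iff, h1.symm, h2.symm]
      have hwm : ∀ r, r ≠ b → (WordRAM.drawWords i m x b).writesMem r = false := by
        intro r h1
        simp [WordRAM.drawWords, WordRAM.forRange, WordRAM.forUp, Program.writesMem,
          Instr.writesMem, beq_eq_false_iff, h1.symm]
      have em := (hf.reg m (hw m him.symm hxm.symm)).trans hm
      have e1 := (hf.reg _ (hw rOne hi1.symm hx1.symm)).trans h1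
      have e0 := (hf.reg _ (hw rZero hi0.symm hx0.symm)).trans h0
      have hev : (Test.lt i m).eval s₁ = true := by
        rw [eval_lt_ofNat hij em (by omega) hN]
        simp; omega
      have hstep : ∀ v : BitVec w, Ok (.instr (.store b i x) :: .instr (.op .add i i rOne) ::
          forUp i m (.instr (.rand x rZero) ;; .instr (.store b i x)) :: k, s₁.setReg x v) post
          (1 + (1 + (6 * M + 1 + avgWords w M fun ω => G' (Fin.cons v ω)))) := by
        intro v
        refine Ok.instr (Ok.instr ?_)
        have hs : (Instr.op .add i i rOne).run ((Instr.store b i x).run (s₁.setReg x v)) =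
            ((s₁.setReg x v).setMem b (BitVec.ofNat w j) v).setReg i (BitVec.ofNat w (j + 1)) := by
          simp [Instr.run, hix, hij, hx1.symm, e1, BinOp.eval, BitVec.ofNat_add]
        rw [hs]
        refine ih (j + 1) (by omega) _ _ (hf.trans ⟨?_, ?_⟩) (by simp) ?_
        · intro r hr
          have hri : r ≠ i := by
            rintro rfl
            simp [WordRAM.drawWords, WordRAM.forRange, WordRAM.forUp, Program.writesReg,
              Instr.writesReg] at hr
          have hrx : r ≠ x := by
            rintro rfl
            simp [WordRAM.drawWords, WordRAM.forRange, WordRAM.forUp, Program.writesReg,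
              Instr.writesReg] at hr
          simp [hri, hrx]
        · intro r hr
          have hrb : r ≠ b := by
            rintro rfl
            simp [WordRAM.drawWords, WordRAM.forRange, WordRAM.forUp, Program.writesMem,
              Instr.writesMem] at hr
          simp [hrb]
        · intro ω s' hf' hlow hhigh
          refine hk (Fin.cons v ω) s' hf' ?_ ?_
          · intro l hl
            rw [hlow l (by omega)]
            have : BitVec.ofNat w l ≠ BitVec.ofNat w j := by
              rw [Ne, ofNat_inj_of_lt (by omega) (by omega)]; omega
            simp [this]
          · intro l
            refine Fin.cases ?_ (fun l => ?_) l
            · have := hlow j (by omega)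
              simpa [Function.update_apply] using this
            · have := hhigh l
              simp only [Fin.cons_succ, Fin.val_succ]
              rw [← this]
              congr 2
              omega
      have hr := Ok.rand (k := .instr (.store b i x) :: .instr (.op .add i i rOne) ::
          forUp i m (.instr (.rand x rZero) ;; .instr (.store b i x)) :: k) (d := x) (s := s₁)
          (a := rZero) (by rw [e0]; rfl) hstep
      have h3 := Ok.loop_true hev (Ok.seq (Ok.seq hr))
      refine h3.mono ?_
      rw [avgWords_succ]
      have hsum : (∑ v : BitVec w, (1 + (1 + (6 * (M : ℝ≥0∞) + 1 +
          avgWords w M fun ω => G' (Fin.cons v ω))))) / 2 ^ w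
          = 2 + (6 * M + 1) +
              (∑ v : BitVec w, avgWords w M fun ω => G' (Fin.cons v ω)) / 2 ^ w := by
        have : ∀ v : BitVec w, (1 + (1 + (6 * (M : ℝ≥0∞) + 1 +
          avgWords w M fun ω => G' (Fin.cons v ω)))) = (2 + (6 * M + 1)) +
            avgWords w M fun ω => G' (Fin.cons v ω) := by intro v; ring
        simp_rw [this]
        rw [Finset.sum_add_distrib, ENNReal.add_div]
        congr 1
        rw [Finset.sum_const, Finset.card_univ, card_bitVec, nsmul_eq_mul]
        push_cast
        rw [mul_comm]
        exact ENNReal.mul_div_cancel_right (by positivity) (ENNReal.pow_ne_top (by simp))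
      rw [hsum]
      refine le_of_eq ?_
      push_cast
      ring
  have hf0 : Frame (WordRAM.drawWords i m x b) s (s.setReg i (BitVec.ofNat w 0)) := by
    refine ⟨fun r hr => ?_, fun _ _ => rfl⟩
    have hri : r ≠ i := by
      rintro rfl
      simp [WordRAM.drawWords, WordRAM.forRange, WordRAM.forUp, Program.writesReg,
        Instr.writesReg] at hr
    simp [hri]
  have h2 := key N 0 (by omega) G _ hf0 (by simp) (fun ω s' hf' _ hω =>
    h ω s' hf' (fun j => by simpa using hω j))
  have h3 := Ok.instr (i := .const i 0) h2
  refine (Ok.seq h3).mono (le_of_eq ?_)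
  ring

/-! ### Parities and linear hash functions -/

/-- The parity of the number of ones in a word. -/
def par (y : BitVec w) : ℕ := (∑ i ∈ Finset.range w, (y.getLsbD i).toNat) % 2

theorem par_lt (y : BitVec w) : par y < 2 := Nat.mod_lt _ two_pos

theorem toNat_xor_bool (a b : Bool) : (a ^^ b).toNat = (a.toNat + b.toNat) % 2 := by
  cases a <;> cases b <;> rfl

theorem par_xor (x y : BitVec w) : par (x ^^^ y) = (par x + par y) % 2 := by
  unfold par
  rw [← Nat.add_mod, ← Finset.sum_add_distrib, Finset.sum_nat_mod,
    Finset.sum_nat_mod _ _ (fun i => (x.getLsbD i).toNat + (y.getLsbD i).toNat)]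
  congr 1
  refine Finset.sum_congr rfl fun i _ => ?_
  rw [BitVec.getLsbD_xor, toNat_xor_bool, Nat.mod_mod]

theorem par_zero : par (0 : BitVec w) = 0 := by simp [par]

theorem par_twoPow {i : ℕ} (hi : i < w) : par (BitVec.twoPow w i) = 1 := by
  unfold par
  rw [Finset.sum_eq_single i]
  · simp [hi]
  · intro b _ hb
    simp [BitVec.getLsbD_twoPow, hb.symm]
  · intro h; exact absurd (Finset.mem_range.2 hi) h

/-- The `b`-bit hash value of `x` whose `i`-th bit is the parity of `rows i &&& x`. -/
def hash (rows : ℕ → BitVec w) : ℕ → BitVec w → ℕ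
  | 0, _ => 0
  | b + 1, x => hash rows b x ^^^ (par (rows b &&& x) * 2 ^ b)

theorem hash_lt (rows : ℕ → BitVec w) (b : ℕ) (x : BitVec w) : hash rows b x < 2 ^ b := by
  induction b with
  | zero => simp [hash]
  | succ b ih =>
    refine Nat.xor_lt_two_pow (ih.trans (by rw [pow_succ]; omega)) ?_
    have := par_lt (rows b &&& x)
    rw [pow_succ]
    have : par (rows b &&& x) * 2 ^ b ≤ 1 * 2 ^ b := Nat.mul_le_mul_right _ (by omega)
    have := Nat.two_pow_pos b
    omega

/-- Hash functions are linear over the field with two elements. -/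
theorem hash_xor (rows : ℕ → BitVec w) (b : ℕ) (x y : BitVec w) :
    hash rows b (x ^^^ y) = hash rows b x ^^^ hash rows b y := by
  induction b with
  | zero => simp [hash]
  | succ b ih =>
    have h : par (rows b &&& (x ^^^ y)) * 2 ^ b =
        (par (rows b &&& x) * 2 ^ b) ^^^ (par (rows b &&& y) * 2 ^ b) := by
      have hd : rows b &&& (x ^^^ y) = (rows b &&& x) ^^^ (rows b &&& y) := by
        ext i hi
        simp [Bool.and_xor_distrib_left]
      rw [hd, par_xor]
      have h1 := par_lt (rows b &&& x)
      have h2 := par_lt (rows b &&& y)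
      interval_cases par (rows b &&& x) <;> interval_cases par (rows b &&& y) <;> simp
    simp only [hash]
    rw [ih, h]
    ac_rfl

theorem hash_eq_zero_iff (rows : ℕ → BitVec w) (b : ℕ) (x : BitVec w) :
    hash rows b x = 0 ↔ ∀ i < b, par (rows i &&& x) = 0 := by
  induction b with
  | zero => simp [hash]
  | succ b ih =>
    rw [hash, Nat.xor_eq_zero_iff]
    have h1 := par_lt (rows b &&& x)
    have h2 := hash_lt rows b x
    constructor
    · intro h i hi
      have h0 : par (rows b &&& x) = 0 := by
        interval_cases h3 : par (rows b &&& x)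
        · rfl
        · omega
      rcases Nat.lt_succ_iff_lt_or_eq.1 hi with hi | rfl
      · exact ih.1 (by rw [h, h0, zero_mul]) i hi
      · exact h0
    · intro h
      rw [h b (by omega), zero_mul]
      exact ih.2 fun i hi => h i (by omega)

theorem hash_congr {rows rows' : ℕ → BitVec w} {b : ℕ} (h : ∀ i < b, rows i = rows' i)
    (x : BitVec w) : hash rows b x = hash rows' b x := by
  induction b with
  | zero => rfl
  | succ b ih => rw [hash, hash, ih fun i hi => h i (by omega), h b (by omega)]

/-! ### The parity of a word in doubly logarithmic time -/

theorem sum_mul_pow_lt {X : ℕ} {d : ℕ → ℕ} (n : ℕ) (hd : ∀ k < n, d k < X) :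
    ∑ k ∈ Finset.range n, d k * X ^ k < X ^ n := by
  induction n with
  | zero => simp
  | succ n ih =>
    rw [Finset.sum_range_succ, pow_succ]
    have h1 := ih fun k hk => hd k (by omega)
    have h2 : d n * X ^ n + X ^ n ≤ X ^ n * X := by
      have := hd n (by omega)
      nlinarith [Nat.zero_le (X ^ n)]
    omega

/-- Multiplying by `1 + X + X ^ 2 + ⋯` sums up the digits in base `X`. -/
theorem sum_pow_mul_sum_pow (X B : ℕ) (a : ℕ → ℕ) : ∃ q,
    (∑ k ∈ Finset.range B, a k * X ^ k) * ∑ k ∈ Finset.range B, X ^ k =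
      ∑ k ∈ Finset.range B, (∑ i ∈ Finset.range (k + 1), a i) * X ^ k + X ^ B * q := by
  induction B generalizing a with
  | zero => exact ⟨0, by simp⟩
  | succ B ih =>
    obtain ⟨q, hq⟩ := ih fun k => a (k + 1)
    refine ⟨q + ∑ k ∈ Finset.range B, a (k + 1) * X ^ k, ?_⟩
    set A := ∑ k ∈ Finset.range B, a (k + 1) * X ^ k with hA
    set M := ∑ k ∈ Finset.range B, X ^ k with hM
    have e1 : ∑ k ∈ Finset.range (B + 1), a k * X ^ k = X * A + a 0 := by
      rw [Finset.sum_range_succ', hA, Finset.mul_sum]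
      simp only [pow_zero, mul_one]
      congr 1
      exact Finset.sum_congr rfl fun k _ => by ring
    have e2 : ∑ k ∈ Finset.range (B + 1), X ^ k = M + X ^ B := Finset.sum_range_succ _ _
    have e3 : ∑ k ∈ Finset.range (B + 1), X ^ k = X * M + 1 := by
      rw [Finset.sum_range_succ', hM, Finset.mul_sum]
      simp only [pow_zero]
      congr 1
      exact Finset.sum_congr rfl fun k _ => by ring
    have e4 : ∑ k ∈ Finset.range (B + 1), (∑ i ∈ Finset.range (k + 1), a i) * X ^ k =
        X * ∑ k ∈ Finset.range B, (∑ i ∈ Finset.range (k + 1), a (i + 1)) * X ^ k +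
          a 0 * (X * M + 1) := by
      rw [← e3, Finset.mul_sum, Finset.mul_sum, Finset.sum_range_succ',
        Finset.sum_range_succ' (fun k => a 0 * X ^ k), ← add_assoc, ← Finset.sum_add_distrib]
      congr 1
      · refine Finset.sum_congr rfl fun k _ => ?_
        rw [Finset.sum_range_succ' a (k + 1)]
        ring
    rw [e4, e1, pow_succ]
    calc (X * A + a 0) * ∑ k ∈ Finset.range (B + 1), X ^ k
        = X * (A * ∑ k ∈ Finset.range (B + 1), X ^ k) +
            a 0 * ∑ k ∈ Finset.range (B + 1), X ^ k := by ring
      _ = X * (A * M + A * X ^ B) + a 0 * (X * M + 1) := by rw [e2, ← e2, e3, ← e3, e2]; ring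
      _ = _ := by rw [hq]; ring

/-- A number all of whose ones are at multiples of `G`. -/
theorem eq_sum_of_testBit {G : ℕ} (hG : 0 < G) (B v : ℕ) (hv : v < 2 ^ (G * B))
    (h : ∀ i, ¬ G ∣ i → v.testBit i = false) :
    v = ∑ k ∈ Finset.range B, (v.testBit (G * k)).toNat * (2 ^ G) ^ k := by
  induction B generalizing v with
  | zero => simpa using hv
  | succ B ih =>
    have h1 : v / 2 ^ G < 2 ^ (G * B) := by
      rw [Nat.div_lt_iff_lt_mul (by positivity), ← pow_add]
      exact hv.trans_eq (by ring)
    have h2 := ih (v / 2 ^ G) h1 (by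
      intro i hi
      rw [Nat.testBit_div_two_pow]
      exact h _ (by rwa [Nat.dvd_add_left (dvd_refl G)]))
    have h3 : v % 2 ^ G = (v.testBit 0).toNat := by
      refine Nat.eq_of_testBit_eq fun i => ?_
      rw [Nat.testBit_mod_two_pow]
      rcases Nat.eq_zero_or_pos i with rfl | hi
      · cases v.testBit 0 <;> simp [hG]
      · have : (v.testBit 0).toNat.testBit i = false := by
          refine Nat.testBit_lt_two_pow ((Bool.toNat_lt _).trans_le ?_)
          calc 2 = 2 ^ 1 := by norm_num
            _ ≤ 2 ^ i := Nat.pow_le_pow_right (by norm_num) hi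
        rw [this]
        by_cases hiG : i < G
        · rw [h i (Nat.not_dvd_of_pos_of_lt hi hiG)]; simp
        · simp [hiG]
    rw [Finset.sum_range_succ', ← Nat.div_add_mod v (2 ^ G)]
    conv_lhs => rw [h2, h3]
    rw [Nat.div_add_mod, Finset.mul_sum]
    congr 1
    · refine Finset.sum_congr rfl fun k _ => ?_
      rw [Nat.testBit_div_two_pow, show G * k + G = G * (k + 1) by ring]
      ring
    · simp

theorem sum_range_mul_eq (f : ℕ → ℕ) (G B : ℕ) :
    ∑ i ∈ Finset.range (G * B), f i =
      ∑ k ∈ Finset.range B, ∑ t ∈ Finset.range G, f (G * k + t) := by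
  induction B with
  | zero => simp
  | succ B ih => rw [Nat.mul_succ, Finset.sum_range_add, ih, Finset.sum_range_succ]

/-- Summing up by one multiplication the parities of the blocks of length `G` of a word. -/
theorem parity_of_blocks {G : ℕ} (hG : 0 < G) (hw : 0 < w) (hwG : w < 2 ^ G) (y z M : BitVec w)
    (hz : ∀ i, (z.getLsbD i).toNat = (∑ t ∈ Finset.range G, (y.getLsbD (i + t)).toNat) % 2)
    (hM : ∀ i, M.getLsbD i = decide (i < w ∧ G ∣ i)) :
    (((z &&& M) * M) >>> (w - 1 - (w - 1) % G)) &&& 1 = BitVec.ofNat w (par y) := by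
  set B' := (w - 1) / G with hB'
  have hP : w - 1 - (w - 1) % G = G * B' := by
    have := Nat.div_add_mod (w - 1) G
    rw [← hB'] at this
    omega
  have hPw : G * B' < w := by
    have := Nat.mul_div_le (w - 1) G
    omega
  have hwB : w ≤ G * (B' + 1) := by
    have := Nat.lt_mul_div_succ (w - 1) hG
    rw [← hB'] at this
    omega
  have hkw : ∀ k, k < B' + 1 → G * k < w := fun k hk =>
    (Nat.mul_le_mul_left G (by omega : k ≤ B')).trans_lt hPw
  have hbound : ∀ v : BitVec w, v.toNat < 2 ^ (G * (B' + 1)) := fun v =>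
    v.isLt.trans_le (Nat.pow_le_pow_right (by norm_num) hwB)
  set a : ℕ → ℕ := fun k => (z.getLsbD (G * k)).toNat with ha
  have eM : M.toNat = ∑ k ∈ Finset.range (B' + 1), (2 ^ G) ^ k := by
    rw [eq_sum_of_testBit hG (B' + 1) M.toNat (hbound M)]
    · refine Finset.sum_congr rfl fun k hk => ?_
      rw [BitVec.testBit_toNat, hM]
      simp [hkw k (Finset.mem_range.1 hk)]
    · intro i hi
      rw [BitVec.testBit_toNat, hM]
      simp [hi]
  have eA : (z &&& M).toNat = ∑ k ∈ Finset.range (B' + 1), a k * (2 ^ G) ^ k := by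
    rw [eq_sum_of_testBit hG (B' + 1) _ (hbound (z &&& M))]
    · refine Finset.sum_congr rfl fun k hk => ?_
      rw [BitVec.testBit_toNat, BitVec.getLsbD_and, hM]
      simp [hkw k (Finset.mem_range.1 hk), ha]
    · intro i hi
      rw [BitVec.testBit_toNat, BitVec.getLsbD_and, hM]
      simp [hi]
  obtain ⟨q, hq⟩ := sum_pow_mul_sum_pow (2 ^ G) (B' + 1) a
  rw [← eA, ← eM] at hq
  have ha1 : ∀ k, a k ≤ 1 := fun k => by
    have := Bool.toNat_lt (z.getLsbD (G * k))
    simp only [ha]; omega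
  have hB'w : B' + 1 ≤ w := by
    have : B' ≤ w - 1 := Nat.div_le_self _ _
    omega
  have hS : ∀ k < B' + 1, ∑ i ∈ Finset.range (k + 1), a i < 2 ^ G := by
    intro k hk
    calc ∑ i ∈ Finset.range (k + 1), a i ≤ ∑ i ∈ Finset.range (k + 1), 1 :=
          Finset.sum_le_sum fun i _ => ha1 i
      _ = k + 1 := by simp
      _ < 2 ^ G := by omega
  have hpar : par y = (∑ i ∈ Finset.range (B' + 1), a i) % 2 := by
    unfold par
    have e1 : ∑ i ∈ Finset.range w, (y.getLsbD i).toNat =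
        ∑ i ∈ Finset.range (G * (B' + 1)), (y.getLsbD i).toNat := by
      refine Finset.sum_subset (Finset.range_mono hwB) fun i _ hi => ?_
      rw [BitVec.getLsbD_of_ge _ _ (by simpa using hi)]
      rfl
    rw [e1, sum_range_mul_eq, Finset.sum_nat_mod, Finset.sum_nat_mod _ _ a]
    congr 1
    refine Finset.sum_congr rfl fun k _ => ?_
    rw [ha]
    simp only
    rw [hz, Nat.mod_mod]
  have htop : ((z &&& M).toNat * M.toNat) / 2 ^ (G * B') % 2 = par y := by
    rw [hq, Finset.sum_range_succ, hpar]
    have hlow := sum_mul_pow_lt (X := 2 ^ G) (d := fun k => ∑ i ∈ Finset.range (k + 1), a i) B'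
      (fun k hk => hS k (by omega))
    rw [pow_mul]
    set low := ∑ k ∈ Finset.range B', (∑ i ∈ Finset.range (k + 1), a i) * (2 ^ G) ^ k
    set S := ∑ i ∈ Finset.range (B' + 1), a i
    have : low + S * (2 ^ G) ^ B' + (2 ^ G) ^ (B' + 1) * q =
        low + (2 ^ G) ^ B' * (S + 2 ^ G * q) := by ring
    rw [this, Nat.add_mul_div_left _ _ (by positivity), Nat.div_eq_of_lt hlow, zero_add]
    obtain ⟨G', rfl⟩ : ∃ G', G = G' + 1 := ⟨G - 1, by omega⟩
    rw [pow_succ, show S + 2 ^ G' * 2 * q = S + 2 * (2 ^ G' * q) by ring,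
      Nat.add_mul_mod_self_left]
  refine BitVec.eq_of_toNat_eq ?_
  rw [BitVec.toNat_and, BitVec.toNat_ushiftRight, BitVec.toNat_mul, BitVec.toNat_ofNat,
    Nat.mod_eq_of_lt ((par_lt y).trans_le (by
      calc 2 = 2 ^ 1 := by norm_num
        _ ≤ 2 ^ w := Nat.pow_le_pow_right (by norm_num) hw)),
    show BitVec.toNat (1 : BitVec w) = 1 by
      rw [show (1 : BitVec w) = BitVec.ofNat w 1 from rfl, toNat_ofNat_of_lt]
      exact Nat.one_lt_two_pow hw.ne',
    Nat.and_one_is_mod, Nat.shiftRight_eq_div_pow, hP, ← htop]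
  have h1 := Nat.testBit_mod_two_pow ((z &&& M).toNat * M.toNat) w (G * B')
  rw [decide_eq_true hPw, Bool.true_and, Nat.testBit_eq_decide_div_mod_eq,
    Nat.testBit_eq_decide_div_mod_eq, decide_eq_decide] at h1
  omega

/-- Replace register `138` by its parity. Register `33` holds the block length `G`, register `36`
the mask of the multiples of `G`, register `39` the largest multiple of `G` below `w`. -/
def parityProg : Program :=
  blk [.op .add 141 rOne rZero] ;;
  .loop (.lt 141 33) (blk [.op .shr 144 138 141, .op .xor 138 138 144, .op .add 141 141 141]) ;;
  blk [.op .and 138 138 36, .op .mul 138 138 36, .op .shr 138 138 39, .op .and 138 138 rOne]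

/-- The constants that the computation of parities uses, for block length `2 ^ g`. -/
structure ParityEnv (g : ℕ) (s : State w) : Prop where
  w_pos : 0 < w
  w_lt : w < 2 ^ 2 ^ g
  g_lt : 2 ^ g < 2 ^ w
  one : s.reg rOne = BitVec.ofNat w 1
  zero : s.reg rZero = BitVec.ofNat w 0
  block : s.reg 33 = BitVec.ofNat w (2 ^ g)
  mask : ∀ i, (s.reg 36).getLsbD i = decide (i < w ∧ 2 ^ g ∣ i)
  top : s.reg 39 = BitVec.ofNat w (w - 1 - (w - 1) % 2 ^ g)

theorem ParityEnv.congr {g : ℕ} {s s' : State w} (h : ParityEnv g s)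
    (hr : ∀ r < 120, s'.reg r = s.reg r) : ParityEnv g s' where
  w_pos := h.w_pos
  w_lt := h.w_lt
  g_lt := h.g_lt
  one := (hr _ (by norm_num)).trans h.one
  zero := (hr _ (by norm_num)).trans h.zero
  block := (hr _ (by norm_num)).trans h.block
  mask := by rw [hr 36 (by norm_num)]; exact h.mask
  top := (hr _ (by norm_num)).trans h.top

theorem toNat_lt_two_pow (w : ℕ) : w < 2 ^ w := Nat.lt_two_pow_self

/-- Shifting by powers of two gives the parities of all blocks of length `G = 2 ^ g` in time
`O(g)`. As `w < 2 ^ G`, one multiplication sums up the parities of `w / G` disjoint blocks without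
overflow. -/
theorem parityProg_spec {g : ℕ} {s : State w} (h : ParityEnv g s) :
    Det parityProg s (8 * g + 20) fun s' => s'.reg 138 = BitVec.ofNat w (par (s.reg 138)) := by
  have hww := toNat_lt_two_pow w
  refine ((Det.blk (Q := fun s' => s'.reg 141 = BitVec.ofNat w 1 ∧ s'.reg 138 = s.reg 138)
    ?_).seq (T₂ := 8 * g + 1 + 9 + 1) ?_).le (by simp; omega)
  · simp [execs, Instr.run, BinOp.eval, h.one, h.zero]
  rintro s₁ hf₁ ⟨h141, h138⟩
  refine (Det.seq (T₁ := 8 * g + 1) (T₂ := 9) (Q := fun s' => ∀ i, ((s'.reg 138).getLsbD i).toNat =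
    (∑ t ∈ Finset.range (2 ^ g), ((s.reg 138).getLsbD (i + t)).toNat) % 2) ?_ ?_).le (by omega)
  · refine (Det.loop (N := g) (fun _ => 7) (fun j s' => s'.reg 141 = BitVec.ofNat w (2 ^ j) ∧
      ∀ i, ((s'.reg 138).getLsbD i).toNat =
        (∑ t ∈ Finset.range (2 ^ j), ((s.reg 138).getLsbD (i + t)).toNat) % 2) ?_ ?_ ?_).mono
      (by simp; omega) (fun s' _ h => h.2)
    · refine ⟨h141, fun i => ?_⟩
      rw [h138]
      simp [Nat.mod_eq_of_lt (Bool.toNat_lt _)]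
    · rintro j hj s' hf ⟨hd, hy⟩
      have hjg : 2 ^ j < 2 ^ g := Nat.pow_lt_pow_right (by norm_num) hj
      have h33 : s'.reg 33 = BitVec.ofNat w (2 ^ g) :=
        ((hf.reg 33 rfl).trans (hf₁.reg 33 rfl)).trans h.block
      refine ⟨by rw [eval_lt_ofNat hd h33 (hjg.trans h.g_lt) h.g_lt]; simpa using hjg, ?_⟩
      refine Det.blk ?_
      refine ⟨?_, fun i => ?_⟩
      · simp only [execs, Instr.run, BinOp.eval, reg_setReg]
        simp only [if_true, Nat.reduceEqDiff, if_false, hd, BitVec.ofNat_add_ofNat]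
        congr 1
        rw [pow_succ]; ring
      · simp only [execs, Instr.run, BinOp.eval, reg_setReg]
        simp only [if_true, Nat.reduceEqDiff, if_false, hd]
        rw [BitVec.getLsbD_xor, toNat_xor_bool, BitVec.getLsbD_ushiftRight,
          toNat_ofNat_of_lt (hjg.trans h.g_lt), hy, hy, pow_succ, mul_two, Finset.sum_range_add,
          ← Nat.add_mod]
        congr 2
        refine Finset.sum_congr rfl fun t _ => ?_
        rw [show 2 ^ j + i + t = i + (2 ^ j + t) by ring]
    · rintro s' hf ⟨hd, -⟩
      have h33 : s'.reg 33 = BitVec.ofNat w (2 ^ g) :=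
        ((hf.reg 33 rfl).trans (hf₁.reg 33 rfl)).trans h.block
      rw [eval_lt_ofNat hd h33 h.g_lt h.g_lt]
      simp
  · intro s₂ hf₂ hz
    have e36 : s₂.reg 36 = s.reg 36 := (hf₂.reg 36 rfl).trans (hf₁.reg 36 rfl)
    have e39 : s₂.reg 39 = _ := ((hf₂.reg 39 rfl).trans (hf₁.reg 39 rfl)).trans h.top
    have e6 : s₂.reg 6 = _ := ((hf₂.reg 6 rfl).trans (hf₁.reg 6 rfl)).trans h.one
    refine Det.blk ?_
    have := parity_of_blocks (Nat.two_pow_pos g) h.w_pos h.w_lt (s.reg 138) (s₂.reg 138)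
      (s₂.reg 36) hz (by rw [e36]; exact h.mask)
    simp only [execs, Instr.run, BinOp.eval, reg_setReg]
    simp only [if_true, Nat.reduceEqDiff, if_false]
    rw [← this, e39, e6, toNat_ofNat_of_lt (by omega)]
    rfl

/-- Compute in register `129` the hash value of the word in register `120`; register `126` holds
`2 ^ b` for the number `b` of bits, and the rows are the words of bank `tb` from the address in
register `123` on. -/
def hashProg (tb : ℕ) : Program :=
  blk [.op .add 129 rZero rZero, .op .add 132 rOne rZero, .op .add 135 123 rZero] ;;
  .loop (.lt 132 126) (
    blk [.load 138 tb 135, .op .and 138 138 120] ;; parityProg ;;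
    blk [.op .mul 138 138 132, .op .xor 129 129 138, .op .add 132 132 132,
      .op .add 135 135 rOne])

/-- A bound on the time for hash values of `b` bits. -/
def hashTime (g b : ℕ) : ℕ := b * (8 * g + 40) + 10

theorem hashProg_spec {g b base tb : ℕ} {s : State w} (h : ParityEnv g s)
    (h126 : s.reg 126 = BitVec.ofNat w (2 ^ b)) (hb : 2 ^ b < 2 ^ w)
    (h123 : s.reg 123 = BitVec.ofNat w base) :
    Det (hashProg tb) s (hashTime g b) fun s' => s'.reg 129 =
      BitVec.ofNat w (hash (fun i => s.mem tb (BitVec.ofNat w (base + i))) b (s.reg 120)) := by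
  set rows : ℕ → BitVec w := fun i => s.mem tb (BitVec.ofNat w (base + i)) with hrows
  refine ((Det.blk (Q := fun s' => s'.reg 129 = BitVec.ofNat w 0 ∧ s'.reg 132 = BitVec.ofNat w 1 ∧
    s'.reg 135 = BitVec.ofNat w base) ?_).seq (T₂ := b * (8 * g + 40) + 1) ?_).le
    (by simp [hashTime]; omega)
  · simp [execs, Instr.run, BinOp.eval, h.one, h.zero, h123]
  rintro s₁ hf₁ ⟨h129, h132, h135⟩
  refine (Det.loop (N := b) (fun _ => 8 * g + 39) (fun j s' =>
    s'.reg 129 = BitVec.ofNat w (hash rows j (s.reg 120)) ∧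
    s'.reg 132 = BitVec.ofNat w (2 ^ j) ∧ s'.reg 135 = BitVec.ofNat w (base + j)) ?_ ?_ ?_).mono
    (by simp) (fun s' _ h => h.1)
  · exact ⟨h129, h132, h135⟩
  · rintro j hj s₂ hf₂ ⟨i129, i132, i135⟩
    have hjb : 2 ^ j < 2 ^ b := Nat.pow_lt_pow_right (by norm_num) hj
    have e126 : s₂.reg 126 = _ := ((hf₂.reg 126 rfl).trans (hf₁.reg 126 rfl)).trans h126
    have e120 : s₂.reg 120 = s.reg 120 := (hf₂.reg 120 rfl).trans (hf₁.reg 120 rfl)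
    have emem : s₂.mem tb = s.mem tb := (hf₂.mem tb rfl).trans (hf₁.mem tb rfl)
    have henv : ParityEnv g s₂ := h.congr fun r hr =>
      (hf₂.below rfl hr).trans (hf₁.below rfl hr)
    refine ⟨by rw [eval_lt_ofNat i132 e126 (hjb.trans hb) hb]; simpa using hjb, ?_⟩
    refine ((Det.blk (Q := fun s' => s'.reg 138 = rows j &&& s.reg 120) ?_).seq
      (T₂ := 8 * g + 20 + 9 + 1) ?_).le (by simp; omega)
    · simp [execs, Instr.run, BinOp.eval, i135, e120, emem, hrows]
    intro s₃ hf₃ h138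
    have henv₃ : ParityEnv g s₃ := henv.congr fun r hr => hf₃.below rfl hr
    refine Det.seq (parityProg_spec henv₃) (T₂ := 9) ?_
    intro s₄ hf₄ hp
    refine Det.blk ?_
    have k129 : s₄.reg 129 = _ := ((hf₄.reg 129 rfl).trans (hf₃.reg 129 rfl)).trans i129
    have k132 : s₄.reg 132 = _ := ((hf₄.reg 132 rfl).trans (hf₃.reg 132 rfl)).trans i132
    have k135 : s₄.reg 135 = _ := ((hf₄.reg 135 rfl).trans (hf₃.reg 135 rfl)).trans i135
    have k6 : s₄.reg 6 = _ := (hf₄.reg 6 rfl).trans henv₃.one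
    rw [h138] at hp
    simp only [execs, Instr.run, BinOp.eval, reg_setReg]
    simp only [if_true, Nat.reduceEqDiff, if_false, k129, k132, k135, k6, hp,
      BitVec.ofNat_add_ofNat, BitVec.ofNat_mul_ofNat, ← BitVec.ofNat_xor]
    exact ⟨rfl, by rw [pow_succ, mul_two], by rw [add_assoc]⟩
  · rintro s₂ hf₂ ⟨-, i132, -⟩
    have e126 : s₂.reg 126 = _ := ((hf₂.reg 126 rfl).trans (hf₁.reg 126 rfl)).trans h126
    rw [eval_lt_ofNat i132 e126 hb hb]
    simp

/-! ### Register and bank numbers of the reduction -/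

/-- Word length; at the end, the answer. -/
notation "rW" => 0
/-- Number of elements. -/
notation "rN" => 3
/-- The approximation of `n ^ γ`. -/
notation "rPow" => 12
/-- Number `R` of buckets. -/
notation "rR" => 15
/-- The number `r` of bits of a bucket. -/
notation "rLgR" => 18
/-- The product `R * m`. -/
notation "rProd" => 21
/-- Size `m` of a chunk. -/
notation "rM" => 24
/-- The logarithm `s` of the size of a chunk. -/
notation "rLgM" => 27
/-- The logarithm `l` of the number of elements, rounded up. -/
notation "rLgN" => 30
/-- The block length `2 ^ g` for parities. -/
notation "rBlock" => 33
/-- The word whose ones are at the multiples of the block length. -/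
notation "rMask" => 36
/-- The largest multiple of the block length less than `w`. -/
notation "rTop" => 39
/-- Number `L` of repetitions. -/
notation "rReps" => 42
/-- Number `Z` of random words for each hash function. -/
notation "rStride" => 45
/-- Number `L * Z` of random words. -/
notation "rTape" => 48
/-- The number `s + 1` of bits of a shift. -/
notation "rShU" => 51
/-- The number of bits of a shift and a chunk number. -/
notation "rShT" => 54
/-- The number `2 ^ (s + 1)` of shifts. -/
notation "rTwoM" => 57
/-- Mask for shifts. -/
notation "rMaskU" => 60
/-- Mask for chunk numbers. -/
notation "rMaskI" => 63
/-- Size of the universe of the sets. -/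
notation "rC" => 66
/-- Number of sets of each family. -/
notation "rFam" => 69
/-- The product `n * R`. -/
notation "rNR" => 72
/-- Mask for buckets. -/
notation "rMaskR" => 75
/-- Mask for positions in a chunk. -/
notation "rMaskM" => 78
/-- The product `m * m`. -/
notation "rMM" => 81
/-- The number `2 * R * m` of cells for the arranged words. -/
notation "rCells" => 84
/-- The product `n * m`. -/
notation "rNM" => 87
/-- Scratch register. -/
notation "rTmp" => 105
/-- Scratch register. -/
notation "rTmp'" => 108

/-- The bank of the input words. -/
notation "bX" => 0

/-! ### The parameters -/

/-- The parameters of the reduction: `n` elements are hashed to `2 ^ r` buckets and divided into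
chunks of size `2 ^ s`; `4 * l` is the number of repetitions, and parities are computed with blocks
of length `2 ^ g`. -/
structure Params where
  (n r s l g : ℕ)

namespace Params

variable (P : Params)

/-- Number of buckets. -/
def R : ℕ := 2 ^ P.r
/-- Size of a chunk. -/
def m : ℕ := 2 ^ P.s
/-- Number of repetitions. -/
def L : ℕ := 4 * P.l
/-- Number of random words for each hash function. -/
def Z : ℕ := P.r + 2 * P.s + 2
/-- Number of sets of each family. -/
def fam : ℕ := 4 * (P.R * P.m) * P.L

theorem R_pos : 0 < P.R := Nat.two_pow_pos _
theorem m_pos : 0 < P.m := Nat.two_pow_pos _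

/-- All numbers that occur in the reduction fit into a word. -/
structure Fits (w : ℕ) : Prop where
  w_pos : 0 < w
  w_lt : w < 2 ^ 2 ^ P.g
  g_lt : 2 ^ P.g < 2 ^ w
  two_le_n : 2 ≤ P.n
  l_pos : 1 ≤ P.l
  n_le : P.n ≤ P.R * P.m
  n_lt : P.n < 2 ^ w
  n_sq : P.n ^ 2 ≤ 2 ^ w
  tape : P.L * P.Z < 2 ^ w
  fam_lt : P.fam + 1 < 2 ^ w
  flat : P.fam * P.m < 2 ^ w
  queries : 11 * P.n * P.R * P.L < 2 ^ w
  univ : 4 * (P.m * P.m) < 2 ^ w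
  nm : P.n * P.m < 2 ^ w
  shift : P.s + P.r + 2 < 2 ^ w

theorem Fits.cells_lt {P : Params} (h : P.Fits w) : 4 * (P.R * P.m) < 2 ^ w := by
  have h1 := h.fam_lt
  have h2 : 1 ≤ P.L := by have := h.l_pos; simp only [L]; omega
  have : 4 * (P.R * P.m) * 1 ≤ P.fam := Nat.mul_le_mul_left _ h2
  omega

end Params

/-- The constants of the reduction are in their registers, and the input words are in their
bank. -/
structure Env (P : Params) (X : List (BitVec w)) (s : State w) : Prop where
  parity : ParityEnv P.g s
  wordLen : s.reg rW = BitVec.ofNat w w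
  n : s.reg rN = BitVec.ofNat w P.n
  R : s.reg rR = BitVec.ofNat w P.R
  lgR : s.reg rLgR = BitVec.ofNat w P.r
  m : s.reg rM = BitVec.ofNat w P.m
  lgM : s.reg rLgM = BitVec.ofNat w P.s
  L : s.reg rReps = BitVec.ofNat w P.L
  Z : s.reg rStride = BitVec.ofNat w P.Z
  tape : s.reg rTape = BitVec.ofNat w (P.L * P.Z)
  shU : s.reg rShU = BitVec.ofNat w (P.s + 1)
  shT : s.reg rShT = BitVec.ofNat w (P.s + 1 + P.r + 1)
  twoM : s.reg rTwoM = BitVec.ofNat w (2 ^ (P.s + 1))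
  maskU : s.reg rMaskU = BitVec.ofNat w (2 ^ (P.s + 1) - 1)
  maskI : s.reg rMaskI = BitVec.ofNat w (2 ^ (P.r + 1) - 1)
  C : s.reg rC = BitVec.ofNat w (2 ^ (2 * P.s + 2))
  fam : s.reg rFam = BitVec.ofNat w P.fam
  nR : s.reg rNR = BitVec.ofNat w (P.n * P.R)
  maskR : s.reg rMaskR = BitVec.ofNat w (2 ^ P.r - 1)
  maskM : s.reg rMaskM = BitVec.ofNat w (2 ^ P.s - 1)
  mm : s.reg rMM = BitVec.ofNat w (P.m * P.m)
  cells : s.reg rCells = BitVec.ofNat w (2 * (P.R * P.m))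
  nm : s.reg rNM = BitVec.ofNat w (P.n * P.m)
  input : ∀ j < X.length, s.mem bX (BitVec.ofNat w j) = X.getD j 0

theorem Env.congr {P : Params} {X : List (BitVec w)} {s s' : State w} (h : Env P X s)
    (hr : ∀ r < 90, r % 3 = 0 → s'.reg r = s.reg r) (hm : s'.mem bX = s.mem bX) : Env P X s' where
  parity := by
    have hp := h.parity
    exact ⟨hp.w_pos, hp.w_lt, hp.g_lt, (hr _ (by norm_num) (by norm_num)).trans hp.one,
      (hr _ (by norm_num) (by norm_num)).trans hp.zero,
      (hr _ (by norm_num) (by norm_num)).trans hp.block,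
      by rw [hr _ (by norm_num) (by norm_num)]; exact hp.mask,
      (hr _ (by norm_num) (by norm_num)).trans hp.top⟩
  wordLen := (hr _ (by norm_num) (by norm_num)).trans h.wordLen
  n := (hr _ (by norm_num) (by norm_num)).trans h.n
  R := (hr _ (by norm_num) (by norm_num)).trans h.R
  lgR := (hr _ (by norm_num) (by norm_num)).trans h.lgR
  m := (hr _ (by norm_num) (by norm_num)).trans h.m
  lgM := (hr _ (by norm_num) (by norm_num)).trans h.lgM
  L := (hr _ (by norm_num) (by norm_num)).trans h.L
  Z := (hr _ (by norm_num) (by norm_num)).trans h.Z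
  tape := (hr _ (by norm_num) (by norm_num)).trans h.tape
  shU := (hr _ (by norm_num) (by norm_num)).trans h.shU
  shT := (hr _ (by norm_num) (by norm_num)).trans h.shT
  twoM := (hr _ (by norm_num) (by norm_num)).trans h.twoM
  maskU := (hr _ (by norm_num) (by norm_num)).trans h.maskU
  maskI := (hr _ (by norm_num) (by norm_num)).trans h.maskI
  C := (hr _ (by norm_num) (by norm_num)).trans h.C
  fam := (hr _ (by norm_num) (by norm_num)).trans h.fam
  nR := (hr _ (by norm_num) (by norm_num)).trans h.nR
  maskR := (hr _ (by norm_num) (by norm_num)).trans h.maskR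
  maskM := (hr _ (by norm_num) (by norm_num)).trans h.maskM
  mm := (hr _ (by norm_num) (by norm_num)).trans h.mm
  cells := (hr _ (by norm_num) (by norm_num)).trans h.cells
  nm := (hr _ (by norm_num) (by norm_num)).trans h.nm
  input := by rw [hm]; exact h.input

theorem Env.frame {P : Params} {X : List (BitVec w)} {s s' : State w} (h : Env P X s) {p : Program}
    (hf : Frame p s s') (hr : p.regsFrom 90 = true) (hm : p.writesMem bX = false) : Env P X s' :=
  h.congr (fun _ h90 _ => hf.below hr h90) (hf.mem _ hm)

/-! ### Computing the parameters -/

/-- `J` is the least number of doublings that takes `a` to at least `v`. -/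
def IsLog (a v J : ℕ) : Prop := v ≤ a * 2 ^ J ∧ ∀ j < J, a * 2 ^ j < v

theorem exists_isLog {a : ℕ} (ha : 0 < a) (v : ℕ) : ∃ J, IsLog a v J := by
  have h : ∃ J, v ≤ a * 2 ^ J :=
    ⟨v, Nat.lt_two_pow_self.le.trans (Nat.le_mul_of_pos_left _ ha)⟩
  exact ⟨Nat.find h, Nat.find_spec h, fun j hj => not_le.1 (Nat.find_min h hj)⟩

theorem IsLog.le {a v J J' : ℕ} (h : IsLog a v J) (h' : v ≤ a * 2 ^ J') : J ≤ J' :=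
  not_lt.1 fun hlt => absurd (h.2 J' hlt) (not_lt.2 h')

theorem IsLog.lt_two_mul {a v J : ℕ} (h : IsLog a v J) (ha : a < 2 * v) : a * 2 ^ J < 2 * v := by
  cases J with
  | zero => simpa using ha
  | succ J =>
    have := h.2 J (by omega)
    rw [pow_succ, ← mul_assoc]
    omega

/-- Double register `acc` until it is at least register `lim`, counting in register `cnt`. -/
def doubling (acc cnt lim : ℕ) : Program :=
  .loop (.lt acc lim) (blk [.op .add acc acc acc, .op .add cnt cnt rOne])

theorem doubling_spec {acc cnt lim a v J : ℕ} {s : State w} (hJ : IsLog a v J)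
    (h1 : s.reg rOne = BitVec.ofNat w 1) (hacc : s.reg acc = BitVec.ofNat w a)
    (hcnt : s.reg cnt = BitVec.ofNat w 0) (hlim : s.reg lim = BitVec.ofNat w v) (hv : v < 2 ^ w)
    (ha : a * 2 ^ J < 2 ^ w) (h₁ : acc ≠ cnt) (h₂ : acc ≠ lim) (h₃ : cnt ≠ lim) (h₄ : acc ≠ rOne)
    (h₅ : cnt ≠ rOne) :
    Det (doubling acc cnt lim) s (6 * J + 1) fun s' =>
      s'.reg acc = BitVec.ofNat w (a * 2 ^ J) ∧ s'.reg cnt = BitVec.ofNat w J := by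
  have hw : ∀ r, acc ≠ r → cnt ≠ r → (doubling acc cnt lim).writesReg r = false := by
    intro r h h'
    simp [doubling, blk, Program.writesReg, Instr.writesReg, beq_eq_false_iff, h, h']
  refine (Det.loop (N := J) (fun _ => 5) (fun j s' => s'.reg acc = BitVec.ofNat w (a * 2 ^ j) ∧
    s'.reg cnt = BitVec.ofNat w j) ⟨by simpa using hacc, hcnt⟩ ?_ ?_).mono (by simp; omega)
    (fun _ _ h => h)
  · rintro j hj s' hf ⟨e1, e2⟩
    have e3 := (hf.reg lim (hw _ h₂ h₃)).trans hlim
    have e4 := (hf.reg rOne (hw _ h₄ h₅)).trans h1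
    have hlt := hJ.2 j hj
    refine ⟨by rw [eval_lt_ofNat e1 e3 (by omega) hv]; simpa using hlt, Det.blk ?_⟩
    simp only [execs, Instr.run, BinOp.eval, reg_setReg, if_true, h₁, h₁.symm, h₄.symm,
      if_false, e1, e2, e4, BitVec.ofNat_add_ofNat, and_true]
    rw [pow_succ]
    congr 1
    ring
  · rintro s' hf ⟨e1, -⟩
    have e3 := (hf.reg lim (hw _ h₂ h₃)).trans hlim
    rw [eval_lt_ofNat e1 e3 ha hv]
    simpa using hJ.1

/-- Compute the mask whose ones are at the multiples of the block length. -/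
def maskProg : Program :=
  blk [.const rMask 1, .op .add rTmp rBlock rZero] ;;
  .loop (.lt rTmp rW) (blk [.op .shl rTmp' rMask rTmp, .op .or rMask rMask rTmp',
    .op .add rTmp rTmp rTmp])

theorem maskProg_spec {G J : ℕ} {s : State w} (hG : 0 < G) (hJ : IsLog G w J)
    (hJw : G * 2 ^ J < 2 ^ w) (h0 : s.reg rZero = BitVec.ofNat w 0)
    (hw : s.reg rW = BitVec.ofNat w w) (hblock : s.reg rBlock = BitVec.ofNat w G) :
    Det maskProg s (8 * J + 10) fun s' =>
      ∀ i, (s'.reg rMask).getLsbD i = decide (i < w ∧ G ∣ i) := by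
  have hww := toNat_lt_two_pow w
  refine ((Det.blk (Q := fun s' => s'.reg rMask = BitVec.ofNat w 1 ∧
    s'.reg rTmp = BitVec.ofNat w G) ?_).seq (T₂ := 8 * J + 1) ?_).le (by simp; omega)
  · simp [execs, Instr.run, BinOp.eval, h0, hblock]
  rintro s₁ hf₁ ⟨e36, e105⟩
  have d0 : s₁.reg rW = BitVec.ofNat w w := (hf₁.reg _ rfl).trans hw
  refine (Det.loop (N := J) (fun _ => 7) (fun j s' => s'.reg rTmp = BitVec.ofNat w (G * 2 ^ j) ∧
      ∀ i, (s'.reg rMask).getLsbD i = decide (i < w ∧ G ∣ i ∧ i < G * 2 ^ j)) ?_ ?_ ?_).mono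
      (by simp; omega) ?_
  · refine ⟨by simpa using e105, fun i => ?_⟩
    rw [e36, BitVec.getLsbD_ofNat, Bool.eq_iff_iff]
    simp only [Bool.and_eq_true, decide_eq_true_eq, pow_zero, mul_one,
      Nat.testBit_one_eq_true_iff_self_eq_zero]
    constructor
    · rintro ⟨h, rfl⟩
      exact ⟨h, dvd_zero _, hG⟩
    · rintro ⟨h, hd, hlt⟩
      exact ⟨h, Nat.eq_zero_of_dvd_of_lt hd hlt⟩
  · rintro j hj s' hf ⟨e1, e2⟩
    have hlt := hJ.2 j hj
    have e0 : s'.reg rW = BitVec.ofNat w w := (hf.reg _ rfl).trans d0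
    refine ⟨by rw [eval_lt_ofNat e1 e0 (by omega) hww]; simpa using hlt, Det.blk ?_⟩
    simp only [execs, Instr.run, BinOp.eval, reg_setReg]
    simp only [if_true, Nat.reduceEqDiff, if_false, e1, BitVec.ofNat_add_ofNat]
    refine ⟨by rw [pow_succ]; congr 1; ring, fun i => ?_⟩
    rw [BitVec.getLsbD_or, BitVec.getLsbD_shiftLeft, e2, e2, toNat_ofNat_of_lt (by omega),
      Bool.eq_iff_iff]
    simp only [Bool.or_eq_true, Bool.and_eq_true, decide_eq_true_eq, Bool.not_eq_true',
      decide_eq_false_iff_not, not_lt, pow_succ, ← mul_assoc]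
    have hd : G ∣ G * 2 ^ j := dvd_mul_right _ _
    constructor
    · rintro (⟨h1, h2, h3⟩ | ⟨⟨h1, h2⟩, -, h3, h4⟩)
      · exact ⟨h1, h2, by omega⟩
      · refine ⟨h1, ?_, by omega⟩
        have := (Nat.dvd_add_iff_left hd).1 h3
        rwa [Nat.sub_add_cancel h2] at this
    · rintro ⟨h1, h2, h3⟩
      by_cases h : i < G * 2 ^ j
      · exact Or.inl ⟨h1, h2, h⟩
      · exact Or.inr ⟨⟨h1, by omega⟩, by omega, Nat.dvd_sub h2 hd, by omega⟩
  · rintro s' hf ⟨e1, -⟩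
    have e0 : s'.reg rW = BitVec.ofNat w w := (hf.reg _ rfl).trans d0
    rw [eval_lt_ofNat e1 e0 hJw hww]
    simpa using hJ.1
  · rintro s' - ⟨-, h⟩ i
    rw [h]
    have := hJ.1
    congr 1
    simp only [eq_iff_iff]
    constructor
    · rintro ⟨a, b, c⟩; exact ⟨a, b⟩
    · rintro ⟨a, b⟩; exact ⟨a, b, by omega⟩

theorem ofNat_sub_of_le {a b : ℕ} (h : b ≤ a) :
    BitVec.ofNat w a - BitVec.ofNat w b = BitVec.ofNat w (a - b) := by
  rw [sub_eq_iff_eq_add, BitVec.ofNat_add_ofNat, Nat.sub_add_cancel h]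

/-- Compute all parameters, the approximation of `n ^ γ` being in register `2`. -/
def paramsProg : Program :=
  blk [.op .add rPow 2 rZero, .op .add rR rOne rZero, .const rLgR 0] ;; doubling rR rLgR rPow ;;
  blk [.op .add rProd rR rZero, .const rLgM 0] ;; doubling rProd rLgM rN ;;
  blk [.op .add rTmp rOne rZero, .const rLgN 0] ;; doubling rTmp rLgN rN ;;
  blk [.op .add rTmp rOne rZero, .const rTmp' 0] ;; doubling rTmp rTmp' rW ;;
  blk [.op .add rTmp' rTmp' rOne, .op .add rBlock rOne rZero, .const 111 0] ;;
  doubling rBlock 111 rTmp' ;;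
  maskProg ;;
  blk [.op .sub rTmp rW rOne, .op .sub rTmp' rBlock rOne, .op .and rTmp' rTmp rTmp',
    .op .sub rTop rTmp rTmp',
    .op .shl rM rOne rLgM,
    .op .add rReps rLgN rLgN, .op .add rReps rReps rReps,
    .op .add rStride rLgM rLgM, .op .add rStride rStride rLgR,
    .op .add rStride rStride rOne, .op .add rStride rStride rOne,
    .op .mul rTape rReps rStride,
    .op .add rShU rLgM rOne,
    .op .add rShT rShU rLgR, .op .add rShT rShT rOne,
    .op .add rTwoM rM rM, .op .sub rMaskU rTwoM rOne,
    .op .add rMaskI rR rR, .op .sub rMaskI rMaskI rOne,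
    .op .mul rC rTwoM rTwoM,
    .op .mul rCells rR rM, .op .add rCells rCells rCells,
    .op .add rFam rCells rCells, .op .mul rFam rFam rReps,
    .op .mul rNR rN rR, .op .sub rMaskR rR rOne, .op .sub rMaskM rM rOne,
    .op .mul rMM rM rM, .op .mul rNM rN rM]

theorem paramsProg_spec {P : Params} {X : List (BitVec w)} {v q : ℕ} {s : State w} (hP : P.Fits w)
    (hr : IsLog 1 v P.r) (hs : IsLog P.R P.n P.s) (hl : IsLog 1 P.n P.l)
    (hq : IsLog 1 w q) (hg : IsLog 1 (q + 1) P.g) (hv : v < 2 ^ w)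
    (h1 : s.reg rOne = BitVec.ofNat w 1) (h0 : s.reg rZero = BitVec.ofNat w 0)
    (hw : s.reg rW = BitVec.ofNat w w) (hn : s.reg rN = BitVec.ofNat w P.n)
    (h2 : s.reg 2 = BitVec.ofNat w v)
    (hX : ∀ j < X.length, s.mem bX (BitVec.ofNat w j) = X.getD j 0) :
    Det paramsProg s (6 * P.r + 6 * P.s + 6 * P.l + 14 * q + 6 * P.g + 150) (Env P X) := by
  have hww := toNat_lt_two_pow w
  have hw1 := hP.w_pos
  have h2w : 2 * w ≤ 2 ^ w := by
    obtain ⟨u, rfl⟩ : ∃ u, w = u + 1 := ⟨w - 1, by omega⟩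
    have := toNat_lt_two_pow u
    rw [pow_succ]; omega
  have hcell := hP.cells_lt
  have hm1 := P.m_pos
  have hR1 := P.R_pos
  have hRm : P.R ≤ P.R * P.m := Nat.le_mul_of_pos_right _ hm1
  have hmR : P.m ≤ P.R * P.m := Nat.le_mul_of_pos_left _ hR1
  have hl2 : 1 * 2 ^ P.l < 2 ^ w := by
    have h := hl.lt_two_mul (by have := hP.two_le_n; omega)
    have h' := hP.n_sq
    have := hP.two_le_n
    nlinarith
  have hq2 : 1 * 2 ^ q < 2 ^ w := (hq.lt_two_mul (by omega)).trans_le h2w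
  have hq3 : q + 1 < 2 ^ w := by
    have := toNat_lt_two_pow q
    omega
  have hn := hn
  -- the number of buckets
  refine ((Det.blk (Q := fun s' => s'.reg rPow = BitVec.ofNat w v ∧ s'.reg rR = BitVec.ofNat w 1 ∧
    s'.reg rLgR = BitVec.ofNat w 0) ?_).seq
    (T₂ := 6 * P.r + 6 * P.s + 6 * P.l + 14 * q + 6 * P.g + 140)
      ?_).le (by simp; omega)
  · simp [execs, Instr.run, BinOp.eval, h0, h1, h2]
  rintro s₁ f₁ ⟨a1, a2, a3⟩
  have o₁ := (f₁.reg rOne rfl).trans h1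
  have z₁ := (f₁.reg rZero rfl).trans h0
  have n₁ := (f₁.reg rN rfl).trans hn
  have w₁ := (f₁.reg rW rfl).trans hw
  refine ((doubling_spec hr o₁ a2 a3 a1 hv (by rw [one_mul]; change P.R < _; omega) (by decide)
    (by decide) (by decide) (by decide) (by decide)).seq
    (T₂ := 6 * P.s + 6 * P.l + 14 * q + 6 * P.g + 138) ?_).le (by omega)
  rintro s₂ f₂ ⟨hR, hlgR⟩
  rw [one_mul] at hR
  have o₂ := (f₂.reg rOne rfl).trans o₁
  have z₂ := (f₂.reg rZero rfl).trans z₁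
  have n₂ := (f₂.reg rN rfl).trans n₁
  have w₂ := (f₂.reg rW rfl).trans w₁
  -- the size of a chunk
  refine ((Det.blk (Q := fun s' => s'.reg rProd = BitVec.ofNat w P.R ∧
    s'.reg rLgM = BitVec.ofNat w 0) ?_).seq (T₂ := 6 * P.s + 6 * P.l + 14 * q + 6 * P.g + 132)
      ?_).le (by simp; omega)
  · simp [execs, Instr.run, BinOp.eval, z₂, hR, Params.R]
  rintro s₃ f₃ ⟨a1, a2⟩
  have o₃ := (f₃.reg rOne rfl).trans o₂
  have z₃ := (f₃.reg rZero rfl).trans z₂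
  have n₃ := (f₃.reg rN rfl).trans n₂
  have w₃ := (f₃.reg rW rfl).trans w₂
  refine ((doubling_spec hs o₃ a1 a2 n₃ hP.n_lt (by change P.R * P.m < _; omega) (by decide)
    (by decide) (by decide) (by decide) (by decide)).seq
    (T₂ := 6 * P.l + 14 * q + 6 * P.g + 130) ?_).le (by omega)
  rintro s₄ f₄ ⟨-, hlgM⟩
  have o₄ := (f₄.reg rOne rfl).trans o₃
  have z₄ := (f₄.reg rZero rfl).trans z₃
  have n₄ := (f₄.reg rN rfl).trans n₃
  have w₄ := (f₄.reg rW rfl).trans w₃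
  -- the logarithm of the number of elements
  refine ((Det.blk (Q := fun s' => s'.reg rTmp = BitVec.ofNat w 1 ∧
    s'.reg rLgN = BitVec.ofNat w 0) ?_).seq (T₂ := 6 * P.l + 14 * q + 6 * P.g + 124)
      ?_).le (by simp; omega)
  · simp [execs, Instr.run, BinOp.eval, z₄, o₄]
  rintro s₅ f₅ ⟨a1, a2⟩
  have o₅ := (f₅.reg rOne rfl).trans o₄
  have z₅ := (f₅.reg rZero rfl).trans z₄
  have n₅ := (f₅.reg rN rfl).trans n₄
  have w₅ := (f₅.reg rW rfl).trans w₄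
  refine ((doubling_spec hl o₅ a1 a2 n₅ hP.n_lt hl2 (by decide)
    (by decide) (by decide) (by decide) (by decide)).seq
    (T₂ := 14 * q + 6 * P.g + 122) ?_).le (by omega)
  rintro s₆ f₆ ⟨-, hlgN⟩
  have o₆ := (f₆.reg rOne rfl).trans o₅
  have z₆ := (f₆.reg rZero rfl).trans z₅
  have n₆ := (f₆.reg rN rfl).trans n₅
  have w₆ := (f₆.reg rW rfl).trans w₅
  -- the logarithm of the word length
  refine ((Det.blk (Q := fun s' => s'.reg rTmp = BitVec.ofNat w 1 ∧
    s'.reg rTmp' = BitVec.ofNat w 0) ?_).seq (T₂ := 14 * q + 6 * P.g + 116)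
      ?_).le (by simp; omega)
  · simp [execs, Instr.run, BinOp.eval, z₆, o₆]
  rintro s₇ f₇ ⟨a1, a2⟩
  have o₇ := (f₇.reg rOne rfl).trans o₆
  have z₇ := (f₇.reg rZero rfl).trans z₆
  have n₇ := (f₇.reg rN rfl).trans n₆
  have w₇ := (f₇.reg rW rfl).trans w₆
  refine ((doubling_spec hq o₇ a1 a2 w₇ hww hq2 (by decide)
    (by decide) (by decide) (by decide) (by decide)).seq
    (T₂ := 8 * q + 6 * P.g + 114) ?_).le (by omega)
  rintro s₈ f₈ ⟨-, hlgw⟩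
  have o₈ := (f₈.reg rOne rfl).trans o₇
  have z₈ := (f₈.reg rZero rfl).trans z₇
  have n₈ := (f₈.reg rN rfl).trans n₇
  have w₈ := (f₈.reg rW rfl).trans w₇
  -- the block length
  refine ((Det.blk (Q := fun s' => s'.reg rTmp' = BitVec.ofNat w (q + 1) ∧
    s'.reg rBlock = BitVec.ofNat w 1 ∧ s'.reg 111 = BitVec.ofNat w 0) ?_).seq
      (T₂ := 8 * q + 6 * P.g + 106) ?_).le (by simp; omega)
  · simp [execs, Instr.run, BinOp.eval, z₈, o₈, hlgw, BitVec.ofNat_add]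
  rintro s₉ f₉ ⟨a1, a2, a3⟩
  have o₉ := (f₉.reg rOne rfl).trans o₈
  have z₉ := (f₉.reg rZero rfl).trans z₈
  have n₉ := (f₉.reg rN rfl).trans n₈
  have w₉ := (f₉.reg rW rfl).trans w₈
  refine ((doubling_spec hg o₉ a2 a3 a1 hq3 (by rw [one_mul]; exact hP.g_lt) (by decide)
    (by decide) (by decide) (by decide) (by decide)).seq
    (T₂ := 8 * q + 104) ?_).le (by omega)
  rintro s₁₀ f₁₀ ⟨hblock, -⟩
  rw [one_mul] at hblock
  have o₁₀ := (f₁₀.reg rOne rfl).trans o₉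
  have z₁₀ := (f₁₀.reg rZero rfl).trans z₉
  have n₁₀ := (f₁₀.reg rN rfl).trans n₉
  have w₁₀ := (f₁₀.reg rW rfl).trans w₉
  -- the mask
  obtain ⟨J, hJ⟩ := exists_isLog (Nat.two_pow_pos P.g) w
  have hJq : J ≤ q := hJ.le (by
    have := hq.1
    have := Nat.two_pow_pos P.g
    nlinarith [Nat.two_pow_pos q])
  have hJw : 2 ^ P.g * 2 ^ J < 2 ^ w := by
    cases J with
    | zero => simpa using hP.g_lt
    | succ J =>
      have := hJ.2 J (by omega)
      rw [pow_succ, ← mul_assoc]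
      omega
  refine ((maskProg_spec (Nat.two_pow_pos P.g) hJ hJw z₁₀ w₁₀ hblock).seq
    (T₂ := 93) ?_).le (by omega)
  intro s₁₁ f₁₁ hmask
  have o := (f₁₁.reg rOne rfl).trans o₁₀
  have z := (f₁₁.reg rZero rfl).trans z₁₀
  have n := (f₁₁.reg rN rfl).trans n₁₀
  have w' := (f₁₁.reg rW rfl).trans w₁₀
  have kblock := (f₁₁.reg rBlock rfl).trans hblock
  have kR : s₁₁.reg rR = BitVec.ofNat w P.R := by
    rw [f₁₁.reg _ rfl, f₁₀.reg _ rfl, f₉.reg _ rfl, f₈.reg _ rfl, f₇.reg _ rfl, f₆.reg _ rfl,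
      f₅.reg _ rfl, f₄.reg _ rfl, f₃.reg _ rfl, hR]; rfl
  have klgR : s₁₁.reg rLgR = BitVec.ofNat w P.r := by
    rw [f₁₁.reg _ rfl, f₁₀.reg _ rfl, f₉.reg _ rfl, f₈.reg _ rfl, f₇.reg _ rfl, f₆.reg _ rfl,
      f₅.reg _ rfl, f₄.reg _ rfl, f₃.reg _ rfl, hlgR]
  have klgM : s₁₁.reg rLgM = BitVec.ofNat w P.s := by
    rw [f₁₁.reg _ rfl, f₁₀.reg _ rfl, f₉.reg _ rfl, f₈.reg _ rfl, f₇.reg _ rfl, f₆.reg _ rfl,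
      f₅.reg _ rfl, hlgM]
  have klgN : s₁₁.reg rLgN = BitVec.ofNat w P.l := by
    rw [f₁₁.reg _ rfl, f₁₀.reg _ rfl, f₉.reg _ rfl, f₈.reg _ rfl, f₇.reg _ rfl, hlgN]
  have kmem : s₁₁.mem bX = s.mem bX := by
    rw [f₁₁.mem _ rfl, f₁₀.mem _ rfl, f₉.mem _ rfl, f₈.mem _ rfl, f₇.mem _ rfl, f₆.mem _ rfl,
      f₅.mem _ rfl, f₄.mem _ rfl, f₃.mem _ rfl, f₂.mem _ rfl, f₁.mem _ rfl]
  have hsw : (BitVec.ofNat w P.s).toNat = P.s :=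
    toNat_ofNat_of_lt (by have := hP.shift; omega)
  have e_m : BitVec.ofNat w 1 <<< P.s = BitVec.ofNat w (2 ^ P.s) := by
    refine BitVec.eq_of_toNat_eq ?_
    rw [BitVec.toNat_shiftLeft, toNat_ofNat_of_lt (Nat.one_lt_two_pow hw1.ne'), Nat.one_shiftLeft,
      BitVec.toNat_ofNat]
  refine (Det.blk ?_).le (by simp)
  simp only [execs, Instr.run, BinOp.eval, reg_setReg]
  simp only [if_true, Nat.reduceEqDiff, if_false, o, w', n, kblock, kR, klgR, klgM, klgN, hsw, e_m,
    ofNat_sub_of_le hw1, ofNat_sub_of_le (Nat.two_pow_pos P.g), BitVec.ofNat_add_ofNat,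
    BitVec.ofNat_mul_ofNat, ← BitVec.ofNat_and, Nat.and_two_pow_sub_one_eq_mod,
    ofNat_sub_of_le (Nat.mod_le _ _)]
  have two_s : 2 ^ P.s + 2 ^ P.s = 2 ^ (P.s + 1) := by rw [pow_succ]; ring
  have two_r : P.R + P.R = 2 ^ (P.r + 1) := by rw [Params.R, pow_succ]; ring
  have p_s : 1 ≤ 2 ^ P.s := Nat.two_pow_pos _
  have p_s1 : 1 ≤ 2 ^ (P.s + 1) := Nat.two_pow_pos _
  have p_r1 : 1 ≤ 2 ^ (P.r + 1) := Nat.two_pow_pos _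
  refine ⟨⟨hw1, hP.w_lt, hP.g_lt, ?_, ?_, ?_, ?_, ?_⟩, ?_, ?_, ?_, ?_, ?_, ?_, ?_, ?_, ?_, ?_,
    ?_, ?_, ?_, ?_, ?_, ?_, ?_, ?_, ?_, ?_, ?_, ?_, ?_⟩
  all_goals
    simp only [reg_setReg, mem_setReg, if_true, Nat.reduceEqDiff, if_false, o, z, w', n, kblock, kR,
      klgR, klgM, kmem, two_s, two_r,
      ofNat_sub_of_le p_s, ofNat_sub_of_le p_s1, ofNat_sub_of_le p_r1, ofNat_sub_of_le hR1]
  all_goals first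
    | exact hmask
    | exact hX
    | rfl
    | (congr 1
       try simp only [Params.fam, Params.L, Params.Z, Params.m]
       ring)

/-! ### Arranging the words by buckets -/

/-- The members of `X` in bucket `b` of the hash function `h`. -/
def bucket (X : List (BitVec w)) (h : BitVec w → ℕ) (b : ℕ) : List (BitVec w) :=
  X.filter fun x => h x = b

/-- The members of `X` in the first `k` buckets, ordered by buckets. -/
def arranged (X : List (BitVec w)) (h : BitVec w → ℕ) (k : ℕ) : List (BitVec w) :=
  (List.range k).flatMap (bucket X h)

/-- Number of pairs of members of `X` that fall into the same one of the first `k` buckets. -/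
def collisions (X : List (BitVec w)) (h : BitVec w → ℕ) (k : ℕ) : ℕ :=
  ∑ b ∈ Finset.range k, (bucket X h b).length.choose 2

theorem arranged_succ (X : List (BitVec w)) (h : BitVec w → ℕ) (k : ℕ) :
    arranged X h (k + 1) = arranged X h k ++ bucket X h k := by
  simp [arranged, List.range_succ]

theorem countP_lt_succ (X : List (BitVec w)) (h : BitVec w → ℕ) (k : ℕ) :
    X.countP (fun x => h x < k + 1) = X.countP (fun x => h x < k) + X.countP fun x => h x = k := by
  induction X with
  | nil => simp
  | cons a X ih =>
    simp only [List.countP_cons, decide_eq_true_eq, ih]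
    rcases lt_trichotomy (h a) k with h1 | h1 | h1
    · rw [if_pos (by omega : h a < k + 1), if_pos h1, if_neg (by omega)]; omega
    · rw [if_pos (by omega : h a < k + 1), if_neg (by omega), if_pos h1]; omega
    · rw [if_neg (by omega), if_neg (by omega), if_neg (by omega)]; omega

theorem length_arranged (X : List (BitVec w)) (h : BitVec w → ℕ) (k : ℕ) :
    (arranged X h k).length = X.countP fun x => h x < k := by
  induction k with
  | zero => simp [arranged]
  | succ k ih =>
    rw [arranged_succ, List.length_append, ih, bucket, ← List.countP_eq_length_filter,
      countP_lt_succ]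

theorem length_arranged_le (X : List (BitVec w)) (h : BitVec w → ℕ) (k : ℕ) :
    (arranged X h k).length ≤ X.length := by
  rw [length_arranged]
  exact List.countP_le_length

theorem length_arranged_eq {X : List (BitVec w)} {h : BitVec w → ℕ} {k : ℕ} (hk : ∀ x, h x < k) :
    (arranged X h k).length = X.length := by
  rw [length_arranged, List.countP_eq_length]
  simpa using fun x _ => hk x

theorem collisions_succ (X : List (BitVec w)) (h : BitVec w → ℕ) (k : ℕ) :
    collisions X h (k + 1) = collisions X h k + (bucket X h k).length.choose 2 :=
  Finset.sum_range_succ _ _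

theorem choose_two_add_le (a b : ℕ) : a.choose 2 + b.choose 2 ≤ (a + b).choose 2 := by
  induction b with
  | zero => simp
  | succ b ih =>
    rw [← add_assoc, Nat.choose_succ_succ' (a + b) 1, Nat.choose_succ_succ' b 1,
      Nat.choose_one_right,
      Nat.choose_one_right]
    simp only [Nat.reduceAdd]
    omega

theorem collisions_le (X : List (BitVec w)) (h : BitVec w → ℕ) (k : ℕ) :
    collisions X h k ≤ (arranged X h k).length.choose 2 := by
  induction k with
  | zero => simp [collisions]
  | succ k ih =>
    rw [collisions_succ, arranged_succ, List.length_append]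
    exact (Nat.add_le_add_right ih _).trans (choose_two_add_le _ _)

theorem choose_two_lt_sq {n : ℕ} (hn : 0 < n) : n.choose 2 < n ^ 2 := by
  rw [Nat.choose_two_right]
  have : n * (n - 1) / 2 ≤ n * (n - 1) := Nat.div_le_self _ _
  have h2 : n * (n - 1) < n * n := Nat.mul_lt_mul_of_pos_left (by omega) hn
  rw [sq]; omega

/-- The bank of the words arranged by buckets. -/
notation "bSrt" => 3
/-- The bank of the starting positions of the buckets. -/
notation "bStart" => 6
/-- The bank of the random words for the search for buckets. -/
notation "bTapeA" => 9
/-- The bank of the random words for the sets. -/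
notation "bTapeB" => 12

/-- Whether a good hash function has been found. -/
notation "rFound" => 90
/-- The address of the first row of the good hash function. -/
notation "rBase" => 93

/-- Fill the bank of the arranged words with copies of the first input word. -/
def fillProg : Program :=
  blk [.load 150 bX rZero] ;; forRange 153 rCells (blk [.store bSrt 153 150])

theorem fillProg_spec {P : Params} {X : List (BitVec w)} {s : State w} (hP : P.Fits w)
    (hE : Env P X s) (hX : X.length = P.n) :
    Det fillProg s (12 * (P.R * P.m) + 10)
      fun s' => ∀ k < 2 * (P.R * P.m), s'.mem bSrt (BitVec.ofNat w k) ∈ X := by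
  have hc := hP.cells_lt
  have hn := hP.two_le_n
  refine ((Det.blk (Q := fun s' => s'.reg 150 ∈ X) ?_).seq
    (T₂ := 12 * (P.R * P.m) + 3) ?_).le (by simp; omega)
  · have := hE.input 0 (by omega)
    simp only [execs, Instr.run, reg_setReg, if_true, hE.parity.zero, this]
    rw [List.getD_eq_getElem _ _ (by omega)]
    exact List.getElem_mem _
  intro s₁ hf₁ h150
  have hE₁ := hE.frame hf₁ rfl rfl
  refine (Det.forRange (N := 2 * (P.R * P.m)) (fun _ => 3)
    (fun j s' => ∀ k < j, s'.mem bSrt (BitVec.ofNat w k) ∈ X) (by omega) hE₁.cells hE₁.parity.one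
    rfl rfl rfl (by intro j s v h; exact h) (by simp) ?_).le (by simp; omega)
  intro j hj s₂ hf₂ hij hinv
  refine Det.blk ?_
  intro k hk
  simp only [execs, Instr.run, mem_setMem, if_true, hij, hf₂.reg 150 rfl, Function.update_apply]
  split_ifs with hkj
  · exact h150
  · exact hinv k (by
      have : k ≠ j := fun h => hkj (by rw [h])
      omega)

/-- Arrange the words by the buckets of the hash function number register `156`, whose rows are in
the first sequence of random words, and count the collisions. -/
def arrangeProg : Program :=
  blk [.op .mul 123 156 rStride, .op .add 126 rR rZero, .const 159 0, .const 162 0] ;;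
  forRange 165 rR (
    blk [.store bStart 165 159, .op .add 168 159 rZero] ;;
    forRange 171 rN (
      blk [.load 120 bX 171] ;; hashProg bTapeA ;;
      .ite (.eq 129 165)
        (blk [.store bSrt 159 120, .op .sub 174 159 168, .op .add 162 162 174,
          .op .add 159 159 rOne])
        .skip)) ;;
  blk [.store bStart rR 159] ;;
  .ite (.lt rNM 162) .skip (blk [.op .add rFound rOne rZero, .op .add rBase 123 rZero])

/-- The words are arranged by the buckets of `h`. -/
structure Arranged (P : Params) (X : List (BitVec w)) (h : BitVec w → ℕ) (s : State w) : Prop where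
  srt : ∀ k < X.length, s.mem bSrt (BitVec.ofNat w k) = (arranged X h P.R).getD k 0
  start : ∀ b ≤ P.R, s.mem bStart (BitVec.ofNat w b) = BitVec.ofNat w (arranged X h b).length

/-- The `u`-th hash function with `b` bits whose rows are in the sequence `T` of random words. -/
def Params.hashFn (P : Params) (T : ℕ → BitVec w) (b u : ℕ) (x : BitVec w) : ℕ :=
  hash (fun i => T (u * P.Z + i)) b x

/-- A bound on the time of arranging the words. -/
def Params.arrangeTime (P : Params) : ℕ :=
  P.R * (P.n * (hashTime P.g P.r + 20) + 20) + 40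

theorem arrangeProg_spec {P : Params} {X : List (BitVec w)} {s : State w} {T : ℕ → BitVec w}
    {u : ℕ} (hP : P.Fits w) (hE : Env P X s) (hX : X.length = P.n)
    (hT : ∀ j, s.mem bTapeA (BitVec.ofNat w j) = T j) (hu : s.reg 156 = BitVec.ofNat w u)
    (h0 : s.reg rFound = BitVec.ofNat w 0)
    (hin : ∀ k < 2 * (P.R * P.m), s.mem bSrt (BitVec.ofNat w k) ∈ X) :
    Det arrangeProg s P.arrangeTime fun s' =>
      (∀ k < 2 * (P.R * P.m), s'.mem bSrt (BitVec.ofNat w k) ∈ X) ∧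
      ((s'.reg rFound = BitVec.ofNat w 0 ∧ P.n * P.m < collisions X (P.hashFn T P.r u) P.R) ∨
        (s'.reg rFound = BitVec.ofNat w 1 ∧ s'.reg rBase = BitVec.ofNat w (u * P.Z) ∧
          collisions X (P.hashFn T P.r u) P.R ≤ P.n * P.m ∧
          Arranged P X (P.hashFn T P.r u) s')) := by
  set h := P.hashFn T P.r u with hh
  have hhR : ∀ x, h x < P.R := fun x => hash_lt _ _ _
  have hc := hP.cells_lt
  have hn := hP.two_le_n
  have hnw := hP.n_lt
  have hRw : P.R < 2 ^ w := by
    have := Nat.le_mul_of_pos_right P.R P.m_pos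
    omega
  have hcol : ∀ k, collisions X h k < 2 ^ w := fun k => by
    refine ((collisions_le X h k).trans (Nat.choose_le_choose 2
      (length_arranged_le X h k))).trans_lt
      ?_
    rw [hX]
    exact (choose_two_lt_sq (by omega)).trans_le hP.n_sq
  refine ((Det.blk (Q := fun s' => s'.reg 123 = BitVec.ofNat w (u * P.Z) ∧
    s'.reg 126 = BitVec.ofNat w P.R ∧ s'.reg 159 = BitVec.ofNat w 0 ∧
    s'.reg 162 = BitVec.ofNat w 0) ?_).seq
    (T₂ := P.R * (P.n * (hashTime P.g P.r + 20) + 20) + 25) ?_).le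
    (by simp [Params.arrangeTime]; omega)
  · simp [execs, Instr.run, BinOp.eval, hE.Z, hE.R, hE.parity.zero, hu, BitVec.ofNat_mul]
  rintro s₁ hf₁ ⟨a123, a126, a159, a162⟩
  have hE₁ : Env P X s₁ := hE.frame hf₁ rfl rfl
  refine (Det.seq (T₁ := P.R * (P.n * (hashTime P.g P.r + 20) + 20) + 3) (T₂ := 15) (Q := fun s' =>
    (∀ k < 2 * (P.R * P.m), s'.mem bSrt (BitVec.ofNat w k) ∈ X) ∧
    (∀ k < (arranged X h P.R).length, s'.mem bSrt (BitVec.ofNat w k) =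
      (arranged X h P.R).getD k 0) ∧
    (∀ b < P.R, s'.mem bStart (BitVec.ofNat w b) = BitVec.ofNat w (arranged X h b).length) ∧
    s'.reg 159 = BitVec.ofNat w (arranged X h P.R).length ∧
    s'.reg 162 = BitVec.ofNat w (collisions X h P.R)) ?_ ?_).le (by omega)
  · refine (Det.forRange (N := P.R) (fun _ => P.n * (hashTime P.g P.r + 20) + 17) (fun b s' =>
      (∀ k < 2 * (P.R * P.m), s'.mem bSrt (BitVec.ofNat w k) ∈ X) ∧
      (∀ k < (arranged X h b).length, s'.mem bSrt (BitVec.ofNat w k) =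
        (arranged X h b).getD k 0) ∧
      (∀ b' < b, s'.mem bStart (BitVec.ofNat w b') = BitVec.ofNat w (arranged X h b').length) ∧
      s'.reg 159 = BitVec.ofNat w (arranged X h b).length ∧
      s'.reg 162 = BitVec.ofNat w (collisions X h b)) hRw hE₁.R hE₁.parity.one rfl rfl rfl
      (by intro j s v h; simpa using h) ?_ ?_).le (by simp)
    · rw [hf₁.mem bSrt rfl]
      refine ⟨hin, ?_, ?_, ?_, ?_⟩
      · intro k hk; simp [arranged] at hk
      · intro k hk; omega
      · simpa [arranged] using a159
      · simpa [collisions] using a162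
    · rintro b hb s₂ hf₂ hib ⟨i1, i2, i3, i4, i5⟩
      have hE₂ : Env P X s₂ := hE₁.frame hf₂ rfl rfl
      refine ((Det.blk (Q := fun s' => s'.reg 168 = BitVec.ofNat w (arranged X h b).length ∧
        ∀ b' < b + 1, s'.mem bStart (BitVec.ofNat w b') =
          BitVec.ofNat w (arranged X h b').length) ?_).seq
        (T₂ := P.n * (hashTime P.g P.r + 20) + 3) ?_).le (by simp; omega)
      · simp only [execs, Instr.run, BinOp.eval, reg_setReg, mem_setReg, mem_setMem, reg_setMem,
          if_true, i4, hib, hE₂.parity.zero, BitVec.ofNat_add_ofNat, add_zero]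
        refine ⟨trivial, fun b' hb' => ?_⟩
        rw [Function.update_apply]
        split_ifs with hbb
        · rw [(ofNat_inj_of_lt (by omega) (by omega)).1 hbb]
        · exact i3 b' (by
            have : b' ≠ b := fun e => hbb (by rw [e])
            omega)
      rintro s₃ hf₃ ⟨a168, i3'⟩
      have hE₃ : Env P X s₃ := hE₂.frame hf₃ rfl rfl
      set part : ℕ → List (BitVec w) := fun j => (X.take j).filter fun x => h x = b with hpart
      have hpart_len : ∀ j, (arranged X h b ++ part j).length ≤ P.n := by
        intro j
        have h1 := length_arranged_le X h (b + 1)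
        rw [arranged_succ, List.length_append, hX] at h1
        rw [List.length_append]
        have : (part j).length ≤ (bucket X h b).length :=
          ((List.take_sublist j X).filter _).length_le
        omega
      refine (Det.forRange (N := P.n) (fun _ => hashTime P.g P.r + 17) (fun j s' =>
        (∀ k < 2 * (P.R * P.m), s'.mem bSrt (BitVec.ofNat w k) ∈ X) ∧
        (∀ k < (arranged X h b ++ part j).length, s'.mem bSrt (BitVec.ofNat w k) =
          (arranged X h b ++ part j).getD k 0) ∧
        s'.reg 159 = BitVec.ofNat w (arranged X h b ++ part j).length ∧
        s'.reg 162 = BitVec.ofNat w (collisions X h b + (part j).length.choose 2))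
        hnw hE₃.n hE₃.parity.one rfl rfl rfl (by intro j s v h; simpa using h) ?_ ?_).mono
        (by simp) ?_
      · rw [hf₃.mem bSrt rfl, hf₃.reg 159 rfl, hf₃.reg 162 rfl]
        simp only [hpart, List.take_zero, List.filter_nil, List.append_nil, List.length_nil,
          Nat.choose_zero_succ, add_zero]
        exact ⟨i1, i2, i4, i5⟩
      · rintro j hj s₄ hf₄ hij ⟨j1, j2, j4, j5⟩
        have hE₄ : Env P X s₄ := hE₃.frame hf₄ rfl rfl
        set x := X.getD j 0 with hx
        refine ((Det.blk (Q := fun s' => s'.reg 120 = x) ?_).seq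
          (T₂ := hashTime P.g P.r + 11) ?_).le (by simp; omega)
        · simp only [execs, Instr.run, reg_setReg, if_true, hij, hE₄.input j (by omega), hx]
        intro s₅ hf₅ a120
        have hE₅ : Env P X s₅ := hE₄.frame hf₅ rfl rfl
        have b123 : s₅.reg 123 = BitVec.ofNat w (u * P.Z) := by
          rw [hf₅.reg _ rfl, hf₄.reg _ rfl, hf₃.reg _ rfl, hf₂.reg _ rfl, a123]
        have b126 : s₅.reg 126 = BitVec.ofNat w (2 ^ P.r) := by
          rw [hf₅.reg _ rfl, hf₄.reg _ rfl, hf₃.reg _ rfl, hf₂.reg _ rfl, a126]; rfl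
        have bT : s₅.mem bTapeA = s.mem bTapeA := by
          rw [hf₅.mem _ rfl, hf₄.mem _ rfl, hf₃.mem _ rfl, hf₂.mem _ rfl, hf₁.mem _ rfl]
        refine (hashProg_spec hE₅.parity b126 hRw b123).seq (T₂ := 10) ?_
        intro s₆ hf₆ a129
        have hE₆ : Env P X s₆ := hE₅.frame hf₆ rfl rfl
        have e129 : s₆.reg 129 = BitVec.ofNat w (h x) := by
          rw [a129, a120, bT]
          congr 1
          exact hash_congr (fun i _ => hT _) x
        have e165 : s₆.reg 165 = BitVec.ofNat w b := by
          rw [hf₆.reg _ rfl, hf₅.reg _ rfl, hf₄.reg _ rfl, hf₃.reg _ rfl, hib]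
        have e159 : s₆.reg 159 = _ :=
          ((hf₆.reg 159 rfl).trans (hf₅.reg 159 rfl)).trans j4
        have e162 : s₆.reg 162 = _ :=
          ((hf₆.reg 162 rfl).trans (hf₅.reg 162 rfl)).trans j5
        have e168 : s₆.reg 168 = BitVec.ofNat w (arranged X h b).length := by
          rw [hf₆.reg _ rfl, hf₅.reg _ rfl, hf₄.reg _ rfl, a168]
        have e120 : s₆.reg 120 = x := (hf₆.reg _ rfl).trans a120
        have eSrt : s₆.mem bSrt = s₄.mem bSrt := (hf₆.mem _ rfl).trans (hf₅.mem _ rfl)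
        have htest : (Test.eq 129 165).eval s₆ = decide (h x = b) :=
          eval_eq_ofNat e129 e165 ((hhR x).trans hRw) (hb.trans hRw)
        have htake : X.take (j + 1) = X.take j ++ [x] := by
          rw [List.take_succ_eq_append_getElem (by omega), hx,
            List.getD_eq_getElem X 0 (by omega)]
        have hxX : x ∈ X := by
          rw [hx,
            List.getD_eq_getElem X 0 (by omega)]
          exact List.getElem_mem _
        refine Det.ite (T := 9) ?_ ?_
        · intro ht
          rw [htest, decide_eq_true_eq] at ht
          have hp : part (j + 1) = part j ++ [x] := by
            simp only [hpart, htake, List.filter_append]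
            simp [ht]
          have hlen := hpart_len j
          refine Det.blk ?_
          simp only [execs, Instr.run, BinOp.eval, reg_setReg, mem_setReg, mem_setMem, reg_setMem]
          simp only [if_true, Nat.reduceEqDiff, if_false, e159, e168, e162, e120, eSrt,
            hE₆.parity.one, BitVec.ofNat_add_ofNat,
            ofNat_sub_of_le (show (arranged X h b).length ≤ (arranged X h b ++ part j).length by
              simp)]
          refine ⟨?_, ?_, ?_, ?_⟩
          · intro k hk
            rw [Function.update_apply]
            split_ifs
            · exact hxX
            · exact j1 k hk
          · intro k hk
            rw [hp, ← List.append_assoc, List.length_append, List.length_singleton] at hk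
            rw [Function.update_apply, hp, ← List.append_assoc]
            split_ifs with hkk
            · rw [(ofNat_inj_of_lt (by omega) (by omega)).1 hkk]
              rw [List.getD_append_right _ _ _ _ le_rfl]
              simp
            · have : k ≠ (arranged X h b ++ part j).length := fun e => hkk (by rw [e])
              rw [List.getD_append _ _ _ _ (by omega)]
              exact j2 k (by omega)
          · rw [hp, ← List.append_assoc, List.length_append (bs := [x]), List.length_singleton]
          · rw [hp, List.length_append (bs := [x]), List.length_singleton,
              Nat.choose_succ_succ' _ 1, Nat.choose_one_right, List.length_append]
            congr 1
            simp only [Nat.reduceAdd]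
            omega
        · intro ht
          rw [htest, decide_eq_false_iff_not] at ht
          have hp : part (j + 1) = part j := by
            simp only [hpart, htake, List.filter_append]
            simp [ht]
          refine (Det.skip ?_).le (by norm_num)
          rw [hp, e159, e162, eSrt]
          exact ⟨j1, j2, rfl, rfl⟩
      · rintro s₄ hf₄ ⟨j1, j2, j4, j5⟩
        have hp : arranged X h b ++ part P.n = arranged X h (b + 1) := by
          rw [arranged_succ, bucket, ← hX]
          simp only [hpart, List.take_length]
        have hp' : part P.n = bucket X h b := by
          rw [bucket, ← hX]
          simp only [hpart, List.take_length]
        rw [hp] at j2 j4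
        rw [hp', ← collisions_succ] at j5
        rw [hf₄.mem bStart rfl]
        exact ⟨j1, j2, i3', j4, j5⟩
  · rintro s₂ hf₂ ⟨i1, i2, i3, i4, i5⟩
    have hE₂ : Env P X s₂ := hE₁.frame hf₂ rfl rfl
    refine ((Det.blk (Q := fun s' => ∀ b ≤ P.R, s'.mem bStart (BitVec.ofNat w b) =
          BitVec.ofNat w (arranged X h b).length) ?_).seq
        (T₂ := 6) ?_).le (by simp)
    · intro b hb
      simp only [execs, Instr.run, mem_setMem, if_true, i4, hE₂.R, Function.update_apply]
      split_ifs with hbb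
      · rw [(ofNat_inj_of_lt (by omega) (by omega)).1 hbb]
      · exact i3 b (by
          have : b ≠ P.R := fun e => hbb (by rw [e])
          omega)
    intro s₃ hf₃ hstart
    have hE₃ : Env P X s₃ := hE₂.frame hf₃ rfl rfl
    have e162 : s₃.reg 162 = _ := (hf₃.reg 162 rfl).trans i5
    have e123 : s₃.reg 123 = BitVec.ofNat w (u * P.Z) := by
      rw [hf₃.reg _ rfl, hf₂.reg _ rfl, a123]
    have e90 : s₃.reg rFound = BitVec.ofNat w 0 := by
      rw [hf₃.reg _ rfl, hf₂.reg _ rfl, hf₁.reg _ rfl, h0]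
    have htest : (Test.lt rNM 162).eval s₃ = decide (P.n * P.m < collisions X h P.R) :=
      eval_lt_ofNat hE₃.nm e162 hP.nm (hcol _)
    have eSrt : s₃.mem bSrt = s₂.mem bSrt := hf₃.mem _ rfl
    refine Det.ite (T := 5) ?_ ?_
    · intro ht
      rw [htest, decide_eq_true_eq] at ht
      refine (Det.skip ?_).le (by norm_num)
      rw [eSrt]
      exact ⟨i1, Or.inl ⟨e90, ht⟩⟩
    · intro ht
      rw [htest, decide_eq_false_iff_not, not_lt] at ht
      refine Det.blk ?_
      simp only [execs, Instr.run, BinOp.eval, reg_setReg, mem_setReg]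
      simp only [if_true, Nat.reduceEqDiff, if_false, hE₃.parity.one, hE₃.parity.zero, e123,
        BitVec.ofNat_add_ofNat, add_zero, eSrt]
      refine ⟨i1, Or.inr ⟨trivial, trivial, ht, ?_, ?_⟩⟩
      · simp only [mem_setReg, eSrt]
        intro k hk
        exact i2 k (by rwa [length_arranged_eq hhR])
      · exact hstart

/-- Search for a hash function with few collisions. -/
def selectProg : Program :=
  blk [.const rFound 0] ;; forRange 156 rReps (.ite (.eq rFound rZero) arrangeProg .skip)

theorem selectProg_spec {P : Params} {X : List (BitVec w)} {s : State w} {T : ℕ → BitVec w}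
    (hP : P.Fits w) (hE : Env P X s) (hX : X.length = P.n)
    (hT : ∀ j, s.mem bTapeA (BitVec.ofNat w j) = T j)
    (hin : ∀ k < 2 * (P.R * P.m), s.mem bSrt (BitVec.ofNat w k) ∈ X) :
    Det selectProg s (P.L * (P.arrangeTime + 4) + 10) fun s' =>
      (∀ k < 2 * (P.R * P.m), s'.mem bSrt (BitVec.ofNat w k) ∈ X) ∧
      ((s'.reg rFound = BitVec.ofNat w 0 ∧
          ∀ u < P.L, P.n * P.m < collisions X (P.hashFn T P.r u) P.R) ∨
        ∃ u < P.L, s'.reg rFound = BitVec.ofNat w 1 ∧ s'.reg rBase = BitVec.ofNat w (u * P.Z) ∧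
          collisions X (P.hashFn T P.r u) P.R ≤ P.n * P.m ∧
          Arranged P X (P.hashFn T P.r u) s') := by
  have hLw : P.L < 2 ^ w := by
    have := hP.tape
    have : P.L * 1 ≤ P.L * P.Z := Nat.mul_le_mul_left _ (by simp only [Params.Z]; omega)
    omega
  refine ((Det.blk (Q := fun s' => s'.reg rFound = BitVec.ofNat w 0)
    (by simp [execs, Instr.run])).seq
    (T₂ := P.L * (P.arrangeTime + 4) + 3) ?_).le (by simp; omega)
  intro s₁ hf₁ a90
  have hE₁ : Env P X s₁ := hE.frame hf₁ rfl rfl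
  refine (Det.forRange (N := P.L) (fun _ => P.arrangeTime + 1) (fun t s' =>
      (∀ k < 2 * (P.R * P.m), s'.mem bSrt (BitVec.ofNat w k) ∈ X) ∧
      ((s'.reg rFound = BitVec.ofNat w 0 ∧
          ∀ u < t, P.n * P.m < collisions X (P.hashFn T P.r u) P.R) ∨
        ∃ u < P.L, s'.reg rFound = BitVec.ofNat w 1 ∧ s'.reg rBase = BitVec.ofNat w (u * P.Z) ∧
          collisions X (P.hashFn T P.r u) P.R ≤ P.n * P.m ∧
          Arranged P X (P.hashFn T P.r u) s')) hLw hE₁.L hE₁.parity.one rfl rfl rfl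
          ?_ ?_ ?_).le (by simp)
  · rintro t s v ⟨h1, h2⟩
    refine ⟨h1, h2.imp (fun h => by simpa using h) ?_⟩
    rintro ⟨u, hu, h3, h4, h5, h6⟩
    exact ⟨u, hu, by simpa using h3, by simpa using h4, h5, h6.srt, h6.start⟩
  · rw [hf₁.mem _ rfl]
    exact ⟨hin, Or.inl ⟨a90, fun u hu => absurd hu (Nat.not_lt_zero _)⟩⟩
  · rintro t ht s₂ hf₂ hit ⟨h1, h2⟩
    have hE₂ : Env P X s₂ := hE₁.frame hf₂ rfl rfl
    have h1w : 1 < 2 ^ w := Nat.one_lt_two_pow hP.w_pos.ne'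
    rcases h2 with ⟨h3, h4⟩ | ⟨u, hu, h3, h4, h5, h6⟩
    · have htest : (Test.eq rFound rZero).eval s₂ = decide (0 = 0) :=
        eval_eq_ofNat h3 hE₂.parity.zero (by omega) (by omega)
      refine Det.ite (fun _ => ?_) (fun h => by simp [htest] at h)
      have hT₂ : ∀ j, s₂.mem bTapeA (BitVec.ofNat w j) = T j := fun j => by
        rw [hf₂.mem _ rfl, hf₁.mem _ rfl, hT]
      refine (arrangeProg_spec hP hE₂ hX hT₂ hit h3 h1).mono le_rfl ?_
      rintro s₃ - ⟨k1, ⟨k2, k3⟩ | ⟨k2, k3, k4, k5⟩⟩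
      · refine ⟨k1, Or.inl ⟨k2, fun u hu => ?_⟩⟩
        rcases Nat.lt_succ_iff_lt_or_eq.1 hu with hu | rfl
        · exact h4 u hu
        · exact k3
      · exact ⟨k1, Or.inr ⟨t, ht, k2, k3, k4, k5⟩⟩
    · have htest : (Test.eq rFound rZero).eval s₂ = decide (1 = 0) :=
        eval_eq_ofNat h3 hE₂.parity.zero (by omega) (by omega)
      refine Det.ite (fun h => by simp [htest] at h) (fun _ => ?_)
      refine (Det.skip ?_).le (by simp only [Params.arrangeTime]; omega)
      exact ⟨h1, Or.inr ⟨u, hu, h3, h4, h5, h6⟩⟩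

/-! ### Enumerating the pairs of chunks that are tested -/

section Triples

variable (P : Params) (X : List (BitVec w)) (h : BitVec w → ℕ)

/-- The chunk in which bucket `b` starts. -/
def Params.firstChunk (b : ℕ) : ℕ := (arranged X h b).length / P.m

/-- The number of chunks attributed to bucket `b`. -/
def Params.numChunks (b : ℕ) : ℕ := P.firstChunk X h (b + 1) + 1 - P.firstChunk X h b

/-- The tests for the `i`-th word and the bucket `b`, for `e = i * R + b`: the word, a chunk of
bucket `b`, and a chunk of the bucket in which a partner of a member of bucket `b` must be. -/
def Params.triplesAt (e : ℕ) : List (BitVec w × ℕ × ℕ) :=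
  (List.range (P.numChunks X h (e % P.R))).flatMap fun i =>
    (List.range (P.numChunks X h (e % P.R ^^^ h (X.getD (e / P.R) 0)))).map fun j =>
      (X.getD (e / P.R) 0, P.firstChunk X h (e % P.R) + i,
        P.firstChunk X h (e % P.R ^^^ h (X.getD (e / P.R) 0)) + j)

/-- All tests. -/
def Params.triples : List (BitVec w × ℕ × ℕ) :=
  (List.range (P.n * P.R)).flatMap (P.triplesAt X h)

end Triples

section Tests
variable {P : Params} {X : List (BitVec w)} {h : BitVec w → ℕ}

theorem arranged_prefix {j k : ℕ} (hjk : j ≤ k) : arranged X h j <+: arranged X h k := by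
  induction k, hjk using Nat.le_induction with
  | base => exact List.prefix_refl _
  | succ k _ ih => exact ih.trans (by rw [arranged_succ]; exact List.prefix_append _ _)

theorem firstChunk_le_succ (b : ℕ) : P.firstChunk X h b ≤ P.firstChunk X h (b + 1) :=
  Nat.div_le_div_right (arranged_prefix (Nat.le_succ b)).length_le

theorem numChunks_pos (b : ℕ) : 0 < P.numChunks X h b := by
  have := firstChunk_le_succ (P := P) (X := X) (h := h) b
  simp only [Params.numChunks]; omega

theorem length_triplesAt (e : ℕ) : (P.triplesAt X h e).length =
    P.numChunks X h (e % P.R) * P.numChunks X h (e % P.R ^^^ h (X.getD (e / P.R) 0)) := by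
  simp [Params.triplesAt, List.length_flatMap]

theorem length_triples : (P.triples X h).length =
    ∑ e ∈ Finset.range (P.n * P.R), (P.triplesAt X h e).length := by
  rw [Params.triples, List.length_flatMap]
  induction P.n * P.R with
  | zero => rfl
  | succ N ih => rw [List.range_succ, List.map_append, List.sum_append, ih,
      Finset.sum_range_succ, List.map_singleton, List.sum_singleton]

theorem le_length_triples : P.n * P.R ≤ (P.triples X h).length := by
  rw [length_triples]
  calc P.n * P.R = ∑ e ∈ Finset.range (P.n * P.R), 1 := by simp
    _ ≤ _ := Finset.sum_le_sum fun e _ => by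
      rw [length_triplesAt]
      exact Nat.mul_pos (numChunks_pos _) (numChunks_pos _)

theorem numChunks_mul_le (b : ℕ) :
    P.numChunks X h b * P.m ≤ (bucket X h b).length + 2 * P.m := by
  have h1 := firstChunk_le_succ (P := P) (X := X) (h := h) b
  have h2 : P.firstChunk X h (b + 1) * P.m ≤ (arranged X h (b + 1)).length :=
    Nat.div_mul_le_self _ _
  have h3 : (arranged X h b).length < P.firstChunk X h b * P.m + P.m := by
    have := Nat.lt_div_mul_add (a := (arranged X h b).length) P.m_pos
    exact this
  rw [arranged_succ, List.length_append] at h2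
  have h4 : P.numChunks X h b * P.m + P.firstChunk X h b * P.m =
      P.firstChunk X h (b + 1) * P.m + P.m := by
    rw [← add_mul, Params.numChunks, Nat.sub_add_cancel (by omega), add_mul, one_mul]
  omega

theorem sum_length_bucket (k : ℕ) :
    ∑ b ∈ Finset.range k, (bucket X h b).length = (arranged X h k).length := by
  induction k with
  | zero => simp [arranged]
  | succ k ih => rw [Finset.sum_range_succ, ih, arranged_succ, List.length_append]

/-- A bucket of size `B` has at most `B / m + 2` chunks, and the sum of the `B ^ 2` is controlled
by the number of collisions. -/
theorem sum_numChunks_sq_le (hX : X.length = P.n) (hn : P.n ≤ P.R * P.m)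
    (hcol : collisions X h P.R ≤ P.n * P.m) :
    ∑ b ∈ Finset.range P.R, P.numChunks X h b ^ 2 ≤ 11 * P.R := by
  have hm := P.m_pos
  have hsize : ∑ b ∈ Finset.range P.R, (bucket X h b).length ≤ P.n := by
    rw [sum_length_bucket, ← hX]; exact length_arranged_le _ _ _
  have h1 : ∑ b ∈ Finset.range P.R, (P.numChunks X h b * P.m) ^ 2 ≤
      ∑ b ∈ Finset.range P.R, (2 * (bucket X h b).length.choose 2 +
        (4 * P.m + 1) * (bucket X h b).length + 4 * P.m ^ 2) := by
    refine Finset.sum_le_sum fun b _ => ?_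
    refine (Nat.pow_le_pow_left (numChunks_mul_le b) 2).trans (le_of_eq ?_)
    have : (bucket X h b).length ^ 2 =
        2 * (bucket X h b).length.choose 2 + (bucket X h b).length := by
      rw [Nat.choose_two_right, Nat.mul_div_cancel' (Nat.even_mul_pred_self _).two_dvd]
      cases (bucket X h b).length with
      | zero => rfl
      | succ c => simp; ring
    calc ((bucket X h b).length + 2 * P.m) ^ 2
        = (bucket X h b).length ^ 2 + 4 * P.m * (bucket X h b).length + 4 * P.m ^ 2 := by ring
      _ = _ := by rw [this]; ring
  rw [Finset.sum_add_distrib, Finset.sum_add_distrib, ← Finset.mul_sum, ← Finset.mul_sum,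
    Finset.sum_const, Finset.card_range, smul_eq_mul] at h1
  simp_rw [mul_pow] at h1
  rw [← Finset.sum_mul] at h1
  set S := ∑ b ∈ Finset.range P.R, P.numChunks X h b ^ 2
  change S * P.m ^ 2 ≤ 2 * collisions X h P.R + _ + _ at h1
  have h2 : (4 * P.m + 1) * ∑ b ∈ Finset.range P.R, (bucket X h b).length ≤ 5 * P.m * P.n :=
    Nat.mul_le_mul (by omega) hsize
  have h3 : P.n * P.m ≤ P.R * P.m * P.m := Nat.mul_le_mul_right _ hn
  have h4 : S * P.m ^ 2 ≤ 11 * P.R * P.m ^ 2 := by nlinarith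
  exact Nat.le_of_mul_le_mul_right h4 (by positivity)

theorem sum_xor_range (r c : ℕ) (hc : c < 2 ^ r) (f : ℕ → ℕ) :
    ∑ b ∈ Finset.range (2 ^ r), f (b ^^^ c) = ∑ b ∈ Finset.range (2 ^ r), f b := by
  refine Finset.sum_bij' (fun b _ => b ^^^ c) (fun b _ => b ^^^ c) ?_ ?_ ?_ ?_ ?_
  · intro b hb
    exact Finset.mem_range.2 (Nat.xor_lt_two_pow (Finset.mem_range.1 hb) hc)
  · intro b hb
    exact Finset.mem_range.2 (Nat.xor_lt_two_pow (Finset.mem_range.1 hb) hc)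
  · intro b _; simp
  · intro b _; simp
  · intro b _; rfl

/-- For each word, the buckets come in pairs `b`, `b ^^^ h c`, and the product of the numbers of
chunks of a pair is at most the average of their squares. -/
theorem length_triples_le (hX : X.length = P.n) (hn : P.n ≤ P.R * P.m) (hh : ∀ x, h x < P.R)
    (hcol : collisions X h P.R ≤ P.n * P.m) : (P.triples X h).length ≤ 11 * P.n * P.R := by
  rw [length_triples, mul_comm P.n P.R, sum_range_mul_eq]
  have key : ∀ i ∈ Finset.range P.n, ∑ b ∈ Finset.range P.R,
      (P.triplesAt X h (P.R * i + b)).length ≤ 11 * P.R := by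
    intro i _
    have h1 : ∀ b ∈ Finset.range P.R, 2 * (P.triplesAt X h (P.R * i + b)).length ≤
        P.numChunks X h b ^ 2 + P.numChunks X h (b ^^^ h (X.getD i 0)) ^ 2 := by
      intro b hb
      rw [length_triplesAt, Nat.mul_add_mod, Nat.mod_eq_of_lt (Finset.mem_range.1 hb),
        Nat.mul_add_div P.R_pos, Nat.div_eq_of_lt (Finset.mem_range.1 hb), add_zero]
      have := two_mul_le_add_sq (P.numChunks X h b) (P.numChunks X h (b ^^^ h (X.getD i 0)))
      rwa [mul_assoc] at this
    have h2 := Finset.sum_le_sum h1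
    rw [← Finset.mul_sum, Finset.sum_add_distrib,
      show ∑ b ∈ Finset.range P.R, P.numChunks X h (b ^^^ h (X.getD i 0)) ^ 2 = _ from
        sum_xor_range P.r _ (hh _) (fun b => P.numChunks X h b ^ 2)] at h2
    have := sum_numChunks_sq_le hX hn hcol
    change _ ≤ _ + ∑ b ∈ Finset.range P.R, P.numChunks X h b ^ 2 at h2
    omega
  refine (Finset.sum_le_sum key).trans (le_of_eq ?_)
  simp only [Finset.sum_const, Finset.card_range, smul_eq_mul]
  ring

/-- Every word occurs among the arranged words within the range of its bucket. -/
theorem exists_position {x : BitVec w} (hx : x ∈ X) (hxR : h x < P.R) :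
    ∃ k, (arranged X h (h x)).length ≤ k ∧ k < (arranged X h (h x + 1)).length ∧
      (arranged X h P.R).getD k 0 = x := by
  have hb : x ∈ bucket X h (h x) := by simp [bucket, hx]
  obtain ⟨i, hi, hix⟩ := List.getElem_of_mem hb
  refine ⟨(arranged X h (h x)).length + i, by omega, ?_, ?_⟩
  · rw [arranged_succ, List.length_append]; omega
  · obtain ⟨t, ht⟩ := arranged_prefix (X := X) (h := h) (Nat.succ_le_of_lt hxR)
    rw [← ht, Nat.succ_eq_add_one, arranged_succ, List.append_assoc,
      List.getD_append_right _ _ _ _ (by omega), Nat.add_sub_cancel_left,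
      List.getD_append _ _ _ _ hi, List.getD_eq_getElem _ _ hi, hix]

/-- If `a ^^^ b = c` for three of the words, then one of the tests asks for a chunk with `a`, a
chunk with `b`, and the word `c`. -/
theorem exists_triple (hX : X.length = P.n) (hh : ∀ x, h x < P.R)
    (hlin : ∀ x y, h (x ^^^ y) = h x ^^^ h y) {a b c : BitVec w} (ha : a ∈ X) (hb : b ∈ X)
    (hc : c ∈ X) (habc : a ^^^ b = c) :
    ∃ i j, (c, i, j) ∈ P.triples X h ∧
      (∃ k < P.m, i * P.m + k < X.length ∧ (arranged X h P.R).getD (i * P.m + k) 0 = a) ∧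
      (∃ k < P.m, j * P.m + k < X.length ∧ (arranged X h P.R).getD (j * P.m + k) 0 = b) := by
  have hpos : ∀ x ∈ X, ∃ i, P.firstChunk X h (h x) ≤ i ∧
      i < P.firstChunk X h (h x) + P.numChunks X h (h x) ∧ ∃ k < P.m, i * P.m + k < X.length ∧
        (arranged X h P.R).getD (i * P.m + k) 0 = x := by
    intro x hx
    obtain ⟨k, h1, h2, h3⟩ := exists_position (P := P) hx (hh x)
    refine ⟨k / P.m, Nat.div_le_div_right h1, ?_, k % P.m, Nat.mod_lt _ P.m_pos, ?_, ?_⟩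
    · have h4 : k / P.m ≤ P.firstChunk X h (h x + 1) := Nat.div_le_div_right h2.le
      have h5 := firstChunk_le_succ (P := P) (X := X) (h := h) (h x)
      simp only [Params.numChunks]
      omega
    · rw [Nat.div_add_mod']
      exact h2.trans_le (length_arranged_le _ _ _)
    · rw [Nat.div_add_mod', h3]
  obtain ⟨i, i1, i2, i3⟩ := hpos a ha
  obtain ⟨j, j1, j2, j3⟩ := hpos b hb
  obtain ⟨u, hu, huc⟩ := List.getElem_of_mem hc
  refine ⟨i, j, ?_, i3, j3⟩
  have hmod : (P.R * u + h a) % P.R = h a := by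
    rw [Nat.mul_add_mod, Nat.mod_eq_of_lt (hh a)]
  have hdiv : (P.R * u + h a) / P.R = u := by
    rw [Nat.mul_add_div P.R_pos, Nat.div_eq_of_lt (hh a), add_zero]
  have hgc : X.getD u 0 = c := by rw [List.getD_eq_getElem _ _ hu, huc]
  have hhb : h a ^^^ h c = h b := by
    rw [← habc, hlin, ← Nat.xor_assoc, Nat.xor_self, Nat.zero_xor]
  rw [Params.triples, List.mem_flatMap]
  refine ⟨P.R * u + h a, ?_, ?_⟩
  · rw [List.mem_range]
    have h1 : P.R * (u + 1) ≤ P.R * P.n := Nat.mul_le_mul_left _ (by omega)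
    have h2 := hh a
    rw [mul_add, mul_one] at h1
    rw [mul_comm P.n]
    omega
  · rw [Params.triplesAt, hmod, hdiv, hgc, hhb, List.mem_flatMap]
    refine ⟨i - P.firstChunk X h (h a), List.mem_range.2 (by omega), ?_⟩
    rw [List.mem_map]
    refine ⟨j - P.firstChunk X h (h b), List.mem_range.2 (by omega), ?_⟩
    rw [Nat.add_sub_cancel' i1, Nat.add_sub_cancel' j1]

theorem triples_bounds (hX : X.length = P.n) (hn : P.n ≤ P.R * P.m)
    {q : BitVec w × ℕ × ℕ} (hq : q ∈ P.triples X h) :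
    q.1 ∈ X ∧ q.2.1 < 2 * P.R ∧ q.2.2 < 2 * P.R := by
  have hfirst : ∀ b, P.firstChunk X h b ≤ P.R := fun b => by
    refine Nat.div_le_of_le_mul ?_
    rw [mul_comm]
    exact (length_arranged_le X h b).trans (hX ▸ hn)
  have hR := P.R_pos
  have hchunk : ∀ b i, i < P.numChunks X h b → P.firstChunk X h b + i < 2 * P.R := fun b i hi => by
    have := hfirst (b + 1)
    simp only [Params.numChunks] at hi
    omega
  rw [Params.triples, List.mem_flatMap] at hq
  obtain ⟨e, he, hq⟩ := hq
  rw [Params.triplesAt, List.mem_flatMap] at hq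
  obtain ⟨i, hi, hq⟩ := hq
  rw [List.mem_map] at hq
  obtain ⟨j, hj, rfl⟩ := hq
  refine ⟨?_, hchunk _ _ (List.mem_range.1 hi), hchunk _ _ (List.mem_range.1 hj)⟩
  have : e / P.R < X.length := by
    rw [hX, Nat.div_lt_iff_lt_mul P.R_pos]
    exact List.mem_range.1 he
  rw [List.getD_eq_getElem _ _ this]
  exact List.getElem_mem _

/-! ### The program for the enumeration -/

/-- The number of tests. -/
notation "rQ" => 96
/-- The bank of the words of the tests. -/
notation "bQC" => 15
/-- The bank of the first chunks of the tests. -/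
notation "bQI" => 18
/-- The bank of the second chunks of the tests. -/
notation "bQJ" => 21

/-- List the tests. -/
def enumProg : Program :=
  blk [.const rQ 0, .op .add 123 rBase rZero, .op .add 126 rR rZero] ;;
  forRange 150 rNR (
    blk [.op .shr 153 150 rLgR, .load 120 bX 153, .op .and 156 150 rMaskR] ;;
    hashProg bTapeA ;;
    blk [.op .xor 159 156 129,
      .load 162 bStart 156, .op .shr 162 162 rLgM,
      .op .add 165 156 rOne, .load 165 bStart 165, .op .shr 165 165 rLgM, .op .add 165 165 rOne,
      .load 168 bStart 159, .op .shr 168 168 rLgM,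
      .op .add 171 159 rOne, .load 171 bStart 171, .op .shr 171 171 rLgM,
      .op .add 171 171 rOne] ;;
    forUp 162 165 (
      blk [.op .add 174 168 rZero] ;;
      forUp 174 171 (blk [.store bQC rQ 120, .store bQI rQ 162, .store bQJ rQ 174,
        .op .add rQ rQ rOne])))

/-- The tests `qs` are stored in their banks. -/
structure Stored (qs : List (BitVec w × ℕ × ℕ)) (s : State w) : Prop where
  length : s.reg rQ = BitVec.ofNat w qs.length
  get : ∀ k, ∀ hk : k < qs.length, s.mem bQC (BitVec.ofNat w k) = qs[k].1 ∧
    s.mem bQI (BitVec.ofNat w k) = BitVec.ofNat w qs[k].2.1 ∧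
    s.mem bQJ (BitVec.ofNat w k) = BitVec.ofNat w qs[k].2.2

theorem Stored.congr {qs : List (BitVec w × ℕ × ℕ)} {s s' : State w} (hs : Stored qs s)
    (hr : s'.reg rQ = s.reg rQ) (h1 : s'.mem bQC = s.mem bQC) (h2 : s'.mem bQI = s.mem bQI)
    (h3 : s'.mem bQJ = s.mem bQJ) : Stored qs s' :=
  ⟨hr.trans hs.length, by rw [h1, h2, h3]; exact hs.get⟩

theorem ofNat_shr {a c : ℕ} (ha : a < 2 ^ w) (hc : c < 2 ^ w) :
    BitVec.ofNat w a >>> (BitVec.ofNat w c).toNat = BitVec.ofNat w (a / 2 ^ c) := by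
  refine BitVec.eq_of_toNat_eq ?_
  rw [toNat_ofNat_of_lt hc, BitVec.toNat_ushiftRight, toNat_ofNat_of_lt ha,
    Nat.shiftRight_eq_div_pow, toNat_ofNat_of_lt ((Nat.div_le_self _ _).trans_lt ha)]

theorem length_flatMap_range_le {α : Type*} (f : ℕ → List α) {e N : ℕ} (he : e ≤ N) :
    ((List.range e).flatMap f).length ≤ ((List.range N).flatMap f).length := by
  obtain ⟨d, rfl⟩ := Nat.exists_eq_add_of_le he
  rw [List.range_add, List.flatMap_append, List.length_append]
  omega

theorem enumProg_spec {s : State w} {T : ℕ → BitVec w} {u : ℕ} (hP : P.Fits w) (hE : Env P X s)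
    (hX : X.length = P.n) (hT : ∀ j, s.mem bTapeA (BitVec.ofNat w j) = T j)
    (hbase : s.reg rBase = BitVec.ofNat w (u * P.Z))
    (hcol : collisions X (P.hashFn T P.r u) P.R ≤ P.n * P.m)
    (harr : Arranged P X (P.hashFn T P.r u) s) :
    Det enumProg s (P.n * P.R * (hashTime P.g P.r + 50) +
      30 * (P.triples X (P.hashFn T P.r u)).length + 20)
      (Stored (P.triples X (P.hashFn T P.r u))) := by
  set h := P.hashFn T P.r u with hh
  have hhR : ∀ x, h x < P.R := fun x => hash_lt _ _ _
  have hc := hP.cells_lt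
  have hn := hP.two_le_n
  have hnw := hP.n_lt
  have hR := P.R_pos
  have hRw : P.R + 1 < 2 ^ w := by
    have := Nat.le_mul_of_pos_right P.R P.m_pos
    omega
  have hL : 1 ≤ P.L := by have := hP.l_pos; simp only [Params.L]; omega
  have htot : (P.triples X h).length < 2 ^ w := by
    refine (length_triples_le hX hP.n_le hhR hcol).trans_lt (lt_of_le_of_lt ?_ hP.queries)
    exact Nat.le_mul_of_pos_right _ hL
  have hnRw : P.n * P.R < 2 ^ w := le_length_triples.trans_lt htot
  have hfirst : ∀ b, P.firstChunk X h b ≤ P.R := fun b => by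
    refine Nat.div_le_of_le_mul ?_
    rw [mul_comm]
    exact (length_arranged_le X h b).trans (hX ▸ hP.n_le)
  have hlen : ∀ b, (arranged X h b).length < 2 ^ w := fun b =>
    (length_arranged_le X h b).trans_lt (hX ▸ hnw)
  have hrw : P.r < 2 ^ w := by have := hP.shift; omega
  have hsw : P.s < 2 ^ w := by have := hP.shift; omega
  refine ((Det.blk (Q := fun s' => s'.reg rQ = BitVec.ofNat w 0 ∧
    s'.reg 123 = BitVec.ofNat w (u * P.Z) ∧ s'.reg 126 = BitVec.ofNat w P.R) ?_).seq
    (T₂ := P.n * P.R * (hashTime P.g P.r + 50) + 30 * (P.triples X h).length + 3) ?_).le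
    (by simp; omega)
  · simp [execs, Instr.run, BinOp.eval, hE.R, hE.parity.zero, hbase]
  rintro s₁ hf₁ ⟨a96, a123, a126⟩
  have hE₁ : Env P X s₁ := hE.frame hf₁ rfl rfl
  refine (Det.forRange (N := P.n * P.R)
    (fun e => hashTime P.g P.r + 47 + 30 * (P.triplesAt X h e).length)
    (fun e => Stored ((List.range e).flatMap (P.triplesAt X h))) hnRw hE₁.nR hE₁.parity.one rfl rfl
    rfl (fun j s v hs => hs.congr (by simp) rfl rfl rfl) ⟨by simpa using a96, by simp⟩ ?_).mono ?_
    (fun _ _ hs => hs)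
  · intro e he s₂ hf₂ hie hst
    have hE₂ : Env P X s₂ := hE₁.frame hf₂ rfl rfl
    set i := e / P.R with hi
    set b := e % P.R with hb
    set x := X.getD i 0 with hx
    have hiX : i < X.length := by
      rw [hX, hi, Nat.div_lt_iff_lt_mul hR]; exact he
    have hbR : b < P.R := Nat.mod_lt _ hR
    refine ((Det.blk (Q := fun s' => s'.reg 120 = x ∧ s'.reg 156 = BitVec.ofNat w b) ?_).seq
      (T₂ := hashTime P.g P.r + 39 + 30 * (P.triplesAt X h e).length) ?_).le (by simp; omega)
    · simp only [execs, Instr.run, BinOp.eval, reg_setReg, mem_setReg]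
      simp only [if_true, Nat.reduceEqDiff, if_false, hie, hE₂.lgR, hE₂.maskR,
        ofNat_shr (he.trans hnRw) hrw, ← BitVec.ofNat_and, Nat.and_two_pow_sub_one_eq_mod]
      refine ⟨?_, rfl⟩
      change s₂.mem bX (BitVec.ofNat w i) = x
      exact hE₂.input i hiX
    rintro s₃ hf₃ ⟨a120, a156⟩
    have hE₃ : Env P X s₃ := hE₂.frame hf₃ rfl rfl
    have b123 : s₃.reg 123 = BitVec.ofNat w (u * P.Z) := by
      rw [hf₃.reg _ rfl, hf₂.reg _ rfl, a123]
    have b126 : s₃.reg 126 = BitVec.ofNat w (2 ^ P.r) := by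
      rw [hf₃.reg _ rfl, hf₂.reg _ rfl, a126]; rfl
    have bT : s₃.mem bTapeA = s.mem bTapeA := by
      rw [hf₃.mem _ rfl, hf₂.mem _ rfl, hf₁.mem _ rfl]
    refine ((hashProg_spec hE₃.parity b126 (by change P.R < _; omega) b123).seq
      (T₂ := 38 + 30 * (P.triplesAt X h e).length) ?_).le (by omega)
    intro s₄ hf₄ a129
    have hE₄ : Env P X s₄ := hE₃.frame hf₄ rfl rfl
    have e129 : s₄.reg 129 = BitVec.ofNat w (h x) := by
      rw [a129, a120, bT]
      congr 1
      exact hash_congr (fun i _ => hT _) x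
    have e156 : s₄.reg 156 = BitVec.ofNat w b := (hf₄.reg _ rfl).trans a156
    set b₂ := b ^^^ h x with hb₂
    have hb₂R : b₂ < P.R := Nat.xor_lt_two_pow hbR (hhR x)
    have hstart : ∀ b ≤ P.R, s₄.mem bStart (BitVec.ofNat w b) =
        BitVec.ofNat w (arranged X h b).length := by
      rw [hf₄.mem _ rfl, hf₃.mem _ rfl, hf₂.mem _ rfl, hf₁.mem _ rfl]
      exact harr.start
    refine ((Det.blk (Q := fun s' => s'.reg 162 = BitVec.ofNat w (P.firstChunk X h b) ∧
      s'.reg 165 = BitVec.ofNat w (P.firstChunk X h b + P.numChunks X h b) ∧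
      s'.reg 168 = BitVec.ofNat w (P.firstChunk X h b₂) ∧
      s'.reg 171 = BitVec.ofNat w (P.firstChunk X h b₂ + P.numChunks X h b₂)) ?_).seq
      (T₂ := 9 + 30 * (P.triplesAt X h e).length) ?_).le (by simp; omega)
    · have hend : ∀ b, P.firstChunk X h b + P.numChunks X h b = P.firstChunk X h (b + 1) + 1 := by
        intro b
        have := firstChunk_le_succ (P := P) (X := X) (h := h) b
        simp only [Params.numChunks]; omega
      simp only [execs, Instr.run, BinOp.eval, reg_setReg, mem_setReg]
      simp only [if_true, Nat.reduceEqDiff, if_false, e129, e156, ← BitVec.ofNat_xor, ← hb₂,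
        hE₄.parity.one, BitVec.ofNat_add_ofNat, hstart b hbR.le, hstart (b + 1) hbR,
        hstart b₂ hb₂R.le,
        hstart (b₂ + 1) hb₂R, hE₄.lgM, ofNat_shr (hlen _) hsw, hend]
      exact ⟨rfl, rfl, rfl, rfl⟩
    rintro s₅ hf₅ ⟨a162, a165, a168, a171⟩
    have hE₅ : Env P X s₅ := hE₄.frame hf₅ rfl rfl
    have a120' : s₅.reg 120 = x := by rw [hf₅.reg _ rfl, hf₄.reg _ rfl, a120]
    set B := (List.range e).flatMap (P.triplesAt X h) with hB
    have hst₅ : Stored B s₅ := hst.congr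
      (by rw [hf₅.reg _ rfl, hf₄.reg _ rfl, hf₃.reg _ rfl])
      (by rw [hf₅.mem _ rfl, hf₄.mem _ rfl, hf₃.mem _ rfl])
      (by rw [hf₅.mem _ rfl, hf₄.mem _ rfl, hf₃.mem _ rfl])
      (by rw [hf₅.mem _ rfl, hf₄.mem _ rfl, hf₃.mem _ rfl])
    set N := P.numChunks X h b with hN
    set M := P.numChunks X h b₂ with hM
    have hbd : ∀ b, P.firstChunk X h b + P.numChunks X h b < 2 ^ w := fun b => by
      have h1 := firstChunk_le_succ (P := P) (X := X) (h := h) b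
      have h2 := hfirst (b + 1)
      simp only [Params.numChunks]; omega
    set row : ℕ → ℕ → List (BitVec w × ℕ × ℕ) := fun i' k =>
      (List.range k).map fun j' => (x, P.firstChunk X h b + i', P.firstChunk X h b₂ + j') with hrow
    have htrip : P.triplesAt X h e = (List.range N).flatMap (fun i' => row i' M) := rfl
    have hlenB : B.length + N * M ≤ (P.triples X h).length := by
      have h1 := length_flatMap_range_le (P.triplesAt X h) (show e + 1 ≤ P.n * P.R from he)
      rw [List.range_succ, List.flatMap_append, List.length_append] at h1
      simp only [List.flatMap_cons, List.flatMap_nil, List.append_nil] at h1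
      rw [length_triplesAt] at h1
      exact h1
    have hlenN : ∀ k, ((List.range k).flatMap (fun i' => row i' M)).length = k * M := by
      intro k; simp [hrow, List.length_flatMap]
    refine (Det.forUp (N := N) (fun _ => 13 + 12 * M) (fun k => Stored (B ++
      (List.range k).flatMap (fun i' => row i' M))) (hbd b) a162 a165 hE₅.parity.one rfl rfl rfl
      (fun j s v hs => hs.congr (by simp) rfl rfl rfl) (by simpa using hst₅) ?_).mono ?_ ?_
    · intro k hk s₆ hf₆ hik hst₆
      have hE₆ : Env P X s₆ := hE₅.frame hf₆ rfl rfl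
      refine ((Det.blk (Q := fun s' => s'.reg 174 = BitVec.ofNat w (P.firstChunk X h b₂)) ?_).seq
        (T₂ := 9 + 12 * M) ?_).le (by simp; omega)
      · simp [execs, Instr.run, BinOp.eval, hf₆.reg 168 rfl, a168, hE₆.parity.zero]
      intro s₇ hf₇ a174
      have hE₇ : Env P X s₇ := hE₆.frame hf₇ rfl rfl
      have c171 : s₇.reg 171 = _ := ((hf₇.reg _ rfl).trans (hf₆.reg _ rfl)).trans a171
      have c120 : s₇.reg 120 = x := ((hf₇.reg _ rfl).trans (hf₆.reg _ rfl)).trans a120'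
      have c162 : s₇.reg 162 = _ := (hf₇.reg _ rfl).trans hik
      refine (Det.forUp (N := M) (fun _ => 9) (fun l => Stored (B ++
        (List.range k).flatMap (fun i' => row i' M) ++ row k l)) (hbd b₂) a174 c171 hE₇.parity.one
        rfl rfl rfl (fun j s v hs => hs.congr (by simp) rfl rfl rfl) ?_ ?_).mono ?_ ?_
      · have : row k 0 = [] := rfl
        rw [this, List.append_nil]
        exact hst₆.congr (hf₇.reg _ rfl) (hf₇.mem _ rfl) (hf₇.mem _ rfl) (hf₇.mem _ rfl)
      · intro l hl s₈ hf₈ hil hst₈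
        have d120 : s₈.reg 120 = x := (hf₈.reg _ rfl).trans c120
        have d162 : s₈.reg 162 = _ := (hf₈.reg _ rfl).trans c162
        have d6 := (hf₈.reg rOne rfl).trans hE₇.parity.one
        have hrl : row k (l + 1) = row k l ++
            [(x, P.firstChunk X h b + k, P.firstChunk X h b₂ + l)] := by
          simp [hrow, List.range_succ]
        set D := B ++ (List.range k).flatMap (fun i' => row i' M) ++ row k l with hD
        have hDlen : D.length + 1 ≤ (P.triples X h).length := by
          have h1 : D.length = B.length + k * M + l := by
            rw [hD, List.length_append, List.length_append, hlenN]
            simp [hrow]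
          have h2 : (k + 1) * M ≤ N * M := Nat.mul_le_mul_right _ hk
          rw [add_mul, one_mul] at h2
          omega
        refine Det.blk ?_
        rw [hrl, ← List.append_assoc, ← hD]
        constructor
        · simp only [execs, Instr.run, BinOp.eval, reg_setReg, reg_setMem, if_true, d6, hst₈.length,
            BitVec.ofNat_add_ofNat, List.length_append, List.length_singleton]
        · intro j hj
          rw [List.length_append, List.length_singleton] at hj
          simp only [execs, Instr.run, BinOp.eval, reg_setMem, mem_setReg, mem_setMem]
          simp only [if_true, Nat.reduceEqDiff, if_false, hst₈.length, d120, d162, hil,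
            Function.update_apply, ofNat_inj_of_lt (show j < 2 ^ w by omega)
              (show D.length < 2 ^ w by omega)]
          by_cases hjD : j = D.length
          · subst hjD
            simp
          · simp only [if_neg hjD, List.getElem_append_left (show j < D.length by omega)]
            exact hst₈.get j (by omega)
      · simp only [Finset.sum_const, Finset.card_range, smul_eq_mul]
        omega
      · intro s₈ hf₈ hst₈
        have : B ++ (List.range (k + 1)).flatMap (fun i' => row i' M) =
            B ++ (List.range k).flatMap (fun i' => row i' M) ++ row k M := by
          simp [List.range_succ, List.append_assoc]
        rw [this]
        exact hst₈
    · have hNM : N ≤ N * M := Nat.le_mul_of_pos_right _ (numChunks_pos _)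
      have hat : (P.triplesAt X h e).length = N * M := length_triplesAt e
      simp only [Finset.sum_const, Finset.card_range, smul_eq_mul, hat]
      have : N * (13 + 12 * M + 3) = 16 * N + 12 * (N * M) := by ring
      omega
    · intro s₆ hf₆ hst₆
      have : (List.range (e + 1)).flatMap (P.triplesAt X h) = B ++ P.triplesAt X h e := by
        simp [List.range_succ, hB]
      rw [this, htrip]
      exact hst₆
  · rw [length_triples, Finset.mul_sum, Finset.sum_add_distrib, Finset.sum_add_distrib]
    simp only [Finset.sum_const, Finset.card_range, smul_eq_mul]
    rw [mul_add, mul_add]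
    omega

end Tests

/-! ### The two families of sets -/

/-- The distinct values among `a 0, …, a (k - 1)`, in the order of their first occurrences. -/
def distinct (a : ℕ → ℕ) : ℕ → List ℕ
  | 0 => []
  | k + 1 => if a k ∈ distinct a k then distinct a k else distinct a k ++ [a k]

theorem mem_distinct {a : ℕ → ℕ} {k x : ℕ} : x ∈ distinct a k ↔ ∃ j < k, a j = x := by
  induction k with
  | zero => simp [distinct]
  | succ k ih =>
    have h1 : x ∈ distinct a (k + 1) ↔ x ∈ distinct a k ∨ x = a k := by
      simp only [distinct]
      split_ifs with h
      · exact ⟨Or.inl, fun h' => h'.elim id (fun h'' => h'' ▸ h)⟩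
      · simp
    rw [h1, ih]
    constructor
    · rintro (⟨j, hj, rfl⟩ | rfl)
      · exact ⟨j, by omega, rfl⟩
      · exact ⟨k, by omega, rfl⟩
    · rintro ⟨j, hj, rfl⟩
      rcases Nat.lt_succ_iff_lt_or_eq.1 hj with hj | rfl
      · exact Or.inl ⟨j, hj, rfl⟩
      · exact Or.inr rfl

theorem nodup_distinct (a : ℕ → ℕ) (k : ℕ) : (distinct a k).Nodup := by
  induction k with
  | zero => exact List.nodup_nil
  | succ k ih =>
    simp only [distinct]
    split_ifs with h
    · exact ih
    · exact List.Nodup.append ih (List.nodup_singleton _) (by simpa using h)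

theorem length_distinct_le (a : ℕ → ℕ) (k : ℕ) : (distinct a k).length ≤ k := by
  induction k with
  | zero => exact le_rfl
  | succ k ih =>
    simp only [distinct]
    split_ifs with h
    · omega
    · rw [List.length_append, List.length_singleton]; omega

section Families
variable (P : Params) (S T : ℕ → BitVec w)

/-- The elements of the set number `e` of a family, with repetitions. The number `e` encodes a hash
function, a chunk, and a shift `u`, and the elements are the hash values of the members of the chunk
(`S` being the arranged words), shifted by `u * f`. -/
def Params.element (f e k : ℕ) : ℕ :=
  P.hashFn T (2 * P.s + 2) (e / 2 ^ (P.s + 1 + P.r + 1))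
    (S (e / 2 ^ (P.s + 1) % 2 ^ (P.r + 1) * P.m + k)) ^^^ (e % 2 ^ (P.s + 1) * f)

/-- The first `N` sets of a family. -/
def Params.family (f N : ℕ) : List (List ℕ) :=
  (List.range N).map fun e => distinct (P.element S T f e) P.m

end Families

section FamilyProgram
variable {P : Params} {S T : ℕ → BitVec w}

theorem element_lt {f : ℕ} (hf : f ≤ 2 ^ (P.s + 1)) (e k : ℕ) :
    P.element S T f e k < 2 ^ (2 * P.s + 2) := by
  refine Nat.xor_lt_two_pow (hash_lt _ _ _) ?_
  calc e % 2 ^ (P.s + 1) * f ≤ e % 2 ^ (P.s + 1) * 2 ^ (P.s + 1) := Nat.mul_le_mul_left _ hf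
    _ < 2 ^ (P.s + 1) * 2 ^ (P.s + 1) :=
      Nat.mul_lt_mul_of_pos_right (Nat.mod_lt _ (by positivity)) (by positivity)
    _ = 2 ^ (2 * P.s + 2) := by rw [← pow_add]; congr 1; ring

theorem length_family (f N : ℕ) : (P.family S T f N).length = N := by simp [Params.family]

theorem family_succ (f N : ℕ) : P.family S T f (N + 1) =
    P.family S T f N ++ [distinct (P.element S T f N) P.m] := by
  simp [Params.family, List.range_succ]

theorem length_flatten_family_le (f N : ℕ) : (P.family S T f N).flatten.length ≤ N * P.m := by
  induction N with
  | zero => simp [Params.family]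
  | succ N ih =>
    rw [family_succ, List.flatten_append, List.length_append, add_mul, one_mul]
    have := length_distinct_le (P.element S T f N) P.m
    simp only [List.flatten_cons, List.flatten_nil, List.append_nil]
    omega

theorem offsets_append (F : List (List ℕ)) (D : List ℕ) :
    SetDisjInstance.offsets (F ++ [D]) =
      SetDisjInstance.offsets F ++ [F.flatten.length + D.length] := by
  simp only [SetDisjInstance.offsets, List.length_append, List.length_singleton]
  rw [List.range_succ, List.map_append]
  congr 1
  · refine List.map_congr_left fun i hi => ?_
    rw [List.take_append_of_le_length (by have := List.mem_range.1 hi; omega)]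
  · simp [List.take_of_length_le]

theorem length_offsets (F : List (List ℕ)) :
    (SetDisjInstance.offsets F).length = F.length + 1 := by
  simp [SetDisjInstance.offsets]

theorem update_bank {l : List ℕ} (h : l.length < 2 ^ w) (v : ℕ) :
    Function.update (bank l) (BitVec.ofNat w l.length) (BitVec.ofNat w v) = bank (l ++ [v]) := by
  funext a
  rw [Function.update_apply]
  by_cases ha : a = BitVec.ofNat w l.length
  · subst ha
    simp only [if_true, bank]
    rw [toNat_ofNat_of_lt h, List.getD_append_right _ _ _ _ le_rfl]
    simp
  · have hne : a.toNat ≠ l.length := fun h' => ha (by rw [← h']; simp)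
    simp only [if_neg ha, bank]
    congr 1
    rcases lt_or_gt_of_ne hne with h1 | h1
    · rw [List.getD_append _ _ _ _ h1]
    · rw [List.getD_eq_default _ _ (by omega), List.getD_eq_default _ _ (by simp; omega)]

/-- The register with the factor of the shift, for the family `A` (`c = true`) or `B`
(`c = false`). -/
def regShift (c : Bool) : ℕ := cond c rTwoM rOne
/-- The bank of the offsets of the family: bank `0` or `2` of copy `1`. -/
def bankOff (c : Bool) : ℕ := cond c 1 7
/-- The bank of the elements of the family: bank `1` or `3` of copy `1`. -/
def bankElt (c : Bool) : ℕ := cond c 4 10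
/-- The bank of the marks for the family. -/
def bankMark (c : Bool) : ℕ := cond c 24 27

/-- Write down a family. A repeated element is recognized by its mark, the number of the set in
which it occurred last. -/
def familyProg (c : Bool) : Program :=
  blk [.const 147 0, .op .add 126 rC rZero] ;;
  forRange 153 rFam (
    blk [.op .and 156 153 rMaskU, .op .mul 156 156 (regShift c), .op .shr 159 153 rShU,
      .op .and 159 159 rMaskI, .op .mul 159 159 rM, .op .shr 162 153 rShT,
      .op .mul 123 162 rStride, .op .add 165 153 rOne] ;;
    forRange 168 rM (
      blk [.op .add 171 159 168, .load 120 bSrt 171] ;; hashProg bTapeB ;;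
      blk [.op .xor 174 129 156, .load 177 (bankMark c) 174] ;;
      .ite (.eq 177 165) .skip
        (blk [.store (bankMark c) 174 165, .store (bankElt c) 147 174,
          .op .add 147 147 rOne])) ;;
    blk [.store (bankOff c) 165 147])

/-- A bound on the time of writing down a family. -/
def Params.familyTime (P : Params) : ℕ :=
  P.fam * (P.m * (hashTime P.g (2 * P.s + 2) + 24) + 30) + 20

theorem familyProg_spec {X : List (BitVec w)} {s : State w} (c : Bool) (hP : P.Fits w)
    (hE : Env P X s) (hT : ∀ j, s.mem bTapeB (BitVec.ofNat w j) = T j)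
    (hS : ∀ j, s.mem bSrt (BitVec.ofNat w j) = S j) (hoff : s.mem (bankOff c) = bank [])
    (helt : s.mem (bankElt c) = bank []) (hmark : s.mem (bankMark c) = bank []) :
    Det (familyProg c) s P.familyTime fun s' =>
      s'.mem (bankOff c) = bank (SetDisjInstance.offsets
        (P.family S T (cond c (2 ^ (P.s + 1)) 1) P.fam)) ∧
      s'.mem (bankElt c) = bank (P.family S T (cond c (2 ^ (P.s + 1)) 1) P.fam).flatten := by
  set f := cond c (2 ^ (P.s + 1)) 1 with hf
  set F := P.family S T f with hF
  have hfle : f ≤ 2 ^ (P.s + 1) := by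
    cases c
    · exact Nat.one_le_two_pow
    · exact le_rfl
  have hfam := hP.fam_lt
  have hCw : 2 ^ (2 * P.s + 2) < 2 ^ w := by
    have := hP.univ
    have h4 : 2 ^ (2 * P.s + 2) = 4 * (P.m * P.m) := by simp only [Params.m]; ring
    omega
  have hshift := hP.shift
  have hm1 := P.m_pos
  have hmw : P.m < 2 ^ w := by
    have h1 := hP.cells_lt
    have := Nat.le_mul_of_pos_left P.m P.R_pos
    omega
  refine ((Det.blk (Q := fun s' => s'.reg 147 = BitVec.ofNat w 0 ∧
    s'.reg 126 = BitVec.ofNat w (2 ^ (2 * P.s + 2))) ?_).seq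
    (T₂ := P.fam * (P.m * (hashTime P.g (2 * P.s + 2) + 24) + 30) + 3) ?_).le
    (by simp [Params.familyTime]; omega)
  · simp [execs, Instr.run, BinOp.eval, hE.C, hE.parity.zero]
  rintro s₁ hf₁ ⟨a147, a126⟩
  have hE₁ : Env P X s₁ := hE.frame hf₁ rfl rfl
  refine (Det.forRange (N := P.fam)
    (fun _ => P.m * (hashTime P.g (2 * P.s + 2) + 24) + 27)
    (fun e s' => s'.reg 147 = BitVec.ofNat w (F e).flatten.length ∧
      s'.mem (bankOff c) = bank (SetDisjInstance.offsets (F e)) ∧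
      s'.mem (bankElt c) = bank (F e).flatten ∧
      ∀ x, (s'.mem (bankMark c) x).toNat ≤ e)
    (by omega) hE₁.fam hE₁.parity.one rfl rfl rfl ?_ ?_ ?_).mono ?_ ?_
  · rintro j s v ⟨h1, h2⟩
    exact ⟨by simpa using h1, h2⟩
  · refine ⟨by simpa [hF, Params.family] using a147, ?_, ?_, ?_⟩
    · rw [hf₁.mem _ rfl, hoff]
      funext a
      by_cases ha : a.toNat = 0
      · simp [bank, SetDisjInstance.offsets, hF, Params.family, ha]
      · simp only [bank, SetDisjInstance.offsets, hF, Params.family, List.getD_nil]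
        rw [List.getD_eq_default _ _ (by simp; omega)]
    · rw [hf₁.mem _ rfl, helt]
      rfl
    · intro x
      rw [hf₁.mem _ rfl, hmark]
      simp [bank]
  · rintro e he s₂ hf₂ hie ⟨i147, ioff, ielt, imark⟩
    have hE₂ : Env P X s₂ := hE₁.frame hf₂ (by cases c <;> rfl) (by cases c <;> rfl)
    have hshiftReg : s₂.reg (regShift c) = BitVec.ofNat w f := by
      cases c
      · exact hE₂.parity.one
      · exact hE₂.twoM
    set i := e / 2 ^ (P.s + 1) % 2 ^ (P.r + 1) with hi
    set t := e / 2 ^ (P.s + 1 + P.r + 1) with ht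
    set u := e % 2 ^ (P.s + 1) with hu
    refine ((Det.blk (Q := fun s' => s'.reg 156 = BitVec.ofNat w (u * f) ∧
      s'.reg 159 = BitVec.ofNat w (i * P.m) ∧ s'.reg 123 = BitVec.ofNat w (t * P.Z) ∧
      s'.reg 165 = BitVec.ofNat w (e + 1)) ?_).seq
      (T₂ := P.m * (hashTime P.g (2 * P.s + 2) + 24) + 9) ?_).le (by simp; omega)
    · have hne : regShift c ≠ 156 := by cases c <;> simp [regShift]
      simp only [execs, Instr.run, BinOp.eval, reg_setReg]
      simp only [if_true, Nat.reduceEqDiff, if_false, hie, hE₂.maskU, hne, hshiftReg, hE₂.shU,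
        hE₂.maskI, hE₂.m, hE₂.shT, hE₂.Z, hE₂.parity.one,
        ofNat_shr (show e < 2 ^ w by omega) (show P.s + 1 < 2 ^ w by omega),
        ofNat_shr (show e < 2 ^ w by omega) (show P.s + 1 + P.r + 1 < 2 ^ w by omega),
        ← BitVec.ofNat_and, Nat.and_two_pow_sub_one_eq_mod,
        BitVec.ofNat_mul_ofNat, BitVec.ofNat_add_ofNat]
      exact ⟨rfl, rfl, rfl, trivial⟩
    rintro s₃ hf₃ ⟨a156, a159, a123, a165⟩
    have hE₃ : Env P X s₃ := hE₂.frame hf₃ rfl rfl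
    set a := P.element S T f e with ha
    have b147 : s₃.reg 147 = BitVec.ofNat w (F e).flatten.length := by rw [hf₃.reg _ rfl, i147]
    have b126 : s₃.reg 126 = BitVec.ofNat w (2 ^ (2 * P.s + 2)) := by
      rw [hf₃.reg _ rfl, hf₂.reg _ rfl, a126]
    have hlen := length_flatten_family_le (P := P) (S := S) (T := T) f e
    change (F e).flatten.length ≤ e * P.m at hlen
    have hlen' : e * P.m + P.m ≤ P.fam * P.m := by
      calc e * P.m + P.m = (e + 1) * P.m := by ring
        _ ≤ P.fam * P.m := Nat.mul_le_mul_right _ he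
    have hflat := hP.flat
    refine (Det.seq (T₁ := P.m * (hashTime P.g (2 * P.s + 2) + 24) + 3) (T₂ := 3)
      (Q := fun s' => s'.reg 147 = BitVec.ofNat w ((F e).flatten ++ distinct a P.m).length ∧
        s'.mem (bankElt c) = bank ((F e).flatten ++ distinct a P.m) ∧
        ∀ x, (s'.mem (bankMark c) x).toNat ≤ e + 1) ?_ ?_).le (by omega)
    · refine (Det.forRange (N := P.m) (fun _ => hashTime P.g (2 * P.s + 2) + 21)
        (fun k s' => s'.reg 147 = BitVec.ofNat w ((F e).flatten ++ distinct a k).length ∧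
          s'.mem (bankElt c) = bank ((F e).flatten ++ distinct a k) ∧
          (∀ x, (s'.mem (bankMark c) x).toNat ≤ e + 1) ∧
          ∀ x < 2 ^ (2 * P.s + 2), s'.mem (bankMark c) (BitVec.ofNat w x) =
            BitVec.ofNat w (e + 1) ↔ x ∈ distinct a k)
        hmw hE₃.m hE₃.parity.one rfl rfl rfl ?_ ?_ ?_).mono ?_ ?_
      · rintro j s v ⟨h1, h2⟩
        exact ⟨by simpa using h1, h2⟩
      · simp only [distinct, List.append_nil]
        refine ⟨b147, by rw [hf₃.mem _ rfl, ielt], ?_, ?_⟩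
        · intro x
          rw [hf₃.mem _ rfl]
          exact (imark x).trans (Nat.le_succ e)
        · intro x _
          rw [hf₃.mem _ rfl]
          simp only [List.not_mem_nil, iff_false]
          intro h
          have := imark (BitVec.ofNat w x)
          rw [h, toNat_ofNat_of_lt (by omega)] at this
          omega
      · rintro k hk s₄ hf₄ hik ⟨j147, jelt, jle, jmark⟩
        have hE₄ : Env P X s₄ := hE₃.frame hf₄ (by cases c <;> rfl) (by cases c <;> rfl)
        refine ((Det.blk (Q := fun s' => s'.reg 120 = S (i * P.m + k)) ?_).seq
          (T₂ := hashTime P.g (2 * P.s + 2) + 15) ?_).le (by simp; omega)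
        · have c159 : s₄.reg 159 = BitVec.ofNat w (i * P.m) := by rw [hf₄.reg _ rfl, a159]
          have cS : s₄.mem bSrt = s.mem bSrt := by
            rw [hf₄.mem _ (by cases c <;> rfl), hf₃.mem _ rfl, hf₂.mem _ (by cases c <;> rfl),
              hf₁.mem _ rfl]
          simp only [execs, Instr.run, BinOp.eval, reg_setReg, mem_setReg]
          simp only [if_true, Nat.reduceEqDiff, if_false, c159, hik, cS, BitVec.ofNat_add_ofNat, hS]
        intro s₅ hf₅ a120
        have hE₅ : Env P X s₅ := hE₄.frame hf₅ rfl rfl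
        have d126 : s₅.reg 126 = BitVec.ofNat w (2 ^ (2 * P.s + 2)) := by
          rw [hf₅.reg _ rfl, hf₄.reg _ rfl, b126]
        have d123 : s₅.reg 123 = BitVec.ofNat w (t * P.Z) := by
          rw [hf₅.reg _ rfl, hf₄.reg _ rfl, a123]
        have dT : s₅.mem bTapeB = s.mem bTapeB := by
          rw [hf₅.mem _ rfl, hf₄.mem _ (by cases c <;> rfl), hf₃.mem _ rfl,
            hf₂.mem _ (by cases c <;> rfl), hf₁.mem _ rfl]
        refine ((hashProg_spec hE₅.parity d126 hCw d123).seq (T₂ := 14) ?_).le (by omega)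
        intro s₆ hf₆ a129
        have e129 : s₆.reg 129 =
            BitVec.ofNat w (P.hashFn T (2 * P.s + 2) t (S (i * P.m + k))) := by
          rw [a129, a120, dT]
          congr 1
          exact hash_congr (fun i _ => hT _) _
        have e156 : s₆.reg 156 = BitVec.ofNat w (u * f) := by
          rw [hf₆.reg _ rfl, hf₅.reg _ rfl, hf₄.reg _ rfl, a156]
        have eM : s₆.mem (bankMark c) = s₄.mem (bankMark c) := by
          rw [hf₆.mem _ rfl, hf₅.mem _ rfl]
        refine ((Det.blk (Q := fun s' => s'.reg 174 = BitVec.ofNat w (a k) ∧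
          s'.reg 177 = s₄.mem (bankMark c) (BitVec.ofNat w (a k))) ?_).seq (T₂ := 8) ?_).le
          (by simp)
        · simp only [execs, Instr.run, BinOp.eval, reg_setReg, mem_setReg]
          simp only [if_true, Nat.reduceEqDiff, if_false, e129, e156, ← BitVec.ofNat_xor, eM]
          exact ⟨rfl, rfl⟩
        rintro s₇ hf₇ ⟨a174, a177⟩
        have hak : a k < 2 ^ (2 * P.s + 2) := element_lt hfle e k
        have f147 : s₇.reg 147 = BitVec.ofNat w ((F e).flatten ++ distinct a k).length := by
          rw [hf₇.reg _ rfl, hf₆.reg _ rfl, hf₅.reg _ rfl, j147]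
        have f165 : s₇.reg 165 = BitVec.ofNat w (e + 1) := by
          rw [hf₇.reg _ rfl, hf₆.reg _ rfl, hf₅.reg _ rfl, hf₄.reg _ rfl, a165]
        have f6 : s₇.reg rOne = BitVec.ofNat w 1 := by
          rw [hf₇.reg _ rfl, hf₆.reg _ rfl, hf₅.reg _ rfl, hE₄.parity.one]
        have fM : s₇.mem (bankMark c) = s₄.mem (bankMark c) := by rw [hf₇.mem _ rfl, eM]
        have fE : s₇.mem (bankElt c) = s₄.mem (bankElt c) := by
          rw [hf₇.mem _ rfl, hf₆.mem _ rfl, hf₅.mem _ rfl]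
        have htest : (Test.eq 177 165).eval s₇ = decide (a k ∈ distinct a k) := by
          simp only [Test.eval, a177, f165]
          exact decide_eq_decide.2 (jmark _ hak)
        refine Det.ite (fun h => ?_) (fun h => ?_)
        · have hin : a k ∈ distinct a k := by simpa [htest] using h
          refine (Det.skip ?_).le (by omega)
          simp only [distinct, if_pos hin]
          exact ⟨f147, by rw [fE, jelt], by rw [fM]; exact jle, by rw [fM]; exact jmark⟩
        · have hnin : a k ∉ distinct a k := by simpa [htest] using h
          have hl : ((F e).flatten ++ distinct a k).length < 2 ^ w := by
            have := length_distinct_le a k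
            rw [List.length_append]; omega
          have hne1 : bankElt c ≠ bankMark c := by cases c <;> simp [bankElt, bankMark]
          refine Det.blk ?_
          simp only [distinct, if_neg hnin, ← List.append_assoc]
          simp only [execs, Instr.run, BinOp.eval, reg_setReg, reg_setMem, mem_setReg, mem_setMem]
          simp only [if_true, hne1, hne1.symm, if_false, f147, f165, f6, fM, fE, a174, jelt,
            BitVec.ofNat_add_ofNat]
          refine ⟨by simp [add_assoc], update_bank hl _, ?_, ?_⟩
          · intro x
            rw [Function.update_apply]
            split_ifs
            · rw [toNat_ofNat_of_lt (by omega)]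
            · exact jle x
          · intro x hx
            simp only [Function.update_apply, List.mem_append, List.mem_singleton, ← jmark x hx,
              ofNat_inj_of_lt (hx.trans hCw) (hak.trans hCw)]
            by_cases hxa : x = a k <;> simp [hxa]
      · simp only [Finset.sum_const, Finset.card_range, smul_eq_mul, add_assoc, Nat.reduceAdd]
        omega
      · rintro s₄ - ⟨h1, h2, h3, -⟩
        exact ⟨h1, h2, h3⟩
    · rintro s₄ hf₄ ⟨j147, jelt, jle⟩
      have g165 : s₄.reg 165 = BitVec.ofNat w (e + 1) := by rw [hf₄.reg _ rfl, a165]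
      have gO : s₄.mem (bankOff c) = bank (SetDisjInstance.offsets (F e)) := by
        rw [hf₄.mem _ (by cases c <;> rfl), hf₃.mem _ rfl, ioff]
      have hsucc : F (e + 1) = F e ++ [distinct a P.m] := family_succ f e
      have hne1 : bankOff c ≠ bankElt c := by cases c <;> simp [bankOff, bankElt]
      have hne2 : bankOff c ≠ bankMark c := by cases c <;> simp [bankOff, bankMark]
      have hlo : (SetDisjInstance.offsets (F e)).length = e + 1 := by
        rw [length_offsets, hF, length_family]
      refine Det.blk ?_
      simp only [execs, Instr.run, reg_setMem, mem_setMem]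
      simp only [if_true, hne1.symm, hne2.symm, if_false, g165, gO, j147, jelt, hsucc,
        offsets_append, List.flatten_append, List.flatten_cons, List.flatten_nil, List.append_nil]
      refine ⟨trivial, ?_, trivial, jle⟩
      rw [← hlo, List.length_append]
      exact update_bank (by omega) _
  · simp only [Finset.sum_const, Finset.card_range, smul_eq_mul, add_assoc,
      Nat.reduceAdd]
    omega
  · rintro s₂ - ⟨-, h2, h3, -⟩
    exact ⟨h2, h3⟩

end FamilyProgram

/-! ### The queries -/

section Queries
variable (P : Params) (T : ℕ → BitVec w)

/-- The hash value of the word of a test under the hash function number `t`. -/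
def Params.testHash (q : BitVec w × ℕ × ℕ) (t : ℕ) : ℕ := P.hashFn T (2 * P.s + 2) t q.1

/-- The query for the test `q` and the hash function number `t`. The hash value `v` of the word of
the test is split into its upper half `u` and its lower half `u'`. The two chunks contain words
whose hash values add up to `v` iff the hash values of the first chunk, shifted by
`u * 2 ^ (s + 1)`, and those of the second chunk, shifted by `u'`, have one in common. -/
def Params.query (q : BitVec w × ℕ × ℕ) (t : ℕ) : ℕ × ℕ :=
  ((t * 2 ^ (P.r + 1) + q.2.1) * 2 ^ (P.s + 1) + P.testHash T q t / 2 ^ (P.s + 1),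
    (t * 2 ^ (P.r + 1) + q.2.2) * 2 ^ (P.s + 1) + P.testHash T q t % 2 ^ (P.s + 1))

/-- The queries for the first `k` hash functions. -/
def Params.queriesFor (q : BitVec w × ℕ × ℕ) (k : ℕ) : List (ℕ × ℕ) :=
  (List.range k).map (P.query T q)

/-- The queries for the tests `qs`. -/
def Params.queries (qs : List (BitVec w × ℕ × ℕ)) : List (ℕ × ℕ) :=
  qs.flatMap fun q => P.queriesFor T q P.L

end Queries

section QueryProgram
variable {P : Params} {T : ℕ → BitVec w}

theorem length_queries (qs : List (BitVec w × ℕ × ℕ)) :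
    (P.queries T qs).length = qs.length * P.L := by
  induction qs with
  | nil => simp [Params.queries]
  | cons q qs ih =>
    have : P.queries T (q :: qs) = P.queriesFor T q P.L ++ P.queries T qs := rfl
    rw [this, List.length_append, ih, List.length_cons, add_mul, one_mul, add_comm]
    simp [Params.queriesFor]

theorem getElem_queries (qs : List (BitVec w × ℕ × ℕ)) {k t : ℕ} (hk : k < qs.length)
    (ht : t < P.L) : (P.queries T qs)[k * P.L + t]? = some (P.query T qs[k] t) := by
  induction qs generalizing k with
  | nil => simp at hk
  | cons q qs ih =>
    have : P.queries T (q :: qs) = P.queriesFor T q P.L ++ P.queries T qs := rfl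
    have hl : (P.queriesFor T q P.L).length = P.L := by simp [Params.queriesFor]
    rw [this]
    cases k with
    | zero =>
      rw [List.getElem?_append_left (by omega), zero_mul, zero_add]
      simp [Params.queriesFor, ht]
    | succ k =>
      rw [List.getElem?_append_right (by rw [hl, add_mul]; omega), hl,
        show (k + 1) * P.L + t - P.L = k * P.L + t by rw [add_mul]; omega,
        ih (by simpa using hk)]
      rfl

/-- Write down the queries, in banks `4` and `5` of copy `1`. -/
def queriesProg : Program :=
  blk [.const 147 0, .op .add 126 rC rZero] ;;
  forRange 153 rQ (
    blk [.load 120 bQC 153, .load 156 bQI 153, .load 159 bQJ 153] ;;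
    forRange 168 rReps (
      blk [.op .mul 123 168 rStride] ;; hashProg bTapeB ;;
      blk [.op .add 162 rMaskI rOne, .op .mul 162 168 162,
        .op .add 171 162 156, .op .mul 171 171 rTwoM, .op .shr 174 129 rShU,
        .op .add 171 171 174, .store 13 147 171,
        .op .add 171 162 159, .op .mul 171 171 rTwoM, .op .and 174 129 rMaskU,
        .op .add 171 171 174, .store 16 147 171, .op .add 147 147 rOne]))

/-- A bound on the time of writing down the queries for `Q` tests. -/
def Params.queriesTime (P : Params) (Q : ℕ) : ℕ :=
  Q * (P.L * (hashTime P.g (2 * P.s + 2) + 40) + 20) + 20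

theorem queriesProg_spec {X : List (BitVec w)} {qs : List (BitVec w × ℕ × ℕ)} {s : State w}
    (hP : P.Fits w) (hE : Env P X s) (hQ : Stored qs s) (hq : qs.length * P.L < 2 ^ w)
    (hT : ∀ j, s.mem bTapeB (BitVec.ofNat w j) = T j) (h13 : s.mem 13 = bank [])
    (h16 : s.mem 16 = bank []) :
    Det queriesProg s (P.queriesTime qs.length) fun s' =>
      s'.mem 13 = bank ((P.queries T qs).map Prod.fst) ∧
      s'.mem 16 = bank ((P.queries T qs).map Prod.snd) := by
  have hL : 1 ≤ P.L := by have := hP.l_pos; simp only [Params.L]; omega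
  have hLw : P.L < 2 ^ w := by
    have := hP.tape
    have : P.L * 1 ≤ P.L * P.Z := Nat.mul_le_mul_left _ (by simp only [Params.Z]; omega)
    omega
  have hQw : qs.length < 2 ^ w := lt_of_le_of_lt (Nat.le_mul_of_pos_right _ hL) hq
  have hCw : 2 ^ (2 * P.s + 2) < 2 ^ w := by
    have := hP.univ
    have h4 : 2 ^ (2 * P.s + 2) = 4 * (P.m * P.m) := by simp only [Params.m]; ring
    omega
  have hshift := hP.shift
  have hr2 : 2 ^ (P.r + 1) - 1 + 1 = 2 ^ (P.r + 1) := Nat.sub_add_cancel Nat.one_le_two_pow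
  refine ((Det.blk (Q := fun s' => s'.reg 147 = BitVec.ofNat w 0 ∧
    s'.reg 126 = BitVec.ofNat w (2 ^ (2 * P.s + 2))) ?_).seq
    (T₂ := qs.length * (P.L * (hashTime P.g (2 * P.s + 2) + 40) + 20) + 3) ?_).le
    (by simp [Params.queriesTime]; omega)
  · simp [execs, Instr.run, BinOp.eval, hE.C, hE.parity.zero]
  rintro s₁ hf₁ ⟨a147, a126⟩
  have hE₁ : Env P X s₁ := hE.frame hf₁ rfl rfl
  have a96 : s₁.reg rQ = BitVec.ofNat w qs.length := by rw [hf₁.reg _ rfl, hQ.length]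
  refine (Det.forRange (N := qs.length)
    (fun _ => P.L * (hashTime P.g (2 * P.s + 2) + 40) + 17)
    (fun k s' => s'.reg 147 = BitVec.ofNat w (P.queries T (qs.take k)).length ∧
      s'.mem 13 = bank ((P.queries T (qs.take k)).map Prod.fst) ∧
      s'.mem 16 = bank ((P.queries T (qs.take k)).map Prod.snd))
    hQw a96 hE₁.parity.one rfl rfl rfl ?_ ?_ ?_).mono ?_ ?_
  · rintro j s v ⟨h1, h2⟩
    exact ⟨by simpa using h1, h2⟩
  · refine ⟨by simpa [Params.queries] using a147, ?_, ?_⟩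
    · rw [hf₁.mem _ rfl, h13]; rfl
    · rw [hf₁.mem _ rfl, h16]; rfl
  · rintro k hk s₂ hf₂ hik ⟨i147, i13, i16⟩
    have hE₂ : Env P X s₂ := hE₁.frame hf₂ rfl rfl
    obtain ⟨q1, q2, q3⟩ := hQ.get k hk
    set q := qs[k] with hqk
    refine ((Det.blk (Q := fun s' => s'.reg 120 = q.1 ∧ s'.reg 156 = BitVec.ofNat w q.2.1 ∧
      s'.reg 159 = BitVec.ofNat w q.2.2) ?_).seq
      (T₂ := P.L * (hashTime P.g (2 * P.s + 2) + 40) + 3) ?_).le (by simp; omega)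
    · have e1 : s₂.mem bQC = s.mem bQC := by rw [hf₂.mem _ rfl, hf₁.mem _ rfl]
      have e2 : s₂.mem bQI = s.mem bQI := by rw [hf₂.mem _ rfl, hf₁.mem _ rfl]
      have e3 : s₂.mem bQJ = s.mem bQJ := by rw [hf₂.mem _ rfl, hf₁.mem _ rfl]
      simp only [execs, Instr.run, reg_setReg, mem_setReg]
      simp only [if_true, Nat.reduceEqDiff, if_false, hik, e1, e2, e3]
      exact ⟨q1, q2, q3⟩
    rintro s₃ hf₃ ⟨a120, a156, a159⟩
    have hE₃ : Env P X s₃ := hE₂.frame hf₃ rfl rfl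
    set B := P.queries T (qs.take k) with hB
    have htake : P.queries T (qs.take (k + 1)) = B ++ P.queriesFor T q P.L := by
      rw [hB, ← List.take_concat_get' _ _ hk, Params.queries, List.flatMap_append]
      simp [Params.queries, hqk]
    have hBlen : B.length + P.L ≤ qs.length * P.L := by
      rw [hB, length_queries, List.length_take, min_eq_left hk.le]
      calc k * P.L + P.L = (k + 1) * P.L := by ring
        _ ≤ qs.length * P.L := Nat.mul_le_mul_right _ hk
    refine (Det.forRange (N := P.L) (fun _ => hashTime P.g (2 * P.s + 2) + 37)
      (fun t s' => s'.reg 147 = BitVec.ofNat w (B ++ P.queriesFor T q t).length ∧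
        s'.mem 13 = bank ((B ++ P.queriesFor T q t).map Prod.fst) ∧
        s'.mem 16 = bank ((B ++ P.queriesFor T q t).map Prod.snd))
      hLw hE₃.L hE₃.parity.one rfl rfl rfl ?_ ?_ ?_).mono ?_ ?_
    · rintro j s v ⟨h1, h2⟩
      exact ⟨by simpa using h1, h2⟩
    · have : P.queriesFor T q 0 = [] := rfl
      rw [this, List.append_nil]
      exact ⟨by rw [hf₃.reg _ rfl, i147], by rw [hf₃.mem _ rfl, i13], by rw [hf₃.mem _ rfl, i16]⟩
    · rintro t ht s₄ hf₄ hit ⟨j147, j13, j16⟩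
      have hE₄ : Env P X s₄ := hE₃.frame hf₄ rfl rfl
      refine ((Det.blk (Q := fun s' => s'.reg 123 = BitVec.ofNat w (t * P.Z)) ?_).seq
        (T₂ := hashTime P.g (2 * P.s + 2) + 33) ?_).le (by simp; omega)
      · simp [execs, Instr.run, BinOp.eval, hit, hE₄.Z, BitVec.ofNat_mul]
      intro s₅ hf₅ a123
      have hE₅ : Env P X s₅ := hE₄.frame hf₅ rfl rfl
      have d126 : s₅.reg 126 = BitVec.ofNat w (2 ^ (2 * P.s + 2)) := by
        rw [hf₅.reg _ rfl, hf₄.reg _ rfl, hf₃.reg _ rfl, hf₂.reg _ rfl, a126]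
      have d120 : s₅.reg 120 = q.1 := by rw [hf₅.reg _ rfl, hf₄.reg _ rfl, a120]
      have dT : s₅.mem bTapeB = s.mem bTapeB := by
        rw [hf₅.mem _ rfl, hf₄.mem _ rfl, hf₃.mem _ rfl, hf₂.mem _ rfl, hf₁.mem _ rfl]
      refine ((hashProg_spec hE₅.parity d126 hCw a123).seq (T₂ := 27) ?_).le (by omega)
      intro s₆ hf₆ a129
      have hE₆ : Env P X s₆ := hE₅.frame hf₆ rfl rfl
      have e129 : s₆.reg 129 = BitVec.ofNat w (P.testHash T q t) := by
        rw [a129, d120, dT]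
        congr 1
        exact hash_congr (fun i _ => hT _) _
      have e156 : s₆.reg 156 = BitVec.ofNat w q.2.1 := by
        rw [hf₆.reg _ rfl, hf₅.reg _ rfl, hf₄.reg _ rfl, a156]
      have e159 : s₆.reg 159 = BitVec.ofNat w q.2.2 := by
        rw [hf₆.reg _ rfl, hf₅.reg _ rfl, hf₄.reg _ rfl, a159]
      have e168 : s₆.reg 168 = BitVec.ofNat w t := by
        rw [hf₆.reg _ rfl, hf₅.reg _ rfl, hit]
      have e147 : s₆.reg 147 = BitVec.ofNat w (B ++ P.queriesFor T q t).length := by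
        rw [hf₆.reg _ rfl, hf₅.reg _ rfl, j147]
      have e13 : s₆.mem 13 = bank ((B ++ P.queriesFor T q t).map Prod.fst) := by
        rw [hf₆.mem _ rfl, hf₅.mem _ rfl, j13]
      have e16 : s₆.mem 16 = bank ((B ++ P.queriesFor T q t).map Prod.snd) := by
        rw [hf₆.mem _ rfl, hf₅.mem _ rfl, j16]
      have hsucc : B ++ P.queriesFor T q (t + 1) =
          (B ++ P.queriesFor T q t) ++ [P.query T q t] := by
        simp [Params.queriesFor, List.range_succ]
      have hl : (B ++ P.queriesFor T q t).length < 2 ^ w := by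
        have : (P.queriesFor T q t).length = t := by simp [Params.queriesFor]
        rw [List.length_append]; omega
      have hh : P.testHash T q t < 2 ^ w := (hash_lt _ _ _).trans hCw
      set D := B ++ P.queriesFor T q t with hD
      refine Det.blk ?_
      rw [hsucc]
      simp only [execs, Instr.run, BinOp.eval, reg_setReg, reg_setMem, mem_setReg, mem_setMem]
      simp only [if_true, Nat.reduceEqDiff, if_false, e129, e156, e159, e168, e147, e13, e16,
        hE₆.maskI, hE₆.maskU, hE₆.shU, hE₆.twoM, hE₆.parity.one, BitVec.ofNat_add_ofNat, hr2,
        BitVec.ofNat_mul_ofNat, ← BitVec.ofNat_and, Nat.and_two_pow_sub_one_eq_mod,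
        ofNat_shr hh (show P.s + 1 < 2 ^ w by omega)]
      refine ⟨by simp, ?_, ?_⟩
      · have := update_bank (l := D.map Prod.fst) (by simpa using hl) (P.query T q t).1
        rw [List.length_map] at this
        rw [show (D ++ [P.query T q t]).map Prod.fst =
            D.map Prod.fst ++ [(P.query T q t).1] by simp,
          ← this]
        rfl
      · have := update_bank (l := D.map Prod.snd) (by simpa using hl) (P.query T q t).2
        rw [List.length_map] at this
        rw [show (D ++ [P.query T q t]).map Prod.snd =
            D.map Prod.snd ++ [(P.query T q t).2] by simp,
          ← this]
        rfl
    · simp only [Finset.sum_const, Finset.card_range, smul_eq_mul, add_assoc, Nat.reduceAdd]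
      omega
    · rintro s₄ - ⟨h1, h2, h3⟩
      rw [htake]
      exact ⟨h1, h2, h3⟩
  · simp only [Finset.sum_const, Finset.card_range, smul_eq_mul, add_assoc, Nat.reduceAdd]
    omega
  · rintro s₂ - ⟨-, h2, h3⟩
    rw [List.take_length] at h2 h3
    exact ⟨h2, h3⟩

/-! ### Evaluating the answers -/

/-- Whether a test has passed for all hash functions. -/
notation "rFlag" => 99
/-- The number of a test that has passed for all hash functions. -/
notation "rCand" => 102

/-- Search for a test all of whose queries have been answered positively, the answers being in
bank `6` of copy `1`. -/
def scanProg : Program :=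
  blk [.const rFlag 0, .const 147 0] ;;
  forRange 153 rQ (
    blk [.const 156 1] ;;
    forRange 168 rReps (
      blk [.load 159 19 147, .op .add 147 147 rOne] ;;
      .ite (.eq 159 rZero) (blk [.const 156 0]) .skip) ;;
    .ite (.eq 156 rOne) (blk [.const rFlag 1, .op .add rCand 153 rZero]) .skip)

theorem scanProg_spec {X : List (BitVec w)} {V : ℕ → BitVec w} {s : State w} {Q : ℕ}
    (hP : P.Fits w) (hE : Env P X s) (hQ : s.reg rQ = BitVec.ofNat w Q) (hq : Q * P.L < 2 ^ w)
    (hV : ∀ j, s.mem 19 (BitVec.ofNat w j) = V j) :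
    Det scanProg s (Q * (P.L * 13 + 20) + 10) fun s' =>
      (s'.reg rFlag = BitVec.ofNat w 0 ∧ ∀ k < Q, ∃ t < P.L, V (k * P.L + t) = 0) ∨
      ∃ k < Q, s'.reg rFlag = BitVec.ofNat w 1 ∧ s'.reg rCand = BitVec.ofNat w k ∧
        ∀ t < P.L, V (k * P.L + t) ≠ 0 := by
  have hL : 1 ≤ P.L := by have := hP.l_pos; simp only [Params.L]; omega
  have hLw : P.L < 2 ^ w := by
    have := hP.tape
    have : P.L * 1 ≤ P.L * P.Z := Nat.mul_le_mul_left _ (by simp only [Params.Z]; omega)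
    omega
  have hQw : Q < 2 ^ w := lt_of_le_of_lt (Nat.le_mul_of_pos_right _ hL) hq
  have h1w : 1 < 2 ^ w := Nat.one_lt_two_pow hP.w_pos.ne'
  refine ((Det.blk (Q := fun s' => s'.reg rFlag = BitVec.ofNat w 0 ∧
    s'.reg 147 = BitVec.ofNat w 0) ?_).seq (T₂ := Q * (P.L * 13 + 20) + 3) ?_).le (by simp; omega)
  · simp [execs, Instr.run]
  rintro s₁ hf₁ ⟨a99, a147⟩
  have hE₁ : Env P X s₁ := hE.frame hf₁ rfl rfl
  refine (Det.forRange (N := Q) (fun _ => P.L * 13 + 15)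
    (fun k s' => s'.reg 147 = BitVec.ofNat w (k * P.L) ∧
      ((s'.reg rFlag = BitVec.ofNat w 0 ∧ ∀ k' < k, ∃ t < P.L, V (k' * P.L + t) = 0) ∨
      ∃ k < Q, s'.reg rFlag = BitVec.ofNat w 1 ∧ s'.reg rCand = BitVec.ofNat w k ∧
        ∀ t < P.L, V (k * P.L + t) ≠ 0))
    hQw (by rw [hf₁.reg _ rfl, hQ]) hE₁.parity.one rfl rfl rfl ?_ ?_ ?_).mono ?_ ?_
  · rintro j s v ⟨h1, h2⟩
    exact ⟨by simpa using h1, by simpa using h2⟩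
  · exact ⟨by simpa using a147, Or.inl ⟨a99, by simp⟩⟩
  · rintro k hk s₂ hf₂ hik ⟨i147, i99⟩
    have hE₂ : Env P X s₂ := hE₁.frame hf₂ rfl rfl
    refine ((Det.blk (Q := fun s' => s'.reg 156 = BitVec.ofNat w 1) ?_).seq
      (T₂ := P.L * 13 + 10) ?_).le (by simp; omega)
    · simp [execs, Instr.run]
    intro s₃ hf₃ a156
    have hE₃ : Env P X s₃ := hE₂.frame hf₃ rfl rfl
    have b147 : s₃.reg 147 = BitVec.ofNat w (k * P.L) := by rw [hf₃.reg _ rfl, i147]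
    refine (Det.seq (T₁ := P.L * 13 + 3) (T₂ := 6)
      (Q := fun s' => s'.reg 147 = BitVec.ofNat w ((k + 1) * P.L) ∧
        ((s'.reg 156 = BitVec.ofNat w 1 ∧ ∀ t < P.L, V (k * P.L + t) ≠ 0) ∨
          s'.reg 156 = BitVec.ofNat w 0 ∧ ∃ t < P.L, V (k * P.L + t) = 0)) ?_ ?_).le (by omega)
    · refine (Det.forRange (N := P.L) (fun _ => 10)
        (fun u s' => s'.reg 147 = BitVec.ofNat w (k * P.L + u) ∧
          ((s'.reg 156 = BitVec.ofNat w 1 ∧ ∀ t < u, V (k * P.L + t) ≠ 0) ∨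
            s'.reg 156 = BitVec.ofNat w 0 ∧ ∃ t < P.L, V (k * P.L + t) = 0))
        hLw hE₃.L hE₃.parity.one rfl rfl rfl ?_ ?_ ?_).mono ?_ ?_
      · rintro j s v ⟨h1, h2⟩
        exact ⟨by simpa using h1, by simpa using h2⟩
      · exact ⟨by simpa using b147, Or.inl ⟨a156, by simp⟩⟩
      · rintro u hu s₄ hf₄ hiu ⟨j147, j156⟩
        have hE₄ : Env P X s₄ := hE₃.frame hf₄ rfl rfl
        refine ((Det.blk (Q := fun s' => s'.reg 159 = V (k * P.L + u) ∧
          s'.reg 147 = BitVec.ofNat w (k * P.L + (u + 1))) ?_).seq (T₂ := 4) ?_).le (by simp)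
        · have e19 : s₄.mem 19 = s.mem 19 := by
            rw [hf₄.mem _ rfl, hf₃.mem _ rfl, hf₂.mem _ rfl, hf₁.mem _ rfl]
          simp only [execs, Instr.run, BinOp.eval, reg_setReg]
          simp only [if_true, Nat.reduceEqDiff, if_false, j147, e19, hV, hE₄.parity.one,
            BitVec.ofNat_add_ofNat, add_assoc]
          exact ⟨trivial, trivial⟩
        rintro s₅ hf₅ ⟨a159, c147⟩
        have c9 : s₅.reg rZero = BitVec.ofNat w 0 := by rw [hf₅.reg _ rfl, hE₄.parity.zero]
        have c156 : s₅.reg 156 = s₄.reg 156 := hf₅.reg _ rfl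
        have htest : (Test.eq 159 rZero).eval s₅ = decide (V (k * P.L + u) = 0) := by
          simp only [Test.eval, a159, c9]
          rfl
        refine Det.ite (fun h => ?_) (fun h => ?_)
        · have h0 : V (k * P.L + u) = 0 := by simpa [htest] using h
          refine Det.blk ?_
          simp only [execs, Instr.run, reg_setReg]
          simp only [if_true, Nat.reduceEqDiff, if_false]
          exact ⟨c147, Or.inr ⟨trivial, u, hu, h0⟩⟩
        · have h0 : V (k * P.L + u) ≠ 0 := by simpa [htest] using h
          refine (Det.skip ⟨c147, ?_⟩).le (by norm_num)
          rw [c156]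
          refine j156.imp (fun ⟨h1, h2⟩ => ⟨h1, fun t ht => ?_⟩) id
          rcases Nat.lt_succ_iff_lt_or_eq.1 ht with ht | rfl
          · exact h2 t ht
          · exact h0
      · simp
      · rintro s₄ - ⟨h1, h2⟩
        exact ⟨by rw [h1]; congr 1; ring, h2⟩
    · rintro s₄ hf₄ ⟨j147, j156⟩
      have c99 : s₄.reg rFlag = s₂.reg rFlag := by rw [hf₄.reg _ rfl, hf₃.reg _ rfl]
      have c102 : s₄.reg rCand = s₂.reg rCand := by rw [hf₄.reg _ rfl, hf₃.reg _ rfl]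
      have c153 : s₄.reg 153 = BitVec.ofNat w k := by rw [hf₄.reg _ rfl, hf₃.reg _ rfl, hik]
      have hE₄ : Env P X s₄ := hE₃.frame hf₄ rfl rfl
      rcases j156 with ⟨j1, j2⟩ | ⟨j1, j2⟩
      · have htest : (Test.eq 156 rOne).eval s₄ = decide (1 = 1) :=
          eval_eq_ofNat j1 hE₄.parity.one h1w h1w
        refine Det.ite (fun _ => ?_) (fun h => by simp [htest] at h)
        refine Det.blk ?_
        simp only [execs, Instr.run, BinOp.eval, reg_setReg]
        simp only [if_true, Nat.reduceEqDiff, if_false, c153, hE₄.parity.zero,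
          BitVec.ofNat_add_ofNat, add_zero]
        exact ⟨j147, Or.inr ⟨k, hk, trivial, rfl, j2⟩⟩
      · have htest : (Test.eq 156 rOne).eval s₄ = decide (0 = 1) :=
          eval_eq_ofNat j1 hE₄.parity.one (by omega) h1w
        refine Det.ite (fun h => by simp [htest] at h) (fun _ => ?_)
        refine (Det.skip ⟨j147, ?_⟩).le (by norm_num)
        rw [c99, c102]
        refine i99.imp (fun ⟨h1, h2⟩ => ⟨h1, fun k' hk' => ?_⟩) id
        rcases Nat.lt_succ_iff_lt_or_eq.1 hk' with hk' | rfl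
        · exact h2 k' hk'
        · exact j2
  · simp only [Finset.sum_const, Finset.card_range, smul_eq_mul, add_assoc, Nat.reduceAdd]
    have : P.L * 13 + 18 ≤ P.L * 13 + 20 := by omega
    have := Nat.mul_le_mul_left Q this
    omega
  · rintro s₂ - ⟨-, h2⟩
    exact h2

/-- Check by brute force whether the two chunks of the test found contain words whose sum is the
word of the test. -/
def verifyProg : Program :=
  blk [.load 147 bQC rCand, .load 150 bQI rCand, .op .mul 150 150 rM, .load 153 bQJ rCand,
    .op .mul 153 153 rM, .const 156 0] ;;
  forRange 168 rMM (
    blk [.op .shr 159 168 rLgM, .op .add 159 150 159, .load 159 bSrt 159,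
      .op .and 162 168 rMaskM, .op .add 162 153 162, .load 162 bSrt 162,
      .op .xor 159 159 162] ;;
    .ite (.eq 159 147) (blk [.const 156 1]) .skip)

theorem verifyProg_spec {X : List (BitVec w)} {S : ℕ → BitVec w} {s : State w}
    {qs : List (BitVec w × ℕ × ℕ)} {k : ℕ} (hP : P.Fits w) (hE : Env P X s) (hQ : Stored qs s)
    (hk : k < qs.length) (hS : ∀ j, s.mem bSrt (BitVec.ofNat w j) = S j)
    (hc : s.reg rCand = BitVec.ofNat w k) :
    Det verifyProg s (P.m * P.m * 23 + 20) fun s' =>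
      (s'.reg 156 = BitVec.ofNat w 1 ∧ ∃ i < P.m, ∃ j < P.m,
        S (qs[k].2.1 * P.m + i) ^^^ S (qs[k].2.2 * P.m + j) = qs[k].1) ∨
      (s'.reg 156 = BitVec.ofNat w 0 ∧ ∀ i < P.m, ∀ j < P.m,
        S (qs[k].2.1 * P.m + i) ^^^ S (qs[k].2.2 * P.m + j) ≠ qs[k].1) := by
  obtain ⟨q1, q2, q3⟩ := hQ.get k hk
  set q := qs[k]
  have hm1 := P.m_pos
  have hmm : P.m * P.m < 2 ^ w := by have := hP.univ; omega
  have hsw : P.s < 2 ^ w := by have := hP.shift; omega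
  refine ((Det.blk (Q := fun s' => s'.reg 147 = q.1 ∧ s'.reg 150 = BitVec.ofNat w (q.2.1 * P.m) ∧
    s'.reg 153 = BitVec.ofNat w (q.2.2 * P.m) ∧ s'.reg 156 = BitVec.ofNat w 0) ?_).seq
    (T₂ := P.m * P.m * 23 + 3) ?_).le (by simp; omega)
  · simp only [execs, Instr.run, BinOp.eval, reg_setReg, mem_setReg]
    simp only [if_true, Nat.reduceEqDiff, if_false, hc, q1, q2, q3, hE.m, BitVec.ofNat_mul_ofNat]
    exact ⟨trivial, trivial, trivial, trivial⟩
  rintro s₁ hf₁ ⟨a147, a150, a153, a156⟩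
  have hE₁ : Env P X s₁ := hE.frame hf₁ rfl rfl
  refine (Det.forRange (N := P.m * P.m) (fun _ => 20)
    (fun u s' => (s'.reg 156 = BitVec.ofNat w 1 ∧ ∃ i < P.m, ∃ j < P.m,
        S (q.2.1 * P.m + i) ^^^ S (q.2.2 * P.m + j) = q.1) ∨
      (s'.reg 156 = BitVec.ofNat w 0 ∧ ∀ v < u,
        S (q.2.1 * P.m + v / P.m) ^^^ S (q.2.2 * P.m + v % P.m) ≠ q.1))
    hmm hE₁.mm hE₁.parity.one rfl rfl rfl ?_ ?_ ?_).mono ?_ ?_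
  · rintro j s v h
    simpa using h
  · exact Or.inr ⟨a156, by simp⟩
  · rintro u hu s₂ hf₂ hiu hinv
    have hE₂ : Env P X s₂ := hE₁.frame hf₂ rfl rfl
    refine ((Det.blk (Q := fun s' => s'.reg 159 =
      S (q.2.1 * P.m + u / P.m) ^^^ S (q.2.2 * P.m + u % P.m)) ?_).seq (T₂ := 4) ?_).le (by simp)
    · have eS : s₂.mem bSrt = s.mem bSrt := by rw [hf₂.mem _ rfl, hf₁.mem _ rfl]
      have c150 : s₂.reg 150 = _ := (hf₂.reg _ rfl).trans a150
      have c153 : s₂.reg 153 = _ := (hf₂.reg _ rfl).trans a153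
      simp only [execs, Instr.run, BinOp.eval, reg_setReg, mem_setReg]
      simp only [if_true, Nat.reduceEqDiff, if_false, hiu, c150, c153, hE₂.lgM, hE₂.maskM,
        ofNat_shr (hu.trans hmm) hsw, ← BitVec.ofNat_and, Nat.and_two_pow_sub_one_eq_mod,
        BitVec.ofNat_add_ofNat, eS, hS]
      rfl
    intro s₃ hf₃ a159
    have c147 : s₃.reg 147 = q.1 := by rw [hf₃.reg _ rfl, hf₂.reg _ rfl, a147]
    have c156 : s₃.reg 156 = s₂.reg 156 := hf₃.reg _ rfl
    refine Det.ite (fun h => ?_) (fun h => ?_)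
    · have h0 : S (q.2.1 * P.m + u / P.m) ^^^ S (q.2.2 * P.m + u % P.m) = q.1 := by
        simpa [Test.eval, a159, c147] using h
      refine Det.blk (Or.inl ⟨?_, u / P.m, Nat.div_lt_of_lt_mul hu, u % P.m, Nat.mod_lt _ hm1, h0⟩)
      simp [execs, Instr.run]
    · have h0 : S (q.2.1 * P.m + u / P.m) ^^^ S (q.2.2 * P.m + u % P.m) ≠ q.1 := by
        simpa [Test.eval, a159, c147] using h
      refine (Det.skip ?_).le (by norm_num)
      rw [c156]
      refine hinv.imp id (fun ⟨h1, h2⟩ => ⟨h1, fun v hv => ?_⟩)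
      rcases Nat.lt_succ_iff_lt_or_eq.1 hv with hv | rfl
      · exact h2 v hv
      · exact h0
  · simp
  · rintro s₂ - h
    refine h.imp id (fun ⟨h1, h2⟩ => ⟨h1, fun i hi j hj => ?_⟩)
    have := h2 (P.m * i + j) (by
      calc P.m * i + j < P.m * i + P.m := by omega
        _ = P.m * (i + 1) := by ring
        _ ≤ P.m * P.m := Nat.mul_le_mul_left _ hi)
    rwa [Nat.mul_add_div hm1, Nat.div_eq_of_lt hj, add_zero, Nat.mul_add_mod,
      Nat.mod_eq_of_lt hj] at this

/-! ### Brute force -/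

/-- Solve 3XOR by trying all triples. -/
def bruteProg : Program :=
  blk [.const 147 0] ;;
  forRange 150 rN (
    blk [.load 153 bX 150] ;;
    forRange 156 rN (
      blk [.load 159 bX 156, .op .xor 159 153 159] ;;
      forRange 162 rN (
        blk [.load 165 bX 162] ;; .ite (.eq 159 165) (blk [.const 147 1]) .skip))) ;;
  blk [.op .add 0 147 rZero]

/-- A bound on the time of the brute force algorithm. -/
def bruteTime (n : ℕ) : ℕ := n * (n * (n * 11 + 12) + 10) + 20

theorem bruteProg_spec {X : List (BitVec w)} {s : State w} (hX : X.length < 2 ^ w) (hw : 0 < w)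
    (h1 : s.reg rOne = BitVec.ofNat w 1) (h0 : s.reg rZero = BitVec.ofNat w 0)
    (hn : s.reg rN = BitVec.ofNat w X.length)
    (hin : ∀ j < X.length, s.mem bX (BitVec.ofNat w j) = X.getD j 0) :
    Det bruteProg s (bruteTime X.length) fun s' =>
      s'.reg 0 ≠ 0 ↔ ∃ a ∈ X, ∃ b ∈ X, ∃ c ∈ X, a ^^^ b = c := by
  have h1w : 1 < 2 ^ w := Nat.one_lt_two_pow hw.ne'
  set n := X.length with hXn
  set x : ℕ → BitVec w := fun j => X.getD j 0 with hx
  have hmem : ∀ j < n, x j ∈ X := fun j hj => by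
    rw [hx]
    simp only
    rw [List.getD_eq_getElem _ _ hj]
    exact List.getElem_mem _
  have hidx : ∀ a ∈ X, ∃ j < n, x j = a := fun a ha => by
    obtain ⟨j, hj, rfl⟩ := List.getElem_of_mem ha
    exact ⟨j, hj, List.getD_eq_getElem _ _ hj⟩
  -- the flag is set only if there is a solution
  let J : Prop → State w → Prop := fun none s' =>
    (s'.reg 147 = BitVec.ofNat w 1 ∧ ∃ a ∈ X, ∃ b ∈ X, ∃ c ∈ X, a ^^^ b = c) ∨
      s'.reg 147 = BitVec.ofNat w 0 ∧ none
  refine ((Det.blk (Q := fun s' => s'.reg 147 = BitVec.ofNat w 0) ?_).seq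
    (T₂ := n * (n * (n * 11 + 12) + 10) + 7) ?_).le (by simp [bruteTime]; omega)
  · simp [execs, Instr.run]
  intro s₁ hf₁ a147
  have b1 : s₁.reg rOne = BitVec.ofNat w 1 := by rw [hf₁.reg _ rfl, h1]
  have bn : s₁.reg rN = BitVec.ofNat w n := by rw [hf₁.reg _ rfl, hn]
  have bX' : s₁.mem bX = s.mem bX := hf₁.mem _ rfl
  refine (Det.seq (T₁ := n * (n * (n * 11 + 12) + 10) + 3) (T₂ := 3)
    (Q := J (∀ i < n, ∀ j < n, ∀ k < n, x i ^^^ x j ≠ x k)) ?_ ?_).le (by omega)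
  · refine (Det.forRange (N := n) (fun _ => n * (n * 11 + 12) + 7)
      (fun i' => J (∀ i < i', ∀ j < n, ∀ k < n, x i ^^^ x j ≠ x k)) hX bn b1 rfl rfl rfl
      (fun j s v h => by simpa [J] using h) (Or.inr ⟨a147, by simp⟩) ?_).mono (by simp)
      (fun _ _ h => h)
    intro i hi s₂ hf₂ hii hinv
    refine ((Det.blk (Q := fun s' => s'.reg 153 = x i) ?_).seq
      (T₂ := n * (n * 11 + 12) + 3) ?_).le (by simp; omega)
    · simp [execs, Instr.run, hii, hf₂.mem bX rfl, bX', hin i hi, hx]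
    intro s₃ hf₃ a153
    refine (Det.forRange (N := n) (fun _ => n * 11 + 9)
      (fun j' => J ((∀ i' < i, ∀ j < n, ∀ k < n, x i' ^^^ x j ≠ x k) ∧
        ∀ j < j', ∀ k < n, x i ^^^ x j ≠ x k)) hX
      (by rw [hf₃.reg _ rfl, hf₂.reg _ rfl, bn]) (by rw [hf₃.reg _ rfl, hf₂.reg _ rfl, b1])
      rfl rfl rfl (fun j s v h => by simpa [J] using h) ?_ ?_).mono (by simp) ?_
    · simp only [J, hf₃.reg 147 rfl]
      exact hinv.imp id (fun ⟨h1, h2⟩ => ⟨h1, h2, by simp⟩)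
    · intro j hj s₄ hf₄ hij hinv
      refine ((Det.blk (Q := fun s' => s'.reg 159 = x i ^^^ x j) ?_).seq
        (T₂ := n * 11 + 3) ?_).le (by simp; omega)
      · have c153 : s₄.reg 153 = x i := by rw [hf₄.reg _ rfl, a153]
        have cX : s₄.mem bX = s.mem bX := by
          rw [hf₄.mem _ rfl, hf₃.mem _ rfl, hf₂.mem _ rfl, bX']
        simp [execs, Instr.run, BinOp.eval, hij, cX, c153, hin j hj, hx]
      intro s₅ hf₅ a159
      refine (Det.forRange (N := n) (fun _ => 8)
        (fun k' => J ((∀ i' < i, ∀ j < n, ∀ k < n, x i' ^^^ x j ≠ x k) ∧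
          (∀ j' < j, ∀ k < n, x i ^^^ x j' ≠ x k) ∧ ∀ k < k', x i ^^^ x j ≠ x k)) hX
        (by rw [hf₅.reg _ rfl, hf₄.reg _ rfl, hf₃.reg _ rfl, hf₂.reg _ rfl, bn])
        (by rw [hf₅.reg _ rfl, hf₄.reg _ rfl, hf₃.reg _ rfl, hf₂.reg _ rfl, b1])
        rfl rfl rfl (fun j s v h => by simpa [J] using h) ?_ ?_).mono (by simp) ?_
      · simp only [J, hf₅.reg 147 rfl]
        exact hinv.imp id (fun ⟨h1, h2, h3⟩ => ⟨h1, h2, h3, by simp⟩)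
      · intro k hk s₆ hf₆ hik hinv
        refine ((Det.blk (Q := fun s' => s'.reg 165 = x k) ?_).seq (T₂ := 4) ?_).le (by simp)
        · have cX : s₆.mem bX = s.mem bX := by
            rw [hf₆.mem _ rfl, hf₅.mem _ rfl, hf₄.mem _ rfl, hf₃.mem _ rfl, hf₂.mem _ rfl, bX']
          simp [execs, Instr.run, hik, cX, hin k hk, hx]
        intro s₇ hf₇ a165
        have c159 : s₇.reg 159 = x i ^^^ x j := by rw [hf₇.reg _ rfl, hf₆.reg _ rfl, a159]
        refine Det.ite (fun h => ?_) (fun h => ?_)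
        · have h0 : x i ^^^ x j = x k := by simpa [Test.eval, c159, a165] using h
          refine Det.blk (Or.inl ⟨?_, x i, hmem i hi, x j, hmem j hj, x k, hmem k hk, h0⟩)
          simp [execs, Instr.run]
        · have h0 : x i ^^^ x j ≠ x k := by simpa [Test.eval, c159, a165] using h
          refine (Det.skip ?_).le (by norm_num)
          simp only [J, hf₇.reg 147 rfl]
          refine hinv.imp id (fun ⟨h1, h2, h3, h4⟩ => ⟨h1, h2, h3, fun k' hk' => ?_⟩)
          rcases Nat.lt_succ_iff_lt_or_eq.1 hk' with hk' | rfl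
          · exact h4 k' hk'
          · exact h0
      · rintro s₆ - h
        refine h.imp id (fun ⟨h1, h2, h3, h4⟩ => ⟨h1, h2, fun j' hj' => ?_⟩)
        rcases Nat.lt_succ_iff_lt_or_eq.1 hj' with hj' | rfl
        · exact h3 j' hj'
        · exact h4
    · rintro s₄ - h
      refine h.imp id (fun ⟨h1, h2, h3⟩ => ⟨h1, fun i' hi' => ?_⟩)
      rcases Nat.lt_succ_iff_lt_or_eq.1 hi' with hi' | rfl
      · exact h2 i' hi'
      · exact h3
  · intro s₂ hf₂ hinv
    have c9 : s₂.reg rZero = BitVec.ofNat w 0 := by rw [hf₂.reg _ rfl, hf₁.reg _ rfl, h0]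
    refine Det.blk ?_
    have e0 : (execs [.op .add 0 147 rZero] s₂).reg 0 = s₂.reg 147 := by
      simp [execs, Instr.run, BinOp.eval, c9]
    rw [e0]
    rcases hinv with ⟨h1, h2⟩ | ⟨h1, h2⟩
    · refine ⟨fun _ => h2, fun _ => ?_⟩
      rw [h1]
      exact fun h => absurd ((ofNat_inj_of_lt h1w (by positivity)).1 h) one_ne_zero
    · refine ⟨fun h => absurd h1 h, ?_⟩
      rintro ⟨a, ha, b, hb, c, hc, habc⟩
      obtain ⟨i, hi, rfl⟩ := hidx a ha
      obtain ⟨j, hj, rfl⟩ := hidx b hb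
      obtain ⟨k, hk, rfl⟩ := hidx c hc
      exact absurd habc (h2 i hi j hj k hk)

end QueryProgram

/-! ### The instance of offline SetDisjointness -/

theorem div_mul_xor_mod (h k : ℕ) : (h / 2 ^ k * 2 ^ k) ^^^ (h % 2 ^ k) = h := by
  refine Nat.eq_of_testBit_eq fun i => ?_
  rw [Nat.testBit_xor, Nat.testBit_mul_two_pow, Nat.testBit_div_two_pow, Nat.testBit_mod_two_pow]
  by_cases hi : k ≤ i
  · simp [hi, not_lt.2 hi]
  · simp [hi, not_le.1 hi]

section Instance
variable (P : Params) (S T : ℕ → BitVec w) (qs : List (BitVec w × ℕ × ℕ))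

theorem decode_index {r s t i v : ℕ} (hi : i < 2 ^ (r + 1)) (hv : v < 2 ^ (s + 1)) :
    ((t * 2 ^ (r + 1) + i) * 2 ^ (s + 1) + v) % 2 ^ (s + 1) = v ∧
    ((t * 2 ^ (r + 1) + i) * 2 ^ (s + 1) + v) / 2 ^ (s + 1) % 2 ^ (r + 1) = i ∧
    ((t * 2 ^ (r + 1) + i) * 2 ^ (s + 1) + v) / 2 ^ (s + 1 + r + 1) = t := by
  have h1 : ((t * 2 ^ (r + 1) + i) * 2 ^ (s + 1) + v) / 2 ^ (s + 1) = t * 2 ^ (r + 1) + i := by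
    rw [mul_comm _ (2 ^ (s + 1)), Nat.mul_add_div (by positivity), Nat.div_eq_of_lt hv, add_zero]
  refine ⟨?_, ?_, ?_⟩
  · rw [mul_comm _ (2 ^ (s + 1)), Nat.mul_add_mod, Nat.mod_eq_of_lt hv]
  · rw [h1, mul_comm t, Nat.mul_add_mod, Nat.mod_eq_of_lt hi]
  · rw [show s + 1 + r + 1 = (s + 1) + (r + 1) by ring, pow_add _ (s + 1),
      ← Nat.div_div_eq_div_mul, h1,
      mul_comm t, Nat.mul_add_div (by positivity), Nat.div_eq_of_lt hi, add_zero]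

theorem index_lt {t i v : ℕ} (ht : t < P.L) (hi : i < 2 ^ (P.r + 1)) (hv : v < 2 ^ (P.s + 1)) :
    (t * 2 ^ (P.r + 1) + i) * 2 ^ (P.s + 1) + v < P.fam := by
  calc (t * 2 ^ (P.r + 1) + i) * 2 ^ (P.s + 1) + v
      < (t * 2 ^ (P.r + 1) + i + 1) * 2 ^ (P.s + 1) := by rw [add_mul (t * _ + i)]; omega
    _ ≤ ((t + 1) * 2 ^ (P.r + 1)) * 2 ^ (P.s + 1) :=
        Nat.mul_le_mul_right _ (by rw [add_mul]; omega)
    _ ≤ (P.L * 2 ^ (P.r + 1)) * 2 ^ (P.s + 1) :=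
        Nat.mul_le_mul_right _ (Nat.mul_le_mul_right _ ht)
    _ = P.fam := by simp only [Params.fam, Params.R, Params.m]; ring

theorem getD_family {f e N : ℕ} (he : e < N) :
    (P.family S T f N).getD e [] = distinct (P.element S T f e) P.m := by
  rw [List.getD_eq_getElem _ _ (by rwa [length_family])]
  simp [Params.family]

/-- The instance: the universe consists of hash values, the sets of both families are indexed by
hash functions, chunks and shifts. -/
def Params.inst (hqs : ∀ q ∈ qs, q.2.1 < 2 * P.R ∧ q.2.2 < 2 * P.R) : SetDisjInstance where
  card := 2 ^ (2 * P.s + 2)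
  A := P.family S T (2 ^ (P.s + 1)) P.fam
  B := P.family S T 1 P.fam
  queries := P.queries T qs
  nodup_A D hD := by
    obtain ⟨e, -, rfl⟩ := List.mem_map.1 hD
    exact nodup_distinct _ _
  nodup_B D hD := by
    obtain ⟨e, -, rfl⟩ := List.mem_map.1 hD
    exact nodup_distinct _ _
  subset_A D hD x hx := by
    obtain ⟨e, -, rfl⟩ := List.mem_map.1 hD
    obtain ⟨k, -, rfl⟩ := mem_distinct.1 hx
    exact element_lt le_rfl _ _
  subset_B D hD x hx := by
    obtain ⟨e, -, rfl⟩ := List.mem_map.1 hD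
    obtain ⟨k, -, rfl⟩ := mem_distinct.1 hx
    exact element_lt Nat.one_le_two_pow _ _
  queries_lt q hq := by
    rw [length_family, length_family]
    obtain ⟨q', hq', hq⟩ := List.mem_flatMap.1 hq
    obtain ⟨t, ht, rfl⟩ := List.mem_map.1 hq
    have ht := List.mem_range.1 ht
    obtain ⟨h1, h2⟩ := hqs q' hq'
    have hR : 2 ^ (P.r + 1) = 2 * P.R := by simp only [Params.R]; ring
    have hh : P.testHash T q' t < 2 ^ (P.s + 1) * 2 ^ (P.s + 1) := by
      rw [← pow_add, show P.s + 1 + (P.s + 1) = 2 * P.s + 2 by ring]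
      exact hash_lt _ _ _
    exact ⟨index_lt P ht (hR ▸ h1) (Nat.div_lt_of_lt_mul hh),
      index_lt P ht (hR ▸ h2) (Nat.mod_lt _ (by positivity))⟩

variable {P S T qs}

/-- The query for a test and a hash function is answered positively iff the hash function does not
rule out that the chunks of the test contain words whose sum is the word of the test. -/
theorem meets_query_iff (hqs : ∀ q ∈ qs, q.2.1 < 2 * P.R ∧ q.2.2 < 2 * P.R)
    {q : BitVec w × ℕ × ℕ} (hq : q ∈ qs) {t : ℕ} (ht : t < P.L) :
    (P.inst S T qs hqs).Meets (P.query T q t) ↔ ∃ i < P.m, ∃ j < P.m,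
      P.hashFn T (2 * P.s + 2) t (S (q.2.1 * P.m + i) ^^^ S (q.2.2 * P.m + j) ^^^ q.1) = 0 := by
  obtain ⟨h1, h2⟩ := hqs q hq
  have hR : 2 ^ (P.r + 1) = 2 * P.R := by simp only [Params.R]; ring
  rw [← hR] at h1 h2
  set h := P.hashFn T (2 * P.s + 2) t with hh
  have hlt : h q.1 < 2 ^ (P.s + 1) * 2 ^ (P.s + 1) := by
    rw [← pow_add, show P.s + 1 + (P.s + 1) = 2 * P.s + 2 by ring]
    exact hash_lt _ _ _
  have hu : h q.1 / 2 ^ (P.s + 1) < 2 ^ (P.s + 1) := Nat.div_lt_of_lt_mul hlt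
  have hv : h q.1 % 2 ^ (P.s + 1) < 2 ^ (P.s + 1) := Nat.mod_lt _ (by positivity)
  have hxor : ∀ x y, h (x ^^^ y) = h x ^^^ h y := hash_xor _ _
  obtain ⟨a1, a2, a3⟩ := decode_index (t := t) h1 hu
  obtain ⟨b1, b2, b3⟩ := decode_index (t := t) h2 hv
  have hA : (P.family S T (2 ^ (P.s + 1)) P.fam).getD (P.query T q t).1 [] = distinct
      (fun i => h (S (q.2.1 * P.m + i)) ^^^ (h q.1 / 2 ^ (P.s + 1) * 2 ^ (P.s + 1))) P.m := by
    refine (getD_family P S T (index_lt P ht h1 hu)).trans ?_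
    congr 1
    funext i
    simp only [Params.element, a1, a2, a3]
    rfl
  have hB : (P.family S T 1 P.fam).getD (P.query T q t).2 [] = distinct
      (fun j => h (S (q.2.2 * P.m + j)) ^^^ (h q.1 % 2 ^ (P.s + 1))) P.m := by
    refine (getD_family P S T (index_lt P ht h2 hv)).trans ?_
    congr 1
    funext i
    simp only [Params.element, b1, b2, b3, mul_one]
    rfl
  change (∃ x, x ∈ (P.family S T (2 ^ (P.s + 1)) P.fam).getD (P.query T q t).1 [] ∧
    x ∈ (P.family S T 1 P.fam).getD (P.query T q t).2 []) ↔ _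
  rw [hA, hB]
  simp only [mem_distinct, hxor]
  have key : ∀ x y : ℕ, (x ^^^ (h q.1 / 2 ^ (P.s + 1) * 2 ^ (P.s + 1)) =
      y ^^^ (h q.1 % 2 ^ (P.s + 1))) ↔ x ^^^ y ^^^ h q.1 = 0 := by
    intro x y
    have hd := div_mul_xor_mod (h q.1) (P.s + 1)
    rw [← Nat.xor_eq_zero_iff]
    conv_rhs => rw [← hd]
    refine Eq.congr ?_ rfl
    ac_rfl
  constructor
  · rintro ⟨x, ⟨i, hi, rfl⟩, j, hj, hx⟩
    exact ⟨i, hi, j, hj, (key _ _).1 hx.symm⟩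
  · rintro ⟨i, hi, j, hj, hx⟩
    exact ⟨_, ⟨i, hi, rfl⟩, j, hj, ((key _ _).2 hx).symm⟩

end Instance

/-! ### Registers and banks of the copies -/

/-- Whether the instruction writes a register that satisfies `f` or a bank that satisfies `g`. -/
def Instr.writesWithin (f g : ℕ → Bool) : Instr → Bool
  | .const d _ => f d
  | .op _ d _ _ => f d
  | .not d _ => f d
  | .load d _ _ => f d
  | .store k _ _ => g k
  | .rand d _ => f d

/-- Whether the program writes only registers that satisfy `f` and banks that satisfy `g`. -/
def Program.writesWithin (f g : ℕ → Bool) : Program → Bool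
  | .skip => true
  | .instr i => i.writesWithin f g
  | .seq p q => p.writesWithin f g && q.writesWithin f g
  | .ite _ p q => p.writesWithin f g && q.writesWithin f g
  | .loop _ p => p.writesWithin f g

theorem Program.writesReg_of_writesWithin {f g : ℕ → Bool} {r : ℕ} (hr : f r = false) {p : Program}
    (h : p.writesWithin f g = true) : p.writesReg r = false := by
  induction p with
  | skip => rfl
  | instr i =>
    cases i <;> simp only [Program.writesWithin, Instr.writesWithin] at h <;>
      simp only [Program.writesReg, Instr.writesReg, beq_eq_false_iff] <;>
      rintro rfl <;> simp [hr] at h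
  | seq p q ihp ihq =>
    simp only [Program.writesWithin, Bool.and_eq_true] at h
    simp [Program.writesReg, ihp h.1, ihq h.2]
  | ite c p q ihp ihq =>
    simp only [Program.writesWithin, Bool.and_eq_true] at h
    simp [Program.writesReg, ihp h.1, ihq h.2]
  | loop c p ih => exact ih h

theorem Program.writesMem_of_writesWithin {f g : ℕ → Bool} {r : ℕ} (hr : g r = false) {p : Program}
    (h : p.writesWithin f g = true) : p.writesMem r = false := by
  induction p with
  | skip => rfl
  | instr i =>
    cases i <;> simp only [Program.writesWithin, Instr.writesWithin] at h <;>
      simp only [Program.writesMem, Instr.writesMem, beq_eq_false_iff]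
    rintro rfl
    simp [hr] at h
  | seq p q ihp ihq =>
    simp only [Program.writesWithin, Bool.and_eq_true] at h
    simp [Program.writesMem, ihp h.1, ihq h.2]
  | ite c p q ihp ihq =>
    simp only [Program.writesWithin, Bool.and_eq_true] at h
    simp [Program.writesMem, ihp h.1, ihq h.2]
  | loop c p ih => exact ih h

/-- The numbers that belong to copy `0` or are less than `c`. -/
def ownOrBelow (c i : ℕ) : Bool := Nat.beq (i % 3) 0 || Nat.blt i c

theorem ownOrBelow_copy_one {c i : ℕ} (h : c ≤ copy 1 i) : ownOrBelow c (copy 1 i) = false := by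
  have h3 : copy 1 i % 3 ≠ 0 := by simp only [copy]; omega
  rw [ownOrBelow, Bool.or_eq_false_iff, beq_eq_false_iff, ← Bool.not_eq_true, Nat.blt_eq]
  exact ⟨h3, by omega⟩

/-- The registers of copy `1` from the fifth on and the banks of copy `1` are zero, as are the two
banks of marks. -/
structure Clean (s : State w) : Prop where
  reg : ∀ i, 5 ≤ i → s.reg (copy 1 i) = 0
  mem : ∀ i, s.mem (copy 1 i) = bank []
  markA : s.mem 24 = bank []
  markB : s.mem 27 = bank []

theorem Clean.frame {s s' : State w} (h : Clean s) {p : Program} (hf : Frame p s s')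
    (hp : p.writesWithin (ownOrBelow 0) (ownOrBelow 0) = true) (hA : p.writesMem 24 = false)
    (hB : p.writesMem 27 = false) :
    Clean s' := by
  exact ⟨fun i hi => (hf.reg _ (Program.writesReg_of_writesWithin
      (ownOrBelow_copy_one (Nat.zero_le _)) hp)).trans (h.reg i hi),
    fun i => (hf.mem _ (Program.writesMem_of_writesWithin
      (ownOrBelow_copy_one (Nat.zero_le _)) hp)).trans (h.mem i),
    (hf.mem _ hA).trans h.markA, (hf.mem _ hB).trans h.markB⟩

/-! ### Preparing the call -/

/-- Write down the instance. -/
def buildProg : Program :=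
  familyProg true ;; familyProg false ;; queriesProg ;;
  blk [.op .add 1 rW rZero, .op .add 4 rC rZero, .op .add 7 rFam rZero, .op .add 10 rFam rZero,
    .op .mul 13 rQ rReps]

/-- The initial state for the instance. -/
def Params.callState (P : Params) (S T : ℕ → BitVec w) (qs : List (BitVec w × ℕ × ℕ)) : State w :=
  initState w [w, 2 ^ (2 * P.s + 2), P.fam, P.fam, qs.length * P.L]
    [SetDisjInstance.offsets (P.family S T (2 ^ (P.s + 1)) P.fam),
      (P.family S T (2 ^ (P.s + 1)) P.fam).flatten,
      SetDisjInstance.offsets (P.family S T 1 P.fam), (P.family S T 1 P.fam).flatten,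
      (P.queries T qs).map Prod.fst, (P.queries T qs).map Prod.snd]

theorem Stored.frame {qs : List (BitVec w × ℕ × ℕ)} {s s' : State w} (h : Stored qs s) {p : Program}
    (hf : Frame p s s') (hr : p.writesReg rQ = false) (h1 : p.writesMem bQC = false)
    (h2 : p.writesMem bQI = false) (h3 : p.writesMem bQJ = false) : Stored qs s' :=
  h.congr (hf.reg _ hr) (hf.mem _ h1) (hf.mem _ h2) (hf.mem _ h3)

theorem buildProg_spec {P : Params} {S T : ℕ → BitVec w} {X : List (BitVec w)}
    {qs : List (BitVec w × ℕ × ℕ)} {s : State w} (hP : P.Fits w) (hE : Env P X s)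
    (hQ : Stored qs s) (hq : qs.length * P.L < 2 ^ w)
    (hT : ∀ j, s.mem bTapeB (BitVec.ofNat w j) = T j)
    (hS : ∀ j, s.mem bSrt (BitVec.ofNat w j) = S j) (hC : Clean s) :
    Det buildProg s (2 * P.familyTime + P.queriesTime qs.length + 20) fun s' =>
      (∀ i, s'.reg (copy 1 i) = (P.callState S T qs).reg i) ∧
      ∀ i, s'.mem (copy 1 i) = (P.callState S T qs).mem i := by
  refine ((familyProg_spec true hP hE hT hS (hC.mem 0) (hC.mem 1) hC.markA).seq
    (T₂ := P.familyTime + P.queriesTime qs.length + 15) ?_).le (by omega)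
  rintro s₁ hf₁ ⟨a1, a4⟩
  have hE₁ : Env P X s₁ := hE.frame hf₁ rfl rfl
  refine ((familyProg_spec false (T := T) (S := S) hP hE₁
    (fun j => by rw [hf₁.mem _ rfl, hT]) (fun j => by rw [hf₁.mem _ rfl, hS])
    ((hf₁.mem _ rfl).trans (hC.mem 2)) ((hf₁.mem _ rfl).trans (hC.mem 3))
    ((hf₁.mem _ rfl).trans hC.markB)).seq (T₂ := P.queriesTime qs.length + 14) ?_).le (by omega)
  rintro s₂ hf₂ ⟨a7, a10⟩
  have hE₂ : Env P X s₂ := hE₁.frame hf₂ rfl rfl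
  have hQ₂ : Stored qs s₂ := (hQ.frame hf₁ rfl rfl rfl rfl).frame hf₂ rfl rfl rfl rfl
  refine ((queriesProg_spec (T := T) hP hE₂ hQ₂ hq
    (fun j => by rw [hf₂.mem _ rfl, hf₁.mem _ rfl, hT])
    (by rw [hf₂.mem _ rfl, hf₁.mem _ rfl]; exact hC.mem 4)
    (by rw [hf₂.mem _ rfl, hf₁.mem _ rfl]; exact hC.mem 5)).seq (T₂ := 11) ?_).le (by omega)
  rintro s₃ hf₃ ⟨a13, a16⟩
  have hE₃ : Env P X s₃ := hE₂.frame hf₃ rfl rfl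
  have hQ₃ := hQ₂.frame hf₃ rfl rfl rfl rfl
  refine Det.mono (T := 11) (Q := fun s' => s'.reg 1 = BitVec.ofNat w w ∧
    s'.reg 4 = BitVec.ofNat w (2 ^ (2 * P.s + 2)) ∧ s'.reg 7 = BitVec.ofNat w P.fam ∧
    s'.reg 10 = BitVec.ofNat w P.fam ∧ s'.reg 13 = BitVec.ofNat w (qs.length * P.L))
    (Det.blk ?_) le_rfl ?_
  · simp only [execs, Instr.run, BinOp.eval, reg_setReg]
    simp only [if_true, Nat.reduceEqDiff, if_false, hE₃.wordLen, hE₃.C, hE₃.fam, hQ₃.length, hE₃.L,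
      hE₃.parity.zero, BitVec.ofNat_mul_ofNat, BitVec.ofNat_add_ofNat, add_zero]
    exact ⟨trivial, trivial, trivial, trivial, trivial⟩
  · rintro s₄ hf₄ ⟨r1, r4, r7, r10, r13⟩
    constructor
    · intro i
      rcases lt_or_ge i 5 with hi | hi
      · interval_cases i
        · exact r1
        · exact r4
        · exact r7
        · exact r10
        · exact r13
      · have h16 : ownOrBelow 16 (copy 1 i) = false :=
          ownOrBelow_copy_one (by simp only [copy]; omega)
        rw [hf₄.reg _ (Program.writesReg_of_writesWithin (g := fun _ => true) h16 rfl),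
          hf₃.reg _ (Program.writesReg_of_writesWithin (g := fun _ => true) h16 rfl),
          hf₂.reg _ (Program.writesReg_of_writesWithin (g := fun _ => true) h16 rfl),
          hf₁.reg _ (Program.writesReg_of_writesWithin (g := fun _ => true) h16 rfl), hC.reg i hi]
        simp only [Params.callState, initState]
        rw [List.getD_eq_default _ _ (by simpa using hi)]
        rfl
    · intro i
      rcases lt_or_ge i 6 with hi | hi
      · interval_cases i
        · exact (hf₄.mem _ rfl).trans ((hf₃.mem _ rfl).trans ((hf₂.mem _ rfl).trans a1))
        · exact (hf₄.mem _ rfl).trans ((hf₃.mem _ rfl).trans ((hf₂.mem _ rfl).trans a4))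
        · exact (hf₄.mem _ rfl).trans ((hf₃.mem _ rfl).trans a7)
        · exact (hf₄.mem _ rfl).trans ((hf₃.mem _ rfl).trans a10)
        · exact (hf₄.mem _ rfl).trans a13
        · exact (hf₄.mem _ rfl).trans a16
      · have h19 : ownOrBelow 19 (copy 1 i) = false :=
          ownOrBelow_copy_one (by simp only [copy]; omega)
        rw [hf₄.mem _ (Program.writesMem_of_writesWithin (f := fun _ => true) h19 rfl),
          hf₃.mem _ (Program.writesMem_of_writesWithin (f := fun _ => true) h19 rfl),
          hf₂.mem _ (Program.writesMem_of_writesWithin (f := fun _ => true) h19 rfl),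
          hf₁.mem _ (Program.writesMem_of_writesWithin (f := fun _ => true) h19 rfl), hC.mem i]
        simp only [Params.callState, initState]
        rw [List.getD_eq_default _ _ (by simpa using hi)]

/-! ### Using the answers -/

/-- Some test passes for all hash functions although its chunks do not contain two words whose sum
is the word of the test. -/
def Params.FalseSurvivor (P : Params) (S T : ℕ → BitVec w) (qs : List (BitVec w × ℕ × ℕ)) : Prop :=
  ∃ q ∈ qs, (∀ i < P.m, ∀ j < P.m, S (q.2.1 * P.m + i) ^^^ S (q.2.2 * P.m + j) ≠ q.1) ∧
    ∀ t < P.L, ∃ i < P.m, ∃ j < P.m,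
      P.hashFn T (2 * P.s + 2) t (S (q.2.1 * P.m + i) ^^^ S (q.2.2 * P.m + j) ^^^ q.1) = 0

/-- The answers for the tests `qs`, which are correct for the instance of offline
SetDisjointness. -/
def Params.Answers (P : Params) (S T : ℕ → BitVec w) (qs : List (BitVec w × ℕ × ℕ))
    (V : BitVec w → BitVec w) : Prop :=
  ∀ k, ∀ hk : k < qs.length, ∀ t < P.L, V (BitVec.ofNat w (k * P.L + t)) ≠ 0 ↔
    ∃ i < P.m, ∃ j < P.m, P.hashFn T (2 * P.s + 2) t
      (S (qs[k].2.1 * P.m + i) ^^^ S (qs[k].2.2 * P.m + j) ^^^ qs[k].1) = 0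

/-- The tests `qs` of chunks of `S` find every solution in `X`, and only solutions in `X`. -/
structure Params.Covers (P : Params) (X : List (BitVec w)) (S : ℕ → BitVec w)
    (qs : List (BitVec w × ℕ × ℕ)) : Prop where
  sound : ∀ q ∈ qs, q.1 ∈ X ∧ q.2.1 < 2 * P.R ∧ q.2.2 < 2 * P.R
  mem : ∀ k < 2 * (P.R * P.m), S k ∈ X
  complete : ∀ a ∈ X, ∀ b ∈ X, ∀ c ∈ X, a ^^^ b = c → ∃ q ∈ qs, ∃ i < P.m, ∃ j < P.m,
    S (q.2.1 * P.m + i) ^^^ S (q.2.2 * P.m + j) = q.1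

/-- Derive the answer to the 3XOR instance. -/
def finishProg : Program :=
  scanProg ;; .ite (.eq rFlag rZero) (blk [.const 0 0])
    (verifyProg ;; .ite (.eq 156 rOne) (blk [.const 0 1]) bruteProg)

open Classical in
/-- The answer is always correct, and the brute force algorithm is run only if some test has passed
wrongly. -/
theorem finishProg_spec {P : Params} {S T : ℕ → BitVec w} {X : List (BitVec w)}
    {qs : List (BitVec w × ℕ × ℕ)} {s : State w} (hP : P.Fits w) (hE : Env P X s)
    (hX : X.length = P.n) (hQ : Stored qs s) (hq : qs.length * P.L < 2 ^ w)
    (hS : ∀ j, s.mem bSrt (BitVec.ofNat w j) = S j) (hcov : P.Covers X S qs)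
    (hV : P.Answers S T qs (s.mem 19)) :
    Det finishProg s (qs.length * (P.L * 13 + 20) + P.m * P.m * 23 + 40 +
        if P.FalseSurvivor S T qs then bruteTime P.n else 0)
      fun s' => s'.reg 0 ≠ 0 ↔ ∃ a ∈ X, ∃ b ∈ X, ∃ c ∈ X, a ^^^ b = c := by
  have h1w : 1 < 2 ^ w := Nat.one_lt_two_pow hP.w_pos.ne'
  set F := if P.FalseSurvivor S T qs then bruteTime P.n else 0 with hF
  refine ((scanProg_spec (V := fun j => s.mem 19 (BitVec.ofNat w j)) hP hE hQ.length hq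
    (fun _ => rfl)).seq (T₂ := P.m * P.m * 23 + 28 + F) ?_).le (by omega)
  intro s₁ hf₁ hscan
  have hE₁ : Env P X s₁ := hE.frame hf₁ rfl rfl
  have hQ₁ : Stored qs s₁ := hQ.frame hf₁ rfl rfl rfl rfl
  rcases hscan with ⟨a99, hnone⟩ | ⟨k, hk, a99, a102, hall⟩
  · have htest : (Test.eq rFlag rZero).eval s₁ = decide (0 = 0) :=
      eval_eq_ofNat a99 hE₁.parity.zero (by positivity) (by positivity)
    refine (Det.ite (T := 3) (fun _ => Det.blk ?_) (fun h => by simp [htest] at h)).le (by omega)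
    have e0 : (execs [.const 0 0] s₁).reg 0 = 0 := by simp [execs, Instr.run]
    rw [e0]
    refine ⟨fun h => absurd rfl h, ?_⟩
    -- a solution would make all the queries of one of the tests positive
    rintro ⟨a, ha, b, hb, c, hc, habc⟩
    obtain ⟨q, hqm, i, hi, j, hj, hij⟩ := hcov.complete a ha b hb c hc habc
    obtain ⟨k, hk, rfl⟩ := List.getElem_of_mem hqm
    obtain ⟨t, ht, h0⟩ := hnone k hk
    refine absurd h0 ((hV k hk t ht).2 ⟨i, hi, j, hj, ?_⟩)
    rw [hij, BitVec.xor_self]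
    exact (hash_eq_zero_iff _ _ _).2 fun i _ => by
      rw [BitVec.and_zero]; exact par_zero
  · have htest : (Test.eq rFlag rZero).eval s₁ = decide (1 = 0) :=
      eval_eq_ofNat a99 hE₁.parity.zero h1w (by positivity)
    refine (Det.ite (T := P.m * P.m * 23 + 26 + F) (fun h => by simp [htest] at h)
      (fun _ => ?_)).le (by omega)
    refine ((verifyProg_spec hP hE₁ hQ₁ hk (fun j => by rw [hf₁.mem _ rfl, hS]) a102).seq
      (T₂ := 5 + F) ?_).le (by omega)
    intro s₂ hf₂ hver
    have hE₂ : Env P X s₂ := hE₁.frame hf₂ rfl rfl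
    have hqk : qs[k] ∈ qs := List.getElem_mem _
    obtain ⟨c1, c2, c3⟩ := hcov.sound _ hqk
    rcases hver with ⟨b156, i, hi, j, hj, hij⟩ | ⟨b156, hno⟩
    · have htest : (Test.eq 156 rOne).eval s₂ = decide (1 = 1) :=
        eval_eq_ofNat b156 hE₂.parity.one h1w h1w
      refine (Det.ite (T := 3) (fun _ => Det.blk ?_) (fun h => by simp [htest] at h)).le (by omega)
      have e0 : (execs [.const 0 1] s₂).reg 0 = BitVec.ofNat w 1 := by simp [execs, Instr.run]
      rw [e0]
      have hcell : ∀ {a b : ℕ}, a < 2 * P.R → b < P.m → a * P.m + b < 2 * (P.R * P.m) := by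
        intro a b ha hb
        calc a * P.m + b < (a + 1) * P.m := by rw [add_mul, one_mul]; omega
          _ ≤ 2 * P.R * P.m := Nat.mul_le_mul_right _ ha
          _ = _ := by ring
      exact ⟨fun _ => ⟨_, hcov.mem _ (hcell c2 hi), _, hcov.mem _ (hcell c3 hj), _, c1, hij⟩,
        fun _ h => absurd ((ofNat_inj_of_lt h1w (by positivity)).1 h) one_ne_zero⟩
    · have htest : (Test.eq 156 rOne).eval s₂ = decide (0 = 1) :=
        eval_eq_ofNat b156 hE₂.parity.one (by positivity) h1w
      have hfalse : P.FalseSurvivor S T qs :=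
        ⟨qs[k], hqk, hno, fun t ht => (hV k hk t ht).1 (hall t ht)⟩
      have hFb : F = bruteTime P.n := if_pos hfalse
      refine (Det.ite (T := bruteTime P.n) (fun h => by simp [htest] at h) (fun _ => ?_)).le
        (by omega)
      rw [← hX]
      exact bruteProg_spec (hX ▸ hP.n_lt) hP.w_pos hE₂.parity.one hE₂.parity.zero
        (hX ▸ hE₂.n) hE₂.input

/-! ### The reduction for a good hash function -/

/-- The sequence of the words `ω`, continued by zeros. -/
def tape {N : ℕ} (ω : Fin N → BitVec w) (j : ℕ) : BitVec w := if h : j < N then ω ⟨j, h⟩ else 0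

theorem hashFn_tape {P : Params} {ω : Fin (P.L * P.Z) → BitVec w} {T : ℕ → BitVec w}
    (hT : ∀ j : Fin (P.L * P.Z), T j = ω j) {b u : ℕ} (hb : b ≤ P.Z) (hu : u < P.L) :
    P.hashFn T b u = P.hashFn (tape ω) b u := by
  funext x
  refine hash_congr (fun i hi => ?_) x
  have : u * P.Z + i < P.L * P.Z := by
    calc u * P.Z + i < (u + 1) * P.Z := by rw [add_mul, one_mul]; omega
      _ ≤ P.L * P.Z := Nat.mul_le_mul_right _ hu
  rw [tape, dif_pos this]
  exact hT ⟨_, this⟩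

theorem falseSurvivor_tape {P : Params} {ω : Fin (P.L * P.Z) → BitVec w} {S T : ℕ → BitVec w}
    {qs : List (BitVec w × ℕ × ℕ)} (hT : ∀ j : Fin (P.L * P.Z), T j = ω j) :
    P.FalseSurvivor S T qs ↔ P.FalseSurvivor S (tape ω) qs := by
  have hb : 2 * P.s + 2 ≤ P.Z := by simp only [Params.Z]; omega
  unfold Params.FalseSurvivor
  refine exists_congr fun q => and_congr_right fun _ => and_congr_right fun _ =>
    forall_congr' fun t => forall_congr' fun ht => ?_
  rw [hashFn_tape hT hb ht]

/-- The part of the reduction that follows a successful search for a hash function. -/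
def goodProg (p : Program) : Program :=
  enumProg ;; drawWords 150 rTape 153 bTapeB ;; buildProg ;; p.rename (copy 1) ;; finishProg

/-- A bound on the time of `goodProg`, apart from the call and the brute force algorithm, for at
most `Q` tests. -/
def Params.goodTime (P : Params) (Q : ℕ) : ℕ :=
  P.n * P.R * (hashTime P.g P.r + 50) + 30 * Q + 6 * (P.L * P.Z) + 2 * P.familyTime +
    P.queriesTime Q + Q * (P.L * 13 + 20) + P.m * P.m * 23 + 100

theorem Params.goodTime_mono {P : Params} {Q Q' : ℕ} (h : Q ≤ Q') :
    P.goodTime Q ≤ P.goodTime Q' := by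
  simp only [Params.goodTime, Params.queriesTime]
  gcongr

/-- The program `p` answers all instances that the reduction builds, in expected time at
most `W`. -/
def Params.CallOk (P : Params) (w : ℕ) (p : Program) (W : ℝ≥0∞) : Prop :=
  ∀ (S T : ℕ → BitVec w) (qs : List (BitVec w × ℕ × ℕ)),
    (∀ q ∈ qs, q.2.1 < 2 * P.R ∧ q.2.2 < 2 * P.R) → P.n * P.R ≤ qs.length →
    qs.length ≤ 11 * P.n * P.R →
    HaltsWith p (P.callState S T qs) (fun s => P.Answers S T qs (s.mem 6)) ∧
      expectedTime p (P.callState S T qs) ≤ W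

open Classical in
/-- `D` bounds the expected time that is spent on brute force because a test passes wrongly. -/
theorem goodProg_spec {P : Params} {X : List (BitVec w)} {h : BitVec w → ℕ} {T₀ : ℕ → BitVec w}
    {u : ℕ} {s : State w} {p : Program} {W D : ℝ≥0∞} (hP : P.Fits w) (hE : Env P X s)
    (hX : X.length = P.n) (hT : ∀ j, s.mem bTapeA (BitVec.ofNat w j) = T₀ j)
    (hbase : s.reg rBase = BitVec.ofNat w (u * P.Z)) (hh : P.hashFn T₀ P.r u = h)
    (hcol : collisions X h P.R ≤ P.n * P.m) (harr : Arranged P X h s)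
    (hin : ∀ k < 2 * (P.R * P.m), s.mem bSrt (BitVec.ofNat w k) ∈ X) (hC : Clean s)
    (hp : P.CallOk w p W)
    (hD : ∀ (S : ℕ → BitVec w) (qs : List (BitVec w × ℕ × ℕ)), qs.length ≤ 11 * P.n * P.R →
      avgWords w (P.L * P.Z) (fun ω => if P.FalseSurvivor S (tape ω) qs then (bruteTime P.n : ℝ≥0∞)
        else 0) ≤ D) :
    Ok ([goodProg p], s) (fun s' => s'.reg 0 ≠ 0 ↔ ∃ a ∈ X, ∃ b ∈ X, ∃ c ∈ X, a ^^^ b = c)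
      (P.goodTime (11 * P.n * P.R) + W + D) := by
  subst hh
  set h := P.hashFn T₀ P.r u
  have hhR : ∀ x, h x < P.R := fun x => hash_lt _ _ _
  set qs := P.triples X h with hqs
  have hle : qs.length ≤ 11 * P.n * P.R := length_triples_le hX hP.n_le hhR hcol
  have hge : P.n * P.R ≤ qs.length := le_length_triples
  have hqL : qs.length * P.L < 2 ^ w := (Nat.mul_le_mul_right _ hle).trans_lt hP.queries
  set S : ℕ → BitVec w := fun k => s.mem bSrt (BitVec.ofNat w k) with hS
  have hcov : P.Covers X S qs := by
    refine ⟨fun q hq => triples_bounds hX hP.n_le hq, hin, fun a ha b hb c hc habc => ?_⟩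
    obtain ⟨i, j, h1, ⟨k, hk, hk', hka⟩, l, hl, hl', hlb⟩ :=
      exists_triple hX hhR (hash_xor _ _) ha hb hc habc
    refine ⟨_, h1, k, hk, l, hl, ?_⟩
    rw [hS]
    simp only
    rw [harr.srt _ hk', harr.srt _ hl', hka, hlb, habc]
  have hbounds : ∀ q ∈ qs, q.2.1 < 2 * P.R ∧ q.2.2 < 2 * P.R := fun q hq => (hcov.sound q hq).2
  have henum : Det enumProg s (P.n * P.R * (hashTime P.g P.r + 50) + 30 * qs.length + 20)
      (Stored qs) := enumProg_spec hP hE hX hT hbase hcol harr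
  refine Ok.mono (T := _) (Ok.seq (henum.ok
    (T' := 1 + (6 * (P.L * P.Z : ℕ) + 3 +
      avgWords w (P.L * P.Z) (fun ω => ((2 * P.familyTime + P.queriesTime qs.length + 22 +
        (qs.length * (P.L * 13 + 20) + P.m * P.m * 23 + 40) : ℕ) + W) +
        if P.FalseSurvivor S (tape ω) qs then (bruteTime P.n : ℝ≥0∞) else 0))) ?_)) ?_
  · intro s₁ hf₁ hst₁
    have hE₁ : Env P X s₁ := hE.frame hf₁ rfl rfl
    refine Ok.seq (Ok.drawWords hP.tape hE₁.tape hE₁.parity.one hE₁.parity.zero (by norm_num)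
      (by norm_num) (by norm_num) (by norm_num) (by norm_num) (by norm_num) (by norm_num) ?_)
    intro ω s₂ hf₂ hω
    set T : ℕ → BitVec w := fun j => s₂.mem bTapeB (BitVec.ofNat w j) with hTdef
    have hE₂ : Env P X s₂ := hE₁.frame hf₂ rfl rfl
    have hC₂ : Clean s₂ := (hC.frame hf₁ rfl rfl rfl).frame hf₂ rfl rfl rfl
    have hst₂ : Stored qs s₂ := hst₁.frame hf₂ rfl rfl rfl rfl
    have hS₂ : ∀ j, s₂.mem bSrt (BitVec.ofNat w j) = S j := fun j => by
      rw [hf₂.mem _ rfl, hf₁.mem _ rfl]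
    obtain ⟨hp1, hp2⟩ := hp S T qs hbounds hge hle
    refine Ok.mono (T := _) (Ok.seq ((buildProg_spec (T := T) hP hE₂ hst₂ hqL (fun _ => rfl) hS₂
      hC₂).ok (T' := 1 + (expectedTime p (P.callState S T qs) +
        ((qs.length * (P.L * 13 + 20) + P.m * P.m * 23 + 40 +
          if P.FalseSurvivor S T qs then bruteTime P.n else 0 : ℕ) + 0))) ?_)) ?_
    · rintro s₃ hf₃ ⟨hr, hm⟩
      refine Ok.seq (Ok.call_rename (by norm_num) hp1 hr hm ?_)
      intro s₄ hans
      have hreg₃ : ∀ r < 90, r % 3 = 0 → s₃.reg r = s₂.reg r := fun r h90 hr =>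
        hf₃.reg r (Program.writesReg_of_writesWithin
          (f := fun r => Nat.ble 90 r || !Nat.beq (r % 3) 0) (g := fun _ => true)
          (by
            have : Nat.ble 90 r = false := by
              rw [Bool.eq_false_iff, Ne, Nat.ble_eq]; omega
            simp [hr, this]) rfl)
      have hreg : ∀ r, r % 3 = 0 → (State.embed 1 s₃ s₄).reg r = s₃.reg r := fun r hr => by
        simp [State.embed, hr]
      have hmem : ∀ r, r % 3 = 0 → (State.embed 1 s₃ s₄).mem r = s₃.mem r := fun r hr => by
        simp [State.embed, hr]
      refine (finishProg_spec (S := S) (T := T) hP (hE₂.congr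
        (fun r h90 hr => (hreg r hr).trans (hreg₃ r h90 hr))
        ((hmem _ rfl).trans (hf₃.mem _ rfl))) hX
        ((hst₂.frame hf₃ rfl rfl rfl rfl).congr (hreg _ rfl) (hmem _ rfl) (hmem _ rfl)
          (hmem _ rfl)) hqL ?_ hcov hans).ok fun s₅ _ h₅ => Ok.nil h₅
      intro j
      rw [hmem _ rfl, hf₃.mem _ rfl, hS₂]
    · have hsurv : P.FalseSurvivor S T qs ↔ P.FalseSurvivor S (tape ω) qs :=
        falseSurvivor_tape hω
      simp only [hsurv]
      calc _ ≤ 1 + (((2 * P.familyTime + P.queriesTime qs.length + 20 : ℕ) : ℝ≥0∞) + (1 + (W +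
            (((qs.length * (P.L * 13 + 20) + P.m * P.m * 23 + 40 +
              if P.FalseSurvivor S (tape ω) qs then bruteTime P.n else 0 : ℕ) : ℝ≥0∞) + 0)))) := by
            gcongr
        _ = _ := by push_cast; ring
  · rw [avgWords_add_const]
    have hmono : ((P.goodTime qs.length : ℕ) : ℝ≥0∞) ≤ P.goodTime (11 * P.n * P.R) := by
      exact_mod_cast Params.goodTime_mono hle
    have h3 : ((1 + (P.n * P.R * (hashTime P.g P.r + 50) +
        30 * qs.length + 20 + (1 + (6 * (P.L * P.Z) + 3 + (2 * P.familyTime +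
        P.queriesTime qs.length + 22 + (qs.length * (P.L * 13 + 20) + P.m * P.m * 23 + 40)))))
        : ℕ) : ℝ≥0∞) ≤ (P.goodTime qs.length : ℕ) := by
      rw [Nat.cast_le]
      simp only [Params.goodTime]
      omega
    refine le_trans (le_of_eq ?_)
      (add_le_add (add_le_add (h3.trans hmono) le_rfl) (hD S qs hle))
    push_cast
    ring

/-! ### The reduction -/

/-- The reduction for large inputs, after the approximation of `n ^ γ` has been computed. -/
def mainProg (p : Program) : Program :=
  paramsProg ;; fillProg ;; drawWords 150 rTape 153 bTapeA ;; selectProg ;;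
    .ite (.eq rFound rZero) bruteProg (goodProg p)

/-- A bound on the time of `mainProg`, apart from the call and the brute force algorithm. -/
def Params.mainTime (P : Params) (q : ℕ) : ℕ :=
  6 * P.r + 6 * P.s + 6 * P.l + 14 * q + 6 * P.g + 12 * (P.R * P.m) + 6 * (P.L * P.Z) +
    P.L * (P.arrangeTime + 4) + P.goodTime (11 * P.n * P.R) + 200

open Classical in
/-- `D₁` and `D₂` bound the expected times that are spent on brute force because no good hash
function is found, and because a test passes wrongly. -/
theorem mainProg_spec {P : Params} {X : List (BitVec w)} {v q : ℕ} {s : State w} {p : Program}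
    {W D₁ D₂ : ℝ≥0∞} (hP : P.Fits w)
    (hr : IsLog 1 v P.r) (hs : IsLog P.R P.n P.s) (hl : IsLog 1 P.n P.l)
    (hq : IsLog 1 w q) (hg : IsLog 1 (q + 1) P.g) (hv : v < 2 ^ w)
    (h1 : s.reg rOne = BitVec.ofNat w 1) (h0 : s.reg rZero = BitVec.ofNat w 0)
    (hw : s.reg rW = BitVec.ofNat w w) (hn : s.reg rN = BitVec.ofNat w P.n)
    (h2 : s.reg 2 = BitVec.ofNat w v) (hX : X.length = P.n)
    (hin : ∀ j < X.length, s.mem bX (BitVec.ofNat w j) = X.getD j 0) (hC : Clean s)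
    (hp : P.CallOk w p W)
    (hD₁ : avgWords w (P.L * P.Z) (fun ω => if ∀ u < P.L, P.n * P.m <
      collisions X (P.hashFn (tape ω) P.r u) P.R then (bruteTime P.n : ℝ≥0∞) else 0) ≤ D₁)
    (hD₂ : ∀ (S : ℕ → BitVec w) (qs : List (BitVec w × ℕ × ℕ)), qs.length ≤ 11 * P.n * P.R →
      avgWords w (P.L * P.Z) (fun ω => if P.FalseSurvivor S (tape ω) qs then (bruteTime P.n : ℝ≥0∞)
        else 0) ≤ D₂) :
    Ok ([mainProg p], s) (fun s' => s'.reg 0 ≠ 0 ↔ ∃ a ∈ X, ∃ b ∈ X, ∃ c ∈ X, a ^^^ b = c)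
      (P.mainTime q + W + D₁ + D₂) := by
  have h1w : 1 < 2 ^ w := Nat.one_lt_two_pow hP.w_pos.ne'
  have hrZ : P.r ≤ P.Z := by simp only [Params.Z]; omega
  refine Ok.mono (T := _) (Ok.seq ((paramsProg_spec hP hr hs hl hq hg hv h1 h0 hw hn h2 hin).ok
    (T' := 1 + ((12 * (P.R * P.m) + 10 : ℕ) + (1 + (6 * (P.L * P.Z : ℕ) + 3 +
      avgWords w (P.L * P.Z) (fun ω => ((P.L * (P.arrangeTime + 4) + 12 +
        P.goodTime (11 * P.n * P.R) : ℕ) + W + D₂) + if ∀ u < P.L, P.n * P.m <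
      collisions X (P.hashFn (tape ω) P.r u) P.R then (bruteTime P.n : ℝ≥0∞) else 0))))) ?_)) ?_
  · intro s₁ hf₁ hE₁
    have hC₁ : Clean s₁ := hC.frame hf₁ rfl rfl rfl
    refine Ok.seq ((fillProg_spec hP hE₁ hX).ok ?_)
    intro s₂ hf₂ hin₂
    have hE₂ : Env P X s₂ := hE₁.frame hf₂ rfl rfl
    refine Ok.seq (Ok.drawWords hP.tape hE₂.tape hE₂.parity.one hE₂.parity.zero (by norm_num)
      (by norm_num) (by norm_num) (by norm_num) (by norm_num) (by norm_num) (by norm_num) ?_)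
    intro ω s₃ hf₃ hω
    set T : ℕ → BitVec w := fun j => s₃.mem bTapeA (BitVec.ofNat w j) with hTdef
    have hE₃ : Env P X s₃ := hE₂.frame hf₃ rfl rfl
    refine Ok.mono (T := _) (Ok.seq ((selectProg_spec (T := T) hP hE₃ hX (fun _ => rfl)
      (by rw [hf₃.mem _ rfl]; exact hin₂)).ok (T' := 1 + (((P.goodTime (11 * P.n * P.R) : ℕ) + W +
        D₂) + if ∀ u < P.L, P.n * P.m < collisions X (P.hashFn (tape ω) P.r u) P.R then
          (bruteTime P.n : ℝ≥0∞) else 0)) ?_)) ?_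
    · rintro s₄ hf₄ ⟨hin₄, hsel⟩
      have hE₄ : Env P X s₄ := hE₃.frame hf₄ rfl rfl
      rcases hsel with ⟨a90, hbad⟩ | ⟨u, hu, a90, a93, hcol, harr⟩
      · have htest : (Test.eq rFound rZero).eval s₄ = decide (0 = 0) :=
          eval_eq_ofNat a90 hE₄.parity.zero (by positivity) (by positivity)
        refine Ok.ite (fun _ => ?_) (fun h => by simp [htest] at h)
        have hbad' : ∀ u < P.L, P.n * P.m < collisions X (P.hashFn (tape ω) P.r u) P.R :=
          fun u hu => by
            rw [← hashFn_tape (T := T) hω hrZ hu]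
            exact hbad u hu
        rw [if_pos hbad']
        refine Ok.mono (T := _) ((bruteProg_spec (hX ▸ hP.n_lt) hP.w_pos hE₄.parity.one
          hE₄.parity.zero (hX ▸ hE₄.n) hE₄.input).ok fun s₅ _ h₅ => Ok.nil h₅) ?_
        rw [hX, add_zero]
        exact le_add_self
      · have htest : (Test.eq rFound rZero).eval s₄ = decide (1 = 0) :=
          eval_eq_ofNat a90 hE₄.parity.zero h1w (by positivity)
        refine Ok.ite (fun h => by simp [htest] at h) (fun _ => ?_)
        refine (goodProg_spec hP hE₄ hX (T₀ := T) (fun j => by rw [hf₄.mem _ rfl]) a93 rfl hcol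
          harr hin₄ (((hC₁.frame hf₂ rfl rfl rfl).frame hf₃ rfl rfl rfl).frame hf₄ rfl rfl rfl) hp
          hD₂).mono le_self_add
    · push_cast
      refine le_of_eq ?_
      ring
  · rw [avgWords_add_const]
    have h3 : ((1 + (6 * P.r + 6 * P.s + 6 * P.l + 14 * q + 6 * P.g + 150 + (1 +
        (12 * (P.R * P.m) + 10 + (1 + (6 * (P.L * P.Z) + 3 + (P.L * (P.arrangeTime + 4) + 12 +
        P.goodTime (11 * P.n * P.R))))))) : ℕ) : ℝ≥0∞) ≤ (P.mainTime q : ℕ) := by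
      rw [Nat.cast_le]
      simp only [Params.mainTime]
      omega
    refine le_trans (le_of_eq ?_) (add_le_add (add_le_add (add_le_add h3 le_rfl) hD₁) le_rfl)
    push_cast
    ring

/-! ### Probabilities of bad random words -/

/-- The average of the indicator of an event, scaled by `c`. -/
theorem avgWords_ite_le {N c D : ℕ} (E : (Fin N → BitVec w) → Prop) [DecidablePred E]
    (h : c * (Finset.univ.filter E).card ≤ D * (2 ^ w) ^ N) :
    avgWords w N (fun ω => if E ω then (c : ℝ≥0∞) else 0) ≤ D := by
  unfold avgWords
  refine ENNReal.div_le_of_le_mul ?_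
  rw [Finset.sum_ite, Finset.sum_const, Finset.sum_const_zero, add_zero, nsmul_eq_mul, mul_comm]
  exact_mod_cast h

/-- Half of all words have even intersection with a nonzero word. -/
theorem card_par_eq_zero {z : BitVec w} (hz : z ≠ 0) :
    (Finset.univ.filter fun y : BitVec w => par (y &&& z) = 0).card * 2 = 2 ^ w := by
  obtain ⟨i, hi, hzi⟩ : ∃ i, i < w ∧ z.getLsbD i = true := by
    by_contra hcon
    push Not at hcon
    refine hz (BitVec.eq_of_getLsbD_eq fun i hi => ?_)
    simpa using hcon i hi
  have hand : BitVec.twoPow w i &&& z = BitVec.twoPow w i := by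
    refine BitVec.eq_of_getLsbD_eq fun j hj => ?_
    rw [BitVec.getLsbD_and, BitVec.getLsbD_twoPow]
    by_cases hij : i = j
    · subst hij; simp [hzi]
    · simp [hij]
  have hflip : ∀ y : BitVec w, par ((y ^^^ BitVec.twoPow w i) &&& z) = (par (y &&& z) + 1) % 2 := by
    intro y
    have : (y ^^^ BitVec.twoPow w i) &&& z = (y &&& z) ^^^ BitVec.twoPow w i := by
      rw [← hand]
      ext j hj
      simp only [BitVec.getElem_and, BitVec.getElem_xor]
      cases y[j] <;> cases z[j] <;> simp
    rw [this, par_xor, par_twoPow hi]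
  have hcard : (Finset.univ.filter fun y : BitVec w => par (y &&& z) = 0).card =
      (Finset.univ.filter fun y : BitVec w => ¬ par (y &&& z) = 0).card := by
    refine Finset.card_bij' (fun y _ => y ^^^ BitVec.twoPow w i)
      (fun y _ => y ^^^ BitVec.twoPow w i) ?_ ?_ ?_ ?_
    · intro y hy
      simp only [Finset.mem_filter, Finset.mem_univ, true_and] at hy ⊢
      rw [hflip, hy]; norm_num
    · intro y hy
      simp only [Finset.mem_filter, Finset.mem_univ, true_and] at hy ⊢
      have := par_lt (y &&& z)
      rw [hflip, show par (y &&& z) = 1 by omega]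
    · intro y _; simp
    · intro y _; simp
  have htot := Finset.card_filter_add_card_filter_not (s := (Finset.univ : Finset (BitVec w)))
    (fun y => par (y &&& z) = 0)
  rw [Finset.card_univ, card_bitVec] at htot
  omega

theorem hash_tape_eq_zero_iff {Z b : ℕ} (hb : b ≤ Z) (β : Fin Z → BitVec w) (z : BitVec w) :
    hash (tape β) b z = 0 ↔ ∀ i : Fin Z, i.val < b → par (β i &&& z) = 0 := by
  rw [hash_eq_zero_iff]
  constructor
  · intro h i hi
    have := h i hi
    rwa [tape, dif_pos i.2] at this
  · intro h i hi
    rw [tape, dif_pos (hi.trans_le hb)]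
    exact h ⟨i, _⟩ hi

/-- A nonzero word has hash value zero with probability `2 ^ (-b)`. -/
theorem card_hash_eq_zero {Z b : ℕ} (hb : b ≤ Z) {z : BitVec w} (hz : z ≠ 0) :
    (Finset.univ.filter fun β : Fin Z → BitVec w => hash (tape β) b z = 0).card * 2 ^ b =
      (2 ^ w) ^ Z := by
  have hset : (Finset.univ.filter fun β : Fin Z → BitVec w => hash (tape β) b z = 0) =
      Fintype.piFinset fun i : Fin Z => if i.val < b then
        Finset.univ.filter fun y : BitVec w => par (y &&& z) = 0 else Finset.univ := by
    ext β
    simp only [Finset.mem_filter, Finset.mem_univ, true_and, hash_tape_eq_zero_iff hb,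
      Fintype.mem_piFinset]
    refine forall_congr' fun i => ?_
    by_cases hi : i.val < b <;> simp [hi]
  have h2 : (2 : ℕ) ^ b = ∏ i : Fin Z, if i.val < b then 2 else 1 := by
    rw [Fin.prod_univ_eq_prod_range (fun i => if i < b then 2 else 1) Z, Finset.prod_ite,
      Finset.prod_const, Finset.prod_const_one, mul_one]
    congr 1
    have : (Finset.range Z).filter (· < b) = Finset.range b := by
      ext i; simp only [Finset.mem_filter, Finset.mem_range]; omega
    rw [this, Finset.card_range]
  rw [hset, Fintype.card_piFinset, h2, ← Finset.prod_mul_distrib]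
  rw [Finset.prod_congr rfl (g := fun _ => 2 ^ w), Finset.prod_const, Finset.card_univ,
    Fintype.card_fin]
  intro i _
  by_cases hi : i.val < b
  · simp only [hi, if_true]
    exact card_par_eq_zero hz
  · simp only [hi, if_false, mul_one]
    rw [Finset.card_univ, card_bitVec]

/-- The `u`-th block of a sequence of words. -/
def block {L Z : ℕ} (ω : Fin (L * Z) → BitVec w) (u : Fin L) (i : Fin Z) : BitVec w :=
  ω (finProdFinEquiv (u, i))

/-- The blocks are independent. -/
theorem card_forall_block {L Z : ℕ} (E : (Fin Z → BitVec w) → Prop) [DecidablePred E]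
    [DecidablePred fun ω : Fin (L * Z) → BitVec w => ∀ u, E (block ω u)] :
    (Finset.univ.filter fun ω : Fin (L * Z) → BitVec w => ∀ u, E (block ω u)).card =
      (Finset.univ.filter E).card ^ L := by
  have h := Fintype.card_piFinset (fun _ : Fin L => Finset.univ.filter E)
  rw [Finset.prod_const, Finset.card_univ, Fintype.card_fin] at h
  rw [← h]
  refine Finset.card_equiv ((Equiv.arrowCongr finProdFinEquiv.symm (Equiv.refl _)).trans
    (Equiv.curry (Fin L) (Fin Z) (BitVec w))) fun ω => ?_
  simp only [Finset.mem_filter, Finset.mem_univ, true_and, Fintype.mem_piFinset]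
  rfl

theorem hashFn_tape_block {P : Params} (ω : Fin (P.L * P.Z) → BitVec w) {b : ℕ} (hb : b ≤ P.Z)
    (u : Fin P.L) : P.hashFn (tape ω) b u = hash (tape (block ω u)) b := by
  funext x
  refine hash_congr (fun i hi => ?_) x
  have : u * P.Z + i < P.L * P.Z := by
    calc u * P.Z + i < (u + 1) * P.Z := by rw [add_mul, one_mul]; omega
      _ ≤ P.L * P.Z := Nat.mul_le_mul_right _ u.2
  rw [tape, tape, dif_pos this, dif_pos (hi.trans_le hb), block]
  congr 1
  ext
  simp only [finProdFinEquiv_apply_val]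
  ring

theorem two_mul_collisions_le {X : List (BitVec w)} (hX : X.Nodup) (h : BitVec w → ℕ) (k : ℕ) :
    2 * collisions X h k ≤ (X.toFinset.offDiag.filter fun p => h p.1 = h p.2).card := by
  have hb : ∀ b, (bucket X h b).length = (X.toFinset.filter fun x => h x = b).card := by
    intro b
    have : (X.toFinset.filter fun x => h x = b) = (bucket X h b).toFinset := by
      ext x; simp [bucket]
    rw [this]
    exact (List.toFinset_card_of_nodup (hX.filter _)).symm
  have hsub : (Finset.range k).biUnion
      (fun b => (X.toFinset.filter fun x => h x = b).offDiag) ⊆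
      X.toFinset.offDiag.filter fun p => h p.1 = h p.2 := by
    intro p hp
    simp only [Finset.mem_biUnion, Finset.mem_offDiag, Finset.mem_filter] at hp ⊢
    obtain ⟨b, -, ⟨h1, h2⟩, ⟨h3, h4⟩, h5⟩ := hp
    exact ⟨⟨h1, h3, h5⟩, h2.trans h4.symm⟩
  refine le_trans (le_of_eq ?_) (Finset.card_le_card hsub)
  rw [Finset.card_biUnion, collisions, Finset.mul_sum]
  · refine Finset.sum_congr rfl fun b _ => ?_
    rw [Finset.offDiag_card, ← hb, Nat.choose_two_right,
      Nat.mul_div_cancel' (Nat.even_mul_pred_self _).two_dvd, Nat.mul_sub_one]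
  · intro b _ b' _ hbb
    rw [Function.onFun, Finset.disjoint_left]
    intro p hp hp'
    simp only [Finset.mem_offDiag, Finset.mem_filter] at hp hp'
    exact hbb (hp.1.2.symm.trans hp'.1.2)

open Classical in
/-- By Markov's inequality, a random hash function has few collisions with probability at least
one half. -/
theorem card_many_collisions {Z r m : ℕ} {X : List (BitVec w)} (hX : X.Nodup)
    (h0 : 0 < X.length) (hm : 0 < m) (hr : r ≤ Z) (hn : X.length ≤ 2 ^ r * m) :
    (Finset.univ.filter fun β : Fin Z → BitVec w =>
      X.length * m < collisions X (hash (tape β) r) (2 ^ r)).card * 2 ≤ (2 ^ w) ^ Z := by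
  set n := X.length with hnX
  set bad := Finset.univ.filter fun β : Fin Z → BitVec w =>
    n * m < collisions X (hash (tape β) r) (2 ^ r) with hbad
  have hF : X.toFinset.card = n := List.toFinset_card_of_nodup hX
  have h1 : bad.card * (n * m) ≤
      ∑ β : Fin Z → BitVec w, collisions X (hash (tape β) r) (2 ^ r) := by
    rw [← smul_eq_mul, ← Finset.sum_const]
    calc ∑ _β ∈ bad, n * m ≤ ∑ β ∈ bad, collisions X (hash (tape β) r) (2 ^ r) :=
          Finset.sum_le_sum fun β hβ => (Finset.mem_filter.1 hβ).2.le
      _ ≤ _ := Finset.sum_le_sum_of_subset (Finset.subset_univ _)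
  have h2 : (∑ β : Fin Z → BitVec w, collisions X (hash (tape β) r) (2 ^ r)) * (2 * 2 ^ r) ≤
      n * n * (2 ^ w) ^ Z := by
    calc (∑ β : Fin Z → BitVec w, collisions X (hash (tape β) r) (2 ^ r)) * (2 * 2 ^ r)
        = (∑ β : Fin Z → BitVec w, 2 * collisions X (hash (tape β) r) (2 ^ r)) * 2 ^ r := by
          rw [← Finset.mul_sum]; ring
      _ ≤ (∑ β : Fin Z → BitVec w, (X.toFinset.offDiag.filter fun p =>
            hash (tape β) r p.1 = hash (tape β) r p.2).card) * 2 ^ r :=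
          Nat.mul_le_mul_right _ (Finset.sum_le_sum fun β _ => two_mul_collisions_le hX _ _)
      _ = (∑ p ∈ X.toFinset.offDiag, (Finset.univ.filter fun β : Fin Z → BitVec w =>
            hash (tape β) r p.1 = hash (tape β) r p.2).card) * 2 ^ r := by
          congr 1
          simp only [Finset.card_filter]
          exact Finset.sum_comm
      _ = ∑ p ∈ X.toFinset.offDiag, (2 ^ w) ^ Z := by
          rw [Finset.sum_mul]
          refine Finset.sum_congr rfl fun p hp => ?_
          have hz : p.1 ^^^ p.2 ≠ 0 := fun h =>
            (Finset.mem_offDiag.1 hp).2.2 (BitVec.xor_eq_zero_iff.1 h)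
          rw [← card_hash_eq_zero hr hz]
          congr 3
          funext β
          rw [hash_xor, Nat.xor_eq_zero_iff]
      _ ≤ n * n * (2 ^ w) ^ Z := by
          rw [Finset.sum_const, smul_eq_mul, Finset.offDiag_card, hF]
          exact Nat.mul_le_mul_right _ (Nat.sub_le _ _)
  have h3 : bad.card * 2 * (n * (2 ^ r * m)) ≤ (2 ^ w) ^ Z * (n * (2 ^ r * m)) := by
    calc bad.card * 2 * (n * (2 ^ r * m)) = bad.card * (n * m) * (2 * 2 ^ r) := by ring
      _ ≤ n * n * (2 ^ w) ^ Z := (Nat.mul_le_mul_right _ h1).trans h2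
      _ ≤ n * (2 ^ r * m) * (2 ^ w) ^ Z := Nat.mul_le_mul_right _ (Nat.mul_le_mul_left _ hn)
      _ = _ := by ring
  exact Nat.le_of_mul_le_mul_right h3 (by positivity)

open Classical in
/-- With high probability one of the hash functions has few collisions. -/
theorem avgWords_bad_le {P : Params} {X : List (BitVec w)} {c D : ℕ} (hX : X.Nodup)
    (hlen : X.length = P.n) (h0 : 0 < P.n) (hn : P.n ≤ P.R * P.m) (hc : c ≤ D * 2 ^ P.L) :
    avgWords w (P.L * P.Z) (fun ω => if ∀ u < P.L, P.n * P.m <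
      collisions X (P.hashFn (tape ω) P.r u) P.R then (c : ℝ≥0∞) else 0) ≤ D := by
  refine avgWords_ite_le _ ?_
  have hrZ : P.r ≤ P.Z := by simp only [Params.Z]; omega
  have hcard := card_many_collisions (Z := P.Z) hX (hlen ▸ h0) P.m_pos hrZ (hlen ▸ hn)
  set E : (Fin P.Z → BitVec w) → Prop :=
    fun β => X.length * P.m < collisions X (hash (tape β) P.r) (2 ^ P.r)
  have hset : (Finset.univ.filter fun ω : Fin (P.L * P.Z) → BitVec w => ∀ u < P.L, P.n * P.m <
      collisions X (P.hashFn (tape ω) P.r u) P.R) =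
      Finset.univ.filter fun ω => ∀ u, E (block ω u) := by
    ext ω
    simp only [Finset.mem_filter, Finset.mem_univ, true_and, E]
    constructor
    · intro h u
      rw [hlen, ← hashFn_tape_block ω hrZ u]
      exact h u u.2
    · intro h u hu
      have := h ⟨u, hu⟩
      rw [hlen, ← hashFn_tape_block ω hrZ] at this
      exact this
  rw [hset, card_forall_block E]
  calc c * (Finset.univ.filter E).card ^ P.L
      ≤ D * 2 ^ P.L * (Finset.univ.filter E).card ^ P.L := Nat.mul_le_mul_right _ hc
    _ = D * ((Finset.univ.filter E).card * 2) ^ P.L := by rw [mul_pow]; ring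
    _ ≤ D * ((2 ^ w) ^ P.Z) ^ P.L := Nat.mul_le_mul_left _ (Nat.pow_le_pow_left hcard _)
    _ = D * (2 ^ w) ^ (P.L * P.Z) := by rw [← pow_mul, mul_comm P.L]

open Classical in
/-- By the union bound, a test of chunks without a solution passes for a random hash function with
probability at most a quarter. -/
theorem card_survives {P : Params} {S : ℕ → BitVec w} {q : BitVec w × ℕ × ℕ} :
    (Finset.univ.filter fun β : Fin P.Z → BitVec w =>
      (∀ i < P.m, ∀ j < P.m, S (q.2.1 * P.m + i) ^^^ S (q.2.2 * P.m + j) ≠ q.1) ∧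
      ∃ i < P.m, ∃ j < P.m, hash (tape β) (2 * P.s + 2)
        (S (q.2.1 * P.m + i) ^^^ S (q.2.2 * P.m + j) ^^^ q.1) = 0).card * 4 ≤ (2 ^ w) ^ P.Z := by
  by_cases hq : ∀ i < P.m, ∀ j < P.m, S (q.2.1 * P.m + i) ^^^ S (q.2.2 * P.m + j) ≠ q.1
  swap
  · simp [hq]
  set z : ℕ × ℕ → BitVec w := fun p => S (q.2.1 * P.m + p.1) ^^^ S (q.2.2 * P.m + p.2) ^^^ q.1
  have hb : 2 * P.s + 2 ≤ P.Z := by simp only [Params.Z]; omega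
  set I := Finset.range P.m ×ˢ Finset.range P.m
  have hsub : (Finset.univ.filter fun β : Fin P.Z → BitVec w =>
      (∀ i < P.m, ∀ j < P.m, S (q.2.1 * P.m + i) ^^^ S (q.2.2 * P.m + j) ≠ q.1) ∧
      ∃ i < P.m, ∃ j < P.m, hash (tape β) (2 * P.s + 2)
        (S (q.2.1 * P.m + i) ^^^ S (q.2.2 * P.m + j) ^^^ q.1) = 0) ⊆
      I.biUnion fun p => Finset.univ.filter fun β => hash (tape β) (2 * P.s + 2) (z p) = 0 := by
    intro β hβ
    simp only [Finset.mem_filter, Finset.mem_univ, true_and, Finset.mem_biUnion, I,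
      Finset.mem_product, Finset.mem_range] at hβ ⊢
    obtain ⟨-, i, hi, j, hj, h⟩ := hβ
    exact ⟨(i, j), ⟨hi, hj⟩, h⟩
  have h1 := (Finset.card_le_card hsub).trans Finset.card_biUnion_le
  have h2 : (∑ p ∈ I, (Finset.univ.filter fun β : Fin P.Z → BitVec w =>
      hash (tape β) (2 * P.s + 2) (z p) = 0).card) * 2 ^ (2 * P.s + 2) =
      P.m * P.m * (2 ^ w) ^ P.Z := by
    rw [Finset.sum_mul, Finset.sum_congr rfl (g := fun _ => (2 ^ w) ^ P.Z), Finset.sum_const,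
      Finset.card_product, Finset.card_range, smul_eq_mul]
    intro p hp
    simp only [I, Finset.mem_product, Finset.mem_range] at hp
    refine card_hash_eq_zero hb fun h => hq _ hp.1 _ hp.2 (BitVec.xor_eq_zero_iff.1 h)
  have h4 : 2 ^ (2 * P.s + 2) = 4 * (P.m * P.m) := by simp only [Params.m]; ring
  have hm := P.m_pos
  refine Nat.le_of_mul_le_mul_right (c := P.m * P.m) ?_ (by positivity)
  calc _ = _ * 2 ^ (2 * P.s + 2) := by rw [h4, mul_assoc]
    _ ≤ _ := Nat.mul_le_mul_right _ h1
    _ = _ := by rw [h2, mul_comm]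

open Classical in
/-- With high probability no test passes wrongly. -/
theorem avgWords_falseSurvivor_le {P : Params} {S : ℕ → BitVec w}
    {qs : List (BitVec w × ℕ × ℕ)} {c D : ℕ} (hc : qs.length * c ≤ D * 4 ^ P.L) :
    avgWords w (P.L * P.Z) (fun ω => if P.FalseSurvivor S (tape ω) qs then (c : ℝ≥0∞) else 0)
      ≤ D := by
  refine avgWords_ite_le _ ?_
  have hb : 2 * P.s + 2 ≤ P.Z := by simp only [Params.Z]; omega
  set E : BitVec w × ℕ × ℕ → (Fin P.Z → BitVec w) → Prop := fun q β =>
    (∀ i < P.m, ∀ j < P.m, S (q.2.1 * P.m + i) ^^^ S (q.2.2 * P.m + j) ≠ q.1) ∧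
      ∃ i < P.m, ∃ j < P.m, hash (tape β) (2 * P.s + 2)
        (S (q.2.1 * P.m + i) ^^^ S (q.2.2 * P.m + j) ^^^ q.1) = 0 with hE
  set M := (2 ^ w) ^ P.Z / 4 with hM
  have hsub : (Finset.univ.filter fun ω : Fin (P.L * P.Z) → BitVec w =>
      P.FalseSurvivor S (tape ω) qs) ⊆
      qs.toFinset.biUnion fun q => Finset.univ.filter fun ω => ∀ u, E q (block ω u) := by
    intro ω hω
    simp only [Finset.mem_filter, Finset.mem_univ, true_and, Finset.mem_biUnion,
      List.mem_toFinset] at hω ⊢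
    obtain ⟨q, hq, h1, h2⟩ := hω
    refine ⟨q, hq, fun u => ⟨h1, ?_⟩⟩
    have := h2 u u.2
    rwa [hashFn_tape_block ω hb] at this
  have hcard : (Finset.univ.filter fun ω : Fin (P.L * P.Z) → BitVec w =>
      P.FalseSurvivor S (tape ω) qs).card ≤ qs.length * M ^ P.L := by
    refine (Finset.card_le_card hsub).trans ((Finset.card_biUnion_le_card_mul _ _ (M ^ P.L)
      fun q _ => ?_).trans (Nat.mul_le_mul_right _ (List.toFinset_card_le _)))
    rw [card_forall_block (E q)]
    refine Nat.pow_le_pow_left ?_ _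
    rw [hM, Nat.le_div_iff_mul_le (by norm_num)]
    exact card_survives
  calc c * _ ≤ c * (qs.length * M ^ P.L) := Nat.mul_le_mul_left _ hcard
    _ = qs.length * c * M ^ P.L := by ring
    _ ≤ D * 4 ^ P.L * M ^ P.L := Nat.mul_le_mul_right _ hc
    _ = D * (M * 4) ^ P.L := by rw [mul_pow]; ring
    _ ≤ D * ((2 ^ w) ^ P.Z) ^ P.L :=
        Nat.mul_le_mul_left _ (Nat.pow_le_pow_left (Nat.div_mul_le_self _ _) _)
    _ = D * (2 ^ w) ^ (P.L * P.Z) := by rw [← pow_mul, mul_comm P.L]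

/-! ### The whole reduction -/

/-- Compute the number of elements divided by `2 ^ j` in register `105`, and set up the constants
and the input of the program for powers. -/
def initProg (j : ℕ) : Program :=
  blk [.const rOne 1, .op .add rN 1 rZero, .op .add 2 rW rZero, .op .add 5 1 rZero,
    .op .add rTmp 1 rZero] ;;
  blk (List.replicate j (.op .shr rTmp rTmp rOne))

/-- The algorithm for 3XOR that calls the algorithm `p` for offline SetDisjointness and the program
`pw` for powers. Inputs with fewer than `2 ^ j` elements are solved by brute force. -/
def reduction (p pw : Program) (j : ℕ) : Program :=
  initProg j ;; .ite (.eq rTmp rZero) bruteProg (pw.rename (copy 2) ;; mainProg p)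

theorem execs_shr (j : ℕ) {x : ℕ} (hx : x < 2 ^ w) {s : State w} (hw : 0 < w)
    (h1 : s.reg rOne = BitVec.ofNat w 1) (h : s.reg rTmp = BitVec.ofNat w x) :
    (execs (List.replicate j (.op .shr rTmp rTmp rOne)) s).reg rTmp =
      BitVec.ofNat w (x / 2 ^ j) := by
  induction j generalizing x s with
  | zero => simpa [execs] using h
  | succ j ih =>
    rw [List.replicate_succ, execs, ih (x := x / 2) (by omega)]
    · rw [Nat.div_div_eq_div_mul, pow_succ']
    · simpa [Instr.run] using h1
    · have h1w : 1 < 2 ^ w := Nat.one_lt_two_pow hw.ne'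
      have hx2 := ofNat_shr hx h1w
      rw [pow_one] at hx2
      simp only [Instr.run, BinOp.eval, reg_setReg, if_true, h, h1, hx2]

theorem frame_shr (j : ℕ) {s s' : State w}
    (hf : Frame (blk (List.replicate j (.op .shr rTmp rTmp rOne))) s s') :
    (∀ r ≠ rTmp, s'.reg r = s.reg r) ∧ ∀ b, s'.mem b = s.mem b := by
  have hr : ∀ r ≠ rTmp, (blk (List.replicate j (.op .shr rTmp rTmp rOne))).writesReg r = false := by
    intro r hr
    clear hf
    induction j with
    | zero => rfl
    | succ j ih =>
      simp only [List.replicate_succ, blk, Program.writesReg, Instr.writesReg,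
        Bool.or_eq_false_iff, beq_eq_false_iff]
      exact ⟨hr.symm, ih⟩
  have hm : ∀ b, (blk (List.replicate j (.op .shr rTmp rTmp rOne))).writesMem b = false := by
    intro b
    clear hf hr
    induction j with
    | zero => rfl
    | succ j ih =>
      simp only [List.replicate_succ, blk, Program.writesMem, Instr.writesMem, Bool.false_or]
      exact ih
  exact ⟨fun r h => hf.reg r (hr r h), fun b => hf.mem b (hm b)⟩

theorem bruteTime_le {n : ℕ} (hn : 1 ≤ n) : bruteTime n ≤ 53 * n ^ 3 := by
  have h1 : n ≤ n ^ 3 := Nat.le_self_pow (by norm_num) n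
  have h2 : n ^ 2 ≤ n ^ 3 := Nat.pow_le_pow_right hn (by norm_num)
  have : bruteTime n = 11 * n ^ 3 + 12 * n ^ 2 + 10 * n + 20 := by simp only [bruteTime]; ring
  omega

/-- The parameters `P` are those that the reduction computes from the approximation `v` of
`n ^ γ`. -/
structure Params.Computed (P : Params) (w n v q : ℕ) : Prop where
  n_eq : P.n = n
  logR : IsLog 1 v P.r
  logM : IsLog P.R P.n P.s
  logN : IsLog 1 P.n P.l
  logW : IsLog 1 w q
  logG : IsLog 1 (q + 1) P.g

theorem Params.Computed.pow_le {P : Params} {n v q : ℕ} (h : P.Computed w n v q) :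
    n ^ 4 ≤ 2 ^ P.L := by
  have := h.logN.1
  rw [one_mul, h.n_eq] at this
  calc n ^ 4 ≤ (2 ^ P.l) ^ 4 := Nat.pow_le_pow_left this 4
    _ = 2 ^ P.L := by rw [← pow_mul, mul_comm, Params.L]

/-- Correctness and expected time of the reduction. `good` is what is known about the
approximation of `n ^ γ`, and `W` and `Tm` bound the times of the call and of the rest of the
reduction. -/
theorem reduction_spec {n j : ℕ} {X : List (BitVec w)} {p pw : Program} {good : ℕ → Prop}
    {W : ℝ≥0∞} {Tm : ℕ} (hw : 0 < w) (hX : X.length = n) (hnd : X.Nodup) (hn : n ^ 2 ≤ 2 ^ w)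
    (hpw : 2 ^ j ≤ n → HaltsWith pw (initState w [w, n] []) fun s => good (s.reg 0).toNat)
    (hmain : 2 ^ j ≤ n → ∀ v < 2 ^ w, good v → ∃ P : Params, ∃ q, P.Computed w n v q ∧ P.Fits w ∧
      P.R * P.m ≤ 2 * n ∧ P.CallOk w p W ∧ P.mainTime q ≤ Tm) :
    Ok ([reduction p pw j], initState w [w, n] [X.map BitVec.toNat])
      (fun s' => s'.reg 0 ≠ 0 ↔ ∃ a ∈ X, ∃ b ∈ X, ∃ c ∈ X, a ^^^ b = c)
      (if 2 ^ j ≤ n then expectedTime pw (initState w [w, n] []) + W + (Tm + 2 * j + 2000 : ℕ)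
        else (bruteTime n + 2 * j + 2000 : ℕ)) := by
  have h1w : 1 < 2 ^ w := Nat.one_lt_two_pow hw.ne'
  have hnw : n < 2 ^ w := by
    rcases Nat.lt_or_ge n 2 with h | h
    · omega
    · nlinarith
  set s₀ := initState w [w, n] [X.map BitVec.toNat] with hs₀
  have hin : ∀ k < X.length, s₀.mem bX (BitVec.ofNat w k) = X.getD k 0 := by
    intro k hk
    have : (X.map BitVec.toNat).getD k 0 = (X[k]).toNat := by
      rw [List.getD_eq_getElem _ _ (by simpa using hk), List.getElem_map]
    rw [List.getD_eq_getElem _ _ hk]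
    change BitVec.ofNat w ((X.map BitVec.toNat).getD (BitVec.ofNat w k).toNat 0) = _
    rw [toNat_ofNat_of_lt (by omega), this, BitVec.ofNat_toNat, BitVec.setWidth_eq]
  have hz : ∀ i, 2 ≤ i → s₀.reg i = BitVec.ofNat w 0 := fun i hi => by
    change BitVec.ofNat w ([w, n].getD i 0) = _
    rw [List.getD_eq_default _ _ (by simpa using hi)]
  have hm : ∀ b, 1 ≤ b → s₀.mem b = bank [] := fun b hb => by
    change bank ([X.map BitVec.toNat].getD b []) = _
    rw [List.getD_eq_default _ _ (by simpa using hb)]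
  have hinit : Det (initProg j) s₀ (2 * j + 13) fun s => s.reg rTmp = BitVec.ofNat w (n / 2 ^ j) ∧
      s.reg rOne = BitVec.ofNat w 1 ∧ s.reg rZero = BitVec.ofNat w 0 ∧
      s.reg rW = BitVec.ofNat w w ∧ s.reg rN = BitVec.ofNat w n ∧ s.reg 2 = BitVec.ofNat w w ∧
      s.reg 5 = BitVec.ofNat w n ∧ (∀ i, 5 < i → i ≠ rOne → i ≠ rTmp → s.reg i = 0) ∧
      ∀ b, s.mem b = s₀.mem b := by
    refine (Det.seq (T₁ := 11) (T₂ := 2 * j + 1) (Q := fun s => s.reg rTmp = BitVec.ofNat w n ∧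
      s.reg rOne = BitVec.ofNat w 1 ∧ s.reg rZero = BitVec.ofNat w 0 ∧
      s.reg rW = BitVec.ofNat w w ∧ s.reg rN = BitVec.ofNat w n ∧ s.reg 2 = BitVec.ofNat w w ∧
      s.reg 5 = BitVec.ofNat w n ∧ (∀ i, 5 < i → i ≠ rOne → i ≠ rTmp → s.reg i = 0) ∧
      ∀ b, s.mem b = s₀.mem b) (Det.blk ?_) ?_).le (by omega)
    · have e0 : s₀.reg rW = BitVec.ofNat w w := rfl
      have e1 : s₀.reg 1 = BitVec.ofNat w n := rfl
      have e9 : s₀.reg rZero = BitVec.ofNat w 0 := hz _ (by norm_num)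
      simp only [execs, Instr.run, BinOp.eval, reg_setReg, mem_setReg]
      simp only [if_true, Nat.reduceEqDiff, if_false, e0, e1, e9, BitVec.ofNat_add_ofNat, add_zero,
        OfNat.zero_ne_ofNat]
      refine ⟨trivial, trivial, trivial, trivial, trivial, trivial, trivial, fun i h5 h6 h105 => ?_,
        fun _ => trivial⟩
      rw [if_neg h105, if_neg (by omega), if_neg (by omega), if_neg (by omega), if_neg h6]
      exact hz i (by omega)
    · rintro s hf ⟨a1, a2, a3, a4, a5, a6, a7, a8, a9⟩
      refine (Det.blk (Q := fun s => s.reg rTmp = BitVec.ofNat w (n / 2 ^ j))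
        (execs_shr j hnw hw a2 a1) (by simp [Instr.isDet])).mono (by simp) ?_
      intro s' hf' h'
      obtain ⟨f1, f2⟩ := frame_shr j hf'
      exact ⟨h', (f1 _ (by norm_num)).trans a2, (f1 _ (by norm_num)).trans a3,
        (f1 _ (by norm_num)).trans a4, (f1 _ (by norm_num)).trans a5,
        (f1 _ (by norm_num)).trans a6, (f1 _ (by norm_num)).trans a7,
        fun i h5 h6 h105 => (f1 _ h105).trans (a8 i h5 h6 h105), fun b => (f2 b).trans (a9 b)⟩
  split_ifs with hj
  · refine Ok.mono (T := _) (Ok.seq (hinit.ok (T' := 1 + (1 + (expectedTime pw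
      (initState w [w, n] []) + (Tm + W + (53 : ℕ) + (1166 : ℕ))))) ?_)) ?_
    · rintro s₁ - ⟨a105, a6, a9, a0, a3, a2, a5, az, am⟩
      have htest : (Test.eq rTmp rZero).eval s₁ = decide (n / 2 ^ j = 0) :=
        eval_eq_ofNat a105 a9 ((Nat.div_le_self _ _).trans_lt hnw) (by positivity)
      have hne : n / 2 ^ j ≠ 0 := (Nat.div_pos hj (by positivity)).ne'
      refine Ok.ite (fun h => by simp [htest] at h; omega) (fun _ => Ok.seq ?_)
      refine Ok.call_rename (by norm_num) (hpw hj) ?_ ?_ ?_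
      · intro i
        rcases i with _ | _ | i
        · exact a2
        · exact a5
        · change s₁.reg (3 * (i + 2) + 2) = BitVec.ofNat w 0
          exact az _ (by omega) (by omega) (by omega)
      · intro i
        rw [am, hm _ (by simp only [copy]; omega)]
        rfl
      · intro s' hv
        obtain ⟨P, q, hcomp, hfit, hRm, hcall, htime⟩ := hmain hj _ (BitVec.isLt _) hv
        have hPn := hcomp.n_eq
        have hpow := hcomp.pow_le
        have hn1 : 1 ≤ n := le_trans Nat.one_le_two_pow hj
        have hbr : bruteTime P.n ≤ 53 * n ^ 3 := by
          rw [hPn]; exact bruteTime_le hn1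
        have hreg : ∀ r, r % 3 ≠ 2 → (State.embed 2 s₁ s').reg r = s₁.reg r := fun r hr => by
          simp [State.embed, hr]
        have hmem : ∀ r, r % 3 ≠ 2 → (State.embed 2 s₁ s').mem r = s₁.mem r := fun r hr => by
          simp [State.embed, hr]
        refine (mainProg_spec (D₁ := (53 : ℕ)) (D₂ := (1166 : ℕ)) hfit hcomp.logR hcomp.logM
          hcomp.logN hcomp.logW hcomp.logG (BitVec.isLt (s'.reg 0))
          ((hreg _ (by norm_num)).trans a6) ((hreg _ (by norm_num)).trans a9)
          ((hreg _ (by norm_num)).trans a0) ?_ ?_ (hX.trans hPn.symm) ?_ ?_ hcall ?_ ?_).mono ?_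
        · rw [hreg _ (by norm_num), a3, hPn]
        · rw [BitVec.ofNat_toNat, BitVec.setWidth_eq]
          exact embed_reg_copy (by norm_num) s₁ s' 0
        · intro k hk
          rw [hmem _ (by norm_num), am, hin k hk]
        · refine ⟨fun i hi => ?_, fun i => ?_, ?_, ?_⟩
          · rw [hreg _ (by simp only [copy]; omega)]
            exact az _ (by simp only [copy]; omega) (by simp only [copy]; omega)
              (by simp only [copy]; omega)
          · rw [hmem _ (by simp only [copy]; omega), am, hm _ (by simp only [copy]; omega)]
          · rw [hmem _ (by norm_num), am, hm _ (by norm_num)]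
          · rw [hmem _ (by norm_num), am, hm _ (by norm_num)]
        · refine avgWords_bad_le hnd (hX.trans hPn.symm) (by omega) hfit.n_le ?_
          refine hbr.trans (Nat.mul_le_mul_left _ (le_trans ?_ hpow))
          exact Nat.pow_le_pow_right hn1 (by norm_num)
        · intro S qs hqs
          refine avgWords_falseSurvivor_le ?_
          have hR : P.R ≤ 2 * n := (Nat.le_mul_of_pos_right _ P.m_pos).trans hRm
          calc qs.length * bruteTime P.n ≤ (11 * n * (2 * n)) * (53 * n ^ 3) := by
                refine Nat.mul_le_mul (hqs.trans ?_) hbr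
                rw [hPn]
                exact Nat.mul_le_mul_left _ hR
            _ = 1166 * n ^ 5 := by ring
            _ ≤ 1166 * n ^ 8 := Nat.mul_le_mul_left _ (Nat.pow_le_pow_right hn1 (by norm_num))
            _ = 1166 * (n ^ 4 * n ^ 4) := by ring
            _ ≤ 1166 * (2 ^ P.L * 2 ^ P.L) := Nat.mul_le_mul_left _ (Nat.mul_le_mul hpow hpow)
            _ = 1166 * 4 ^ P.L := by rw [← mul_pow]; norm_num
        · gcongr
    · have h3 : ((1 + (2 * j + 13) + 1 + 1 + Tm + 53 + 1166 : ℕ) : ℝ≥0∞) ≤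
          (Tm + 2 * j + 2000 : ℕ) := by
        rw [Nat.cast_le]; omega
      refine le_trans (le_of_eq ?_) (add_le_add le_rfl h3)
      push_cast
      ring
  · refine Ok.mono (T := _) (Ok.seq (hinit.ok (T' := 1 + ((bruteTime n : ℕ) + 0)) ?_)) ?_
    · rintro s₁ - ⟨a105, a6, a9, a0, a3, a2, a5, az, am⟩
      have htest : (Test.eq rTmp rZero).eval s₁ = decide (n / 2 ^ j = 0) :=
        eval_eq_ofNat a105 a9 ((Nat.div_le_self _ _).trans_lt hnw) (by positivity)
      have hne : n / 2 ^ j = 0 := Nat.div_eq_of_lt (not_le.1 hj)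
      rw [hne] at htest
      refine Ok.ite (fun _ => ?_) (fun h => by simp [htest] at h)
      rw [← hX]
      exact (bruteProg_spec (hX ▸ hnw) hw a6 a9 (hX ▸ a3)
        (fun k hk => by rw [am, hin k hk])).ok fun s₂ _ h₂ => Ok.nil h₂
    · have h3 : ((1 + (2 * j + 13) + 1 + bruteTime n : ℕ) : ℝ≥0∞) ≤
          (bruteTime n + 2 * j + 2000 : ℕ) := by
        rw [Nat.cast_le]; omega
      refine le_trans (le_of_eq ?_) h3
      push_cast
      ring

/-! ### Growth of the parameters -/

/-- Logarithmic factors are absorbed by a larger exponent. -/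
theorem eventually_mul_log_lt (c : ℝ) {x y : ℝ} (hxy : x < y) (j : ℕ) :
    ∀ᶠ n : ℕ in atTop, c * ((n : ℝ) ^ x * Real.log n ^ j) < (n : ℝ) ^ y := by
  have h1 := (isLittleO_log_rpow_rpow_atTop (j : ℝ) (sub_pos.2 hxy)).comp_tendsto
    (tendsto_natCast_atTop_atTop (R := ℝ))
  have h2 := h1.def (c := 1 / (|c| + 1)) (by positivity)
  filter_upwards [h2, eventually_ge_atTop 1] with n hn hn1
  have hn0 : (0 : ℝ) < n := by exact_mod_cast hn1
  have hlog : 0 ≤ Real.log n := Real.log_nonneg (by exact_mod_cast hn1)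
  have hx : (0 : ℝ) < (n : ℝ) ^ x := by positivity
  have hd : (0 : ℝ) < (n : ℝ) ^ (y - x) := by positivity
  have hn' : Real.log n ^ j ≤ 1 / (|c| + 1) * (n : ℝ) ^ (y - x) := by
    simp only [Function.comp, Real.rpow_natCast, Real.norm_eq_abs] at hn
    rwa [abs_of_nonneg (pow_nonneg hlog j), abs_of_pos hd] at hn
  have hy : (n : ℝ) ^ y = (n : ℝ) ^ x * (n : ℝ) ^ (y - x) := by
    rw [← Real.rpow_add hn0]; congr 1; ring
  rw [hy]
  calc c * ((n : ℝ) ^ x * Real.log n ^ j) ≤ |c| * ((n : ℝ) ^ x * Real.log n ^ j) :=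
        mul_le_mul_of_nonneg_right (le_abs_self c) (by positivity)
    _ ≤ |c| * ((n : ℝ) ^ x * (1 / (|c| + 1) * (n : ℝ) ^ (y - x))) := by gcongr
    _ = (n : ℝ) ^ x * (n : ℝ) ^ (y - x) * (|c| / (|c| + 1)) := by ring
    _ < (n : ℝ) ^ x * (n : ℝ) ^ (y - x) * 1 := by
        refine mul_lt_mul_of_pos_left ?_ (by positivity)
        rw [div_lt_one (by positivity)]
        linarith
    _ = _ := mul_one _

/-- The sizes of the parameters in terms of `n`. -/
structure Params.Scaled (P : Params) (γ a b : ℝ) : Prop where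
  n_ge : 2 ≤ P.n
  R_ge : a * (P.n : ℝ) ^ γ ≤ P.R
  R_le : (P.R : ℝ) ≤ 2 * b * (P.n : ℝ) ^ γ
  Rm_ge : P.n ≤ P.R * P.m
  Rm_le : P.R * P.m ≤ 2 * P.n
  l_ge : Real.log P.n ≤ P.l
  l_le : (P.l : ℝ) ≤ 3 * Real.log P.n
  rs_le : P.r + P.s ≤ P.l

section Scaled
variable {P : Params} {γ a b : ℝ}

theorem Params.Scaled.n_pos (h : P.Scaled γ a b) : (0 : ℝ) < P.n := by
  have := h.n_ge
  exact_mod_cast (by omega : 0 < P.n)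

theorem Params.Scaled.log_pos (h : P.Scaled γ a b) : 0 < Real.log P.n :=
  Real.log_pos (by have := h.n_ge; exact_mod_cast (by omega : 1 < P.n))

theorem Params.Scaled.m_le (h : P.Scaled γ a b) (ha : 0 < a) :
    (P.m : ℝ) ≤ 2 / a * (P.n : ℝ) ^ (1 - γ) := by
  have hn := h.n_pos
  have h1 : a * (P.n : ℝ) ^ γ * P.m ≤ 2 * P.n :=
    (mul_le_mul_of_nonneg_right h.R_ge (by positivity)).trans (by exact_mod_cast h.Rm_le)
  have hγ : (0 : ℝ) < (P.n : ℝ) ^ γ := by positivity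
  rw [Real.rpow_sub hn, Real.rpow_one, div_mul_div_comm, le_div_iff₀ (by positivity)]
  linarith

theorem Params.Scaled.le_m (h : P.Scaled γ a b) (hb : 0 < b) :
    1 / (2 * b) * (P.n : ℝ) ^ (1 - γ) ≤ P.m := by
  have hn := h.n_pos
  have h1 : (P.n : ℝ) ≤ 2 * b * (P.n : ℝ) ^ γ * P.m := by
    refine le_trans ?_ (mul_le_mul_of_nonneg_right h.R_le (by positivity))
    exact_mod_cast h.Rm_ge
  have hγ : (0 : ℝ) < (P.n : ℝ) ^ γ := by positivity
  rw [Real.rpow_sub hn, Real.rpow_one, div_mul_div_comm, div_le_iff₀ (by positivity)]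
  linarith

theorem Params.Scaled.fam_ge (h : P.Scaled γ a b) :
    16 * (P.n * Real.log P.n) ≤ (P.fam : ℝ) := by
  have h1 : (P.n : ℝ) ≤ P.R * P.m := by exact_mod_cast h.Rm_ge
  have h2 := h.l_ge
  have h3 := h.log_pos
  have h4 := h.n_pos
  simp only [Params.fam, Params.L]
  push_cast
  nlinarith [mul_le_mul h1 h2 h3.le (by positivity)]

theorem Params.Scaled.fam_le (h : P.Scaled γ a b) :
    (P.fam : ℝ) ≤ 96 * (P.n * Real.log P.n) := by
  have h1 : (P.R * P.m : ℝ) ≤ 2 * P.n := by exact_mod_cast h.Rm_le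
  have h2 := h.l_le
  have h4 := h.n_pos
  simp only [Params.fam, Params.L]
  push_cast
  nlinarith [mul_le_mul h1 h2 (by positivity) (by positivity)]

theorem Params.Scaled.queries_ge (h : P.Scaled γ a b) {Q : ℕ} (hQ : P.n * P.R ≤ Q) :
    4 * a * ((P.n : ℝ) ^ (1 + γ) * Real.log P.n) ≤ (Q * P.L : ℕ) := by
  have hn := h.n_pos
  have h1 := h.R_ge
  have h2 := h.l_ge
  have h3 := h.log_pos
  have hQ' : (P.n * P.R : ℝ) ≤ Q := by exact_mod_cast hQ
  rw [Real.rpow_add hn, Real.rpow_one]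
  simp only [Params.L]
  push_cast
  calc 4 * a * ((P.n : ℝ) * (P.n : ℝ) ^ γ * Real.log P.n)
      = P.n * (a * (P.n : ℝ) ^ γ) * (4 * Real.log P.n) := by ring
    _ ≤ P.n * P.R * (4 * P.l) := by gcongr
    _ ≤ Q * (4 * P.l) := by gcongr

theorem Params.Scaled.queries_le (h : P.Scaled γ a b) (hb : 0 < b) {Q : ℕ}
    (hQ : Q ≤ 11 * P.n * P.R) :
    ((Q * P.L : ℕ) : ℝ) ≤ 264 * b * ((P.n : ℝ) ^ (1 + γ) * Real.log P.n) := by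
  have hn := h.n_pos
  have h1 := h.R_le
  have h2 := h.l_le
  have hQ' : (Q : ℝ) ≤ 11 * P.n * P.R := by exact_mod_cast hQ
  rw [Real.rpow_add hn, Real.rpow_one]
  simp only [Params.L]
  push_cast
  calc (Q : ℝ) * (4 * P.l) ≤ 11 * P.n * P.R * (4 * P.l) := by gcongr
    _ ≤ 11 * P.n * (2 * b * (P.n : ℝ) ^ γ) * (4 * (3 * Real.log P.n)) := by gcongr
    _ = _ := by ring

theorem Params.Scaled.flat_le (h : P.Scaled γ a b) (ha : 0 < a) :
    ((P.fam * P.m : ℕ) : ℝ) ≤ 192 / a * ((P.n : ℝ) ^ (2 - γ) * Real.log P.n) := by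
  have hn := h.n_pos
  have h1 := h.fam_le
  have h2 := h.m_le ha
  have h3 := h.log_pos
  rw [show 2 - γ = 1 + (1 - γ) by ring, Real.rpow_add hn, Real.rpow_one]
  push_cast
  calc (P.fam : ℝ) * P.m ≤ 96 * (P.n * Real.log P.n) * (2 / a * (P.n : ℝ) ^ (1 - γ)) := by gcongr
    _ = _ := by ring

theorem Params.Scaled.card_le (h : P.Scaled γ a b) (ha : 0 < a) :
    ((2 ^ (2 * P.s + 2) : ℕ) : ℝ) ≤ 16 / a ^ 2 * (P.n : ℝ) ^ (2 - 2 * γ) := by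
  have hn := h.n_pos
  have h2 := h.m_le ha
  have h4 : 2 ^ (2 * P.s + 2) = 4 * (P.m * P.m) := by simp only [Params.m]; ring
  rw [h4, show 2 - 2 * γ = (1 - γ) + (1 - γ) by ring, Real.rpow_add hn]
  push_cast
  calc 4 * ((P.m : ℝ) * P.m) ≤
        4 * ((2 / a * (P.n : ℝ) ^ (1 - γ)) * (2 / a * (P.n : ℝ) ^ (1 - γ))) := by gcongr
    _ = _ := by field_simp; ring

theorem Params.Scaled.card_ge (h : P.Scaled γ a b) (hb : 0 < b) :
    1 / b ^ 2 * (P.n : ℝ) ^ (2 - 2 * γ) ≤ ((2 ^ (2 * P.s + 2) : ℕ) : ℝ) := by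
  have hn := h.n_pos
  have h2 := h.le_m hb
  have h4 : 2 ^ (2 * P.s + 2) = 4 * (P.m * P.m) := by simp only [Params.m]; ring
  rw [h4, show 2 - 2 * γ = (1 - γ) + (1 - γ) by ring, Real.rpow_add hn]
  push_cast
  calc _ = 4 * ((1 / (2 * b) * (P.n : ℝ) ^ (1 - γ)) * (1 / (2 * b) * (P.n : ℝ) ^ (1 - γ))) := by
        field_simp; ring
    _ ≤ 4 * ((P.m : ℝ) * P.m) := by gcongr

theorem Params.Scaled.hasSize (h : P.Scaled γ a b) (ha : 0 < a) (hb : 0 < b) {k K : ℝ}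
    (hk₁ : k ≤ 1 / b ^ 2) (hk₂ : k ≤ 16) (hk₃ : k ≤ 4 * a) (hK₁ : 16 / a ^ 2 ≤ K) (hK₂ : 96 ≤ K)
    (hK₃ : 2 / a ≤ K) (hK₄ : 264 * b ≤ K) {S T : ℕ → BitVec w} {qs : List (BitVec w × ℕ × ℕ)}
    (hqs : ∀ q ∈ qs, q.2.1 < 2 * P.R ∧ q.2.2 < 2 * P.R) (hge : P.n * P.R ≤ qs.length)
    (hle : qs.length ≤ 11 * P.n * P.R) : (P.inst S T qs hqs).HasSize γ k K P.n := by
  have hn := h.n_pos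
  have hlog := h.log_pos
  have hset : ∀ f, ∀ D ∈ P.family S T f P.fam, (D.length : ℝ) ≤ K * (P.n : ℝ) ^ (1 - γ) := by
    intro f D hD
    obtain ⟨e, -, rfl⟩ := List.mem_map.1 hD
    have h1 : ((distinct (P.element S T f e) P.m).length : ℝ) ≤ P.m := by
      exact_mod_cast length_distinct_le _ _
    exact h1.trans ((h.m_le ha).trans (by gcongr))
  refine ⟨?_, ?_, ?_, ?_, ?_, hset _, hset _, ?_, ?_⟩
  · exact le_trans (by gcongr) (h.card_ge hb)
  · exact (h.card_le ha).trans (by gcongr)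
  · exact (length_family _ _).trans (length_family _ _).symm
  · refine le_trans (by gcongr) (h.fam_ge.trans (le_of_eq ?_))
    exact congrArg _ (length_family _ _).symm
  · refine le_trans (le_of_eq ?_) (h.fam_le.trans (by gcongr))
    exact congrArg _ (length_family _ _)
  · refine le_trans (by gcongr) ((h.queries_ge hge).trans (le_of_eq ?_))
    exact congrArg _ (length_queries _).symm
  · refine le_trans (le_of_eq ?_) ((h.queries_le hb hle).trans (by gcongr))
    exact congrArg _ (length_queries _)

end Scaled

/-- What `n` must satisfy for the numbers of the reduction to fit into a word of length at least
`2 log₂ n`. -/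
structure LargeEnough (γ a b : ℝ) (n : ℕ) : Prop where
  n_ge : 4 ≤ n
  pow_lt : b * ((n : ℝ) ^ γ * Real.log n ^ 0) < (n : ℝ) ^ (1 : ℝ)
  flat : 192 / a * ((n : ℝ) ^ (2 - γ) * Real.log n ^ 1) < (n : ℝ) ^ (2 : ℝ)
  queries : 264 * b * ((n : ℝ) ^ (1 + γ) * Real.log n ^ 1) < (n : ℝ) ^ (2 : ℝ)
  univ : 16 / a ^ 2 * ((n : ℝ) ^ (2 - 2 * γ) * Real.log n ^ 0) < (n : ℝ) ^ (2 : ℝ)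
  fam : 97 * ((n : ℝ) ^ (1 : ℝ) * Real.log n ^ 1) < (n : ℝ) ^ (2 : ℝ)
  tape : 96 * ((n : ℝ) ^ (0 : ℝ) * Real.log n ^ 2) < (n : ℝ) ^ (2 : ℝ)

theorem eventually_largeEnough {γ a b : ℝ} (h0 : 0 < γ) (h1 : γ < 1) :
    ∀ᶠ n : ℕ in atTop, LargeEnough γ a b n := by
  filter_upwards [eventually_ge_atTop 4, eventually_mul_log_lt b h1 0,
    eventually_mul_log_lt (192 / a) (show 2 - γ < 2 by linarith) 1,
    eventually_mul_log_lt (264 * b) (show 1 + γ < 2 by linarith) 1,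
    eventually_mul_log_lt (16 / a ^ 2) (show 2 - 2 * γ < 2 by linarith) 0,
    eventually_mul_log_lt 97 (show (1 : ℝ) < 2 by norm_num) 1,
    eventually_mul_log_lt 96 (show (0 : ℝ) < 2 by norm_num) 2] with n h1 h2 h4 h5 h6 h7 h8
  exact ⟨h1, h2, h4, h5, h6, h7, h8⟩

/-- For large `n`, all numbers fit into a word. -/
theorem Params.Scaled.fits {P : Params} {γ a b : ℝ} {n v q : ℕ} (h : P.Scaled γ a b) (ha : 0 < a)
    (hb : 0 < b) (hc : P.Computed w n v q) (hl : LargeEnough γ a b n) (hw : 0 < w)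
    (hn : n ^ 2 ≤ 2 ^ w) : P.Fits w := by
  obtain rfl := hc.n_eq
  have hn0 := h.n_pos
  have hlog := h.log_pos
  have hn4 := hl.n_ge
  have hnR : ((P.n : ℝ)) ^ (2 : ℝ) ≤ ((2 ^ w : ℕ) : ℝ) := by
    rw [Real.rpow_two]; exact_mod_cast hn
  have hlog1 : 1 ≤ Real.log P.n := by
    rw [Real.le_log_iff_exp_le hn0]
    have : (4 : ℝ) ≤ P.n := by exact_mod_cast hn4
    linarith [Real.exp_one_lt_d9]
  have hlt : ∀ {c : ℕ} {x : ℝ}, (c : ℝ) ≤ x → x < (P.n : ℝ) ^ (2 : ℝ) → c < 2 ^ w :=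
    fun h1 h2 => by exact_mod_cast (h1.trans_lt h2).trans_le hnR
  have hflat : P.fam * P.m < 2 ^ w := hlt (h.flat_le ha) (by simpa using hl.flat)
  have htape : 4 * P.l * (2 * P.l + 2) < 2 ^ w := by
    refine hlt (x := 96 * Real.log P.n ^ 2) ?_ (by simpa using hl.tape)
    have h1 := h.l_le
    push_cast
    have h2 : 2 * (P.l : ℝ) + 2 ≤ 8 * Real.log P.n := by linarith
    calc 4 * (P.l : ℝ) * (2 * P.l + 2) ≤ 4 * (3 * Real.log P.n) * (8 * Real.log P.n) := by gcongr
      _ = _ := by ring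
  have hl1 : 1 ≤ P.l := by
    have : (1 : ℝ) ≤ P.l := hlog1.trans h.l_ge
    exact_mod_cast this
  have hrs := h.rs_le
  have hm := P.m_pos
  have hR := P.R_pos
  have hw2 : w ≤ 2 ^ (w - 1) := by
    have := toNat_lt_two_pow (w - 1); omega
  have hqw : q ≤ w - 1 := hc.logW.le (by simpa using hw2)
  have hgq : P.g ≤ q := hc.logG.le (by have := toNat_lt_two_pow q; simpa using this)
  refine ⟨hw, ?_, Nat.pow_lt_pow_right (by norm_num) (by omega), by omega, hl1, h.Rm_ge, ?_, hn, ?_,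
    ?_, hflat, ?_, ?_, ?_, ?_⟩
  · have h1 := hc.logW.1
    have h2 := hc.logG.1
    rw [one_mul] at h1 h2
    exact h1.trans_lt (Nat.pow_lt_pow_right (by norm_num) (by omega))
  · nlinarith
  · refine lt_of_le_of_lt (Nat.mul_le_mul_left _ ?_) htape
    simp only [Params.Z]; omega
  · refine hlt (x := 97 * (P.n * Real.log P.n)) ?_ (by simpa using hl.fam)
    have h1 := h.fam_le
    have h2 : (1 : ℝ) ≤ P.n := by exact_mod_cast (by omega : 1 ≤ P.n)
    push_cast
    nlinarith
  · exact hlt (h.queries_le hb le_rfl) (by simpa using hl.queries)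
  · have h4 : 2 ^ (2 * P.s + 2) = 4 * (P.m * P.m) := by simp only [Params.m]; ring
    rw [← h4]
    exact hlt (h.card_le ha) (by simpa using hl.univ)
  · refine lt_of_le_of_lt (Nat.mul_le_mul_right _ ?_) hflat
    calc P.n ≤ P.R * P.m := h.Rm_ge
      _ ≤ 4 * (P.R * P.m) * P.L := by
        simp only [Params.L]
        nlinarith [Nat.mul_le_mul_left (P.R * P.m) hl1]
  · nlinarith

/-- The parameters that the reduction computes from an approximation of `n ^ γ` have the right
sizes. -/
theorem exists_params {γ a b : ℝ} {n v : ℕ} (ha : 0 < a) (hl : LargeEnough γ a b n) (w : ℕ)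
    (h₁ : a * (n : ℝ) ^ γ ≤ v) (h₂ : (v : ℝ) ≤ b * (n : ℝ) ^ γ) :
    ∃ P : Params, ∃ q, P.Computed w n v q ∧ P.Scaled γ a b := by
  have hn4 := hl.n_ge
  have hn0 : (0 : ℝ) < n := by exact_mod_cast (by omega : 0 < n)
  have hnγ : (0 : ℝ) < (n : ℝ) ^ γ := by positivity
  have hv : 1 ≤ v := by
    have : (0 : ℝ) < v := lt_of_lt_of_le (by positivity) h₁
    exact_mod_cast this
  have hvn : v < n := by
    have : b * (n : ℝ) ^ γ < n := by simpa using hl.pow_lt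
    exact_mod_cast h₂.trans_lt this
  obtain ⟨r, hr⟩ := exists_isLog one_pos v
  obtain ⟨s, hs⟩ := exists_isLog (Nat.two_pow_pos r) n
  obtain ⟨l, hl'⟩ := exists_isLog one_pos n
  obtain ⟨q, hq⟩ := exists_isLog one_pos w
  obtain ⟨g, hg⟩ := exists_isLog one_pos (q + 1)
  have hr2 := hr.lt_two_mul (by omega)
  have hr1 := hr.1
  rw [one_mul] at hr1 hr2
  have hs2 := hs.lt_two_mul (by omega)
  have hl2 := hl'.lt_two_mul (by omega)
  have hl1 := hl'.1
  rw [one_mul] at hl1 hl2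
  refine ⟨⟨n, r, s, l, g⟩, q, ⟨rfl, hr, hs, hl', hq, hg⟩, ?_⟩
  have hlog : 1 ≤ Real.log n := by
    rw [Real.le_log_iff_exp_le hn0]
    have : (4 : ℝ) ≤ n := by exact_mod_cast hn4
    linarith [Real.exp_one_lt_d9]
  have hlog2 : Real.log 2 ≤ 1 := by linarith [Real.log_two_lt_d9]
  have hlog2' : 1 / 2 ≤ Real.log 2 := by linarith [Real.log_two_gt_d9]
  refine ⟨by simpa using (by omega : 2 ≤ n), ?_, ?_, hs.1, hs2.le, ?_, ?_, ?_⟩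
  · exact h₁.trans (by simp only [Params.R]; exact_mod_cast hr1)
  · have : ((2 ^ r : ℕ) : ℝ) ≤ 2 * v := by exact_mod_cast hr2.le
    simp only [Params.R]
    linarith
  · have h3 : Real.log n ≤ l * Real.log 2 := by
      rw [← Real.log_pow]
      exact Real.log_le_log hn0 (by exact_mod_cast hl1)
    have : (0 : ℝ) ≤ l := by positivity
    simp only
    nlinarith
  · have h3 : l * Real.log 2 ≤ Real.log 2 + Real.log n := by
      rw [← Real.log_pow, ← Real.log_mul (by norm_num) hn0.ne']
      exact Real.log_le_log (by positivity) (by exact_mod_cast hl2.le)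
    have h4 : Real.log n ≤ 2 * Real.log 2 * Real.log n := by nlinarith
    have h5 : Real.log 2 * (l : ℝ) ≤ Real.log 2 * (3 * Real.log n) := by nlinarith
    exact le_of_mul_le_mul_left h5 (by linarith)
  · have : 2 ^ (r + s) < 2 ^ (l + 1) := by
      rw [pow_add, pow_succ]
      omega
    have := (Nat.pow_lt_pow_iff_right (by norm_num)).1 this
    simp only
    omega

/-! ### The running time of the reduction -/

theorem hashTime_mono {g b g' b' : ℕ} (hg : g ≤ g') (hb : b ≤ b') :
    hashTime g b ≤ hashTime g' b' := by
  simp only [hashTime]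
  gcongr

/-- Up to logarithmic factors, the reduction takes time `n * (R + m)`. -/
theorem Params.Scaled.mainTime_le {P : Params} {γ a b : ℝ} (h : P.Scaled γ a b) (q : ℕ) :
    P.mainTime q ≤ 50000 * (P.n * (P.R + P.m) * (P.l + P.g + 1) ^ 3) + 14 * q := by
  set u := P.l + P.g with hu
  have hn : 1 ≤ P.n := by have := h.n_ge; omega
  have hR := P.R_pos
  have hm := P.m_pos
  have hRm := h.Rm_le
  have hr : P.r ≤ u := by have := h.rs_le; omega
  have hs : P.s ≤ u := by have := h.rs_le; omega
  have hl : P.l ≤ u := by omega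
  have hg : P.g ≤ u := by omega
  have hmm : P.m * P.m ≤ 2 * P.n * P.m :=
    Nat.mul_le_mul_right _ ((Nat.le_mul_of_pos_left _ hR).trans hRm)
  have hfam : P.fam ≤ 4 * (2 * P.n) * (4 * u) := by simp only [Params.fam, Params.L]; gcongr
  have hL : P.L ≤ 4 * u := by simp only [Params.L]; gcongr
  have hZ : P.Z ≤ 3 * u + 2 := by simp only [Params.Z]; omega
  have hh₁ : hashTime P.g P.r ≤ hashTime u u := hashTime_mono hg hr
  have hh₂ : hashTime P.g (2 * P.s + 2) ≤ hashTime u (2 * u + 2) := hashTime_mono hg (by omega)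
  have h1 : P.mainTime q ≤ 6 * u + 6 * u + 6 * u + 14 * q + 6 * u + 12 * (2 * P.n) +
      6 * (4 * u * (3 * u + 2)) +
      4 * u * (P.R * (P.n * (hashTime u u + 20) + 20) + 40 + 4) +
      (P.n * P.R * (hashTime u u + 50) + 30 * (11 * P.n * P.R) + 6 * (4 * u * (3 * u + 2)) +
        2 * (4 * (2 * P.n) * (4 * u) * (P.m * (hashTime u (2 * u + 2) + 24) + 30) + 20) +
        (11 * P.n * P.R * (4 * u * (hashTime u (2 * u + 2) + 40) + 20) + 20) +
        11 * P.n * P.R * (4 * u * 13 + 20) + 2 * P.n * P.m * 23 + 100) + 200 := by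
    simp only [Params.mainTime, Params.goodTime, Params.arrangeTime, Params.familyTime,
      Params.queriesTime]
    gcongr
  refine h1.trans ?_
  obtain ⟨n, hn'⟩ := Nat.exists_eq_add_of_le hn
  obtain ⟨R, hR'⟩ := Nat.exists_eq_add_of_le hR
  obtain ⟨m, hm'⟩ := Nat.exists_eq_add_of_le hm
  rw [hn', hR', hm']
  simp only [hashTime]
  -- As a polynomial in `u`, `n - 1`, `R - 1` and `m - 1`, the difference of the two sides has
  -- nonnegative coefficients.
  zify
  rw [← sub_nonneg]
  ring_nf
  positivity

/-- For large `n`, the parameters are computed, and the queries are built and evaluated, in time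
`n ^ (2 - δ)`. -/
theorem eventually_mainTime_le {W : ℕ → Set ℕ} (hW : AdmissibleWordLengths W) {γ a b δ : ℝ}
    (ha : 0 < a) (hδ₁ : δ < γ) (hδ₂ : δ < 1 - γ) :
    ∀ᶠ n : ℕ in atTop, ∀ w ∈ W n, ∀ (P : Params) (v q : ℕ), P.Computed w n v q →
      P.Scaled γ a b → (P.mainTime q : ℝ) ≤ (n : ℝ) ^ (2 - δ) := by
  obtain ⟨K, hK⟩ := hW.upper
  filter_upwards [hK, eventually_ge_atTop 4,
    eventually_mul_log_lt (2 * |K|) (show (1 : ℝ) < 3 / 2 by norm_num) 1,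
    eventually_mul_log_lt 4 (show (3 / 2 : ℝ) < 2 by norm_num) 0,
    eventually_mul_log_lt (4 * (50000 * 729 * (2 * b))) (show 1 + γ < 2 - δ by linarith) 3,
    eventually_mul_log_lt (4 * (50000 * 729 * (2 / a))) (show 2 - γ < 2 - δ by linarith) 3,
    eventually_mul_log_lt (4 * 14) (show (0 : ℝ) < 2 - δ by linarith) 0,
    eventually_mul_log_lt (4 * (28 * |K|)) (show (1 : ℝ) < 2 - δ by linarith) 1]
    with n hn hn4 e1 e2 e3 e4 e5 e6 w hw P v q hc h
  obtain rfl := hc.n_eq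
  have hn0 := h.n_pos
  have hlog1 : 1 ≤ Real.log P.n := by
    rw [Real.le_log_iff_exp_le hn0]
    have : (4 : ℝ) ≤ P.n := by exact_mod_cast hn4
    linarith [Real.exp_one_lt_d9]
  have hlog2 : 1 / 2 ≤ Real.log 2 := by linarith [Real.log_two_gt_d9]
  have hq : (q : ℝ) ≤ 1 + 2 * |K| * (P.n * Real.log P.n) := by
    rcases Nat.eq_zero_or_pos q with rfl | hq0
    · simp only [Nat.cast_zero]; positivity
    have h1 : 2 ^ (q - 1) < w := by simpa using hc.logW.2 (q - 1) (by omega)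
    have h2 : (2 : ℝ) ^ ((q - 1 : ℕ) : ℝ) < 2 ^ (K * (P.n * Real.logb 2 P.n)) := by
      rw [Real.rpow_natCast]
      exact lt_of_lt_of_le (by exact_mod_cast h1) (hn w hw)
    have h3 := (Real.rpow_lt_rpow_left_iff (by norm_num)).1 h2
    have h4 : Real.logb 2 P.n ≤ 2 * Real.log P.n := by
      rw [Real.logb, div_le_iff₀ (by linarith)]
      nlinarith
    have h5 : 0 ≤ Real.logb 2 P.n := div_nonneg (by linarith) (by linarith)
    have h6 : K * (P.n * Real.logb 2 P.n) ≤ |K| * (P.n * (2 * Real.log P.n)) :=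
      mul_le_mul (le_abs_self K) (by gcongr) (by positivity) (by positivity)
    rw [Nat.cast_sub hq0, Nat.cast_one] at h3
    linarith
  have hg : (P.g : ℝ) ≤ 5 * Real.log P.n := by
    rcases Nat.eq_zero_or_pos P.g with hg0 | hg0
    · rw [hg0, Nat.cast_zero]; positivity
    have h1 : 2 ^ (P.g - 1) < q + 1 := by simpa using hc.logG.2 (P.g - 1) (by omega)
    have h2 : ((2 ^ (P.g - 1) : ℕ) : ℝ) < (P.n : ℝ) ^ (2 : ℝ) := by
      have h2' : ((2 ^ (P.g - 1) : ℕ) : ℝ) ≤ q := by exact_mod_cast Nat.lt_succ_iff.1 h1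
      have hn1 : (1 : ℝ) ≤ (P.n : ℝ) ^ (3 / 2 : ℝ) :=
        Real.one_le_rpow (by exact_mod_cast (by omega : 1 ≤ P.n)) (by norm_num)
      simp only [pow_zero, mul_one, pow_one, Real.rpow_one] at e1 e2
      linarith
    have h3 := Real.log_lt_log (by positivity) h2
    rw [Nat.cast_pow, Real.log_pow, Real.log_rpow hn0, Nat.cast_ofNat, Nat.cast_sub hg0,
      Nat.cast_one] at h3
    have h4 : (1 : ℝ) ≤ P.g := by exact_mod_cast hg0
    nlinarith
  have hU : ((P.l : ℝ) + P.g + 1) ≤ 9 * Real.log P.n := by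
    have := h.l_le
    linarith
  have hR : (P.n : ℝ) * P.R ≤ 2 * b * (P.n : ℝ) ^ (1 + γ) := by
    rw [Real.rpow_add hn0, Real.rpow_one]
    calc (P.n : ℝ) * P.R ≤ P.n * (2 * b * (P.n : ℝ) ^ γ) := by gcongr; exact h.R_le
      _ = _ := by ring
  have hm : (P.n : ℝ) * P.m ≤ 2 / a * (P.n : ℝ) ^ (2 - γ) := by
    rw [show 2 - γ = 1 + (1 - γ) by ring, Real.rpow_add hn0, Real.rpow_one]
    calc (P.n : ℝ) * P.m ≤ P.n * (2 / a * (P.n : ℝ) ^ (1 - γ)) := by gcongr; exact h.m_le ha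
      _ = _ := by ring
  have hmain : (P.mainTime q : ℝ) ≤
      50000 * (P.n * (P.R + P.m) * (P.l + P.g + 1) ^ 3) + 14 * q := by
    exact_mod_cast h.mainTime_le q
  have hU3 : ((P.l : ℝ) + P.g + 1) ^ 3 ≤ 729 * Real.log P.n ^ 3 := by
    calc ((P.l : ℝ) + P.g + 1) ^ 3 ≤ (9 * Real.log P.n) ^ 3 := by gcongr
      _ = _ := by ring
  have hprod : (P.n : ℝ) * (P.R + P.m) * (P.l + P.g + 1) ^ 3 ≤
      (2 * b * (P.n : ℝ) ^ (1 + γ) + 2 / a * (P.n : ℝ) ^ (2 - γ)) * (729 * Real.log P.n ^ 3) := by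
    have h0 : (0 : ℝ) ≤ P.n * P.R + P.n * P.m := by positivity
    refine mul_le_mul ?_ hU3 (by positivity) (by linarith)
    rw [mul_add]
    exact add_le_add hR hm
  simp only [pow_zero, mul_one, pow_one, Real.rpow_one, Real.rpow_zero] at e5 e6
  nlinarith

theorem IsLog.unique {a v J J' : ℕ} (h : IsLog a v J) (h' : IsLog a v J') : J = J' :=
  le_antisymm (h.le h'.1) (h'.le h.1)

theorem Params.Computed.unique {P P' : Params} {n v q q' : ℕ} (h : P.Computed w n v q)
    (h' : P'.Computed w n v q') : P = P' ∧ q = q' := by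
  obtain ⟨n₁, r, s, l, g⟩ := P
  obtain ⟨n₂, r', s', l', g'⟩ := P'
  obtain ⟨rfl, hr, hs, hl, hq, hg⟩ := h
  obtain ⟨rfl, hr', hs', hl', hq', hg'⟩ := h'
  obtain rfl : r = r' := hr.unique hr'
  obtain rfl : s = s' := hs.unique hs'
  obtain rfl : l = l' := hl.unique hl'
  obtain rfl := hq.unique hq'
  obtain rfl : g = g' := hg.unique hg'
  exact ⟨rfl, rfl⟩

/-! ### The call of the algorithm for offline SetDisjointness -/

/-- An algorithm for offline SetDisjointness answers the instances that the reduction builds. -/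
theorem Params.Scaled.callOk {W : ℕ → Set ℕ} {P : Params} {γ a b k K : ℝ} {p : Program}
    (h : P.Scaled γ a b) (hP : P.Fits w) (ha : 0 < a) (hb : 0 < b) (hk₁ : k ≤ 1 / b ^ 2)
    (hk₂ : k ≤ 16) (hk₃ : k ≤ 4 * a) (hK₁ : 16 / a ^ 2 ≤ K) (hK₂ : 96 ≤ K) (hK₃ : 2 / a ≤ K)
    (hK₄ : 264 * b ≤ K) (hp : Solves W (setDisjointness γ k K) p) (hw : w ∈ W P.n) :
    P.CallOk w p (worstCaseTime W (setDisjointness γ k K) p P.n) := by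
  intro S T qs hqs hge hle
  have hlen : (P.queries T qs).length = qs.length * P.L := length_queries qs
  have hsize := h.hasSize ha hb hk₁ hk₂ hk₃ hK₁ hK₂ hK₃ hK₄ (S := S) (T := T) hqs hge hle
  have hfam : ∀ f, (P.family S T f P.fam).length < 2 ^ w := fun f => by
    rw [length_family]
    have := hP.fam_lt
    omega
  have hflat : ∀ f, (P.family S T f P.fam).flatten.length < 2 ^ w := fun f =>
    (length_flatten_family_le f P.fam).trans_lt hP.flat
  have hfits : (P.inst S T qs hqs).Fits w := by
    refine ⟨?_, hfam _, hfam _, ?_, hflat _, hflat _⟩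
    · have h1 := hP.univ
      have h4 : 2 ^ (2 * P.s + 2) = 4 * (P.m * P.m) := by simp only [Params.m]; ring
      rwa [← h4] at h1
    · refine lt_of_le_of_lt (le_of_eq hlen) (lt_of_le_of_lt ?_ hP.queries)
      exact Nat.mul_le_mul_right _ hle
  let I : (setDisjointness γ k K).Inst P.n w := ⟨P.inst S T qs hqs, hsize, hfits⟩
  have hinput : (setDisjointness γ k K).input I = P.callState S T qs := by
    change initState w [w, 2 ^ (2 * P.s + 2), (P.family S T (2 ^ (P.s + 1)) P.fam).length,
      (P.family S T 1 P.fam).length, (P.queries T qs).length] _ = _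
    rw [length_family, length_family, hlen]
    rfl
  have hrun := hp P.n w hw I
  rw [hinput] at hrun
  refine ⟨(Ok.haltsWith (Ok.call hrun fun s hs => Ok.nil ?_)).1, ?_⟩
  · intro k hk t ht
    have hget := getElem_queries (P := P) (T := T) qs hk ht
    obtain ⟨hj, hget'⟩ := List.getElem?_eq_some_iff.1 hget
    refine (hs (k * P.L + t) hj).trans ?_
    change (P.inst S T qs hqs).Meets (P.queries T qs)[k * P.L + t] ↔ _
    rw [hget']
    exact meets_query_iff hqs (List.getElem_mem hk) ht
  · rw [← hinput]
    exact le_iSup₂_of_le w hw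
      (le_iSup (fun I => expectedTime p ((setDisjointness γ k K).input I)) I)

end WordRAM

theorem mainTheorem3 (γ : ℝ) (hγ0 : 0 < γ) (hγ1 : γ < 1) (hγ : PowComputable γ) :
    ∃ k₀ K₀ : ℝ, 0 < k₀ ∧ 0 < K₀ ∧
      ∀ k K : ℝ, 0 < k → k ≤ k₀ → K₀ ≤ K →
      ∀ W : ℕ → Set ℕ, AdmissibleWordLengths W →
      ∀ f : ℕ → ℝ, IsPowLittleOOne f →
        RequiresExpectedTime W threeXOR (fun n => (n : ℝ) ^ 2 / f n) →
        RequiresExpectedTime W (setDisjointness γ k K) (fun n => (n : ℝ) ^ 2 / f n) := by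
  obtain ⟨pw, ε, a, b₀, D, hε, ha, hpw⟩ := hγ
  set b := max b₀ 1 with hb_def
  have hb : 0 < b := lt_max_of_lt_right one_pos
  refine ⟨min (1 / b ^ 2) (min 16 (4 * a)), max (16 / a ^ 2) (max 96 (max (2 / a) (264 * b))),
    by positivity, by positivity, ?_⟩
  intro k K _ hk hK W hW f ⟨g, hg, hf⟩ h3 p hp
  simp only [le_min_iff] at hk
  simp only [max_le_iff] at hK
  obtain ⟨hk₁, hk₂, hk₃⟩ := hk
  obtain ⟨hK₁, hK₂, hK₃, hK₄⟩ := hK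
  obtain ⟨j, hj⟩ := eventually_atTop.1 (eventually_largeEnough (a := a) (b := b) hγ0 hγ1)
  have hlarge : ∀ n, 2 ^ j ≤ n → LargeEnough γ a b n := fun n hn =>
    hj n (Nat.lt_two_pow_self.le.trans hn)
  -- The reduction is correct, and its running time is determined by a bound on `mainTime`.
  have hred : ∀ n, ∀ w ∈ W n, ∀ X : List (BitVec w), X.Nodup → X.length = n → ∀ Tm : ℕ,
      (∀ v < 2 ^ w, ∀ (P : Params) (q : ℕ), P.Computed w n v q → P.Scaled γ a b →
        P.mainTime q ≤ Tm) →
      Ok ([reduction p pw j], initState w [w, n] [X.map BitVec.toNat])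
        (fun s' => s'.reg 0 ≠ 0 ↔ ∃ a ∈ X, ∃ b ∈ X, ∃ c ∈ X, a ^^^ b = c)
        (if 2 ^ j ≤ n then expectedTime pw (initState w [w, n] []) +
          worstCaseTime W (setDisjointness γ k K) p n + (Tm + 2 * j + 2000 : ℕ)
          else (bruteTime n + 2 * j + 2000 : ℕ)) := by
    intro n w hw X hnd hX Tm hTm
    have hn := hW.lower n w hw
    have hw1 := hW.pos n w hw
    refine reduction_spec (good := fun v => a * (n : ℝ) ^ γ ≤ v ∧ (v : ℝ) ≤ b * (n : ℝ) ^ γ)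
      hw1 hX hnd hn (fun hjn => ?_) (fun hjn v hv hgood => ?_)
    · have h1 : 1 ≤ n := Nat.one_le_two_pow.trans hjn
      refine (Ok.haltsWith (Ok.call (hpw n w h1 hw1 hn).1 fun s hs => Ok.nil ⟨hs.1, ?_⟩)).1
      exact hs.2.trans (mul_le_mul_of_nonneg_right (le_max_left _ _) (by positivity))
    · obtain ⟨P, q, hc, h⟩ := exists_params ha (hlarge n hjn) w hgood.1 hgood.2
      have hfits := h.fits ha hb hc (hlarge n hjn) hw1 hn
      obtain rfl := hc.n_eq
      exact ⟨P, q, hc, hfits, h.Rm_le, h.callOk hfits ha hb hk₁ hk₂ hk₃ hK₁ hK₂ hK₃ hK₄ hp hw,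
        hTm v hv P q hc h⟩
  have hsolves : Solves W threeXOR (reduction p pw j) := by
    intro n w hw X
    have hbound : ∀ v, ∃ t : ℕ, ∀ (P : Params) (q : ℕ), P.Computed w n v q → P.mainTime q ≤ t := by
      intro v
      by_cases h : ∃ (P : Params) (q : ℕ), P.Computed w n v q
      · obtain ⟨P, q, hc⟩ := h
        refine ⟨P.mainTime q, fun P' q' hc' => ?_⟩
        obtain ⟨rfl, rfl⟩ := hc.unique hc'
        exact le_rfl
      · exact ⟨0, fun P q hc => absurd ⟨P, q, hc⟩ h⟩
    choose t ht using hbound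
    exact (hred n w hw X.1 X.2.1 X.2.2 ((Finset.range (2 ^ w)).sup t) fun v hv P q hc _ =>
      (ht v P q hc).trans (Finset.le_sup (Finset.mem_range.2 hv))).haltsWith.1
  obtain ⟨c, hc, hev⟩ := h3 _ hsolves
  refine ⟨c / 2, by positivity, ?_⟩
  set δ := min γ (min (1 - γ) ε) / 2 with hδ
  have hmin : 0 < min γ (min (1 - γ) ε) := lt_min hγ0 (lt_min (by linarith) hε)
  have hδ0 : 0 < δ := by positivity
  have hδ₁ : δ < γ := (half_lt_self hmin).trans_le (min_le_left _ _)
  have hδ₂ : δ < 1 - γ :=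
    (half_lt_self hmin).trans_le ((min_le_right _ _).trans (min_le_left _ _))
  have hδ₃ : δ < ε :=
    (half_lt_self hmin).trans_le ((min_le_right _ _).trans (min_le_right _ _))
  filter_upwards [hev, hf, hg.eventually_le_const (show (0 : ℝ) < δ / 2 by positivity),
    eventually_mainTime_le hW (b := b) ha hδ₁ hδ₂, eventually_ge_atTop (2 ^ j),
    eventually_mul_log_lt (6 / c * |D|) (show 2 - ε < 2 - δ / 2 by linarith) 0,
    eventually_mul_log_lt (6 / c) (show 2 - δ < 2 - δ / 2 by linarith) 0,
    eventually_mul_log_lt (6 / c * (2 * j + 2000)) (show 0 < 2 - δ / 2 by linarith) 0]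
    with n hn hfn hgn hmain hjn e1 e2 e3
  have hn1 : 1 ≤ n := Nat.one_le_two_pow.trans hjn
  have hn0 : (0 : ℝ) < n := by exact_mod_cast hn1
  have hT : (n : ℝ) ^ (2 - δ / 2) ≤ (n : ℝ) ^ 2 / f n := by
    rw [hfn, ← Real.rpow_two, ← Real.rpow_sub hn0]
    exact Real.rpow_le_rpow_of_exponent_le (by exact_mod_cast hn1) (by linarith)
  set T := (n : ℝ) ^ 2 / f n with hTdef
  have hT0 : 0 < T := lt_of_lt_of_le (by positivity) hT
  have hwc : worstCaseTime W threeXOR (reduction p pw j) n ≤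
      ENNReal.ofReal (|D| * (n : ℝ) ^ (2 - ε) + (n : ℝ) ^ (2 - δ) + (2 * j + 2000)) +
        worstCaseTime W (setDisjointness γ k K) p n := by
    refine iSup₂_le fun w hw => iSup_le fun X => ?_
    refine (hred n w hw X.1 X.2.1 X.2.2 ⌊(n : ℝ) ^ (2 - δ)⌋₊ fun v _ P q hc h =>
      Nat.le_floor (hmain w hw P v q hc h)).haltsWith.2.trans ?_
    rw [if_pos hjn, add_right_comm]
    refine add_le_add ?_ le_rfl
    rw [add_assoc (|D| * _), ENNReal.ofReal_add (by positivity) (by positivity)]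
    refine add_le_add ((hpw n w hn1 (hW.pos n w hw) (hW.lower n w hw)).2.trans
      (ENNReal.ofReal_le_ofReal (mul_le_mul_of_nonneg_right (le_abs_self D) (by positivity)))) ?_
    rw [← ENNReal.ofReal_natCast]
    refine ENNReal.ofReal_le_ofReal ?_
    push_cast
    have := Nat.floor_le (show (0 : ℝ) ≤ (n : ℝ) ^ (2 - δ) by positivity)
    linarith
  have hE : |D| * (n : ℝ) ^ (2 - ε) + (n : ℝ) ^ (2 - δ) + (2 * j + 2000) ≤ c / 2 * T := by
    simp only [pow_zero, mul_one, Real.rpow_zero] at e1 e2 e3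
    have e : 6 / c * (|D| * (n : ℝ) ^ (2 - ε) + (n : ℝ) ^ (2 - δ) + (2 * j + 2000)) ≤ 3 * T := by
      linarith
    rw [div_mul_eq_mul_div, div_le_iff₀ hc] at e
    linarith
  have hsum := hn.trans (hwc.trans (add_le_add (ENNReal.ofReal_le_ofReal hE) le_rfl))
  rw [show c * T = c / 2 * T + c / 2 * T by ring,
    ENNReal.ofReal_add (by positivity) (by positivity)] at hsum
  exact (ENNReal.add_le_add_iff_left ENNReal.ofReal_ne_top).1 hsum
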